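/- Let $g,\alpha,h>0$ and $\theta\in(0,1)$. Put $\langle x\rangle=(1+x^2)^{1/2}$, $$\Phi(x,y)=\frac1{4\pi}\log\frac{\cosh(\pi x/h)+\cos(\pi(y/h-\theta))}{\cosh(\pi x/h)+\cos(\pi(y/h+\theta))},\qquad c_1=\frac1{4h}\cot(\pi\theta),$$ the stream function of a unit point vortex at $(0,-(1-\theta)h)$ and the leading velocity coefficient. For a bounded continuous $\eta:\mathbb R\to(-h,\infty)$ let $\Omega(\eta)=\{(x,y):-h<y<\eta(x)\}$, let $H(\eta)\zeta\in H^2(\Omega(\eta))$ be the harmonic function on $\Omega(\eta)$ that equals $\zeta$ on $y=\eta(x)$ and $0$ on $y=-h$, and let $G(\eta)\zeta=(-\eta',1)\cdot\nabla[H(\eta)\zeta]|_{y=\eta}$. Define $$\chi=c_1\Phi_y(\cdot,0)+\tfrac12\Phi_y(\cdot,0)^2,\quad \eta_2=-(g-\alpha^2\partial_x^2)^{-1}\chi,\quad \zeta_3=-\eta_2\,(c_1+\Phi_y(\cdot,0)),\quad c_3=-[H(0)\zeta_3]_y(0,-(1-\theta)h).$$ For $s>3/2$, a wave with velocity $c\in\mathbb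 R$ and vortex strength $\varepsilon\in\mathbb R$ is a pair of even functions $\eta,\zeta\in H^s(\mathbb R)$ with $\eta>-h$ and $|\eta(0)|<(1-\theta)h$ such that $$c\Big[\frac{\eta'\zeta'+G(\eta)\zeta}{\langle\eta'\rangle^2}+\varepsilon\Phi_y\Big]+\frac{(\zeta'+\varepsilon(1,\eta')\cdot\nabla\Phi)^2+(G(\eta)\zeta+\varepsilon(-\eta',1)\cdot\nabla\Phi)^2}{2\langle\eta'\rangle^2}+g\eta-\alpha^2\Big(\frac{\eta'}{\langle\eta'\rangle}\Big)'=0,$$ $$c\eta+\zeta+\varepsilon\Phi=0,\qquad c=c_1\varepsilon-[H(\eta)\zeta]_y(0,-(1-\theta)h),$$ where $\Phi$ and its derivatives are evaluated at $y=\eta(x)$ and the first equation holds in the sense of distributions. The wave moves to the right if $c>0$ and to the left if $c<0$. **Proposition.** If $\theta\le 1/2$, then $c_3<0$. Moreover, let $\theta=1/2$ and $s>3/2$. Then there is $\delta>0$ such that every wave with $\|\eta\|_{H^s},\|\zeta\|_{H^s},|c|,|\varepsilon|<\delta$ is left-moving ($c<0$) if $\varepsilon>0$ and right-moving ($c>0$)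 if $\varepsilon<0$. In particular, for every curve $\varepsilon\mapsto(\eta(\varepsilon),\zeta(\varepsilon),c(\varepsilon))$ of waves of strength $\varepsilon$, defined on an open interval containing $0$ and tending to $(0,0,0)$ in $H^s\times H^s\times\mathbb R$ as $\varepsilon\to0$, there is $\varepsilon_0>0$ such that the wave is left-moving for $0<\varepsilon<\varepsilon_0$ and right-moving for $-\varepsilon_0<\varepsilon<0$. -/

import Mathlib

open MeasureTheory Filter Topology InnerProductSpace
open scoped ENNReal FourierTransform SchwartzMap ContDiff

noncomputable section

namespace PointVortex

/-! The plane is modelled by `ℂ`, the point `(x, y)` being `x + i y`. -/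

/-! ### Sobolev spaces on the line -/

/-- The real function `f` is (the continuous representative of) an element of `H^s(ℝ)`.
It is only used for `s > 1/2`, where every class has exactly one continuous representative. -/
def MemHs (s : ℝ) (f : ℝ → ℝ) : Prop :=
  Continuous f ∧ ∃ hf : MemLp (fun x => (f x : ℂ)) 2 (volume : Measure ℝ),
    TemperedDistribution.MemSobolev s 2 ((hf.toLp _ : Lp ℂ 2 (volume : Measure ℝ)) : 𝓢'(ℝ, ℂ))

/-- The norm of `f` in `H^s(ℝ)`: the `L²` norm of its Bessel potential of order `s`
(the set below has exactly one element when `f` lies in `H^s(ℝ)`). -/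
def hsNorm (s : ℝ) (f : ℝ → ℝ) : ℝ :=
  sInf {r : ℝ | ∃ (hf : MemLp (fun x => (f x : ℂ)) 2 (volume : Measure ℝ))
    (u : Lp ℂ 2 (volume : Measure ℝ)),
    TemperedDistribution.besselPotential ℝ ℂ s
      ((hf.toLp _ : Lp ℂ 2 (volume : Measure ℝ)) : 𝓢'(ℝ, ℂ)) = (u : 𝓢'(ℝ, ℂ)) ∧ r = ‖u‖}

/-- `f` belongs to the even functions in `H^s(ℝ)`. -/
def MemHsEven (s : ℝ) (f : ℝ → ℝ) : Prop :=
  MemHs s f ∧ ∀ x, f (-x) = f x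

/-! ### The fluid domain and the boundary operators -/

/-- The fluid domain `Ω(η) = {(x, y) : -h < y < η(x)}`. -/
def fluidDomain (h : ℝ) (η : ℝ → ℝ) : Set ℂ :=
  {z : ℂ | -h < z.im ∧ z.im < η z.re}

/-- The partial derivative in the horizontal variable. -/
def dX (ψ : ℂ → ℝ) (z : ℂ) : ℝ := fderiv ℝ ψ z 1

/-- The partial derivative in the vertical variable. -/
def dY (ψ : ℂ → ℝ) (z : ℂ) : ℝ := fderiv ℝ ψ z Complex.I

/-- `ψ = H(η)ζ`: the function `ψ` is harmonic in `Ω(η)`, belongs to `H²(Ω(η))`, equals `ζ` on the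
surface and vanishes at the bottom. Since `ψ` is smooth in `Ω(η)`, its weak derivatives are the
classical ones; since `H²(Ω(η))` embeds into the continuous functions on the closure, the boundary
values are attained pointwise. -/
structure IsHarmonicExtension (h : ℝ) (η ζ : ℝ → ℝ) (ψ : ℂ → ℝ) : Prop where
  harmonic : HarmonicContOnCl ψ (fluidDomain h η)
  sobolev : ∀ k : ℕ, k ≤ 2 →
    MemLp (iteratedFDeriv ℝ k ψ) 2 ((volume : Measure ℂ).restrict (fluidDomain h η))
  surface : ∀ x : ℝ, ψ ⟨x, η x⟩ = ζ x
  bottom : ∀ x : ℝ, ψ ⟨x, -h⟩ = 0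

open Classical in
/-- The harmonic extension operator `H(η)ζ` (zero if there is no harmonic extension). -/
def harmonicExtension (h : ℝ) (η ζ : ℝ → ℝ) : ℂ → ℝ :=
  if H : ∃ ψ, IsHarmonicExtension h η ζ ψ then H.choose else 0

/-- `τ` is the trace in `L²` of `f` on the surface `y = η(x)`, as a function of `x`: the limit in
`L²(ℝ)` of `f(x, η(x) - t)` as `t ↓ 0`. For `f` in `H¹(Ω(η))` that is smooth in `Ω(η)` this is the
usual Sobolev trace. -/
def IsSurfaceTrace (η : ℝ → ℝ) (f : ℂ → ℝ) (τ : ℝ → ℝ) : Prop :=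
  MemLp τ 2 (volume : Measure ℝ) ∧
    Tendsto (fun t : ℝ => eLpNorm (fun x : ℝ => f ⟨x, η x - t⟩ - τ x) 2 (volume : Measure ℝ))
      (𝓝[>] 0) (𝓝 0)

/-- `w = G(η)ζ = (-η', 1) · ∇ψ` at the surface, where `ψ = H(η)ζ`. -/
def IsDirichletToNeumann (η : ℝ → ℝ) (ψ : ℂ → ℝ) (w : ℝ → ℝ) : Prop :=
  ∃ p q : ℝ → ℝ, IsSurfaceTrace η (dX ψ) p ∧ IsSurfaceTrace η (dY ψ) q ∧
    ∀ x, w x = -deriv η x * p x + q x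

/-! ### The vortex stream function and the governing equations -/

/-- The stream function `Φ` of a unit point vortex at `(0, -(1 - θ)h)`. -/
def vortexStream (h θ x y : ℝ) : ℝ :=
  1 / (4 * Real.pi) *
    Real.log ((Real.cosh (Real.pi * x / h) + Real.cos (Real.pi * (y / h - θ))) /
      (Real.cosh (Real.pi * x / h) + Real.cos (Real.pi * (y / h + θ))))

/-- `Φ_x`. -/
def vortexStreamX (h θ x y : ℝ) : ℝ := deriv (fun x' => vortexStream h θ x' y) x

/-- `Φ_y`. -/
def vortexStreamY (h θ x y : ℝ) : ℝ := deriv (fun y' => vortexStream h θ x y') y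

/-- The position `(0, -(1 - θ)h)` of the vortex. -/
def vortexPoint (h θ : ℝ) : ℂ := ⟨0, -((1 - θ) * h)⟩

/-- `c₁ = cot(πθ) / (4h)`. -/
def c₁ (h θ : ℝ) : ℝ := 1 / (4 * h) * Real.cot (Real.pi * θ)

/-- The Japanese bracket `⟨x⟩ = (1 + x²)^{1/2}`. -/
def bracket (x : ℝ) : ℝ := Real.sqrt (1 + x ^ 2)

/-- The Bernoulli expression without its curvature term:
`c[(η'ζ' + w)/⟨η'⟩² + εΦ_y] + ((ζ' + ε(1,η')·∇Φ)² + (w + ε(-η',1)·∇Φ)²)/(2⟨η'⟩²) + gη`,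
where `w = G(η)ζ` and `∇Φ` is evaluated at the surface. -/
def bernoulliRegular (g h θ : ℝ) (η ζ w : ℝ → ℝ) (c ε : ℝ) (x : ℝ) : ℝ :=
  c * ((deriv η x * deriv ζ x + w x) / bracket (deriv η x) ^ 2 +
      ε * vortexStreamY h θ x (η x)) +
    ((deriv ζ x +
          ε * (vortexStreamX h θ x (η x) + deriv η x * vortexStreamY h θ x (η x))) ^ 2 +
        (w x +
          ε * (-deriv η x * vortexStreamX h θ x (η x) + vortexStreamY h θ x (η x))) ^ 2) /
      (2 * bracket (deriv η x) ^ 2) +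
    g * η x

/-- The Bernoulli equation `bernoulliRegular - α²κ(η) = 0` with the curvature
`κ(η) = (η'/⟨η'⟩)'`, in the sense of distributions. -/
def BernoulliEquation (g α h θ : ℝ) (η ζ w : ℝ → ℝ) (c ε : ℝ) : Prop :=
  ∀ φ : ℝ → ℝ, ContDiff ℝ ∞ φ → HasCompactSupport φ →
    (∫ x, bernoulliRegular g h θ η ζ w c ε x * φ x) +
      α ^ 2 * ∫ x, deriv η x / bracket (deriv η x) * deriv φ x = 0

/-- The profile `η` lies above the bottom, and `|η(0)| < (1 - θ)h`. -/
def Admissible (h θ : ℝ) (η : ℝ → ℝ) : Prop :=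
  (∀ x, -h < η x) ∧ |η 0| < (1 - θ) * h

/-- `(η, ζ, c, ε)` solves the Zakharov--Craig--Sulem formulation for a travelling wave of velocity
`c` with a point vortex of strength `ε` at `(0, -(1 - θ)h)`, in the space of even `H^s` functions:
the Bernoulli equation, the integrated kinematic equation `cη + ζ + εΦ = 0`, and the vorticity
equation `c = c₁ε - [H(η)ζ]_y(0, -(1 - θ)h)`. Positive and negative `c` correspond to waves that
move to the right and to the left, respectively. -/
structure IsWave (g α h θ s : ℝ) (η ζ : ℝ → ℝ) (c ε : ℝ) : Prop where
  mem_surface : MemHsEven s η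
  mem_trace : MemHsEven s ζ
  admissible : Admissible h θ η
  kinematic : ∀ x, c * η x + ζ x + ε * vortexStream h θ x (η x) = 0
  dynamic : ∃ (ψ : ℂ → ℝ) (w : ℝ → ℝ),
    IsHarmonicExtension h η ζ ψ ∧ IsDirichletToNeumann η ψ w ∧
    BernoulliEquation g α h θ η ζ w c ε ∧
    c - c₁ h θ * ε + dY ψ (vortexPoint h θ) = 0

/-! ### The coefficient `c₃` -/

/-- `(g - α²∂ₓ²)⁻¹ f`, the Fourier multiplier `1 / (g + α²ξ²)` (in terms of the angular frequency
`2πξ`, because of the normalization of the Fourier transform). -/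
def invHelmholtz (g α : ℝ) (f : ℝ → ℝ) (x : ℝ) : ℝ :=
  (𝓕⁻ (fun ξ : ℝ => 𝓕 (fun y : ℝ => (f y : ℂ)) ξ /
    ((g + α ^ 2 * (2 * Real.pi * ξ) ^ 2 : ℝ) : ℂ)) x).re

/-- `χ = c₁Φ_y(·, 0) + Φ_y(·, 0)²/2`. -/
def χ (h θ x : ℝ) : ℝ :=
  c₁ h θ * vortexStreamY h θ x 0 + 1 / 2 * vortexStreamY h θ x 0 ^ 2

/-- `η₂ = -(g - α²∂ₓ²)⁻¹ χ`. -/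
def η₂ (g α h θ x : ℝ) : ℝ := -invHelmholtz g α (χ h θ) x

/-- `ζ₃ = -η₂ (c₁ + Φ_y(·, 0))`. -/
def ζ₃ (g α h θ x : ℝ) : ℝ := -η₂ g α h θ x * (c₁ h θ + vortexStreamY h θ x 0)

/-- `c₃ = -[H(0)ζ₃]_y(0, -(1 - θ)h)`. -/
def c₃ (g α h θ : ℝ) : ℝ :=
  -dY (harmonicExtension h (fun _ => 0) (ζ₃ g α h θ)) (vortexPoint h θ)

end PointVortex

end

/-! Both claims rest on one representation formula. Put `κ = π/h`, `q = cos(πθ)` and `K(z) = 2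
sinh(κz) / (cosh(κz) + q)`. The function `Im K` is harmonic in the strip `-h < y < 0`, vanishes on
both boundary lines, and has a dipole at the vortex. Green's second identity for `ψ = H(η)ζ` and `Im
K` therefore expresses `4h ψ_y` at the vortex by boundary data: by `∫ ζ K'` below a flat surface
(`dY_vortexPoint_flat`), with a further term `-∫ (Im K) w`, `w = G(η)ζ`, below a curved one
(`dY_vortexPoint_eq`). On the flat surface `K' = 2κ(1 + q cosh κx) / (cosh κx + q)²`, which is
positive when `q ≥ 0`, that is, when `θ ≤ 1/2`.

For `c₃` this leaves the sign of `ζ₃`. When `θ ≤ 1/2` one has `c₁ ≥ 0` and `Φ_y(·,0) > 0`, so `χ >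
0`; the maximum principle for `g - α²∂ₓ²` gives `η₂ < 0`, hence `ζ₃ > 0` and `c₃ < 0`
(`exists_schwartz_ζ₃`, `c₃_neg`). It must also be shown that `ζ₃` has a harmonic extension at all,
which is done by Fourier analysis for every Schwartz function (`exists_isHarmonicExtension_flat`).

For `θ = 1/2` no expansion of the waves and no bifurcation theory is used; an arbitrary small wave
is estimated directly. Now `c₁ = 0` and `Φ(·,0) = 0`. Let `E` be the `H¹` norm of `η` and `W` the
`L²` norm of `w`. Four estimates are combined. (a) The kinematic equation gives `‖ζ‖_{H¹} ≲
(|c|+|ε|)E`, and the Rellich identity turns this into `W ≲ (|c|+|ε|)E` (`exists_trace_bound`,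
`exists_wave_reduction`). (b) Testing the Bernoulli equation with `η` shows that `E` is small
compared with `|ε|` (`energy_estimate`). (c) The representation formula gives `4hc = εL + (higher
order)` with `L = ∫ η b k`, where `b = Φ_y(·,0)` and `k = K'` on the surface
(`exists_speed_estimate`); hence `|c| ≲ |ε|E`. (d) Testing the Bernoulli equation with the positive
solution `V` of `(g - α²∂ₓ²)V = bk` gives `L ≤ -(const) ε² + o(ε²)`, because the dynamic pressure
`ε²Φ_y²/2` of the vortex flow depresses the surface (`test_estimate`). Together, `4hc` is `ε` times
a negative number of order `ε²`, so `c` and `ε` have opposite signs (`exists_sign_of_estimates`,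
`exists_sign_velocity`).

Much of the length comes from the low regularity. Boundary values of gradients exist only as `L²`
limits of slices, so the divergence theorem is proved by averaging over thin layers
(`integral_divergence_eq`), and each boundary term is justified in that form. -/

noncomputable section
namespace PointVortex

/-! ### The divergence theorem on the fluid domain -/

/-- The part of the fluid domain at vertical distance less than `t` from the surface. -/
def topLayer (h : ℝ) (η : ℝ → ℝ) (t : ℝ) : Set ℂ :=
  {z : ℂ | z ∈ fluidDomain h η ∧ η z.re - t < z.im}

/-- The part of the fluid domain at distance less than `t` from the bottom. -/
def bottomLayer (h : ℝ) (η : ℝ → ℝ) (t : ℝ) : Set ℂ :=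
  {z : ℂ | z ∈ fluidDomain h η ∧ z.im < -h + t}

lemma isOpen_fluidDomain {h : ℝ} {η : ℝ → ℝ} (hη : Continuous η) : IsOpen (fluidDomain h η) :=
  (isOpen_lt continuous_const Complex.continuous_im).inter
    (isOpen_lt Complex.continuous_im (hη.comp Complex.continuous_re))

lemma isOpen_topLayer {h t : ℝ} {η : ℝ → ℝ} (hη : Continuous η) : IsOpen (topLayer h η t) :=
  (isOpen_fluidDomain hη).inter
    (isOpen_lt ((hη.comp Complex.continuous_re).sub continuous_const) Complex.continuous_im)

lemma isOpen_bottomLayer {h t : ℝ} {η : ℝ → ℝ} (hη : Continuous η) :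
    IsOpen (bottomLayer h η t) :=
  (isOpen_fluidDomain hη).inter (isOpen_lt Complex.continuous_im continuous_const)

/-- Coordinates `(x, d)`, where `d` is the depth below the surface. -/
def shear (η : ℝ → ℝ) (hη : Continuous η) : ℝ × ℝ ≃ₜ ℂ where
  toFun p := ⟨p.1, η p.1 - p.2⟩
  invFun z := (z.re, η z.re - z.im)
  left_inv p := by simp
  right_inv z := by apply Complex.ext <;> simp
  continuous_toFun := by
    have : (fun p : ℝ × ℝ => (⟨p.1, η p.1 - p.2⟩ : ℂ)) =
        fun p => (p.1 : ℂ) + ((η p.1 - p.2 : ℝ) : ℂ) * Complex.I := by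
      funext p; apply Complex.ext <;> simp
    rw [this]; fun_prop
  continuous_invFun := by
    have := Complex.continuous_re
    have := Complex.continuous_im
    fun_prop

lemma shear_apply {η : ℝ → ℝ} (hη : Continuous η) (x d : ℝ) :
    shear η hη (x, d) = ⟨x, η x - d⟩ := rfl

/-- On each vertical line the map is a reflection followed by a translation. All integrals over
layers below a curved surface are computed in these coordinates. -/
lemma measurePreserving_shear {η : ℝ → ℝ} (hη : Continuous η) :
    MeasurePreserving (shear η hη) := by
  have h1 : MeasurePreserving (fun p : ℝ × ℝ => (p.1, η p.1 - p.2))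
      ((volume : Measure ℝ).prod volume) ((volume : Measure ℝ).prod volume) := by
    refine MeasurePreserving.skew_product (f := id) (MeasurePreserving.id _)
      (g := fun x d => η x - d) (by fun_prop) (Eventually.of_forall fun x => ?_)
    exact (Measure.measurePreserving_sub_left volume (η x)).map_eq
  exact Complex.volume_preserving_equiv_real_prod.symm.comp h1

lemma shear_preimage_topLayer {h b t : ℝ} {η : ℝ → ℝ} (hη : Continuous η)
    (hb : ∀ x, -h + b ≤ η x) (ht : t ≤ b) :
    shear η hη ⁻¹' topLayer h η t = Set.univ ×ˢ Set.Ioo 0 t := by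
  ext ⟨x, d⟩
  simp only [topLayer, fluidDomain, Set.mem_preimage, shear_apply, Set.mem_ofPred_eq, Set.mem_prod,
    Set.mem_univ, true_and, Set.mem_Ioo]
  have := hb x
  constructor
  · rintro ⟨⟨_, h2⟩, h3⟩; constructor <;> linarith
  · rintro ⟨h1, h2⟩; refine ⟨⟨?_, ?_⟩, ?_⟩ <;> linarith

lemma exists_bound_deriv_smoothTransition :
    ∃ K, 0 < K ∧ ∀ x, |deriv Real.smoothTransition x| ≤ K := by
  have hc : Continuous (deriv Real.smoothTransition) :=
    (Real.smoothTransition.contDiff (n := 1)).continuous_deriv (by simp)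
  obtain ⟨K, hK⟩ := (isCompact_Icc (a := (0 : ℝ)) (b := 1)).exists_bound_of_continuousOn
    hc.continuousOn
  refine ⟨|K| + 1, by positivity, fun x => ?_⟩
  rcases lt_or_ge x 0 with hx | hx
  · have : Real.smoothTransition =ᶠ[𝓝 x] fun _ => 0 := by
      filter_upwards [Iio_mem_nhds hx] with y hy
      exact Real.smoothTransition.zero_of_nonpos (le_of_lt hy)
    rw [this.deriv_eq]; simp; positivity
  rcases lt_or_ge 1 x with hx1 | hx1
  · have : Real.smoothTransition =ᶠ[𝓝 x] fun _ => 1 := by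
      filter_upwards [Ioi_mem_nhds hx1] with y hy
      exact Real.smoothTransition.one_of_one_le (le_of_lt hy)
    rw [this.deriv_eq]; simp; positivity
  · have := hK x ⟨hx, hx1⟩
    rw [Real.norm_eq_abs] at this
    linarith [le_abs_self K]

lemma deriv_smoothTransition_eq_zero {x : ℝ} (hx : x ≤ 0 ∨ 1 ≤ x) :
    deriv Real.smoothTransition x = 0 := by
  apply IsLocalExtr.deriv_eq_zero
  rcases hx with hx | hx
  · left
    refine Eventually.of_forall fun y => ?_
    rw [Real.smoothTransition.zero_of_nonpos hx]; exact Real.smoothTransition.nonneg y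
  · right
    refine Eventually.of_forall fun y => ?_
    rw [Real.smoothTransition.one_of_one_le hx]; exact Real.smoothTransition.le_one y

lemma integrable_deriv_smoothTransition : Integrable (deriv Real.smoothTransition) := by
  have hc : Continuous (deriv Real.smoothTransition) :=
    (Real.smoothTransition.contDiff (n := 1)).continuous_deriv (by simp)
  refine hc.integrable_of_hasCompactSupport (HasCompactSupport.of_support_subset_isCompact
    (isCompact_Icc (a := (0 : ℝ)) (b := 1)) fun x hx => ?_)
  by_contra hx'
  rw [Set.mem_Icc, not_and_or, not_le, not_le] at hx'
  exact hx (deriv_smoothTransition_eq_zero (hx'.imp le_of_lt le_of_lt))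

lemma integral_deriv_smoothTransition : ∫ x, deriv Real.smoothTransition x = 1 := by
  have h := integral_of_hasDerivAt_of_tendsto (f := Real.smoothTransition)
    (f' := deriv Real.smoothTransition) (m := 0) (n := 1)
    (fun x => ((Real.smoothTransition.contDiff (n := 1)).differentiable (by simp) x).hasDerivAt)
    integrable_deriv_smoothTransition
    (tendsto_const_nhds.congr' ?_) (tendsto_const_nhds.congr' ?_)
  · simpa using h
  · filter_upwards [eventually_le_atBot (0 : ℝ)] with x hx
    exact (Real.smoothTransition.zero_of_nonpos hx).symm
  · filter_upwards [eventually_ge_atTop (1 : ℝ)] with x hx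
    exact (Real.smoothTransition.one_of_one_le hx).symm

lemma integral_deriv_smoothTransition_scaled {t : ℝ} (ht : 0 < t) :
    ∫ d, deriv Real.smoothTransition ((d - t) / t) / t = 1 := by
  have h1 : (fun d => deriv Real.smoothTransition ((d - t) / t) / t) =
      fun d => (fun e => deriv Real.smoothTransition (e / t) / t) (d - t) := rfl
  rw [h1, integral_sub_right_eq_self (fun e => deriv Real.smoothTransition (e / t) / t) t,
    integral_div, Measure.integral_comp_div, integral_deriv_smoothTransition]
  simp [abs_of_pos ht, ht.ne']

/-- The derivative of the cutoff has unit mass in the depth variable, so this average over a layer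
reproduces the surface integral exactly, for each thickness and not only in the limit. -/
lemma integral_layer_average {η : ℝ → ℝ} (hη : Continuous η) (τ : ℝ → ℝ) {t : ℝ} (ht : 0 < t) :
    ∫ z : ℂ, deriv Real.smoothTransition ((η z.re - z.im - t) / t) / t * τ z.re = ∫ x, τ x := by
  rw [← (measurePreserving_shear hη).integral_comp (shear η hη).measurableEmbedding]
  have : ∀ p : ℝ × ℝ, deriv Real.smoothTransition ((η (shear η hη p).re - (shear η hη p).im - t) / t)
      / t * τ (shear η hη p).re
      = τ p.1 * (deriv Real.smoothTransition ((p.2 - t) / t) / t) := by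
    rintro ⟨x, d⟩
    simp [shear_apply, mul_comm]
  simp_rw [this]
  rw [Measure.volume_eq_prod, integral_prod_mul τ
    (fun d => deriv Real.smoothTransition ((d - t) / t) / t),
    integral_deriv_smoothTransition_scaled ht, mul_one]

lemma integrable_layer_average {η : ℝ → ℝ} (hη : Continuous η) {τ : ℝ → ℝ} (hτ : Integrable τ)
    {t : ℝ} (ht : 0 < t) : Integrable
      (fun z : ℂ => deriv Real.smoothTransition ((η z.re - z.im - t) / t) / t * τ z.re) := by
  rw [← (measurePreserving_shear hη).integrable_comp_emb (shear η hη).measurableEmbedding]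
  have h2 : Integrable (fun d => deriv Real.smoothTransition ((d - t) / t) / t) :=
    ((integrable_deriv_smoothTransition.comp_div ht.ne').comp_sub_right t).div_const t
  have := hτ.mul_prod h2
  refine (this.congr (Eventually.of_forall ?_))
  rintro ⟨x, d⟩
  simp [shear_apply, mul_comm]

end PointVortex
end

/-! ### Cutoff in layers along the boundary and proof of the divergence theorem -/

noncomputable section
namespace PointVortex

/-- The cutoff function that vanishes at depth less than `t` and at height less than `t`. -/
def layerCutoff (h : ℝ) (η : ℝ → ℝ) (t : ℝ) (z : ℂ) : ℝ :=
  Real.smoothTransition ((η z.re - z.im - t) / t) * Real.smoothTransition ((z.im + h - t) / t)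

lemma hasFDerivAt_layerCutoff (h : ℝ) {η : ℝ → ℝ} (hη : Differentiable ℝ η) (t : ℝ) (z : ℂ) :
    HasFDerivAt (layerCutoff h η t)
      (Real.smoothTransition ((η z.re - z.im - t) / t) •
        ((deriv Real.smoothTransition ((z.im + h - t) / t) / t) • Complex.imCLM) +
      Real.smoothTransition ((z.im + h - t) / t) •
        ((deriv Real.smoothTransition ((η z.re - z.im - t) / t) / t) •
          (deriv η z.re • Complex.reCLM - Complex.imCLM))) z := by
  have hS : ∀ x, HasDerivAt Real.smoothTransition (deriv Real.smoothTransition x) x := fun x =>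
    ((Real.smoothTransition.contDiff (n := 1)).differentiable (by simp) x).hasDerivAt
  have hu : HasFDerivAt (fun z : ℂ => (η z.re - z.im - t) / t)
      (t⁻¹ • (deriv η z.re • Complex.reCLM - Complex.imCLM)) z := by
    have h1 : HasFDerivAt (fun z : ℂ => η z.re) (deriv η z.re • Complex.reCLM) z :=
      (hη z.re).hasDerivAt.comp_hasFDerivAt z Complex.reCLM.hasFDerivAt
    have := ((h1.sub Complex.imCLM.hasFDerivAt).sub_const t).const_smul t⁻¹
    refine this.congr_of_eventuallyEq (Eventually.of_forall fun w => ?_)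
    simp [div_eq_inv_mul]
  have hv : HasFDerivAt (fun z : ℂ => (z.im + h - t) / t) (t⁻¹ • Complex.imCLM) z := by
    have := ((Complex.imCLM.hasFDerivAt (x := z)).add_const (h - t)).const_smul t⁻¹
    refine this.congr_of_eventuallyEq (Eventually.of_forall fun w => ?_)
    simp [div_eq_inv_mul]; ring_nf; simp
  have h1 := (hS ((η z.re - z.im - t) / t)).comp_hasFDerivAt z hu
  have h2 := (hS ((z.im + h - t) / t)).comp_hasFDerivAt z hv
  refine (h1.mul h2).congr_fderiv ?_
  simp only [Function.comp_apply, smul_smul, div_eq_mul_inv]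

lemma dX_layerCutoff (h : ℝ) {η : ℝ → ℝ} (hη : Differentiable ℝ η) (t : ℝ) (z : ℂ) :
    dX (layerCutoff h η t) z = Real.smoothTransition ((z.im + h - t) / t) *
      (deriv Real.smoothTransition ((η z.re - z.im - t) / t) / t * deriv η z.re) := by
  simp [dX, (hasFDerivAt_layerCutoff h hη t z).fderiv]

lemma dY_layerCutoff (h : ℝ) {η : ℝ → ℝ} (hη : Differentiable ℝ η) (t : ℝ) (z : ℂ) :
    dY (layerCutoff h η t) z = Real.smoothTransition ((η z.re - z.im - t) / t) *
        (deriv Real.smoothTransition ((z.im + h - t) / t) / t) -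
      Real.smoothTransition ((z.im + h - t) / t) *
        (deriv Real.smoothTransition ((η z.re - z.im - t) / t) / t) := by
  simp [dY, (hasFDerivAt_layerCutoff h hη t z).fderiv]; ring

lemma continuous_layerCutoff (h : ℝ) {η : ℝ → ℝ} (hη : Continuous η) (t : ℝ) :
    Continuous (layerCutoff h η t) := by
  have := Real.smoothTransition.continuous
  have := Complex.continuous_re
  have := Complex.continuous_im
  unfold layerCutoff
  fun_prop

lemma abs_layerCutoff_le (h : ℝ) (η : ℝ → ℝ) (t : ℝ) (z : ℂ) : |layerCutoff h η t z| ≤ 1 := by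
  unfold layerCutoff
  rw [abs_of_nonneg (mul_nonneg (Real.smoothTransition.nonneg _) (Real.smoothTransition.nonneg _))]
  exact mul_le_one₀ (Real.smoothTransition.le_one _) (Real.smoothTransition.nonneg _)
    (Real.smoothTransition.le_one _)

/-- The points at vertical distance at least `t` from both boundaries form a closed set inside the
domain. Products with the cutoff are thus controlled on the whole plane by data inside the domain.
-/
lemma tsupport_layerCutoff_subset {h : ℝ} {η : ℝ → ℝ} (hη : Continuous η) {t : ℝ} (ht : 0 < t) :
    tsupport (layerCutoff h η t) ⊆ fluidDomain h η := by
  have hc : IsClosed {z : ℂ | z.im + t ≤ η z.re ∧ -h + t ≤ z.im} :=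
    (isClosed_le (Complex.continuous_im.add continuous_const)
      (hη.comp Complex.continuous_re)).inter (isClosed_le continuous_const Complex.continuous_im)
  refine (closure_minimal (fun z hz => ?_) hc).trans fun z hz => ⟨?_, ?_⟩
  · simp only [Function.mem_support, layerCutoff] at hz
    constructor
    · by_contra hcon
      apply hz
      rw [Real.smoothTransition.zero_of_nonpos, zero_mul]
      exact div_nonpos_of_nonpos_of_nonneg (by linarith [not_le.1 hcon]) ht.le
    · by_contra hcon
      apply hz
      rw [Real.smoothTransition.zero_of_nonpos (x := (z.im + h - t) / t), mul_zero]
      exact div_nonpos_of_nonpos_of_nonneg (by linarith [not_le.1 hcon]) ht.le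
  · linarith [hz.2]
  · linarith [hz.1]

lemma tendsto_layerCutoff {h : ℝ} {η : ℝ → ℝ} {z : ℂ} (hz : z ∈ fluidDomain h η) :
    Tendsto (fun t => layerCutoff h η t z) (𝓝[>] 0) (𝓝 1) := by
  obtain ⟨h1, h2⟩ := hz
  refine tendsto_const_nhds.congr' ?_
  have hpos : 0 < min ((η z.re - z.im) / 2) ((z.im + h) / 2) := by
    apply lt_min <;> linarith
  filter_upwards [Ioo_mem_nhdsGT hpos] with t ht
  obtain ⟨ht0, ht1⟩ := ht
  rw [lt_min_iff] at ht1
  rw [layerCutoff, Real.smoothTransition.one_of_one_le, Real.smoothTransition.one_of_one_le, mul_one]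
  · rw [le_div_iff₀ ht0]; linarith [ht1.2]
  · rw [le_div_iff₀ ht0]; linarith [ht1.1]

/-- Integration by parts over the whole plane: the cutoff is supported inside the domain, so there
are no boundary terms, and the flux appears as an integral against the gradient of the cutoff. -/
lemma integral_layerCutoff_mul_divergence {h : ℝ} {η : ℝ → ℝ} {M : ℝ} {Y₁ Y₂ : ℂ → ℝ}
    (hη : ContDiff ℝ 1 η) (hM : ∀ x, |deriv η x| ≤ M)
    (hd₁ : ∀ z ∈ fluidDomain h η, DifferentiableAt ℝ Y₁ z)
    (hd₂ : ∀ z ∈ fluidDomain h η, DifferentiableAt ℝ Y₂ z)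
    (hi₁ : IntegrableOn Y₁ (fluidDomain h η)) (hi₂ : IntegrableOn Y₂ (fluidDomain h η))
    (hi₁' : IntegrableOn (dX Y₁) (fluidDomain h η))
    (hi₂' : IntegrableOn (dY Y₂) (fluidDomain h η)) {t : ℝ} (ht : 0 < t) :
    ∫ z in fluidDomain h η, layerCutoff h η t z * (dX Y₁ z + dY Y₂ z) =
      -∫ z in fluidDomain h η,
        (dX (layerCutoff h η t) z * Y₁ z + dY (layerCutoff h η t) z * Y₂ z) := by
  have hΩ : MeasurableSet (fluidDomain h η) := (isOpen_fluidDomain hη.continuous).measurableSet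
  have hηd : Differentiable ℝ η := hη.differentiable (by simp)
  have hηc := hη.continuous
  have hη' : Continuous (deriv η) := hη.continuous_deriv (by simp)
  have hS' : Continuous (deriv Real.smoothTransition) :=
    (Real.smoothTransition.contDiff (n := 1)).continuous_deriv (by simp)
  have hSc := Real.smoothTransition.continuous
  have hre := Complex.continuous_re
  have him := Complex.continuous_im
  obtain ⟨K, hK0, hK⟩ := exists_bound_deriv_smoothTransition
  have hS1 : ∀ x, |Real.smoothTransition x| ≤ 1 := fun x => by
    rw [abs_of_nonneg (Real.smoothTransition.nonneg x)]; exact Real.smoothTransition.le_one x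
  have hts := tsupport_layerCutoff_subset (h := h) hηc ht
  have hM0 : 0 ≤ M := (abs_nonneg _).trans (hM 0)
  have hout : ∀ z ∉ fluidDomain h η, z ∉ tsupport (layerCutoff h η t) := fun z hz h' => hz (hts h')
  have hk0 : ∀ z ∉ fluidDomain h η, layerCutoff h η t z = 0 := fun z hz =>
    image_eq_zero_of_notMem_tsupport (hout z hz)
  have hf0 : ∀ z ∉ fluidDomain h η, fderiv ℝ (layerCutoff h η t) z = 0 := fun z hz => by
    by_contra hne
    exact hout z hz (support_fderiv_subset ℝ hne)
  have hkc := continuous_layerCutoff h hηc t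
  have hkd : ∀ z, DifferentiableAt ℝ (layerCutoff h η t) z := fun z =>
    (hasFDerivAt_layerCutoff h hηd t z).differentiableAt
  -- One computation for both components of the field, used with the directions `1` and `I`.
  have key : ∀ (v : ℂ) (Y : ℂ → ℝ) (C : ℝ), Continuous (fun z => fderiv ℝ (layerCutoff h η t) z v) →
      (∀ z, |fderiv ℝ (layerCutoff h η t) z v| ≤ C) →
      (∀ z ∈ fluidDomain h η, DifferentiableAt ℝ Y z) → IntegrableOn Y (fluidDomain h η) →
      IntegrableOn (fun z => fderiv ℝ Y z v) (fluidDomain h η) →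
      IntegrableOn (fun z => layerCutoff h η t z * fderiv ℝ Y z v) (fluidDomain h η) ∧
      IntegrableOn (fun z => fderiv ℝ (layerCutoff h η t) z v * Y z) (fluidDomain h η) ∧
      ∫ z in fluidDomain h η, layerCutoff h η t z * fderiv ℝ Y z v =
        -∫ z in fluidDomain h η, fderiv ℝ (layerCutoff h η t) z v * Y z := by
    intro v Y C hcont hC hd hi hi'
    have i1 : IntegrableOn (fun z => layerCutoff h η t z * fderiv ℝ Y z v) (fluidDomain h η) :=
      hi'.bdd_mul hkc.aestronglyMeasurable.restrict
        (Eventually.of_forall fun z => by simpa using abs_layerCutoff_le h η t z)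
    have i2 : IntegrableOn (fun z => fderiv ℝ (layerCutoff h η t) z v * Y z) (fluidDomain h η) :=
      hi.bdd_mul hcont.aestronglyMeasurable.restrict
        (Eventually.of_forall fun z => by simpa using hC z)
    have i3 : IntegrableOn (fun z => layerCutoff h η t z * Y z) (fluidDomain h η) :=
      hi.bdd_mul hkc.aestronglyMeasurable.restrict
        (Eventually.of_forall fun z => by simpa using abs_layerCutoff_le h η t z)
    refine ⟨i1, i2, ?_⟩
    rw [setIntegral_eq_integral_of_forall_compl_eq_zero (fun z hz => by simp [hk0 z hz]),
      setIntegral_eq_integral_of_forall_compl_eq_zero (fun z hz => by simp [hf0 z hz])]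
    rw [integrableOn_iff_integrable_of_support_subset] at i1 i2 i3
    · exact integral_mul_fderiv_eq_neg_fderiv_mul_of_integrable i2 i1 i3
        (fun z _ => hkd z) (fun z hz => hd z (hts hz))
    · intro z hz; by_contra hcon; simp [hk0 z hcon] at hz
    · intro z hz; by_contra hcon; simp [hf0 z hcon] at hz
    · intro z hz; by_contra hcon; simp [hk0 z hcon] at hz
  have hcX : Continuous (fun z => fderiv ℝ (layerCutoff h η t) z 1) := by
    have : (fun z => fderiv ℝ (layerCutoff h η t) z 1) = _ := funext (dX_layerCutoff h hηd t)
    rw [this]; fun_prop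
  have hcY : Continuous (fun z => fderiv ℝ (layerCutoff h η t) z Complex.I) := by
    have : (fun z => fderiv ℝ (layerCutoff h η t) z Complex.I) = _ :=
      funext (dY_layerCutoff h hηd t)
    rw [this]; fun_prop
  have hbX : ∀ z, |fderiv ℝ (layerCutoff h η t) z 1| ≤ 1 * (K / t * M) := by
    intro z
    have := dX_layerCutoff h hηd t z
    rw [dX] at this
    rw [this, abs_mul, abs_mul, abs_div, abs_of_pos ht]
    gcongr
    exacts [hS1 _, hK _, hM _]
  have hbY : ∀ z, |fderiv ℝ (layerCutoff h η t) z Complex.I| ≤ 1 * (K / t) + 1 * (K / t) := by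
    intro z
    have := dY_layerCutoff h hηd t z
    rw [dY] at this
    rw [this]
    refine (abs_sub _ _).trans ?_
    rw [abs_mul, abs_mul, abs_div, abs_div, abs_of_pos ht]
    gcongr
    exacts [hS1 _, hK _, hS1 _, hK _]
  obtain ⟨a1, a2, a3⟩ := key 1 Y₁ _ hcX hbX hd₁ hi₁ hi₁'
  obtain ⟨b1, b2, b3⟩ := key Complex.I Y₂ _ hcY hbY hd₂ hi₂ hi₂'
  simp_rw [mul_add, dX, dY]
  rw [integral_add a1 b1, integral_add a2 b2, a3, b3]
  ring

/-- The divergence theorem on the fluid domain. The outward fluxes through the surface and the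
bottom are attained as averages over thin layers. -/
theorem integral_divergence_eq {h b M : ℝ} {η τ : ℝ → ℝ} {Y₁ Y₂ : ℂ → ℝ}
    (hη : ContDiff ℝ 1 η) (hM : ∀ x, |deriv η x| ≤ M) (hb0 : 0 < b) (hb : ∀ x, -h + b ≤ η x)
    (hd₁ : ∀ z ∈ fluidDomain h η, DifferentiableAt ℝ Y₁ z)
    (hd₂ : ∀ z ∈ fluidDomain h η, DifferentiableAt ℝ Y₂ z)
    (hi₁ : IntegrableOn Y₁ (fluidDomain h η)) (hi₂ : IntegrableOn Y₂ (fluidDomain h η))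
    (hi₁' : IntegrableOn (dX Y₁) (fluidDomain h η))
    (hi₂' : IntegrableOn (dY Y₂) (fluidDomain h η)) (hτ : Integrable τ)
    (htop : Tendsto (fun t => t⁻¹ * ∫ z in topLayer h η t,
      |(-deriv η z.re * Y₁ z + Y₂ z) - τ z.re|) (𝓝[>] 0) (𝓝 0))
    (hbot : Tendsto (fun t => t⁻¹ * ∫ z in bottomLayer h η t, |Y₂ z|) (𝓝[>] 0) (𝓝 0)) :
    ∫ z in fluidDomain h η, (dX Y₁ z + dY Y₂ z) = ∫ x, τ x := by
  have hΩ : MeasurableSet (fluidDomain h η) := (isOpen_fluidDomain hη.continuous).measurableSet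
  have hηd : Differentiable ℝ η := hη.differentiable (by simp)
  have hηc := hη.continuous
  have hη' : Continuous (deriv η) := hη.continuous_deriv (by simp)
  have hS' : Continuous (deriv Real.smoothTransition) :=
    (Real.smoothTransition.contDiff (n := 1)).continuous_deriv (by simp)
  have hre := Complex.continuous_re
  have him := Complex.continuous_im
  obtain ⟨K, hK0, hK⟩ := exists_bound_deriv_smoothTransition
  set F : ℂ → ℝ := fun z => -deriv η z.re * Y₁ z + Y₂ z with hF
  have hFi : IntegrableOn F (fluidDomain h η) := by
    refine Integrable.add ?_ hi₂
    refine hi₁.bdd_mul (c := M) (by fun_prop) (Eventually.of_forall fun z => ?_)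
    simpa using hM z.re
  have lim1 : Tendsto (fun t => ∫ z in fluidDomain h η, layerCutoff h η t z * (dX Y₁ z + dY Y₂ z))
      (𝓝[>] 0) (𝓝 (∫ z in fluidDomain h η, (dX Y₁ z + dY Y₂ z))) := by
    refine tendsto_integral_filter_of_dominated_convergence
      (fun z => |dX Y₁ z + dY Y₂ z|) ?_ ?_ (hi₁'.add hi₂').abs ?_
    · refine Eventually.of_forall fun t => ?_
      exact (continuous_layerCutoff h hηc t).aestronglyMeasurable.restrict.mul
        (hi₁'.add hi₂').aestronglyMeasurable
    · refine Eventually.of_forall fun t => Eventually.of_forall fun z => ?_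
      rw [norm_mul, Real.norm_eq_abs, Real.norm_eq_abs]
      exact mul_le_of_le_one_left (abs_nonneg _) (abs_layerCutoff_le h η t z)
    · filter_upwards [ae_restrict_mem hΩ] with z hz
      simpa using (tendsto_layerCutoff hz).mul_const (dX Y₁ z + dY Y₂ z)
  refine tendsto_nhds_unique lim1 ?_
  -- The cutoff varies between distances `t` and `2t` from the boundary, so the error lives in
  -- layers of thickness `2t`.
  have h2t : Tendsto (fun t : ℝ => 2 * t) (𝓝[>] 0) (𝓝[>] 0) := by
    refine tendsto_nhdsWithin_iff.2 ⟨?_, ?_⟩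
    · have : Tendsto (fun t : ℝ => 2 * t) (𝓝 0) (𝓝 (2 * 0)) := tendsto_id.const_mul 2
      simpa using this.mono_left nhdsWithin_le_nhds
    · filter_upwards [self_mem_nhdsWithin] with t ht
      simpa using ht
  have lim0 := ((htop.comp h2t).const_mul (2 * K)).add ((hbot.comp h2t).const_mul (2 * K))
  simp only [mul_zero, add_zero, Function.comp_def] at lim0
  refine tendsto_iff_norm_sub_tendsto_zero.2 (squeeze_zero' (Eventually.of_forall fun _ =>
    norm_nonneg _) ?_ lim0)
  -- For `4t < b` the upper and lower transition layers are disjoint, so at each point at least one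
  -- of the two cutoff factors is locally constant.
  filter_upwards [Ioo_mem_nhdsGT (show (0 : ℝ) < b / 4 by positivity)] with t ht
  obtain ⟨ht0, htb⟩ := ht
  rw [integral_layerCutoff_mul_divergence hη hM hd₁ hd₂ hi₁ hi₂ hi₁' hi₂' ht0]
  have hlayer : ∀ z ∈ fluidDomain h η,
      dX (layerCutoff h η t) z * Y₁ z + dY (layerCutoff h η t) z * Y₂ z =
      deriv Real.smoothTransition ((z.im + h - t) / t) / t * Y₂ z -
        deriv Real.smoothTransition ((η z.re - z.im - t) / t) / t * F z := by
    intro z _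
    rw [dX_layerCutoff h hηd, dY_layerCutoff h hηd]
    have hbz := hb z.re
    rcases le_or_gt ((η z.re - z.im - t) / t) 1 with hu | hu
    · have hv : 1 ≤ (z.im + h - t) / t := by
        rw [div_le_iff₀ ht0] at hu; rw [le_div_iff₀ ht0]; linarith
      rw [Real.smoothTransition.one_of_one_le hv, deriv_smoothTransition_eq_zero (Or.inr hv), hF]
      ring
    · rw [Real.smoothTransition.one_of_one_le hu.le,
        deriv_smoothTransition_eq_zero (Or.inr hu.le)]
      ring
  rw [setIntegral_congr_fun hΩ hlayer]
  have hbdd : ∀ (g : ℂ → ℝ), Continuous g → ∀ G : ℂ → ℝ, IntegrableOn G (fluidDomain h η) →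
      IntegrableOn (fun z => deriv Real.smoothTransition (g z) / t * G z) (fluidDomain h η) := by
    intro g hg G hG
    refine hG.bdd_mul (c := K / t) (by fun_prop) (Eventually.of_forall fun z => ?_)
    rw [Real.norm_eq_abs, abs_div, abs_of_pos ht0]
    exact div_le_div_of_nonneg_right (hK _) ht0.le
  have iB := hbdd (fun z => (z.im + h - t) / t) (by fun_prop) Y₂ hi₂
  have iT := hbdd (fun z => (η z.re - z.im - t) / t) (by fun_prop) F hFi
  rw [integral_sub iB iT]
  have iτ := integrable_layer_average hηc hτ ht0
  -- Writing `∫ τ` as a layer average lets it be compared with the flux `F` under the same integral;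
  -- only `F - τ` remains.
  have hττ : ∫ x, τ x = ∫ z in fluidDomain h η,
      deriv Real.smoothTransition ((η z.re - z.im - t) / t) / t * τ z.re := by
    rw [setIntegral_eq_integral_of_forall_compl_eq_zero, integral_layer_average hηc τ ht0]
    intro z hz
    rw [deriv_smoothTransition_eq_zero, zero_div, zero_mul]
    by_contra hcon
    push Not at hcon
    apply hz
    rw [lt_div_iff₀ ht0, div_lt_iff₀ ht0] at hcon
    have := hb z.re
    constructor <;> linarith
  rw [hττ, neg_sub]
  have e1 : (∫ z in fluidDomain h η, deriv Real.smoothTransition ((η z.re - z.im - t) / t) / t * F z)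
      - (∫ z in fluidDomain h η, deriv Real.smoothTransition ((z.im + h - t) / t) / t * Y₂ z) -
      (∫ z in fluidDomain h η, deriv Real.smoothTransition ((η z.re - z.im - t) / t) / t * τ z.re)
      = (∫ z in fluidDomain h η,
          deriv Real.smoothTransition ((η z.re - z.im - t) / t) / t * (F z - τ z.re)) -
        ∫ z in fluidDomain h η, deriv Real.smoothTransition ((z.im + h - t) / t) / t * Y₂ z := by
    simp_rw [mul_sub]
    rw [integral_sub iT iτ.integrableOn]
    ring
  rw [e1]
  refine (norm_sub_le _ _).trans (add_le_add ?_ ?_)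
  · have hsub : ∀ z ∈ fluidDomain h η, z ∉ topLayer h η (2 * t) →
        deriv Real.smoothTransition ((η z.re - z.im - t) / t) / t * (F z - τ z.re) = 0 := by
      intro z hz hz'
      rw [deriv_smoothTransition_eq_zero, zero_div, zero_mul]
      right
      rw [le_div_iff₀ ht0]
      by_contra hcon
      exact hz' ⟨hz, by linarith⟩
    rw [setIntegral_eq_of_subset_of_forall_sdiff_eq_zero hΩ
      (show topLayer h η (2 * t) ⊆ fluidDomain h η from fun z hz => hz.1)
      (fun z hz => hsub z hz.1 hz.2)]
    have iFτ : IntegrableOn (fun z => |F z - τ z.re|) (topLayer h η (2 * t)) := by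
      refine Integrable.abs (Integrable.sub (hFi.mono_set fun z hz => hz.1) ?_)
      have hpre := shear_preimage_topLayer (h := h) (t := 2 * t) hηc hb (by linarith)
      rw [← IntegrableOn, ← (measurePreserving_shear hηc).integrableOn_comp_preimage
        (shear η hηc).measurableEmbedding, hpre]
      have : Integrable (fun p : ℝ × ℝ => τ p.1 * (Set.Ioo 0 (2 * t)).indicator 1 p.2) :=
        hτ.mul_prod (((integrableOn_const (measure_Ioo_lt_top.ne) :
          IntegrableOn (fun _ => (1 : ℝ)) (Set.Ioo 0 (2 * t)) volume)).integrable_indicator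
          measurableSet_Ioo)
      refine this.integrableOn.congr_fun (fun p hp => ?_) (MeasurableSet.univ.prod measurableSet_Ioo)
      rcases p with ⟨x, d⟩
      have : d ∈ Set.Ioo 0 (2 * t) := hp.2
      change τ x * (Set.Ioo 0 (2 * t)).indicator 1 d = τ x
      rw [Set.indicator_of_mem this, Pi.one_apply, mul_one]
    calc _ ≤ ∫ z in topLayer h η (2 * t), (K / t) * |F z - τ z.re| := by
          refine norm_integral_le_of_norm_le (iFτ.const_mul _) (Eventually.of_forall fun z => ?_)
          rw [norm_mul, Real.norm_eq_abs, Real.norm_eq_abs, abs_div, abs_of_pos ht0]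
          gcongr
          exact hK _
      _ = _ := by
          rw [integral_const_mul]; simp only [hF]; field_simp
  · have hsub : ∀ z ∈ fluidDomain h η, z ∉ bottomLayer h η (2 * t) →
        deriv Real.smoothTransition ((z.im + h - t) / t) / t * Y₂ z = 0 := by
      intro z hz hz'
      rw [deriv_smoothTransition_eq_zero, zero_div, zero_mul]
      right
      rw [le_div_iff₀ ht0]
      by_contra hcon
      exact hz' ⟨hz, by linarith⟩
    rw [setIntegral_eq_of_subset_of_forall_sdiff_eq_zero hΩ
      (show bottomLayer h η (2 * t) ⊆ fluidDomain h η from fun z hz => hz.1)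
      (fun z hz => hsub z hz.1 hz.2)]
    calc _ ≤ ∫ z in bottomLayer h η (2 * t), (K / t) * |Y₂ z| := by
          refine norm_integral_le_of_norm_le
            (((hi₂.mono_set fun z hz => hz.1).abs).const_mul _) (Eventually.of_forall fun z => ?_)
          rw [norm_mul, Real.norm_eq_abs, Real.norm_eq_abs, abs_div, abs_of_pos ht0]
          gcongr
          exact hK _
      _ = _ := by
          rw [integral_const_mul]; field_simp

end PointVortex
end

noncomputable section
namespace PointVortex

/-! ### Traces on the surface and thin layers -/

/-- A continuously differentiable surface of bounded slope that stays away from the bottom. -/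
structure IsTameSurface (h b M : ℝ) (η : ℝ → ℝ) : Prop where
  contDiff : ContDiff ℝ 1 η
  abs_deriv_le : ∀ x, |deriv η x| ≤ M
  pos : 0 < b
  above : ∀ x, -h + b ≤ η x

namespace IsTameSurface

variable {h b M : ℝ} {η : ℝ → ℝ}

lemma continuous (hS : IsTameSurface h b M η) : Continuous η := hS.contDiff.continuous

lemma continuous_deriv (hS : IsTameSurface h b M η) : Continuous (deriv η) :=
  hS.contDiff.continuous_deriv (by simp)

lemma isOpen (hS : IsTameSurface h b M η) : IsOpen (fluidDomain h η) :=
  isOpen_fluidDomain hS.continuous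

lemma measurableSet (hS : IsTameSurface h b M η) : MeasurableSet (fluidDomain h η) :=
  hS.isOpen.measurableSet

lemma mem_of_depth (hS : IsTameSurface h b M η) {d : ℝ} (hd : 0 < d) (hdb : d < b) (x : ℝ) :
    (⟨x, η x - d⟩ : ℂ) ∈ fluidDomain h η := by
  have := hS.above x
  constructor <;> simp only <;> linarith

lemma mem_closure (hS : IsTameSurface h b M η) {z : ℂ} (h1 : -h ≤ z.im) (h2 : z.im ≤ η z.re) :
    z ∈ closure (fluidDomain h η) := by
  have hb := hS.above z.re
  have hb0 := hS.pos
  -- The point is moved vertically towards the midpoint between bottom and surface.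
  let c : ℝ → ℂ := fun s => z + ((s * ((η z.re - h) / 2 - z.im) : ℝ) : ℂ) * Complex.I
  have hc : Continuous c := by fun_prop
  have h0 : Tendsto c (𝓝[>] 0) (𝓝 z) := by
    have := (hc.tendsto 0).mono_left (nhdsWithin_le_nhds (s := Set.Ioi 0))
    simpa [c] using this
  refine mem_closure_of_tendsto h0 ?_
  filter_upwards [Ioo_mem_nhdsGT (zero_lt_one' ℝ)] with s hs
  obtain ⟨hs0, hs1⟩ := hs
  constructor <;> simp [c] <;> nlinarith

end IsTameSurface

lemma continuous_mk_sub {η : ℝ → ℝ} (hη : Continuous η) (d : ℝ) :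
    Continuous fun x : ℝ => (⟨x, η x - d⟩ : ℂ) :=
  (shear η hη).continuous.comp (by fun_prop : Continuous fun x : ℝ => (x, d))

lemma IsTameSurface.continuous_slice {h b M : ℝ} {η : ℝ → ℝ} (hS : IsTameSurface h b M η)
    {E : Type*} [TopologicalSpace E] {f : ℂ → E}
    (hf : ContinuousOn f (fluidDomain h η)) {d : ℝ} (hd : 0 < d) (hdb : d < b) :
    Continuous fun x : ℝ => f ⟨x, η x - d⟩ :=
  hf.comp_continuous (continuous_mk_sub hS.continuous d) (hS.mem_of_depth hd hdb)

/-- `τ` is the trace in `L¹` of `f` on the surface. -/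
def IsSurfaceTraceOne (η : ℝ → ℝ) (f : ℂ → ℝ) (τ : ℝ → ℝ) : Prop :=
  Integrable τ ∧
    Tendsto (fun t : ℝ => eLpNorm (fun x : ℝ => f ⟨x, η x - t⟩ - τ x) 1 (volume : Measure ℝ))
      (𝓝[>] 0) (𝓝 0)

section Traces

variable {h b M : ℝ} {η : ℝ → ℝ}

lemma IsSurfaceTrace.add (hS : IsTameSurface h b M η) {f g : ℂ → ℝ} {τ σ : ℝ → ℝ}
    (hfc : ContinuousOn f (fluidDomain h η)) (hgc : ContinuousOn g (fluidDomain h η))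
    (hf : IsSurfaceTrace η f τ) (hg : IsSurfaceTrace η g σ) :
    IsSurfaceTrace η (fun z => f z + g z) (fun x => τ x + σ x) := by
  refine ⟨hf.1.add hg.1, ?_⟩
  have h0 := hf.2.add hg.2
  rw [add_zero] at h0
  refine tendsto_of_tendsto_of_tendsto_of_le_of_le' tendsto_const_nhds h0
    (Eventually.of_forall fun _ => zero_le) ?_
  filter_upwards [Ioo_mem_nhdsGT hS.pos] with t ht
  refine le_trans (le_of_eq ?_) (eLpNorm_add_le
    ((hS.continuous_slice hfc ht.1 ht.2).aestronglyMeasurable.sub hf.1.aestronglyMeasurable)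
    ((hS.continuous_slice hgc ht.1 ht.2).aestronglyMeasurable.sub hg.1.aestronglyMeasurable)
    (by norm_num))
  congr 1; ext x; simp only [Pi.add_apply]; ring

lemma IsSurfaceTrace.mul_left {f : ℂ → ℝ} {τ u : ℝ → ℝ} {C : ℝ}
    (hu : AEStronglyMeasurable u) (huC : ∀ x, |u x| ≤ C) (hf : IsSurfaceTrace η f τ) :
    IsSurfaceTrace η (fun z => u z.re * f z) (fun x => u x * τ x) := by
  refine ⟨hf.1.of_le_mul (c := C) (hu.mul hf.1.aestronglyMeasurable)
    (Eventually.of_forall fun x => ?_), ?_⟩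
  · rw [norm_mul]; exact mul_le_mul_of_nonneg_right (huC x) (norm_nonneg _)
  have h0 := ENNReal.Tendsto.const_mul (a := ENNReal.ofReal C) hf.2 (Or.inr ENNReal.ofReal_ne_top)
  rw [mul_zero] at h0
  refine tendsto_of_tendsto_of_tendsto_of_le_of_le tendsto_const_nhds h0
    (fun _ => zero_le) fun t => ?_
  refine eLpNorm_le_mul_eLpNorm_of_ae_le_mul (Eventually.of_forall fun x => ?_) 2
  rw [← mul_sub, norm_mul]
  exact mul_le_mul_of_nonneg_right (huC x) (norm_nonneg _)

lemma eLpNorm_one_mul_le {u v : ℝ → ℝ} (hu : AEStronglyMeasurable u) (hv : AEStronglyMeasurable v) :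
    eLpNorm (fun x => u x * v x) 1 volume ≤ eLpNorm u 2 volume * eLpNorm v 2 volume := by
  have := eLpNorm_smul_le_mul_eLpNorm (p := 2) (q := 2) (r := 1) hv hu
  exact this

/-- The product of two functions with traces in `L²` has a trace in `L¹`. -/
lemma IsSurfaceTrace.mul (hS : IsTameSurface h b M η) {f g : ℂ → ℝ} {τ σ : ℝ → ℝ}
    (hfc : ContinuousOn f (fluidDomain h η)) (hgc : ContinuousOn g (fluidDomain h η))
    (hf : IsSurfaceTrace η f τ) (hg : IsSurfaceTrace η g σ) :
    IsSurfaceTraceOne η (fun z => f z * g z) (fun x => τ x * σ x) := by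
  refine ⟨hf.1.integrable_mul hg.1, ?_⟩
  have h0 : Tendsto (fun t : ℝ => eLpNorm (fun x : ℝ => f ⟨x, η x - t⟩ - τ x) 2 volume *
      (eLpNorm (fun x : ℝ => g ⟨x, η x - t⟩ - σ x) 2 volume + eLpNorm σ 2 volume) +
      eLpNorm τ 2 volume * eLpNorm (fun x : ℝ => g ⟨x, η x - t⟩ - σ x) 2 volume)
      (𝓝[>] 0) (𝓝 (0 * (0 + eLpNorm σ 2 volume) + eLpNorm τ 2 volume * 0)) := by
    refine (ENNReal.Tendsto.mul hf.2 (Or.inr ?_) (hg.2.add tendsto_const_nhds) (Or.inr (by simp))).add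
      (ENNReal.Tendsto.const_mul hg.2 (Or.inr hf.1.eLpNorm_ne_top))
    simpa using hg.1.eLpNorm_ne_top
  rw [zero_mul, mul_zero, add_zero] at h0
  refine tendsto_of_tendsto_of_tendsto_of_le_of_le' tendsto_const_nhds h0
    (Eventually.of_forall fun _ => zero_le) ?_
  filter_upwards [Ioo_mem_nhdsGT hS.pos] with t ht
  have mf := (hS.continuous_slice hfc ht.1 ht.2).aestronglyMeasurable (μ := volume)
  have mg := (hS.continuous_slice hgc ht.1 ht.2).aestronglyMeasurable (μ := volume)
  have mτ := hf.1.aestronglyMeasurable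
  have mσ := hg.1.aestronglyMeasurable
  have hsplit : (fun x : ℝ => f ⟨x, η x - t⟩ * g ⟨x, η x - t⟩ - τ x * σ x) =
      (fun x : ℝ => (f ⟨x, η x - t⟩ - τ x) * g ⟨x, η x - t⟩) +
        fun x : ℝ => τ x * (g ⟨x, η x - t⟩ - σ x) := by
    ext x; simp only [Pi.add_apply]; ring
  rw [hsplit]
  refine (eLpNorm_add_le ((mf.sub mτ).mul mg) (mτ.mul (mg.sub mσ)) le_rfl).trans
    (add_le_add ((eLpNorm_one_mul_le (mf.sub mτ) mg).trans ?_) (eLpNorm_one_mul_le mτ (mg.sub mσ)))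
  refine mul_le_mul' le_rfl ?_
  refine le_trans (le_of_eq ?_) (eLpNorm_add_le (mg.sub mσ) mσ (by norm_num : (1 : ℝ≥0∞) ≤ 2))
  congr 1; ext x; simp

lemma IsSurfaceTraceOne.add (hS : IsTameSurface h b M η) {f g : ℂ → ℝ} {τ σ : ℝ → ℝ}
    (hfc : ContinuousOn f (fluidDomain h η)) (hgc : ContinuousOn g (fluidDomain h η))
    (hf : IsSurfaceTraceOne η f τ) (hg : IsSurfaceTraceOne η g σ) :
    IsSurfaceTraceOne η (fun z => f z + g z) (fun x => τ x + σ x) := by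
  refine ⟨hf.1.add hg.1, ?_⟩
  have h0 := hf.2.add hg.2
  rw [add_zero] at h0
  refine tendsto_of_tendsto_of_tendsto_of_le_of_le' tendsto_const_nhds h0
    (Eventually.of_forall fun _ => zero_le) ?_
  filter_upwards [Ioo_mem_nhdsGT hS.pos] with t ht
  refine le_trans (le_of_eq ?_) (eLpNorm_add_le
    ((hS.continuous_slice hfc ht.1 ht.2).aestronglyMeasurable.sub hf.1.aestronglyMeasurable)
    ((hS.continuous_slice hgc ht.1 ht.2).aestronglyMeasurable.sub hg.1.aestronglyMeasurable)
    le_rfl)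
  congr 1; ext x; simp only [Pi.add_apply]; ring

/-- A trace depends only on slices close to the surface. This discards a cutoff in the height, which
equals one there. -/
lemma IsSurfaceTraceOne.congr_top {t₀ : ℝ} (ht₀ : 0 < t₀) {f g : ℂ → ℝ} {τ : ℝ → ℝ}
    (hfg : ∀ z : ℂ, η z.re - t₀ < z.im → f z = g z) (hf : IsSurfaceTraceOne η f τ) :
    IsSurfaceTraceOne η g τ := by
  refine ⟨hf.1, hf.2.congr' ?_⟩
  filter_upwards [Ioo_mem_nhdsGT ht₀] with t ht
  congr 1; ext x
  rw [hfg _ (by simp only; linarith [ht.2])]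

lemma continuousOn_aestronglyMeasurable {U : Set ℂ} (hU : IsOpen U) {f : ℂ → ℝ}
    (hf : ContinuousOn f U) : AEStronglyMeasurable f (volume.restrict U) :=
  hf.aestronglyMeasurable hU.measurableSet

/-- A function with a trace in `L¹` is close to it on average over thin layers. -/
lemma IsSurfaceTraceOne.tendsto_layer (hS : IsTameSurface h b M η) {F : ℂ → ℝ} {τ : ℝ → ℝ}
    (hF : ContinuousOn F (fluidDomain h η)) (hτ : IsSurfaceTraceOne η F τ) :
    Tendsto (fun t => t⁻¹ * ∫ z in topLayer h η t, |F z - τ z.re|) (𝓝[>] 0) (𝓝 0) := by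
  refine Metric.tendsto_nhds.2 fun ε hε => ?_
  have h1 : ∀ᶠ t in 𝓝[>] (0 : ℝ), eLpNorm (fun x : ℝ => F ⟨x, η x - t⟩ - τ x) 1 volume <
      ENNReal.ofReal (ε / 2) :=
    hτ.2.eventually_lt_const (by simpa using hε)
  obtain ⟨δ, hδ0, hδ⟩ := (mem_nhdsGT_iff_exists_Ioo_subset).1 h1
  filter_upwards [Ioo_mem_nhdsGT (lt_min hδ0 hS.pos)] with t ht
  obtain ⟨ht0, htm⟩ := ht
  rw [lt_min_iff] at htm
  have hηc := hS.continuous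
  have hpre := shear_preimage_topLayer (h := h) hηc hS.above htm.2.le
  have hbound : ∫⁻ z in topLayer h η t, ENNReal.ofReal ‖F z - τ z.re‖ ≤
      ENNReal.ofReal (ε / 2) * ENNReal.ofReal t := by
    rw [← (measurePreserving_shear hηc).setLIntegral_comp_preimage_emb
      (shear η hηc).measurableEmbedding, hpre, Measure.volume_eq_prod, ← Measure.prod_restrict,
      Measure.restrict_univ]
    -- Tonelli with the depth as outer variable: each slice contributes at most `ε/2`, and the depth
    -- ranges over an interval of length `t`.
    refine (lintegral_prod_symm _ ?_).le.trans ?_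
    · refine AEMeasurable.ennreal_ofReal (AEStronglyMeasurable.norm ?_).aemeasurable
      refine AEStronglyMeasurable.sub ?_ ?_
      · have hc : ContinuousOn (fun p : ℝ × ℝ => F (shear η hηc p)) (Set.univ ×ˢ Set.Ioo 0 t) := by
          refine hF.comp (shear η hηc).continuous.continuousOn fun p hp => ?_
          rw [← hpre] at hp
          exact hp.1
        have := hc.aestronglyMeasurable (μ := (volume : Measure (ℝ × ℝ)))
          (MeasurableSet.univ.prod measurableSet_Ioo)
        rwa [Measure.volume_eq_prod, ← Measure.prod_restrict, Measure.restrict_univ] at this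
      · exact hτ.1.aestronglyMeasurable.comp_fst
    · calc _ ≤ ∫⁻ d in Set.Ioo 0 t, ENNReal.ofReal (ε / 2) := by
            refine setLIntegral_mono measurable_const fun d hd => ?_
            have := hδ (⟨hd.1, hd.2.trans htm.1⟩ : d ∈ Set.Ioo 0 δ)
            refine le_trans (le_of_eq ?_) (le_of_lt this)
            rw [eLpNorm_one_eq_lintegral_enorm]
            simp [shear_apply, Real.enorm_eq_ofReal_abs]
        _ = _ := by simp
  have h2 := norm_integral_le_lintegral_norm (μ := volume.restrict (topLayer h η t))
    (fun z => |F z - τ z.re|)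
  simp only [Real.norm_eq_abs, abs_abs] at h2
  have h3 := ENNReal.toReal_mono (by finiteness) hbound
  simp only [Real.norm_eq_abs] at h3
  rw [ENNReal.toReal_mul, ENNReal.toReal_ofReal (by positivity), ENNReal.toReal_ofReal ht0.le] at h3
  rw [dist_zero_right, norm_mul, Real.norm_eq_abs, abs_of_pos (inv_pos.2 ht0), Real.norm_eq_abs]
  calc _ ≤ t⁻¹ * (ε / 2 * t) := by gcongr; exact h2.trans h3
    _ = ε / 2 := by field_simp
    _ < ε := by linarith

end Traces

/-- The square of a function that vanishes at one end of an interval is controlled by the square of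
its derivative. -/
lemma ofReal_sq_sub_le {u u' : ℝ → ℝ} {d : ℝ} (hd : 0 < d) (hc : ContinuousOn u (Set.Icc 0 d))
    (hu : ∀ s ∈ Set.Ioo 0 d, HasDerivAt u (u' s) s) (hm : AEStronglyMeasurable u' (volume.restrict (Set.Ioo 0 d))) :
    ENNReal.ofReal ((u d - u 0) ^ 2) ≤
      ENNReal.ofReal d * ∫⁻ s in Set.Ioo 0 d, ENNReal.ofReal (u' s ^ 2) := by
  by_cases hfin : ∫⁻ s in Set.Ioo 0 d, ENNReal.ofReal (u' s ^ 2) = ⊤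
  · rw [hfin, ENNReal.mul_top (by simpa using hd)]; exact le_top
  have hsq : Integrable (fun s => u' s ^ 2) (volume.restrict (Set.Ioo 0 d)) := by
    refine ⟨hm.pow 2, ?_⟩
    rw [hasFiniteIntegral_iff_ofReal (Eventually.of_forall fun s => sq_nonneg _)]
    exact lt_top_iff_ne_top.2 hfin
  have hL2 : MemLp u' 2 (volume.restrict (Set.Ioo 0 d)) := (memLp_two_iff_integrable_sq hm).2 hsq
  have hi : Integrable u' (volume.restrict (Set.Ioo 0 d)) := hL2.integrable (by norm_num)
  have hftc : ∫ s in Set.Ioo 0 d, u' s = u d - u 0 := by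
    have h1 : IntervalIntegrable u' volume 0 d := by
      rw [intervalIntegrable_iff_integrableOn_Ioo_of_le hd.le]; exact hi
    rw [← intervalIntegral.integral_eq_sub_of_hasDerivAt_of_le hd.le hc hu h1,
      intervalIntegral.integral_of_le hd.le, integral_Ioc_eq_integral_Ioo]
  rw [← ofReal_integral_eq_lintegral_ofReal hsq (Eventually.of_forall fun s => sq_nonneg _),
    ← ENNReal.ofReal_mul hd.le, ← hftc]
  refine ENNReal.ofReal_le_ofReal ?_
  set m := ∫ s in Set.Ioo 0 d, u' s with hm'
  -- Cauchy–Schwarz on the interval, read off from the nonnegative variance of `d u'` about the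
  -- total increment `m`.
  have hvar : 0 ≤ ∫ s in Set.Ioo 0 d, (d * u' s - m) ^ 2 := integral_nonneg fun s => sq_nonneg _
  have hexp : ∫ s in Set.Ioo 0 d, (d * u' s - m) ^ 2 =
      d ^ 2 * (∫ s in Set.Ioo 0 d, u' s ^ 2) - d * m ^ 2 := by
    have : ∀ s, (d * u' s - m) ^ 2 = (d ^ 2 * u' s ^ 2 - (2 * d * m) * u' s) + m ^ 2 := fun s => by
      ring
    simp_rw [this]
    have i1 : Integrable (fun s => d ^ 2 * u' s ^ 2 - 2 * d * m * u' s)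
      (volume.restrict (Set.Ioo 0 d)) := (hsq.const_mul _).sub (hi.const_mul _)
    rw [integral_add i1 ((integrableOn_const (measure_Ioo_lt_top.ne) :
        IntegrableOn (fun _ => m ^ 2) (Set.Ioo 0 d) volume)),
      integral_sub (hsq.const_mul _) (hi.const_mul _), integral_const_mul, integral_const_mul,
      ← hm']
    simp [hd.le]
    ring
  rw [hexp] at hvar
  nlinarith

end PointVortex
end

/-! ### Thin layers along the surface and the bottom -/

noncomputable section
namespace PointVortex

/-- Coordinates `(x, d)` near a boundary curve `y = γ(x)`, where `d` is the distance from the curve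
in the vertical direction, measured upwards or downwards, in which the layers of thickness at most
`b` are `A t`. -/
structure IsLayerChart (b : ℝ) (e : ℝ × ℝ ≃ₜ ℂ) (γ : ℝ → ℝ) (σ : ℝ) (A : ℝ → Set ℂ) : Prop where
  measurePreserving : MeasurePreserving e
  apply : ∀ x d, e (x, d) = ⟨x, γ x + σ * d⟩
  sq : σ ^ 2 = 1
  preimage : ∀ t, t ≤ b → e ⁻¹' A t = Set.univ ×ˢ Set.Ioo 0 t

lemma IsTameSurface.isLayerChart_top {h b M : ℝ} {η : ℝ → ℝ} (hS : IsTameSurface h b M η) :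
    IsLayerChart b (shear η hS.continuous) η (-1) (topLayer h η) where
  measurePreserving := measurePreserving_shear hS.continuous
  apply x d := by rw [shear_apply]; ring_nf
  sq := by norm_num
  preimage t ht := shear_preimage_topLayer hS.continuous hS.above ht

/-- Coordinates `(x, d)`, where `d` is the height above the bottom. -/
def bottomChart (h : ℝ) : ℝ × ℝ ≃ₜ ℂ :=
  ((Homeomorph.refl ℝ).prodCongr (Homeomorph.neg ℝ)).trans (shear (fun _ => -h) continuous_const)

lemma bottomChart_apply (h x d : ℝ) : bottomChart h (x, d) = ⟨x, -h + 1 * d⟩ := by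
  change shear (fun _ => -h) continuous_const (x, -d) = _
  rw [shear_apply]; ring_nf

lemma IsTameSurface.isLayerChart_bottom {h b M : ℝ} {η : ℝ → ℝ} (hS : IsTameSurface h b M η) :
    IsLayerChart b (bottomChart h) (fun _ => -h) 1 (bottomLayer h η) where
  measurePreserving := by
    refine (measurePreserving_shear continuous_const).comp ?_
    exact (MeasurePreserving.id _).prod (Measure.measurePreserving_neg (volume : Measure ℝ))
  apply x d := bottomChart_apply h x d
  sq := by norm_num
  preimage t ht := by
    ext ⟨x, d⟩
    simp only [bottomLayer, fluidDomain, Set.mem_preimage, bottomChart_apply, Set.mem_ofPred_eq,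
      Set.mem_prod, Set.mem_univ, true_and, Set.mem_Ioo]
    have := hS.above x
    constructor
    · rintro ⟨⟨_, h2⟩, h3⟩; constructor <;> linarith
    · rintro ⟨h1, h2⟩; refine ⟨⟨?_, ?_⟩, ?_⟩ <;> linarith

section Layer

variable {b σ : ℝ} {e : ℝ × ℝ ≃ₜ ℂ} {γ : ℝ → ℝ} {A : ℝ → Set ℂ} {f : ℂ → ℝ}

lemma IsLayerChart.lintegral_eq (hA : IsLayerChart b e γ σ A) {t : ℝ} (ht : t ≤ b)
    (F : ℂ → ℝ≥0∞) (hF : AEMeasurable F (volume.restrict (A t))) :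
    ∫⁻ z in A t, F z = ∫⁻ x, ∫⁻ d in Set.Ioo 0 t, F (e (x, d)) := by
  have hF' : AEMeasurable (fun p => F (e p)) (volume.restrict (e ⁻¹' A t)) :=
    hF.comp_quasiMeasurePreserving
      (hA.measurePreserving.restrict_preimage_emb e.measurableEmbedding (A t)).quasiMeasurePreserving
  rw [← hA.measurePreserving.setLIntegral_comp_preimage_emb e.measurableEmbedding,
    hA.preimage t ht, Measure.volume_eq_prod, ← Measure.prod_restrict, Measure.restrict_univ,
    lintegral_prod]
  rwa [hA.preimage t ht, Measure.volume_eq_prod, ← Measure.prod_restrict,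
    Measure.restrict_univ] at hF'

lemma measurable_dY (f : ℂ → ℝ) : Measurable (dY f) := measurable_fderiv_apply_const ℝ f Complex.I

lemma measurable_dX (f : ℂ → ℝ) : Measurable (dX f) := measurable_fderiv_apply_const ℝ f 1

lemma IsLayerChart.mem (hA : IsLayerChart b e γ σ A) {t d x : ℝ} (ht : t ≤ b) (hd : 0 < d)
    (hdt : d < t) : e (x, d) ∈ A t := by
  have : ((x, d) : ℝ × ℝ) ∈ e ⁻¹' A t := by
    rw [hA.preimage t ht]; exact ⟨trivial, hd, hdt⟩
  exact this

lemma IsLayerChart.hasDerivAt (hA : IsLayerChart b e γ σ A) {x d : ℝ}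
    (hf : DifferentiableAt ℝ f (e (x, d))) :
    HasDerivAt (fun s => f (e (x, s))) (σ * dY f (e (x, d))) d := by
  have h1 : HasDerivAt (fun s : ℝ => e (x, s)) ((σ : ℂ) * Complex.I) d := by
    have h2 : (fun s : ℝ => e (x, s)) =
        fun s : ℝ => ((x : ℂ) + (γ x : ℂ) * Complex.I) + ((s : ℂ) * σ) * Complex.I := by
      funext s; rw [hA.apply]; apply Complex.ext <;> simp [mul_comm]
    rw [h2]
    have := ((Complex.ofRealCLM.hasDerivAt (x := d)).mul_const (σ : ℂ)).mul_const Complex.I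
    simpa using this.const_add ((x : ℂ) + (γ x : ℂ) * Complex.I)
  have h3 := hf.hasFDerivAt.comp_hasDerivAt d h1
  refine h3.congr_deriv ?_
  have : (σ : ℂ) * Complex.I = σ • Complex.I := by simp
  rw [this, map_smul]; rfl

/-- The fundamental theorem of calculus and Cauchy–Schwarz on each vertical segment. The factor `t`
shows that the slices of an `H¹` function, continuous up to the boundary, converge in `L²` to its
boundary values. -/
lemma IsLayerChart.lintegral_slice_sq_le (hA : IsLayerChart b e γ σ A) {t : ℝ} (ht0 : 0 < t)
    (ht : t < b) (hc : ∀ x, ContinuousOn (fun d => f (e (x, d))) (Set.Icc 0 t))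
    (hd : ∀ z ∈ A b, DifferentiableAt ℝ f z) :
    ∫⁻ x, ENNReal.ofReal ((f (e (x, t)) - f (e (x, 0))) ^ 2) ≤
      ENNReal.ofReal t * ∫⁻ z in A t, ENNReal.ofReal (dY f z ^ 2) := by
  have hm : Measurable fun z => ENNReal.ofReal (dY f z ^ 2) :=
    ((measurable_dY f).pow_const 2).ennreal_ofReal
  rw [hA.lintegral_eq ht.le _ hm.aemeasurable, ← lintegral_const_mul' _ _ ENNReal.ofReal_ne_top]
  refine lintegral_mono fun x => ?_
  refine (ofReal_sq_sub_le (u' := fun s => σ * dY f (e (x, s))) ht0 (hc x) (fun s hs => ?_) ?_).trans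
    (le_of_eq ?_)
  · exact hA.hasDerivAt (hd _ (hA.mem le_rfl hs.1 (hs.2.trans ht)))
  · have h1 : Measurable fun s => e (x, s) := e.measurable.comp (by fun_prop)
    exact (((measurable_dY f).comp h1).const_mul σ).aestronglyMeasurable
  · simp only [mul_pow, hA.sq, one_mul]

/-- Poincaré's inequality in a layer of thickness `t`. The gain `t²` compensates the division by `t`
in layer averages. -/
lemma IsLayerChart.lintegral_layer_sq_le (hA : IsLayerChart b e γ σ A) {t : ℝ}
    (ht : t < b) (hfm : AEMeasurable f (volume.restrict (A t)))
    (hc : ∀ x, ContinuousOn (fun d => f (e (x, d))) (Set.Icc 0 t))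
    (hd : ∀ z ∈ A b, DifferentiableAt ℝ f z) (h0 : ∀ x, f (e (x, 0)) = 0) :
    ∫⁻ z in A t, ENNReal.ofReal (f z ^ 2) ≤
      ENNReal.ofReal (t ^ 2) * ∫⁻ z in A t, ENNReal.ofReal (dY f z ^ 2) := by
  have hm : Measurable fun z => ENNReal.ofReal (dY f z ^ 2) :=
    ((measurable_dY f).pow_const 2).ennreal_ofReal
  rw [hA.lintegral_eq ht.le _ (hfm.pow_const 2).ennreal_ofReal,
    hA.lintegral_eq ht.le _ hm.aemeasurable, ← lintegral_const_mul' _ _ ENNReal.ofReal_ne_top]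
  refine lintegral_mono fun x => ?_
  calc _ ≤ ∫⁻ d in Set.Ioo 0 t, (ENNReal.ofReal t *
          ∫⁻ s in Set.Ioo 0 t, ENNReal.ofReal (dY f (e (x, s)) ^ 2)) := by
        refine setLIntegral_mono measurable_const fun d hd' => ?_
        have h1 := ofReal_sq_sub_le (u := fun s => f (e (x, s)))
          (u' := fun s => σ * dY f (e (x, s))) hd'.1
          ((hc x).mono (Set.Icc_subset_Icc_right hd'.2.le)) (fun s hs => ?_) ?_
        · simp only [h0, sub_zero, mul_pow, hA.sq, one_mul] at h1
          refine h1.trans (mul_le_mul' (ENNReal.ofReal_le_ofReal hd'.2.le) ?_)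
          exact lintegral_mono_set (Set.Ioo_subset_Ioo_right hd'.2.le)
        · exact hA.hasDerivAt (hd _ (hA.mem le_rfl hs.1 (hs.2.trans (hd'.2.trans ht))))
        · have h1 : Measurable fun s => e (x, s) := e.measurable.comp (by fun_prop)
          exact (((measurable_dY f).comp h1).const_mul σ).aestronglyMeasurable
    _ ≤ _ := by
        rw [setLIntegral_const, Real.volume_Ioo, sub_zero, mul_comm, ← mul_assoc]
        rcases le_or_gt t 0 with ht0 | ht0
        · simp [ENNReal.ofReal_of_nonpos ht0]
        · rw [← ENNReal.ofReal_mul ht0.le, pow_two]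

/-- If `f` vanishes on the boundary curve and `dY f` and `g` are square integrable, then the average
of `f g` over thin layers tends to zero. -/
lemma IsLayerChart.tendsto_average_mul (hA : IsLayerChart b e γ σ A) (hb : 0 < b) {g : ℂ → ℝ}
    (hmono : ∀ t < b, A t ⊆ A b) (hAm : ∀ t, MeasurableSet (A t))
    (hempty : ∀ z, ∀ᶠ t in 𝓝[>] (0 : ℝ), z ∉ A t)
    (hfm : ContinuousOn f (A b))
    (hc : ∀ x, ∀ t < b, ContinuousOn (fun d => f (e (x, d))) (Set.Icc 0 t))
    (hd : ∀ z ∈ A b, DifferentiableAt ℝ f z) (h0 : ∀ x, f (e (x, 0)) = 0)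
    (hfy : MemLp (dY f) 2 (volume.restrict (A b))) (hg : MemLp g 2 (volume.restrict (A b))) :
    Tendsto (fun t => t⁻¹ * ∫ z in A t, |f z * g z|) (𝓝[>] 0) (𝓝 0) := by
  have hfy2 : IntegrableOn (fun z => dY f z ^ 2) (A b) := hfy.integrable_sq
  have hg2 : IntegrableOn (fun z => g z ^ 2) (A b) := hg.integrable_sq
  have hG : IntegrableOn (fun z => dY f z ^ 2 + g z ^ 2) (A b) := hfy2.add hg2
  -- The layers shrink to the empty set, so by dominated convergence the energy in them tends to
  -- zero.
  have lim : Tendsto (fun t => ∫ z in A t, (dY f z ^ 2 + g z ^ 2)) (𝓝[>] 0) (𝓝 0) := by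
    have h1 : Tendsto (fun t => ∫ z in A b, (A t).indicator (fun z => dY f z ^ 2 + g z ^ 2) z)
        (𝓝[>] 0) (𝓝 (∫ z in A b, (0 : ℝ))) := by
      refine tendsto_integral_filter_of_dominated_convergence (fun z => dY f z ^ 2 + g z ^ 2)
        (Eventually.of_forall fun t => hG.aestronglyMeasurable.indicator (hAm t))
        (Eventually.of_forall fun t => Eventually.of_forall fun z => ?_) hG
        (Eventually.of_forall fun z => ?_)
      · refine (norm_indicator_le_norm_self _ _).trans (le_of_eq ?_)
        rw [Real.norm_eq_abs, abs_of_nonneg (by positivity)]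
      · refine tendsto_const_nhds.congr' ?_
        filter_upwards [hempty z] with t ht
        rw [Set.indicator_of_notMem ht]
    rw [integral_zero] at h1
    refine h1.congr' ?_
    filter_upwards [Ioo_mem_nhdsGT hb] with t ht
    rw [setIntegral_indicator (hAm t), Set.inter_eq_right.2 (hmono t ht.2)]
  have lim' := lim.div_const 2
  rw [zero_div] at lim'
  refine squeeze_zero' ?_ ?_ lim'
  · filter_upwards [self_mem_nhdsWithin] with t ht
    exact mul_nonneg (inv_nonneg.2 (le_of_lt ht)) (integral_nonneg fun z => abs_nonneg _)
  filter_upwards [Ioo_mem_nhdsGT hb] with t ht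
  obtain ⟨ht0, htb⟩ := ht
  have hsq := hA.lintegral_layer_sq_le htb (((hfm.mono (hmono t htb)).aestronglyMeasurable
    (hAm t)).aemeasurable) (fun x => hc x t htb) hd h0
  have ify := hfy2.mono_set (hmono t htb)
  have ig := hg2.mono_set (hmono t htb)
  rw [← ofReal_integral_eq_lintegral_ofReal ify (Eventually.of_forall fun z => sq_nonneg _),
    ← ENNReal.ofReal_mul (sq_nonneg t)] at hsq
  have if2 : IntegrableOn (fun z => f z ^ 2) (A t) := by
    refine ⟨((hfm.mono (hmono t htb)).aestronglyMeasurable (hAm t)).pow 2, ?_⟩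
    rw [hasFiniteIntegral_iff_ofReal (Eventually.of_forall fun s => sq_nonneg _)]
    exact hsq.trans_lt ENNReal.ofReal_lt_top
  rw [← ofReal_integral_eq_lintegral_ofReal if2 (Eventually.of_forall fun z => sq_nonneg _)] at hsq
  have hsq' := (ENNReal.ofReal_le_ofReal_iff
    (mul_nonneg (sq_nonneg t) (integral_nonneg fun z => sq_nonneg _))).1 hsq
  -- Young's inequality with weight `t`: `|fg| ≤ f²/(2t) + t g²/2`. Poincaré's inequality makes the
  -- first term at most `(t/2) ∫ f_y²`, and dividing by `t` leaves half the energy in the layer.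
  have hpt : ∫ z in A t, |f z * g z| ≤ ∫ z in A t, ((2 * t)⁻¹ * f z ^ 2 + t / 2 * g z ^ 2) := by
    refine integral_mono_of_nonneg (Eventually.of_forall fun z => abs_nonneg _)
      ((if2.const_mul _).add (ig.const_mul _)) (Eventually.of_forall fun z => ?_)
    simp only
    rw [abs_mul]
    have h1 : 0 ≤ (|f z| - t * |g z|) ^ 2 := sq_nonneg _
    have h2 : (2 * t)⁻¹ * f z ^ 2 + t / 2 * g z ^ 2 - |f z| * |g z| =
        (2 * t)⁻¹ * (|f z| - t * |g z|) ^ 2 := by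
      rw [← sq_abs (f z), ← sq_abs (g z)]; field_simp; ring
    have h3 : 0 ≤ (2 * t)⁻¹ * (|f z| - t * |g z|) ^ 2 := by positivity
    linarith
  rw [integral_add (if2.const_mul _) (ig.const_mul _), integral_const_mul, integral_const_mul] at hpt
  rw [integral_add ify ig]
  calc _ ≤ t⁻¹ * ((2 * t)⁻¹ * (t ^ 2 * ∫ z in A t, dY f z ^ 2) + t / 2 * ∫ z in A t, g z ^ 2) := by
        refine mul_le_mul_of_nonneg_left (hpt.trans ?_) (inv_nonneg.2 ht0.le)
        gcongr
    _ = _ := by field_simp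

end Layer

end PointVortex
end

/-! ### Partial derivatives in the plane and integrability of the harmonic extension -/

noncomputable section
namespace PointVortex

lemma fderiv_eq_dX_dY (f : ℂ → ℝ) (z v : ℂ) : fderiv ℝ f z v = v.re * dX f z + v.im * dY f z := by
  conv_lhs => rw [show v = v.re • (1 : ℂ) + v.im • Complex.I by simp [Complex.re_add_im]]
  rw [map_add, map_smul, map_smul]
  rfl

lemma abs_dX_le (f : ℂ → ℝ) (z : ℂ) : |dX f z| ≤ ‖fderiv ℝ f z‖ := by
  simpa [dX] using (fderiv ℝ f z).le_opNorm 1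

lemma abs_dY_le (f : ℂ → ℝ) (z : ℂ) : |dY f z| ≤ ‖fderiv ℝ f z‖ := by
  simpa [dY] using (fderiv ℝ f z).le_opNorm Complex.I

lemma dX_mul {f g : ℂ → ℝ} {z : ℂ} (hf : DifferentiableAt ℝ f z) (hg : DifferentiableAt ℝ g z) :
    dX (fun z => f z * g z) z = dX f z * g z + f z * dX g z := by
  rw [dX, fderiv_fun_mul hf hg]; simp [dX]; ring

lemma dY_mul {f g : ℂ → ℝ} {z : ℂ} (hf : DifferentiableAt ℝ f z) (hg : DifferentiableAt ℝ g z) :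
    dY (fun z => f z * g z) z = dY f z * g z + f z * dY g z := by
  rw [dY, fderiv_fun_mul hf hg]; simp [dY]; ring

lemma dX_sub {f g : ℂ → ℝ} {z : ℂ} (hf : DifferentiableAt ℝ f z) (hg : DifferentiableAt ℝ g z) :
    dX (fun z => f z - g z) z = dX f z - dX g z := by
  rw [dX, fderiv_fun_sub hf hg]; rfl

lemma dY_sub {f g : ℂ → ℝ} {z : ℂ} (hf : DifferentiableAt ℝ f z) (hg : DifferentiableAt ℝ g z) :
    dY (fun z => f z - g z) z = dY f z - dY g z := by
  rw [dY, fderiv_fun_sub hf hg]; rfl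

lemma dX_const_mul {f : ℂ → ℝ} {z : ℂ} (c : ℝ) (hf : DifferentiableAt ℝ f z) :
    dX (fun z => c * f z) z = c * dX f z := by
  rw [dX, fderiv_const_mul hf]; rfl

lemma differentiableAt_dX {f : ℂ → ℝ} {z : ℂ} (hf : ContDiffAt ℝ 2 f z) :
    DifferentiableAt ℝ (dX f) z :=
  ((hf.fderiv_right (m := 1) (by norm_num)).differentiableAt (by simp)).clm_apply
    (differentiableAt_const _)

lemma differentiableAt_dY {f : ℂ → ℝ} {z : ℂ} (hf : ContDiffAt ℝ 2 f z) :
    DifferentiableAt ℝ (dY f) z :=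
  ((hf.fderiv_right (m := 1) (by norm_num)).differentiableAt (by simp)).clm_apply
    (differentiableAt_const _)

lemma fderiv_fderiv_apply {f : ℂ → ℝ} {z : ℂ} (hf : ContDiffAt ℝ 2 f z) (v w : ℂ) :
    fderiv ℝ (fun z => fderiv ℝ f z v) z w = fderiv ℝ (fderiv ℝ f) z w v := by
  rw [fderiv_clm_apply ((hf.fderiv_right (m := 1) (by norm_num)).differentiableAt (by simp))
    (differentiableAt_const _)]
  simp

lemma dX_dY_comm {f : ℂ → ℝ} {z : ℂ} (hf : ContDiffAt ℝ 2 f z) :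
    dX (dY f) z = dY (dX f) z := by
  rw [dX, dY]
  unfold dX dY
  rw [fderiv_fderiv_apply hf, fderiv_fderiv_apply hf]
  exact hf.isSymmSndFDerivAt (by simp) _ _

lemma dX_dX_add_dY_dY {f : ℂ → ℝ} {z : ℂ} (hf : HarmonicAt f z) :
    dX (dX f) z + dY (dY f) z = 0 := by
  have h1 := hf.2.self_of_nhds
  rw [laplacian_eq_iteratedFDeriv_complexPlane] at h1
  simp only [iteratedFDeriv_two_apply, Pi.zero_apply, Matrix.cons_val_zero,
    Matrix.cons_val_one] at h1
  rw [dX, dY]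
  unfold dX dY
  rw [fderiv_fderiv_apply hf.1, fderiv_fderiv_apply hf.1]
  exact h1

/-- The Sobolev condition in `IsHarmonicExtension` bounds the whole second derivative; this hands
the bound on to single partial derivatives. -/
lemma norm_fderiv_dX_le {f : ℂ → ℝ} {z : ℂ} (hf : ContDiffAt ℝ 2 f z) :
    ‖fderiv ℝ (dX f) z‖ ≤ ‖iteratedFDeriv ℝ 2 f z‖ := by
  refine ContinuousLinearMap.opNorm_le_bound _ (norm_nonneg _) fun w => ?_
  unfold dX
  rw [fderiv_fderiv_apply hf]
  have h1 : ‖iteratedFDeriv ℝ 2 f z‖ = ‖fderiv ℝ (fderiv ℝ f) z‖ := by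
    rw [← norm_iteratedFDeriv_fderiv, norm_iteratedFDeriv_one]
  rw [h1]
  simpa using (fderiv ℝ (fderiv ℝ f) z).le_opNorm₂ w 1

lemma norm_fderiv_dY_le {f : ℂ → ℝ} {z : ℂ} (hf : ContDiffAt ℝ 2 f z) :
    ‖fderiv ℝ (dY f) z‖ ≤ ‖iteratedFDeriv ℝ 2 f z‖ := by
  refine ContinuousLinearMap.opNorm_le_bound _ (norm_nonneg _) fun w => ?_
  unfold dY
  rw [fderiv_fderiv_apply hf]
  have h1 : ‖iteratedFDeriv ℝ 2 f z‖ = ‖fderiv ℝ (fderiv ℝ f) z‖ := by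
    rw [← norm_iteratedFDeriv_fderiv, norm_iteratedFDeriv_one]
  rw [h1]
  simpa using (fderiv ℝ (fderiv ℝ f) z).le_opNorm₂ w Complex.I

namespace IsHarmonicExtension

variable {h : ℝ} {η ζ : ℝ → ℝ} {ψ : ℂ → ℝ}

lemma contDiffAt (hψ : IsHarmonicExtension h η ζ ψ) {z : ℂ} (hz : z ∈ fluidDomain h η) :
    ContDiffAt ℝ 2 ψ z := hψ.harmonic.contDiffAt hz

lemma differentiableAt (hψ : IsHarmonicExtension h η ζ ψ) {z : ℂ} (hz : z ∈ fluidDomain h η) :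
    DifferentiableAt ℝ ψ z := hψ.harmonic.differentiableAt hz

lemma continuousOn_dX (hψ : IsHarmonicExtension h η ζ ψ) :
    ContinuousOn (dX ψ) (fluidDomain h η) := fun _ hz =>
  (differentiableAt_dX (hψ.contDiffAt hz)).continuousAt.continuousWithinAt

lemma continuousOn_dY (hψ : IsHarmonicExtension h η ζ ψ) :
    ContinuousOn (dY ψ) (fluidDomain h η) := fun _ hz =>
  (differentiableAt_dY (hψ.contDiffAt hz)).continuousAt.continuousWithinAt

lemma memLp (hψ : IsHarmonicExtension h η ζ ψ) :
    MemLp ψ 2 (volume.restrict (fluidDomain h η)) := by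
  have h0 := hψ.sobolev 0 (by norm_num)
  have := (continuousMultilinearCurryFin0 ℝ ℂ ℝ).toContinuousLinearEquiv.toContinuousLinearMap.comp_memLp' h0
  refine this.ae_eq (Eventually.of_forall fun z => ?_)
  simp

lemma memLp_dX (hψ : IsHarmonicExtension h η ζ ψ) :
    MemLp (dX ψ) 2 (volume.restrict (fluidDomain h η)) := by
  refine (hψ.sobolev 1 (by norm_num)).of_le (measurable_dX ψ).aestronglyMeasurable
    (Eventually.of_forall fun z => ?_)
  rw [norm_iteratedFDeriv_one]; exact abs_dX_le ψ z

lemma memLp_dY (hψ : IsHarmonicExtension h η ζ ψ) :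
    MemLp (dY ψ) 2 (volume.restrict (fluidDomain h η)) := by
  refine (hψ.sobolev 1 (by norm_num)).of_le (measurable_dY ψ).aestronglyMeasurable
    (Eventually.of_forall fun z => ?_)
  rw [norm_iteratedFDeriv_one]; exact abs_dY_le ψ z

lemma memLp_second (hψ : IsHarmonicExtension h η ζ ψ) (hη : Continuous η) :
    MemLp (dX (dX ψ)) 2 (volume.restrict (fluidDomain h η)) ∧
    MemLp (dY (dX ψ)) 2 (volume.restrict (fluidDomain h η)) ∧
    MemLp (dX (dY ψ)) 2 (volume.restrict (fluidDomain h η)) ∧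
    MemLp (dY (dY ψ)) 2 (volume.restrict (fluidDomain h η)) := by
  have hm := ae_restrict_mem (μ := (volume : Measure ℂ)) (isOpen_fluidDomain (h := h) hη).measurableSet
  have h2 := hψ.sobolev 2 le_rfl
  refine ⟨h2.of_le (measurable_dX _).aestronglyMeasurable ?_,
    h2.of_le (measurable_dY _).aestronglyMeasurable ?_,
    h2.of_le (measurable_dX _).aestronglyMeasurable ?_,
    h2.of_le (measurable_dY _).aestronglyMeasurable ?_⟩ <;> filter_upwards [hm] with z hz
  · exact (abs_dX_le _ z).trans (norm_fderiv_dX_le (hψ.contDiffAt hz))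
  · exact (abs_dY_le _ z).trans (norm_fderiv_dX_le (hψ.contDiffAt hz))
  · exact (abs_dX_le _ z).trans (norm_fderiv_dY_le (hψ.contDiffAt hz))
  · exact (abs_dY_le _ z).trans (norm_fderiv_dY_le (hψ.contDiffAt hz))

end IsHarmonicExtension

section Boundary

variable {h b M : ℝ} {η ζ : ℝ → ℝ} {ψ f g : ℂ → ℝ}

/-- This removes the surface flux for factors that vanish on the surface, without any trace of the
other factor being known. Hence the energy estimate does not presuppose that the gradient of `ψ` has
a trace. -/
lemma IsTameSurface.tendsto_topLayer_mul (hS : IsTameSurface h b M η)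
    (hc : ContinuousOn f (closure (fluidDomain h η)))
    (hd : ∀ z ∈ fluidDomain h η, DifferentiableAt ℝ f z) (h0 : ∀ x, f ⟨x, η x⟩ = 0)
    (hfy : MemLp (dY f) 2 (volume.restrict (fluidDomain h η)))
    (hg : MemLp g 2 (volume.restrict (fluidDomain h η))) :
    Tendsto (fun t => t⁻¹ * ∫ z in topLayer h η t, |f z * g z|) (𝓝[>] 0) (𝓝 0) := by
  have hsub : ∀ t, topLayer h η t ⊆ fluidDomain h η := fun t z hz => hz.1
  have hle : volume.restrict (topLayer h η b) ≤ volume.restrict (fluidDomain h η) :=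
    Measure.restrict_mono (hsub b) le_rfl
  have hpre := hS.isLayerChart_top
  refine hpre.tendsto_average_mul hS.pos ?_ (fun t => (isOpen_topLayer hS.continuous).measurableSet)
    ?_ (hc.mono ((hsub b).trans subset_closure)) ?_ (fun z hz => hd z hz.1) ?_
    (hfy.mono_measure hle) (hg.mono_measure hle)
  · exact fun t ht z hz => ⟨hz.1, by linarith [hz.2]⟩
  · intro z
    by_cases hz : z ∈ fluidDomain h η
    · filter_upwards [Ioo_mem_nhdsGT (sub_pos.2 hz.2)] with t ht hz'
      linarith [hz'.2, ht.2]
    · exact Eventually.of_forall fun t hz' => hz hz'.1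
  · intro x t ht
    refine hc.comp (by
      have := (shear η hS.continuous).continuous
      fun_prop) fun d hd' => ?_
    have := hS.above x
    refine hS.mem_closure ?_ ?_ <;> simp only [shear_apply] <;> linarith [hd'.1, hd'.2]
  · intro x
    rw [shear_apply, sub_zero]; exact h0 x

lemma IsTameSurface.tendsto_bottomLayer_mul (hS : IsTameSurface h b M η)
    (hc : ContinuousOn f (closure (fluidDomain h η)))
    (hd : ∀ z ∈ fluidDomain h η, DifferentiableAt ℝ f z) (h0 : ∀ x, f ⟨x, -h⟩ = 0)
    (hfy : MemLp (dY f) 2 (volume.restrict (fluidDomain h η)))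
    (hg : MemLp g 2 (volume.restrict (fluidDomain h η))) :
    Tendsto (fun t => t⁻¹ * ∫ z in bottomLayer h η t, |f z * g z|) (𝓝[>] 0) (𝓝 0) := by
  have hsub : ∀ t, bottomLayer h η t ⊆ fluidDomain h η := fun t z hz => hz.1
  have hle : volume.restrict (bottomLayer h η b) ≤ volume.restrict (fluidDomain h η) :=
    Measure.restrict_mono (hsub b) le_rfl
  have hpre := hS.isLayerChart_bottom
  refine hpre.tendsto_average_mul hS.pos ?_
    (fun t => (isOpen_bottomLayer hS.continuous).measurableSet)
    ?_ (hc.mono ((hsub b).trans subset_closure)) ?_ (fun z hz => hd z hz.1) ?_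
    (hfy.mono_measure hle) (hg.mono_measure hle)
  · exact fun t ht z hz => ⟨hz.1, by linarith [hz.2]⟩
  · intro z
    by_cases hz : z ∈ fluidDomain h η
    · filter_upwards [Ioo_mem_nhdsGT (show 0 < z.im + h by linarith [hz.1])] with t ht hz'
      linarith [hz'.2, ht.2]
    · exact Eventually.of_forall fun t hz' => hz hz'.1
  · intro x t ht
    refine hc.comp (by
      have := (bottomChart h).continuous
      fun_prop) fun d hd' => ?_
    have := hS.above x
    refine hS.mem_closure ?_ ?_ <;> simp only [bottomChart_apply] <;> linarith [hd'.1, hd'.2]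
  · intro x
    rw [bottomChart_apply, mul_zero, add_zero]; exact h0 x

lemma eLpNorm_two_eq (u : ℝ → ℝ) :
    eLpNorm u 2 volume = (∫⁻ x, ENNReal.ofReal (u x ^ 2)) ^ (1 / 2 : ℝ) := by
  rw [eLpNorm_eq_lintegral_rpow_enorm_toReal (by norm_num) (by norm_num)]
  simp only [ENNReal.toReal_ofNat]
  congr 2; ext x
  rw [Real.enorm_eq_ofReal_abs, ENNReal.ofReal_rpow_of_nonneg (abs_nonneg _) (by norm_num)]
  norm_num

lemma tendsto_eLpNorm_two_iff {u : ℝ → ℝ → ℝ} {l : Filter ℝ} :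
    Tendsto (fun t => eLpNorm (u t) 2 volume) l (𝓝 0) ↔
      Tendsto (fun t => ∫⁻ x, ENNReal.ofReal (u t x ^ 2)) l (𝓝 0) := by
  simp_rw [eLpNorm_two_eq]
  constructor
  · intro H
    have := H.ennrpow_const 2
    rw [ENNReal.zero_rpow_of_pos (by norm_num)] at this
    refine this.congr fun t => ?_
    rw [← ENNReal.rpow_mul]; norm_num
  · intro H
    have := H.ennrpow_const (1 / 2)
    rwa [ENNReal.zero_rpow_of_pos (by norm_num)] at this

/-- A function in `H¹` that is continuous up to the surface has its boundary values as trace. -/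
lemma IsTameSurface.isSurfaceTrace_of_continuousOn (hS : IsTameSurface h b M η)
    (hc : ContinuousOn f (closure (fluidDomain h η)))
    (hd : ∀ z ∈ fluidDomain h η, DifferentiableAt ℝ f z)
    (hfy : MemLp (dY f) 2 (volume.restrict (fluidDomain h η)))
    {τ : ℝ → ℝ} (hτ : MemLp τ 2) (hfτ : ∀ x, f ⟨x, η x⟩ = τ x) : IsSurfaceTrace η f τ := by
  refine ⟨hτ, tendsto_eLpNorm_two_iff.2 ?_⟩
  have hfin : ∫⁻ z in fluidDomain h η, ENNReal.ofReal (dY f z ^ 2) ≠ ⊤ := by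
    rw [← ofReal_integral_eq_lintegral_ofReal hfy.integrable_sq
      (Eventually.of_forall fun z => sq_nonneg _)]
    exact ENNReal.ofReal_ne_top
  have h0 : Tendsto (fun t => ENNReal.ofReal t *
      ∫⁻ z in fluidDomain h η, ENNReal.ofReal (dY f z ^ 2)) (𝓝[>] 0) (𝓝 0) := by
    have h1 : Tendsto (fun t : ℝ => ENNReal.ofReal t) (𝓝[>] 0) (𝓝 0) := by
      have := (ENNReal.continuous_ofReal.tendsto 0).mono_left
        (nhdsWithin_le_nhds (s := Set.Ioi (0 : ℝ)))
      simpa using this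
    simpa using ENNReal.Tendsto.mul_const h1 (Or.inr hfin)
  refine tendsto_of_tendsto_of_tendsto_of_le_of_le' tendsto_const_nhds h0
    (Eventually.of_forall fun _ => zero_le) ?_
  filter_upwards [Ioo_mem_nhdsGT hS.pos] with t ht
  have key := hS.isLayerChart_top.lintegral_slice_sq_le (f := f) ht.1 ht.2 (fun x => ?_)
    (fun z hz => hd z hz.1)
  · simp only [shear_apply, sub_zero, hfτ] at key
    refine key.trans (mul_le_mul' le_rfl (lintegral_mono_set fun z hz => hz.1))
  · refine hc.comp (by
      have := (shear η hS.continuous).continuous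
      fun_prop) fun d hd' => ?_
    have := hS.above x
    refine hS.mem_closure ?_ ?_ <;> simp only [shear_apply] <;> linarith [hd'.1, hd'.2, ht.2]

/-- A function with a square integrable majorant near the surface has its vertical limits as
trace. -/
lemma IsTameSurface.isSurfaceTrace_of_le (hS : IsTameSurface h b M η)
    (hf : ContinuousOn f (fluidDomain h η)) {τ e : ℝ → ℝ} (he : MemLp e 2) (hτ : Continuous τ)
    (hlim : ∀ x, Tendsto (fun d => f ⟨x, η x - d⟩) (𝓝[>] 0) (𝓝 (τ x)))
    (hle : ∀ z ∈ fluidDomain h η, |f z| ≤ e z.re) : IsSurfaceTrace η f τ := by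
  have hτe : ∀ x, |τ x| ≤ e x := fun x => by
    refine le_of_tendsto (hlim x).abs ?_
    filter_upwards [Ioo_mem_nhdsGT hS.pos] with t ht
    exact hle _ (hS.mem_of_depth ht.1 ht.2 x)
  have he0 : ∀ x, 0 ≤ e x := fun x => (abs_nonneg _).trans (hτe x)
  refine ⟨he.of_le hτ.aestronglyMeasurable (Eventually.of_forall fun x => ?_),
    tendsto_eLpNorm_two_iff.2 ?_⟩
  · rw [Real.norm_eq_abs, Real.norm_eq_abs, abs_of_nonneg (he0 x)]; exact hτe x
  have : Tendsto (fun t => ∫⁻ x, ENNReal.ofReal ((f ⟨x, η x - t⟩ - τ x) ^ 2)) (𝓝[>] 0)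
      (𝓝 (∫⁻ _ : ℝ, 0)) := by
    refine tendsto_lintegral_filter_of_dominated_convergence
      (fun x => ENNReal.ofReal (4 * e x ^ 2)) ?_ ?_ ?_ ?_
    · filter_upwards [Ioo_mem_nhdsGT hS.pos] with t ht
      have := hS.continuous_slice hf ht.1 ht.2
      exact ((this.sub hτ).pow 2).measurable.ennreal_ofReal
    · filter_upwards [Ioo_mem_nhdsGT hS.pos] with t ht
      refine Eventually.of_forall fun x => ENNReal.ofReal_le_ofReal ?_
      have h1 := hle _ (hS.mem_of_depth ht.1 ht.2 x)
      have h2 : |f ⟨x, η x - t⟩ - τ x| ≤ 2 * e x := by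
        refine (abs_sub _ _).trans ?_
        linarith [hτe x]
      calc _ = |f ⟨x, η x - t⟩ - τ x| ^ 2 := (sq_abs _).symm
        _ ≤ (2 * e x) ^ 2 := by gcongr
        _ = _ := by ring
    · have := (he.integrable_sq.const_mul 4)
      rw [← ofReal_integral_eq_lintegral_ofReal this
        (Eventually.of_forall fun z => by positivity)]
      exact ENNReal.ofReal_ne_top
    · refine Eventually.of_forall fun x => ?_
      have h1 := (((hlim x).sub_const (τ x)).pow 2)
      rw [sub_self, zero_pow two_ne_zero] at h1
      simpa [Function.comp_def] using (ENNReal.continuous_ofReal.tendsto 0).comp h1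
  simpa using this

end Boundary

end PointVortex
end

noncomputable section
namespace PointVortex

/-! ### Green's identities for the harmonic extension -/

section Green

variable {h b M : ℝ} {η ζ : ℝ → ℝ} {ψ v : ℂ → ℝ}

lemma IsTameSurface.memLp_normal (hS : IsTameSurface h b M η) (hψ : IsHarmonicExtension h η ζ ψ) :
    MemLp (fun z => -deriv η z.re * dX ψ z + dY ψ z) 2 (volume.restrict (fluidDomain h η)) := by
  have h1 : Continuous fun z : ℂ => -deriv η z.re :=
    (hS.continuous_deriv.comp Complex.continuous_re).neg
  refine MemLp.add (hψ.memLp_dX.of_le_mul (c := M)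
    (h1.aestronglyMeasurable.mul hψ.memLp_dX.aestronglyMeasurable)
    (Eventually.of_forall fun z => ?_)) hψ.memLp_dY
  rw [norm_mul, norm_neg]
  exact mul_le_mul_of_nonneg_right (hS.abs_deriv_le _) (norm_nonneg _)

lemma IsTameSurface.continuousOn_normal (hS : IsTameSurface h b M η)
    (hψ : IsHarmonicExtension h η ζ ψ) :
    ContinuousOn (fun z => -deriv η z.re * dX ψ z + dY ψ z) (fluidDomain h η) :=
  ((hS.continuous_deriv.comp Complex.continuous_re).neg.continuousOn.mul hψ.continuousOn_dX).add
    hψ.continuousOn_dY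

/-- Green's first identity for a function that vanishes on the bottom. -/
theorem IsTameSurface.integral_grad_mul_grad (hS : IsTameSurface h b M η)
    (hψ : IsHarmonicExtension h η ζ ψ)
    (hvc : ContinuousOn v (closure (fluidDomain h η)))
    (hvd : ∀ z ∈ fluidDomain h η, DifferentiableAt ℝ v z) (hv0 : ∀ x, v ⟨x, -h⟩ = 0)
    (hv : MemLp v 2 (volume.restrict (fluidDomain h η)))
    (hvx : MemLp (dX v) 2 (volume.restrict (fluidDomain h η)))
    (hvy : MemLp (dY v) 2 (volume.restrict (fluidDomain h η)))
    {τ : ℝ → ℝ} (hτ : Integrable τ)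
    (htop : Tendsto (fun t => t⁻¹ * ∫ z in topLayer h η t,
      |v z * (-deriv η z.re * dX ψ z + dY ψ z) - τ z.re|) (𝓝[>] 0) (𝓝 0)) :
    ∫ z in fluidDomain h η, (dX v z * dX ψ z + dY v z * dY ψ z) = ∫ x, τ x := by
  obtain ⟨hxx, -, -, hyy⟩ := hψ.memLp_second hS.continuous
  have dx : ∀ z ∈ fluidDomain h η, DifferentiableAt ℝ (dX ψ) z := fun z hz =>
    differentiableAt_dX (hψ.contDiffAt hz)
  have dy : ∀ z ∈ fluidDomain h η, DifferentiableAt ℝ (dY ψ) z := fun z hz =>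
    differentiableAt_dY (hψ.contDiffAt hz)
  have e1 : ∀ z ∈ fluidDomain h η,
      dX (fun z => v z * dX ψ z) z = dX v z * dX ψ z + v z * dX (dX ψ) z :=
    fun z hz => dX_mul (hvd z hz) (dx z hz)
  have e2 : ∀ z ∈ fluidDomain h η,
      dY (fun z => v z * dY ψ z) z = dY v z * dY ψ z + v z * dY (dY ψ) z :=
    fun z hz => dY_mul (hvd z hz) (dy z hz)
  have hgl := integral_divergence_eq (h := h) (τ := τ) (Y₁ := fun z => v z * dX ψ z)
    (Y₂ := fun z => v z * dY ψ z) hS.contDiff hS.abs_deriv_le hS.pos hS.above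
    (fun z hz => (hvd z hz).mul (dx z hz)) (fun z hz => (hvd z hz).mul (dy z hz))
    (hv.integrable_mul hψ.memLp_dX) (hv.integrable_mul hψ.memLp_dY)
    (((hvx.integrable_mul hψ.memLp_dX).add (hv.integrable_mul hxx)).congr
      ((ae_restrict_iff' hS.measurableSet).2 (Eventually.of_forall fun z hz => (e1 z hz).symm)))
    (((hvy.integrable_mul hψ.memLp_dY).add (hv.integrable_mul hyy)).congr
      ((ae_restrict_iff' hS.measurableSet).2 (Eventually.of_forall fun z hz => (e2 z hz).symm)))
    hτ (htop.congr fun t => by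
      congr 2; ext z; congr 1; ring)
    -- There is no flux through the bottom, because `v` vanishes there.
    (hS.tendsto_bottomLayer_mul hvc hvd hv0 hvy hψ.memLp_dY)
  rw [← hgl]
  refine setIntegral_congr_fun hS.measurableSet fun z hz => ?_
  rw [e1 z hz, e2 z hz]
  -- The divergence of `v∇ψ` is `∇v·∇ψ + vΔψ`, and `ψ` is harmonic.
  linear_combination (-v z) * dX_dX_add_dY_dY (hψ.harmonic.harmonicOnNhd z hz)

/-- Green's first identity for a function that vanishes on the whole boundary. -/
theorem IsTameSurface.integral_grad_mul_grad_eq_zero (hS : IsTameSurface h b M η)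
    (hψ : IsHarmonicExtension h η ζ ψ)
    (hvc : ContinuousOn v (closure (fluidDomain h η)))
    (hvd : ∀ z ∈ fluidDomain h η, DifferentiableAt ℝ v z) (hv0 : ∀ x, v ⟨x, -h⟩ = 0)
    (hv1 : ∀ x, v ⟨x, η x⟩ = 0)
    (hv : MemLp v 2 (volume.restrict (fluidDomain h η)))
    (hvx : MemLp (dX v) 2 (volume.restrict (fluidDomain h η)))
    (hvy : MemLp (dY v) 2 (volume.restrict (fluidDomain h η))) :
    ∫ z in fluidDomain h η, (dX v z * dX ψ z + dY v z * dY ψ z) = 0 := by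
  have := hS.integral_grad_mul_grad hψ hvc hvd hv0 hv hvx hvy (τ := fun _ => 0)
    (integrable_zero _ _ _)
    (by simpa using hS.tendsto_topLayer_mul hvc hvd hv1 hvy (hS.memLp_normal hψ))
  simpa using this

/-- Green's first identity in terms of the Dirichlet--Neumann operator. -/
theorem IsTameSurface.integral_grad_mul_grad_eq_trace (hS : IsTameSurface h b M η)
    (hψ : IsHarmonicExtension h η ζ ψ)
    (hvc : ContinuousOn v (closure (fluidDomain h η)))
    (hvd : ∀ z ∈ fluidDomain h η, DifferentiableAt ℝ v z) (hv0 : ∀ x, v ⟨x, -h⟩ = 0)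
    (hv : MemLp v 2 (volume.restrict (fluidDomain h η)))
    (hvx : MemLp (dX v) 2 (volume.restrict (fluidDomain h η)))
    (hvy : MemLp (dY v) 2 (volume.restrict (fluidDomain h η)))
    {ν w : ℝ → ℝ} (hν : IsSurfaceTrace η v ν)
    (hw : IsSurfaceTrace η (fun z => -deriv η z.re * dX ψ z + dY ψ z) w) :
    ∫ z in fluidDomain h η, (dX v z * dX ψ z + dY v z * dY ψ z) = ∫ x, ν x * w x := by
  have hvc' := hvc.mono subset_closure
  have hone := hν.mul hS hvc' (hS.continuousOn_normal hψ) hw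
  exact hS.integral_grad_mul_grad hψ hvc hvd hv0 hv hvx hvy hone.1
    (hone.tendsto_layer hS (hvc'.mul (hS.continuousOn_normal hψ)))

lemma IsTameSurface.isSurfaceTrace_harmonicExtension (hS : IsTameSurface h b M η)
    (hψ : IsHarmonicExtension h η ζ ψ) (hζ : MemLp ζ 2) : IsSurfaceTrace η ψ ζ :=
  hS.isSurfaceTrace_of_continuousOn hψ.harmonic.continuousOn (fun _ hz => hψ.differentiableAt hz)
    hψ.memLp_dY hζ hψ.surface

/-- The divergence theorem for the product of the harmonic extension and a vector field. -/
theorem IsTameSurface.integral_field_mul_grad (hS : IsTameSurface h b M η)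
    (hψ : IsHarmonicExtension h η ζ ψ) (hζ : MemLp ζ 2) {P₁ P₂ : ℂ → ℝ} {Q : ℝ → ℝ}
    (hd₁ : ∀ z ∈ fluidDomain h η, DifferentiableAt ℝ P₁ z)
    (hd₂ : ∀ z ∈ fluidDomain h η, DifferentiableAt ℝ P₂ z)
    (h₁ : MemLp P₁ 2 (volume.restrict (fluidDomain h η)))
    (h₂ : MemLp P₂ 2 (volume.restrict (fluidDomain h η)))
    (h₁' : MemLp (dX P₁) 2 (volume.restrict (fluidDomain h η)))
    (h₂' : MemLp (dY P₂) 2 (volume.restrict (fluidDomain h η)))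
    (hQ : IsSurfaceTrace η (fun z => -deriv η z.re * P₁ z + P₂ z) Q) :
    ∫ z in fluidDomain h η, (dX ψ z * P₁ z + dY ψ z * P₂ z + ψ z * (dX P₁ z + dY P₂ z)) =
      ∫ x, ζ x * Q x := by
  have e1 : ∀ z ∈ fluidDomain h η,
      dX (fun z => ψ z * P₁ z) z = dX ψ z * P₁ z + ψ z * dX P₁ z :=
    fun z hz => dX_mul (hψ.differentiableAt hz) (hd₁ z hz)
  have e2 : ∀ z ∈ fluidDomain h η,
      dY (fun z => ψ z * P₂ z) z = dY ψ z * P₂ z + ψ z * dY P₂ z :=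
    fun z hz => dY_mul (hψ.differentiableAt hz) (hd₂ z hz)
  have hψc := hψ.harmonic.continuousOn.mono subset_closure
  have hPc : ContinuousOn (fun z => -deriv η z.re * P₁ z + P₂ z) (fluidDomain h η) :=
    ((hS.continuous_deriv.comp Complex.continuous_re).neg.continuousOn.mul
      fun z hz => (hd₁ z hz).continuousAt.continuousWithinAt).add
      fun z hz => (hd₂ z hz).continuousAt.continuousWithinAt
  have hone := (hS.isSurfaceTrace_harmonicExtension hψ hζ).mul hS hψc hPc hQ
  have hgl := integral_divergence_eq (h := h) (τ := fun x => ζ x * Q x)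
    (Y₁ := fun z => ψ z * P₁ z)
    (Y₂ := fun z => ψ z * P₂ z) hS.contDiff hS.abs_deriv_le hS.pos hS.above
    (fun z hz => (hψ.differentiableAt hz).mul (hd₁ z hz))
    (fun z hz => (hψ.differentiableAt hz).mul (hd₂ z hz))
    (hψ.memLp.integrable_mul h₁) (hψ.memLp.integrable_mul h₂)
    (((hψ.memLp_dX.integrable_mul h₁).add (hψ.memLp.integrable_mul h₁')).congr
      ((ae_restrict_iff' hS.measurableSet).2 (Eventually.of_forall fun z hz => (e1 z hz).symm)))
    (((hψ.memLp_dY.integrable_mul h₂).add (hψ.memLp.integrable_mul h₂')).congr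
      ((ae_restrict_iff' hS.measurableSet).2 (Eventually.of_forall fun z hz => (e2 z hz).symm)))
    hone.1 ((hone.tendsto_layer hS (hψc.mul hPc)).congr fun t => by
      congr 2; ext z; congr 1; simp only [Pi.mul_apply]; ring)
    (hS.tendsto_bottomLayer_mul hψ.harmonic.continuousOn (fun z hz => hψ.differentiableAt hz)
      hψ.bottom hψ.memLp_dY h₂)
  rw [← hgl]
  refine setIntegral_congr_fun hS.measurableSet fun z hz => ?_
  rw [e1 z hz, e2 z hz]
  ring

/-- A smooth function of the height that equals one above the height `-h / 4` and zero below the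
height `-h / 2`. -/
def heightCutoff (h y : ℝ) : ℝ := Real.smoothTransition ((y + h / 2) / (h / 4))

lemma contDiff_heightCutoff (h : ℝ) : ContDiff ℝ ∞ (heightCutoff h) :=
  Real.smoothTransition.contDiff.comp (by fun_prop)

lemma heightCutoff_of_ge {h y : ℝ} (hh : 0 < h) (hy : -h / 4 ≤ y) : heightCutoff h y = 1 :=
  Real.smoothTransition.one_of_one_le (by rw [le_div_iff₀ (by positivity)]; linarith)

lemma heightCutoff_of_le {h y : ℝ} (hh : 0 < h) (hy : y ≤ -h / 2) : heightCutoff h y = 0 :=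
  Real.smoothTransition.zero_of_nonpos
    (div_nonpos_of_nonpos_of_nonneg (by linarith) (by positivity))

lemma abs_heightCutoff_le (h y : ℝ) : |heightCutoff h y| ≤ 1 := by
  rw [heightCutoff, abs_of_nonneg (Real.smoothTransition.nonneg _)]
  exact Real.smoothTransition.le_one _

lemma exists_bound_deriv_heightCutoff (h : ℝ) : ∃ K, 0 < K ∧ ∀ y, |deriv (heightCutoff h) y| ≤ K := by
  obtain ⟨K, hK0, hK⟩ := exists_bound_deriv_smoothTransition
  refine ⟨K * |(h / 4)⁻¹| + 1, by positivity, fun y => ?_⟩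
  have : HasDerivAt (heightCutoff h)
      (deriv Real.smoothTransition ((y + h / 2) / (h / 4)) * (1 / (h / 4))) y := by
    have h1 : HasDerivAt (fun y => (y + h / 2) / (h / 4)) (1 / (h / 4)) y :=
      ((hasDerivAt_id y).add_const _).div_const _
    exact ((Real.smoothTransition.contDiff (n := 1)).differentiable (by simp) _).hasDerivAt.comp y h1
  rw [this.deriv, abs_mul, one_div]
  have := mul_le_mul_of_nonneg_right (hK ((y + h / 2) / (h / 4))) (abs_nonneg (h / 4)⁻¹)
  linarith

lemma differentiable_heightCutoff_im (h : ℝ) : Differentiable ℝ fun z : ℂ => heightCutoff h z.im :=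
  ((contDiff_heightCutoff h).differentiable (by simp)).comp Complex.imCLM.differentiable

lemma hasFDerivAt_comp_im {u : ℝ → ℝ} (hu : Differentiable ℝ u) (z : ℂ) :
    HasFDerivAt (fun z : ℂ => u z.im) (deriv u z.im • Complex.imCLM) z :=
  (hu z.im).hasDerivAt.comp_hasFDerivAt z Complex.imCLM.hasFDerivAt

lemma hasFDerivAt_comp_re {u : ℝ → ℝ} (hu : Differentiable ℝ u) (z : ℂ) :
    HasFDerivAt (fun z : ℂ => u z.re) (deriv u z.re • Complex.reCLM) z :=
  (hu z.re).hasDerivAt.comp_hasFDerivAt z Complex.reCLM.hasFDerivAt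

lemma dX_comp_im {u : ℝ → ℝ} (hu : Differentiable ℝ u) (z : ℂ) : dX (fun z => u z.im) z = 0 := by
  simp [dX, (hasFDerivAt_comp_im hu z).fderiv]

lemma dY_comp_im {u : ℝ → ℝ} (hu : Differentiable ℝ u) (z : ℂ) :
    dY (fun z => u z.im) z = deriv u z.im := by
  simp [dY, (hasFDerivAt_comp_im hu z).fderiv]

lemma dX_comp_re {u : ℝ → ℝ} (hu : Differentiable ℝ u) (z : ℂ) :
    dX (fun z => u z.re) z = deriv u z.re := by
  simp [dX, (hasFDerivAt_comp_re hu z).fderiv]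

lemma dY_comp_re {u : ℝ → ℝ} (hu : Differentiable ℝ u) (z : ℂ) : dY (fun z => u z.re) z = 0 := by
  simp [dY, (hasFDerivAt_comp_re hu z).fderiv]

/-- Functions of the horizontal variable in `L²` are square integrable over a domain of bounded
height, with an explicit bound. -/
lemma integrableOn_comp_re {h B : ℝ} (hB : ∀ x, η x ≤ B) {u : ℝ → ℝ}
    (hu : Integrable u) (hu0 : ∀ x, 0 ≤ u x) (hhB : -h ≤ B) :
    IntegrableOn (fun z : ℂ => u z.re) (fluidDomain h η) ∧
      ∫ z in fluidDomain h η, u z.re ≤ (B + h) * ∫ x, u x := by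
  have hi : IntegrableOn (fun z : ℂ => u z.re) {z : ℂ | z.im ∈ Set.Ioo (-h) B} := by
    rw [← Complex.volume_preserving_equiv_real_prod.symm.integrableOn_comp_preimage
      Complex.measurableEquivRealProd.symm.measurableEmbedding]
    have : Complex.measurableEquivRealProd.symm ⁻¹' {z : ℂ | z.im ∈ Set.Ioo (-h) B} =
        Set.univ ×ˢ Set.Ioo (-h) B := by
      ext p; simp
    rw [this, IntegrableOn, Measure.volume_eq_prod, ← Measure.prod_restrict, Measure.restrict_univ]
    have h1 : Integrable (fun _ : ℝ => (1 : ℝ)) (volume.restrict (Set.Ioo (-h) B)) :=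
      integrableOn_const measure_Ioo_lt_top.ne
    refine (hu.mul_prod h1).congr (Eventually.of_forall fun p => ?_)
    simp
  have hsub : fluidDomain h η ⊆ {z : ℂ | z.im ∈ Set.Ioo (-h) B} :=
    fun z hz => ⟨hz.1, hz.2.trans_le (hB _)⟩
  refine ⟨hi.mono_set hsub, (setIntegral_mono_set hi (Eventually.of_forall fun z => hu0 _)
    hsub.eventuallyLE).trans (le_of_eq ?_)⟩
  rw [← Complex.volume_preserving_equiv_real_prod.symm.setIntegral_preimage_emb
    Complex.measurableEquivRealProd.symm.measurableEmbedding]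
  have : Complex.measurableEquivRealProd.symm ⁻¹' {z : ℂ | z.im ∈ Set.Ioo (-h) B} =
      Set.univ ×ˢ Set.Ioo (-h) B := by
    ext p; simp
  rw [this, Measure.volume_eq_prod]
  have := setIntegral_prod_mul (μ := volume) (ν := volume) u (fun _ => (1 : ℝ)) Set.univ (Set.Ioo (-h) B)
  simp only [mul_one] at this
  refine (Eq.trans ?_ this).trans ?_
  · rfl
  · simp [mul_comm, max_eq_left (show 0 ≤ B + h by linarith)]

end Green

end PointVortex
end

/-! ### Energy bound, tangential derivative and Rellich identity -/

noncomputable section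
namespace PointVortex

section Energy

variable {h b M : ℝ} {η ζ : ℝ → ℝ} {ψ : ℂ → ℝ}

/-- The standing smallness condition: a surface within `h/8` of rest stays in the region where
`heightCutoff` equals one, and above the ball around the vortex that is used later. -/
lemma isTameSurface_of_abs_le (hh : 0 < h) (hη : ContDiff ℝ 1 η) (hη' : ∀ x, |deriv η x| ≤ 1)
    (hη0 : ∀ x, |η x| ≤ h / 8) : IsTameSurface h (h / 2) 1 η where
  contDiff := hη
  abs_deriv_le := hη'
  pos := by positivity
  above x := by linarith [(abs_le.1 (hη0 x)).1]

/-- The Dirichlet energy of the harmonic extension is controlled by the `H¹` norm of its boundary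
values. -/
theorem exists_energy_bound (hh : 0 < h) : ∃ C, 0 < C ∧ ∀ (η ζ : ℝ → ℝ) (ψ : ℂ → ℝ),
    ContDiff ℝ 1 η → (∀ x, |deriv η x| ≤ 1) → (∀ x, |η x| ≤ h / 8) → ContDiff ℝ 1 ζ →
    MemLp ζ 2 → MemLp (deriv ζ) 2 → IsHarmonicExtension h η ζ ψ →
    ∫ z in fluidDomain h η, (dX ψ z ^ 2 + dY ψ z ^ 2) ≤
      C * ((∫ x, ζ x ^ 2) + ∫ x, deriv ζ x ^ 2) := by
  obtain ⟨K, hK0, hK⟩ := exists_bound_deriv_heightCutoff h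
  refine ⟨(h / 8 + h) * (1 + K ^ 2), by positivity, ?_⟩
  intro η ζ ψ hη hη' hη0 hζ hζ2 hζ2' hψ
  have hS := isTameSurface_of_abs_le hh hη hη' hη0
  have hζd : Differentiable ℝ ζ := hζ.differentiable (by simp)
  have hζc' : Continuous (deriv ζ) := hζ.continuous_deriv (by simp)
  have hκd : Differentiable ℝ (heightCutoff h) := (contDiff_heightCutoff h).differentiable (by simp)
  have hκc' : Continuous (deriv (heightCutoff h)) :=
    (contDiff_heightCutoff h).continuous_deriv (by simp)
  have hre := Complex.continuous_re
  have him := Complex.continuous_im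
  have hB : ∀ x, η x ≤ h / 8 := fun x => (abs_le.1 (hη0 x)).2
  -- An explicit function with the same boundary values as `ψ`, to which Dirichlet's principle
  -- compares `ψ`.
  set Z : ℂ → ℝ := fun z => ζ z.re * heightCutoff h z.im with hZ
  have hZd : Differentiable ℝ Z :=
    (hζd.comp Complex.reCLM.differentiable).mul (differentiable_heightCutoff_im h)
  have hZx : ∀ z, dX Z z = deriv ζ z.re * heightCutoff h z.im := fun z => by
    rw [hZ, dX_mul (hasFDerivAt_comp_re hζd z).differentiableAt
      (hasFDerivAt_comp_im hκd z).differentiableAt, dX_comp_re hζd, dX_comp_im hκd]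
    ring
  have hZy : ∀ z, dY Z z = ζ z.re * deriv (heightCutoff h) z.im := fun z => by
    rw [hZ, dY_mul (hasFDerivAt_comp_re hζd z).differentiableAt
      (hasFDerivAt_comp_im hκd z).differentiableAt, dY_comp_re hζd, dY_comp_im hκd]
    ring
  have hL2 : ∀ (u g : ℝ → ℝ) (C : ℝ), Continuous u → MemLp u 2 → Continuous g → (∀ y, |g y| ≤ C) →
      MemLp (fun z : ℂ => u z.re * g z.im) 2 (volume.restrict (fluidDomain h η)) := by
    intro u g C huc hu hgc hg
    have i1 := (integrableOn_comp_re (h := h) hB hu.integrable_sq (fun x => sq_nonneg _)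
      (by linarith)).1
    have : MemLp (fun z : ℂ => u z.re) 2 (volume.restrict (fluidDomain h η)) :=
      (memLp_two_iff_integrable_sq (by fun_prop)).2 i1
    refine this.of_le_mul (c := C) (by fun_prop) (Eventually.of_forall fun z => ?_)
    rw [norm_mul, mul_comm]
    exact mul_le_mul_of_nonneg_right (hg _) (norm_nonneg _)
  have hZ2 := hL2 ζ _ 1 hζ.continuous hζ2 (contDiff_heightCutoff h).continuous
    (abs_heightCutoff_le h)
  have hZx2 : MemLp (dX Z) 2 (volume.restrict (fluidDomain h η)) := by
    rw [funext hZx]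
    exact hL2 _ _ 1 hζc' hζ2' (contDiff_heightCutoff h).continuous (abs_heightCutoff_le h)
  have hZy2 : MemLp (dY Z) 2 (volume.restrict (fluidDomain h η)) := by
    rw [funext hZy]
    exact hL2 _ _ K hζ.continuous hζ2 hκc' hK
  have hvx : ∀ z ∈ fluidDomain h η, dX (fun z => ψ z - Z z) z = dX ψ z - dX Z z := fun z hz => by
    exact dX_sub (hψ.differentiableAt hz) (hZd z)
  have hvy : ∀ z ∈ fluidDomain h η, dY (fun z => ψ z - Z z) z = dY ψ z - dY Z z := fun z hz => by
    exact dY_sub (hψ.differentiableAt hz) (hZd z)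
  have hae : ∀ {f g : ℂ → ℝ}, (∀ z ∈ fluidDomain h η, f z = g z) →
      f =ᵐ[volume.restrict (fluidDomain h η)] g := fun hfg =>
    (ae_restrict_iff' hS.measurableSet).2 (Eventually.of_forall hfg)
  have key := hS.integral_grad_mul_grad_eq_zero hψ (v := fun z => ψ z - Z z)
    (hψ.harmonic.continuousOn.sub hZd.continuous.continuousOn)
    (fun z hz => (hψ.differentiableAt hz).sub (hZd z))
    (fun x => by simp [hψ.bottom, hZ, heightCutoff_of_le hh (show -h ≤ -h / 2 by linarith)])
    (fun x => by
      simp [hψ.surface, hZ,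
        heightCutoff_of_ge hh (show -h / 4 ≤ η x by linarith [(abs_le.1 (hη0 x)).1])])
    (hψ.memLp.sub hZ2)
    ((hψ.memLp_dX.sub hZx2).ae_eq (hae fun z hz => (hvx z hz).symm))
    ((hψ.memLp_dY.sub hZy2).ae_eq (hae fun z hz => (hvy z hz).symm))
  have iψ : IntegrableOn (fun z => dX ψ z ^ 2 + dY ψ z ^ 2) (fluidDomain h η) :=
    hψ.memLp_dX.integrable_sq.add hψ.memLp_dY.integrable_sq
  have iZ : IntegrableOn (fun z => dX Z z ^ 2 + dY Z z ^ 2) (fluidDomain h η) :=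
    hZx2.integrable_sq.add hZy2.integrable_sq
  have ic : IntegrableOn (fun z => dX Z z * dX ψ z + dY Z z * dY ψ z) (fluidDomain h η) :=
    (hZx2.integrable_mul hψ.memLp_dX).add (hZy2.integrable_mul hψ.memLp_dY)
  -- `ψ - Z` vanishes on the boundary, so it is orthogonal to the harmonic `ψ` in the Dirichlet
  -- form.
  have e1 : ∫ z in fluidDomain h η, (dX ψ z ^ 2 + dY ψ z ^ 2) =
      ∫ z in fluidDomain h η, (dX Z z * dX ψ z + dY Z z * dY ψ z) := by
    rw [← sub_eq_zero, ← integral_sub iψ ic, ← key]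
    refine setIntegral_congr_fun hS.measurableSet fun z hz => ?_
    simp only [hvx z hz, hvy z hz]
    ring
  have e2 : ∫ z in fluidDomain h η, (dX Z z * dX ψ z + dY Z z * dY ψ z) ≤
      ∫ z in fluidDomain h η, (1 / 2 * (dX ψ z ^ 2 + dY ψ z ^ 2) +
        1 / 2 * (dX Z z ^ 2 + dY Z z ^ 2)) := by
    refine integral_mono ic ((iψ.const_mul _).add (iZ.const_mul _)) fun z => ?_
    simp only
    nlinarith [sq_nonneg (dX Z z - dX ψ z), sq_nonneg (dY Z z - dY ψ z)]
  rw [integral_add (iψ.const_mul _) (iZ.const_mul _), integral_const_mul, integral_const_mul] at e2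
  have i0 := integrableOn_comp_re (h := h) hB hζ2.integrable_sq (fun x => sq_nonneg _)
    (by linarith)
  have i1 := integrableOn_comp_re (h := h) hB hζ2'.integrable_sq (fun x => sq_nonneg _)
    (by linarith)
  have e3 : ∫ z in fluidDomain h η, (dX Z z ^ 2 + dY Z z ^ 2) ≤
      ∫ z in fluidDomain h η, (deriv ζ z.re ^ 2 + K ^ 2 * ζ z.re ^ 2) := by
    refine integral_mono iZ (i1.1.add (i0.1.const_mul _)) fun z => ?_
    simp only [hZx, hZy, mul_pow]
    have a1 : heightCutoff h z.im ^ 2 ≤ 1 := by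
      rw [sq_le_one_iff_abs_le_one]; exact abs_heightCutoff_le h _
    have a2 : deriv (heightCutoff h) z.im ^ 2 ≤ K ^ 2 := by
      rw [sq_le_sq, abs_of_pos hK0]; exact hK _
    nlinarith [sq_nonneg (deriv ζ z.re), sq_nonneg (ζ z.re)]
  rw [integral_add i1.1 (i0.1.const_mul _), integral_const_mul] at e3
  have p0 : 0 ≤ ∫ x, ζ x ^ 2 := integral_nonneg fun x => sq_nonneg _
  have p1 : 0 ≤ ∫ x, deriv ζ x ^ 2 := integral_nonneg fun x => sq_nonneg _
  calc ∫ z in fluidDomain h η, (dX ψ z ^ 2 + dY ψ z ^ 2)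
      ≤ ∫ z in fluidDomain h η, (dX Z z ^ 2 + dY Z z ^ 2) := by linarith
    _ ≤ (h / 8 + h) * (∫ x, deriv ζ x ^ 2) + K ^ 2 * ((h / 8 + h) * ∫ x, ζ x ^ 2) := by
        refine e3.trans (add_le_add i1.2 (mul_le_mul_of_nonneg_left i0.2 (sq_nonneg K)))
    _ ≤ _ := by
        have : 0 ≤ h / 8 + h := by positivity
        nlinarith [mul_nonneg this p0, mul_nonneg this p1,
          mul_nonneg (mul_nonneg this (sq_nonneg K)) p1]

/-- The tangential derivative of the harmonic extension at the surface. -/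
lemma IsTameSurface.deriv_eq_tangential (hS : IsTameSurface h b M η)
    (hψ : IsHarmonicExtension h η ζ ψ) (hζ : ContDiff ℝ 1 ζ) (hζ2 : MemLp ζ 2) {p q : ℝ → ℝ}
    (hp : IsSurfaceTrace η (dX ψ) p) (hq : IsSurfaceTrace η (dY ψ) q) :
    ∀ᵐ x, deriv ζ x = p x + deriv η x * q x := by
  have hηd : Differentiable ℝ η := hS.contDiff.differentiable (by simp)
  have hζd : Differentiable ℝ ζ := hζ.differentiable (by simp)
  have hζc' : Continuous (deriv ζ) := hζ.continuous_deriv (by simp)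
  have hη' := hS.continuous_deriv
  have hTc : ContinuousOn (fun z => dX ψ z + deriv η z.re * dY ψ z) (fluidDomain h η) :=
    hψ.continuousOn_dX.add
      ((hη'.comp Complex.continuous_re).continuousOn.mul hψ.continuousOn_dY)
  have hT : IsSurfaceTrace η (fun z => dX ψ z + deriv η z.re * dY ψ z)
      (fun x => p x + deriv η x * q x) :=
    hp.add hS hψ.continuousOn_dX
      ((hη'.comp Complex.continuous_re).continuousOn.mul hψ.continuousOn_dY)
      (hq.mul_left hη'.aestronglyMeasurable hS.abs_deriv_le)
  -- The identity is tested against smooth `φ`. On the slices at depth `t > 0` the chain rule and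
  -- integration by parts are classical, and both sides pass to the limit `t → 0`, one by the trace
  -- of `ψ` and the other by the traces of its gradient.
  refine ae_eq_of_integral_contDiff_smul_eq hζc'.locallyIntegrable
    (hT.1.locallyIntegrable (by norm_num)) fun φ hφ hφc => ?_
  simp only [smul_eq_mul]
  have hφ2 : MemLp φ 2 := hφ.continuous.memLp_of_hasCompactSupport hφc
  have hφc' : Continuous (deriv φ) := hφ.continuous_deriv (by simp)
  have hφ2' : MemLp (deriv φ) 2 := hφc'.memLp_of_hasCompactSupport hφc.deriv
  have hφd : Differentiable ℝ φ := hφ.differentiable (by simp)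
  have htriv : ∀ u : ℝ → ℝ, MemLp u 2 → IsSurfaceTrace η (fun z => u z.re) u := fun u hu =>
    ⟨hu, by simp⟩
  have hc1 : ∀ {u : ℝ → ℝ}, Continuous u →
      ContinuousOn (fun z : ℂ => u z.re) (fluidDomain h η) := fun hu =>
    (hu.comp Complex.continuous_re).continuousOn
  have hψc := hψ.harmonic.continuousOn.mono subset_closure
  have t1 := (htriv φ hφ2).mul hS (hc1 hφ.continuous) hTc hT
  have t2 := (htriv _ hφ2').mul hS (hc1 hφc') hψc (hS.isSurfaceTrace_harmonicExtension hψ hζ2)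
  have lim : ∀ {F : ℂ → ℝ} {τ : ℝ → ℝ}, ContinuousOn F (fluidDomain h η) →
      (∀ᶠ t in 𝓝[>] (0 : ℝ), Integrable fun x : ℝ => F ⟨x, η x - t⟩) → IsSurfaceTraceOne η F τ →
      Tendsto (fun t => ∫ x : ℝ, F ⟨x, η x - t⟩) (𝓝[>] 0) (𝓝 (∫ x, τ x)) := fun _ hi ht =>
    tendsto_integral_of_L1' _ ht.1.aestronglyMeasurable hi ht.2
  have hslice : ∀ᶠ t in 𝓝[>] (0 : ℝ), 0 < t ∧ t < b := Ioo_mem_nhdsGT hS.pos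
  have l1 := lim ((hc1 hφ.continuous).mul hTc) (by
    filter_upwards [hslice] with t ht
    exact (hφ.continuous.mul (hS.continuous_slice hTc ht.1 ht.2)).integrable_of_hasCompactSupport
      hφc.mul_right) t1
  have l2 := lim ((hc1 hφc').mul hψc) (by
    filter_upwards [hslice] with t ht
    exact (hφc'.mul (hS.continuous_slice hψc ht.1 ht.2)).integrable_of_hasCompactSupport
      hφc.deriv.mul_right) t2
  have heq : ∀ᶠ t in 𝓝[>] (0 : ℝ), -∫ x : ℝ, deriv φ x * ψ ⟨x, η x - t⟩ =
      ∫ x : ℝ, φ x * (dX ψ ⟨x, η x - t⟩ + deriv η x * dY ψ ⟨x, η x - t⟩) := by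
    filter_upwards [hslice] with t ht
    have hder : ∀ x, HasDerivAt (fun x : ℝ => ψ ⟨x, η x - t⟩)
        (dX ψ ⟨x, η x - t⟩ + deriv η x * dY ψ ⟨x, η x - t⟩) x := by
      intro x
      have hc : HasDerivAt (fun x : ℝ => (⟨x, η x - t⟩ : ℂ)) (1 + ((deriv η x : ℝ) : ℂ) * Complex.I) x := by
        have h2 : (fun x : ℝ => (⟨x, η x - t⟩ : ℂ)) =
            fun x : ℝ => (x : ℂ) + ((η x : ℂ) - t) * Complex.I := by
          funext s; apply Complex.ext <;> simp
        rw [h2]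
        have h3 : HasDerivAt (fun x : ℝ => (η x : ℂ)) ((deriv η x : ℝ) : ℂ) x :=
          (hηd x).hasDerivAt.ofReal_comp
        refine ((Complex.ofRealCLM.hasDerivAt (x := x)).add
          ((h3.sub_const (t : ℂ)).mul_const Complex.I)).congr_deriv (by simp)
      have := (hψ.differentiableAt (hS.mem_of_depth ht.1 ht.2 x)).hasFDerivAt.comp_hasDerivAt x hc
      refine this.congr_deriv ?_
      rw [fderiv_eq_dX_dY]; simp
    have hs1 := hS.continuous_slice hψc ht.1 ht.2
    have hs2 := hS.continuous_slice hTc ht.1 ht.2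
    rw [integral_mul_deriv_eq_deriv_mul_of_integrable (fun x _ => (hφd x).hasDerivAt) (fun x _ => hder x)]
    · exact (hφ.continuous.mul hs2).integrable_of_hasCompactSupport hφc.mul_right
    · exact (hφc'.mul hs1).integrable_of_hasCompactSupport hφc.deriv.mul_right
    · exact (hφ.continuous.mul hs1).integrable_of_hasCompactSupport hφc.mul_right
  have hlim := tendsto_nhds_unique (l2.neg.congr' heq) l1
  rw [← hlim, integral_mul_deriv_eq_deriv_mul_of_integrable (fun x _ => (hφd x).hasDerivAt)
    (fun x _ => (hζd x).hasDerivAt)]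
  · exact (hφ.continuous.mul hζc').integrable_of_hasCompactSupport hφc.mul_right
  · exact (hφc'.mul hζ.continuous).integrable_of_hasCompactSupport hφc.deriv.mul_right
  · exact (hφ.continuous.mul hζ.continuous).integrable_of_hasCompactSupport hφc.mul_right

/-- The normal flux of the Rellich field. Signs are kept as factors `-1` so that each summand is
literally a product of two functions with `L²` traces. -/
lemma IsTameSurface.isSurfaceTraceOne_rellich (hS : IsTameSurface h b M η)
    (hψ : IsHarmonicExtension h η ζ ψ) {p q : ℝ → ℝ}
    (hp : IsSurfaceTrace η (dX ψ) p) (hq : IsSurfaceTrace η (dY ψ) q) :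
    IsSurfaceTraceOne η
      (fun z => 2 * deriv η z.re * dX ψ z * dY ψ z + dX ψ z * dX ψ z + -1 * dY ψ z * dY ψ z)
      (fun x => 2 * deriv η x * p x * q x + p x * p x + -1 * q x * q x) := by
  have hηc' := hS.continuous_deriv
  have hre := Complex.continuous_re
  have cx := hψ.continuousOn_dX
  have cy := hψ.continuousOn_dY
  have c1 : ContinuousOn (fun z : ℂ => 2 * deriv η z.re * dX ψ z) (fluidDomain h η) :=
    (by fun_prop : ContinuousOn (fun z : ℂ => 2 * deriv η z.re) (fluidDomain h η)).fun_mul cx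
  have c2 : ContinuousOn (fun z : ℂ => 2 * deriv η z.re * dX ψ z * dY ψ z) (fluidDomain h η) :=
    c1.fun_mul cy
  have c3 : ContinuousOn (fun z : ℂ => dX ψ z * dX ψ z) (fluidDomain h η) := cx.fun_mul cx
  have c4 : ContinuousOn (fun z : ℂ => -1 * dY ψ z) (fluidDomain h η) :=
    continuousOn_const.fun_mul cy
  have c5 : ContinuousOn (fun z : ℂ => -1 * dY ψ z * dY ψ z) (fluidDomain h η) := c4.fun_mul cy
  have s1 : IsSurfaceTrace η (fun z => 2 * deriv η z.re * dX ψ z)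
      (fun x => 2 * deriv η x * p x) :=
    hp.mul_left (u := fun x => 2 * deriv η x) (C := 2 * M) (by fun_prop) (fun x => by
      rw [abs_mul, abs_two]; linarith [hS.abs_deriv_le x])
  have s3 : IsSurfaceTrace η (fun z => -1 * dY ψ z) (fun x => -1 * q x) :=
    hq.mul_left (u := fun _ => -1) (C := 1) (by fun_prop) (fun x => by simp)
  exact ((s1.mul hS c1 cy hq).add hS c2 c3 (hp.mul hS cx cx hp)).add hS (c2.fun_add c3) c5
    (s3.mul hS c4 cy hq)

/-- The Rellich identity for the harmonic extension, localized near the surface. -/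
theorem rellich_identity (hh : 0 < h) {p q : ℝ → ℝ} (hη : ContDiff ℝ 1 η)
    (hη' : ∀ x, |deriv η x| ≤ 1) (hη0 : ∀ x, |η x| ≤ h / 8) (hψ : IsHarmonicExtension h η ζ ψ)
    (hp : IsSurfaceTrace η (dX ψ) p) (hq : IsSurfaceTrace η (dY ψ) q) :
    IntegrableOn (fun z => deriv (heightCutoff h) z.im * (dX ψ z ^ 2 - dY ψ z ^ 2))
      (fluidDomain h η) ∧
    Integrable (fun x => 2 * deriv η x * p x * q x + p x * p x + -1 * q x * q x) ∧
    ∫ z in fluidDomain h η, deriv (heightCutoff h) z.im * (dX ψ z ^ 2 - dY ψ z ^ 2) =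
      ∫ x, (2 * deriv η x * p x * q x + p x * p x + -1 * q x * q x) := by
  obtain ⟨K, hK0, hK⟩ := exists_bound_deriv_heightCutoff h
  have hS := isTameSurface_of_abs_le hh hη hη' hη0
  obtain ⟨hxx, hyx, hxy, hyy⟩ := hψ.memLp_second hS.continuous
  have hκd : Differentiable ℝ (heightCutoff h) := (contDiff_heightCutoff h).differentiable (by simp)
  have hκc' : Continuous (deriv (heightCutoff h)) :=
    (contDiff_heightCutoff h).continuous_deriv (by simp)
  have hκc := (contDiff_heightCutoff h).continuous
  have hηc' := hS.continuous_deriv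
  have hre := Complex.continuous_re
  have him := Complex.continuous_im
  have dx : ∀ z ∈ fluidDomain h η, DifferentiableAt ℝ (dX ψ) z := fun z hz =>
    differentiableAt_dX (hψ.contDiffAt hz)
  have dy : ∀ z ∈ fluidDomain h η, DifferentiableAt ℝ (dY ψ) z := fun z hz =>
    differentiableAt_dY (hψ.contDiffAt hz)
  have dκ : ∀ z : ℂ, DifferentiableAt ℝ (fun z : ℂ => heightCutoff h z.im) z := fun z =>
    (hasFDerivAt_comp_im hκd z).differentiableAt
  -- `A` and `B` are the imaginary and real parts of `(ψ_x - iψ_y)²`, which is holomorphic; by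
  -- Cauchy–Riemann the field `(A, B)` is divergence free. The height cutoff then contributes only
  -- the interior term with its own derivative.
  obtain ⟨A, hA⟩ : ∃ A : ℂ → ℝ, A = fun z => -2 * (dX ψ z * dY ψ z) := ⟨_, rfl⟩
  obtain ⟨B, hB⟩ : ∃ B : ℂ → ℝ, B = fun z => dX ψ z ^ 2 - dY ψ z ^ 2 := ⟨_, rfl⟩
  have hB' : (fun z => deriv (heightCutoff h) z.im * (dX ψ z ^ 2 - dY ψ z ^ 2)) =
      fun z => deriv (heightCutoff h) z.im * B z := by rw [hB]
  rw [hB']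
  have dA : ∀ z ∈ fluidDomain h η, DifferentiableAt ℝ A z := fun z hz => hA ▸
    ((dx z hz).mul (dy z hz)).const_mul _
  have dB : ∀ z ∈ fluidDomain h η, DifferentiableAt ℝ B z := fun z hz => hB ▸
    ((dx z hz).pow 2).sub ((dy z hz).pow 2)
  have eA : ∀ z ∈ fluidDomain h η,
      dX A z = -2 * (dX (dX ψ) z * dY ψ z + dX ψ z * dX (dY ψ) z) := fun z hz => by
    rw [← dX_mul (dx z hz) (dy z hz), hA]
    exact dX_const_mul (-2) ((dx z hz).fun_mul (dy z hz))
  have eB : ∀ z ∈ fluidDomain h η,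
      dY B z = 2 * (dX ψ z * dY (dX ψ) z) - 2 * (dY ψ z * dY (dY ψ) z) := fun z hz => by
    have h1 := dY_mul (dx z hz) (dx z hz)
    have h2 := dY_mul (dy z hz) (dy z hz)
    have h3 : B = fun z => dX ψ z * dX ψ z - dY ψ z * dY ψ z := by
      ext z; simp only [hB]; ring
    rw [h3, dY_sub ((dx z hz).fun_mul (dx z hz)) ((dy z hz).fun_mul (dy z hz)), h1, h2]
    ring
  have iA : IntegrableOn A (fluidDomain h η) :=
    hA ▸ (hψ.memLp_dX.integrable_mul hψ.memLp_dY).const_mul _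
  have iB : IntegrableOn B (fluidDomain h η) :=
    hB ▸ hψ.memLp_dX.integrable_sq.sub hψ.memLp_dY.integrable_sq
  have hae : ∀ {f g : ℂ → ℝ}, (∀ z ∈ fluidDomain h η, f z = g z) →
      f =ᵐ[volume.restrict (fluidDomain h η)] g := fun hfg =>
    (ae_restrict_iff' hS.measurableSet).2 (Eventually.of_forall hfg)
  have iA' : IntegrableOn (dX A) (fluidDomain h η) :=
    (((hxx.integrable_mul hψ.memLp_dY).add (hψ.memLp_dX.integrable_mul hxy)).const_mul (-2)).congr
      (hae fun z hz => (eA z hz).symm)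
  have iB' : IntegrableOn (dY B) (fluidDomain h η) :=
    (((hψ.memLp_dX.integrable_mul hyx).const_mul 2).sub
      ((hψ.memLp_dY.integrable_mul hyy).const_mul 2)).congr (hae fun z hz => (eB z hz).symm)
  have bκ : ∀ {f : ℂ → ℝ}, IntegrableOn f (fluidDomain h η) →
      IntegrableOn (fun z => heightCutoff h z.im * f z) (fluidDomain h η) := fun hf =>
    hf.bdd_mul (c := 1) (by fun_prop) (Eventually.of_forall fun z => abs_heightCutoff_le h _)
  have bκ' : ∀ {f : ℂ → ℝ}, IntegrableOn f (fluidDomain h η) →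
      IntegrableOn (fun z => deriv (heightCutoff h) z.im * f z) (fluidDomain h η) := fun hf =>
    hf.bdd_mul (c := K) (by fun_prop) (Eventually.of_forall fun z => hK _)
  have eX : ∀ z ∈ fluidDomain h η, dX (fun z => heightCutoff h z.im * A z) z =
      heightCutoff h z.im * dX A z := fun z hz => by
    rw [dX_mul (dκ z) (dA z hz), dX_comp_im hκd]; ring
  have eY : ∀ z ∈ fluidDomain h η, dY (fun z => heightCutoff h z.im * B z) z =
      deriv (heightCutoff h) z.im * B z + heightCutoff h z.im * dY B z := fun z hz => by
    rw [dY_mul (dκ z) (dB z hz), dY_comp_im hκd]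
  -- the trace of the flux
  have cx := hψ.continuousOn_dX
  have cy := hψ.continuousOn_dY
  have t123 := hS.isSurfaceTraceOne_rellich hψ hp hq
  have cAB : ContinuousOn (fun z => -deriv η z.re * (heightCutoff h z.im * A z) +
      heightCutoff h z.im * B z) (fluidDomain h η) := by
    have c1 : ContinuousOn A (fluidDomain h η) := fun z hz =>
      (dA z hz).continuousAt.continuousWithinAt
    have c2 : ContinuousOn B (fluidDomain h η) := fun z hz =>
      (dB z hz).continuousAt.continuousWithinAt
    have c3 : ContinuousOn (fun z : ℂ => -deriv η z.re) (fluidDomain h η) := by fun_prop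
    have c4 : ContinuousOn (fun z : ℂ => heightCutoff h z.im) (fluidDomain h η) := by fun_prop
    exact (c3.mul (c4.mul c1)).add (c4.mul c2)
  have htr : IsSurfaceTraceOne η (fun z => -deriv η z.re * (heightCutoff h z.im * A z) +
      heightCutoff h z.im * B z)
      (fun x => 2 * deriv η x * p x * q x + p x * p x + -1 * q x * q x) := t123.congr_top (show 0 < h / 8 by positivity) fun z hz => by
    rw [heightCutoff_of_ge hh (by linarith [(abs_le.1 (hη0 z.re)).1])]
    simp only [hA, hB]; ring
  have hgl := integral_divergence_eq (h := h) (Y₁ := fun z => heightCutoff h z.im * A z)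
    (Y₂ := fun z => heightCutoff h z.im * B z) hS.contDiff hS.abs_deriv_le hS.pos hS.above
    (fun z hz => (dκ z).mul (dA z hz)) (fun z hz => (dκ z).mul (dB z hz)) (bκ iA) (bκ iB)
    ((bκ iA').congr (hae fun z hz => (eX z hz).symm))
    (((bκ' iB).add (bκ iB')).congr (hae fun z hz => (eY z hz).symm))
    htr.1 (htr.tendsto_layer hS cAB) (by
      refine tendsto_const_nhds.congr' ?_
      filter_upwards [Ioo_mem_nhdsGT (show 0 < h / 2 by positivity)] with t ht
      rw [setIntegral_congr_fun (isOpen_bottomLayer hS.continuous).measurableSet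
        (g := fun _ => 0) (fun z hz => by
          rw [heightCutoff_of_le hh (by linarith [hz.2, ht.2])]; simp)]
      simp)
  have hdiv : ∫ z in fluidDomain h η, (dX (fun z => heightCutoff h z.im * A z) z +
      dY (fun z => heightCutoff h z.im * B z) z) =
      ∫ z in fluidDomain h η, deriv (heightCutoff h) z.im * B z := by
    refine setIntegral_congr_fun hS.measurableSet fun z hz => ?_
    rw [eX z hz, eY z hz, eA z hz, eB z hz, dX_dY_comm (hψ.contDiffAt hz)]
    linear_combination (-2 * heightCutoff h z.im * dY ψ z) *
      dX_dX_add_dY_dY (hψ.harmonic.harmonicOnNhd z hz)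
  exact ⟨bκ' iB, htr.1, hdiv.symm.trans hgl⟩

/-- The Rellich identity bounds the trace of the gradient of the harmonic extension by the `H¹` norm
of its boundary values. -/
theorem exists_trace_bound (hh : 0 < h) : ∃ C, 0 < C ∧ ∀ (η ζ : ℝ → ℝ) (ψ : ℂ → ℝ) (p q : ℝ → ℝ),
    ContDiff ℝ 1 η → (∀ x, |deriv η x| ≤ 1) → (∀ x, |η x| ≤ h / 8) → ContDiff ℝ 1 ζ →
    MemLp ζ 2 → MemLp (deriv ζ) 2 → IsHarmonicExtension h η ζ ψ →
    IsSurfaceTrace η (dX ψ) p → IsSurfaceTrace η (dY ψ) q →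
    (∫ x, p x ^ 2) + ∫ x, q x ^ 2 ≤ C * ((∫ x, ζ x ^ 2) + ∫ x, deriv ζ x ^ 2) := by
  obtain ⟨K, hK0, hK⟩ := exists_bound_deriv_heightCutoff h
  obtain ⟨C, hC0, hC⟩ := exists_energy_bound hh
  refine ⟨5 + 3 * (K * C), by positivity, ?_⟩
  intro η ζ ψ p q hη hη' hη0 hζ hζ2 hζ2' hψ hp hq
  have hS := isTameSurface_of_abs_le hh hη hη' hη0
  have hE := hC η ζ ψ hη hη' hη0 hζ hζ2 hζ2' hψ
  obtain ⟨iB, iτ, hgl⟩ := rellich_identity hh hη hη' hη0 hψ hp hq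
  have iψ : IntegrableOn (fun z => dX ψ z ^ 2 + dY ψ z ^ 2) (fluidDomain h η) :=
    hψ.memLp_dX.integrable_sq.add hψ.memLp_dY.integrable_sq
  have hlow : -(K * ∫ z in fluidDomain h η, (dX ψ z ^ 2 + dY ψ z ^ 2)) ≤
      ∫ z in fluidDomain h η, deriv (heightCutoff h) z.im * (dX ψ z ^ 2 - dY ψ z ^ 2) := by
    rw [← integral_const_mul, ← integral_neg]
    refine integral_mono (iψ.const_mul K).neg iB fun z => ?_
    have := abs_le.1 (hK z.im)
    nlinarith [sq_nonneg (dX ψ z), sq_nonneg (dY ψ z)]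
  have htan := hS.deriv_eq_tangential hψ hζ hζ2 hp hq
  have iζ := hζ2'.integrable_sq
  have iq := hq.1.integrable_sq
  have ip := hp.1.integrable_sq
  -- With the tangential derivative `ζ' = p + η'q`, the integrand equals `ζ'² - (1 + η'²)q²`. So the
  -- Rellich identity bounds `∫ q²` by `∫ ζ'²` and the energy.
  have hup : ∫ x, (2 * deriv η x * p x * q x + p x * p x + -1 * q x * q x) ≤
      ∫ x, (deriv ζ x ^ 2 - q x ^ 2) := by
    refine integral_mono_ae iτ (iζ.sub iq) ?_
    filter_upwards [htan] with x hx
    rw [hx]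
    nlinarith [sq_nonneg (deriv η x * q x)]
  rw [integral_sub iζ iq] at hup
  -- From `p = ζ' - η'q` and `|η'| ≤ 1`. Adding `∫ p² ≤ 2∫ζ'² + 2∫q²` to `∫ q²` produces the
  -- constant `5 + 3KC`.
  have hpq : ∫ x, p x ^ 2 ≤ ∫ x, (2 * deriv ζ x ^ 2 + 2 * q x ^ 2) := by
    refine integral_mono_ae ip ((iζ.const_mul _).add (iq.const_mul _)) ?_
    filter_upwards [htan] with x hx
    rw [hx]
    have h1 : deriv η x ^ 2 ≤ 1 := by rw [sq_le_one_iff_abs_le_one]; exact hη' x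
    nlinarith [sq_nonneg (p x + 2 * (deriv η x * q x)), sq_nonneg (q x)]
  rw [integral_add (iζ.const_mul _) (iq.const_mul _), integral_const_mul, integral_const_mul] at hpq
  have hmul := mul_le_mul_of_nonneg_left hE hK0.le
  have p0 : 0 ≤ ∫ x, ζ x ^ 2 := integral_nonneg fun x => sq_nonneg _
  have hq' : ∫ x, q x ^ 2 ≤ (∫ x, deriv ζ x ^ 2) +
      K * (C * ((∫ x, ζ x ^ 2) + ∫ x, deriv ζ x ^ 2)) := by linarith
  linarith

end Energy

end PointVortex
end

/-! ### Radial cutoff, mean value property and the flux around a dipole -/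

noncomputable section
namespace PointVortex

/-- A radial cutoff function that vanishes near `z₀` and equals one far from `z₀`. -/
def radialCutoff (z₀ : ℂ) (r : ℝ) (z : ℂ) : ℝ :=
  Real.smoothTransition (4 * ((z.re - z₀.re) ^ 2 + (z.im - z₀.im) ^ 2) / r ^ 2 - 1)

/-- The gradient of `radialCutoff z₀ r` is `radialSlope z₀ r z • (z - z₀)`. -/
def radialSlope (z₀ : ℂ) (r : ℝ) (z : ℂ) : ℝ :=
  8 / r ^ 2 * deriv Real.smoothTransition
    (4 * ((z.re - z₀.re) ^ 2 + (z.im - z₀.im) ^ 2) / r ^ 2 - 1)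

lemma norm_sub_sq_eq (z z₀ : ℂ) : ‖z - z₀‖ ^ 2 = (z.re - z₀.re) ^ 2 + (z.im - z₀.im) ^ 2 := by
  rw [← Complex.normSq_eq_norm_sq, Complex.normSq_apply]; simp; ring

lemma contDiff_radialCutoff (z₀ : ℂ) (r : ℝ) : ContDiff ℝ ∞ (radialCutoff z₀ r) := by
  unfold radialCutoff
  have h1 : ContDiff ℝ ∞ fun z : ℂ => z.re := Complex.reCLM.contDiff
  have h2 : ContDiff ℝ ∞ fun z : ℂ => z.im := Complex.imCLM.contDiff
  exact Real.smoothTransition.contDiff.comp (by fun_prop)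

lemma hasFDerivAt_radialCutoff (z₀ : ℂ) (r : ℝ) (z : ℂ) :
    HasFDerivAt (radialCutoff z₀ r) (radialSlope z₀ r z •
      ((z.re - z₀.re) • Complex.reCLM + (z.im - z₀.im) • Complex.imCLM)) z := by
  have h1 : HasFDerivAt (fun z : ℂ => z.re - z₀.re) Complex.reCLM z :=
    Complex.reCLM.hasFDerivAt.sub_const _
  have h2 : HasFDerivAt (fun z : ℂ => z.im - z₀.im) Complex.imCLM z :=
    Complex.imCLM.hasFDerivAt.sub_const _
  have hS : HasDerivAt Real.smoothTransition _
      (4 * ((z.re - z₀.re) ^ 2 + (z.im - z₀.im) ^ 2) / r ^ 2 - 1) :=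
    ((Real.smoothTransition.contDiff (n := 1)).differentiable (by norm_num) _).hasDerivAt
  refine (hS.comp_hasFDerivAt z ((((((h1.pow 2).add (h2.pow 2)).const_mul 4).mul_const
    ((r ^ 2)⁻¹))).sub_const 1)).congr_fderiv ?_
  ext
  · simp [radialSlope]; ring

lemma dX_radialCutoff (z₀ : ℂ) (r : ℝ) (z : ℂ) :
    dX (radialCutoff z₀ r) z = radialSlope z₀ r z * (z.re - z₀.re) := by
  rw [dX, (hasFDerivAt_radialCutoff z₀ r z).fderiv]; simp

lemma dY_radialCutoff (z₀ : ℂ) (r : ℝ) (z : ℂ) :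
    dY (radialCutoff z₀ r) z = radialSlope z₀ r z * (z.im - z₀.im) := by
  rw [dY, (hasFDerivAt_radialCutoff z₀ r z).fderiv]; simp

lemma abs_radialCutoff_le (z₀ : ℂ) (r : ℝ) (z : ℂ) : |radialCutoff z₀ r z| ≤ 1 := by
  rw [radialCutoff, abs_of_nonneg (Real.smoothTransition.nonneg _)]
  exact Real.smoothTransition.le_one _

lemma radialCutoff_eq_zero {z₀ z : ℂ} {r : ℝ} (hr : 0 < r) (hz : ‖z - z₀‖ ≤ r / 2) :
    radialCutoff z₀ r z = 0 := by
  apply Real.smoothTransition.zero_of_nonpos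
  rw [← norm_sub_sq_eq, sub_nonpos, div_le_one (by positivity)]
  nlinarith [norm_nonneg (z - z₀)]

/-- The transition is complete at distance `r/√2`, which is less than `3r/4`. -/
lemma radialCutoff_eq_one {z₀ z : ℂ} {r : ℝ} (hr : 0 < r) (hz : 3 / 4 * r ≤ ‖z - z₀‖) :
    radialCutoff z₀ r z = 1 := by
  apply Real.smoothTransition.one_of_one_le
  rw [← norm_sub_sq_eq, le_sub_iff_add_le, le_div_iff₀ (by positivity)]
  nlinarith [norm_nonneg (z - z₀)]

lemma radialSlope_eq_zero {z₀ z : ℂ} {r : ℝ} (hr : 0 < r)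
    (hz : ‖z - z₀‖ ≤ r / 2 ∨ 3 / 4 * r ≤ ‖z - z₀‖) : radialSlope z₀ r z = 0 := by
  rw [radialSlope, deriv_smoothTransition_eq_zero, mul_zero]
  rw [← norm_sub_sq_eq]
  refine hz.imp (fun hz => ?_) fun hz => ?_
  · rw [sub_nonpos, div_le_one (by positivity)]
    nlinarith [norm_nonneg (z - z₀)]
  · rw [le_sub_iff_add_le, le_div_iff₀ (by positivity)]
    nlinarith [norm_nonneg (z - z₀)]

lemma continuous_deriv_smoothTransition : Continuous (deriv Real.smoothTransition) :=
  (Real.smoothTransition.contDiff (n := 1)).continuous_deriv (by norm_num)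

lemma contDiff_deriv_smoothTransition : ContDiff ℝ ∞ (deriv Real.smoothTransition) :=
  (contDiff_infty_iff_deriv.1 Real.smoothTransition.contDiff).2

lemma contDiff_radialSlope (z₀ : ℂ) (r : ℝ) : ContDiff ℝ ∞ (radialSlope z₀ r) := by
  unfold radialSlope
  have h1 : ContDiff ℝ ∞ fun z : ℂ => z.re := Complex.reCLM.contDiff
  have h2 : ContDiff ℝ ∞ fun z : ℂ => z.im := Complex.imCLM.contDiff
  exact contDiff_const.mul (contDiff_deriv_smoothTransition.comp (by fun_prop))

lemma tsupport_radialSlope_subset {z₀ : ℂ} {r : ℝ} (hr : 0 < r) :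
    tsupport (radialSlope z₀ r) ⊆ {z | r / 2 ≤ ‖z - z₀‖ ∧ ‖z - z₀‖ ≤ 3 / 4 * r} := by
  refine closure_minimal (fun z hz => ?_) ?_
  · by_contra hcon
    rw [Set.mem_ofPred_eq, not_and_or, not_le, not_le] at hcon
    exact hz (radialSlope_eq_zero hr (hcon.imp le_of_lt le_of_lt))
  · have h1 : Continuous fun z : ℂ => ‖z - z₀‖ := by fun_prop
    exact (isClosed_le continuous_const h1).inter (isClosed_le h1 continuous_const)

lemma hasCompactSupport_radialSlope {z₀ : ℂ} {r : ℝ} (hr : 0 < r) :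
    HasCompactSupport (radialSlope z₀ r) :=
  (isCompact_closedBall z₀ r).of_isClosed_subset (isClosed_tsupport _) fun z hz => by
    have := (tsupport_radialSlope_subset hr hz).2
    rw [mem_closedBall_iff_norm]; linarith

/-- The integrand is the derivative of the cutoff as a function of the radius, which rises from zero
to one. -/
lemma integral_radialProfile {r : ℝ} (hr : 0 < r) :
    ∫ ρ in Set.Ioi (0 : ℝ), ρ * (8 / r ^ 2 * deriv Real.smoothTransition (4 * ρ ^ 2 / r ^ 2 - 1))
      = 1 := by
  have hd : ∀ ρ : ℝ, HasDerivAt (fun ρ : ℝ => Real.smoothTransition (4 * ρ ^ 2 / r ^ 2 - 1))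
      (ρ * (8 / r ^ 2 * deriv Real.smoothTransition (4 * ρ ^ 2 / r ^ 2 - 1))) ρ := fun ρ => by
    have hS : HasDerivAt Real.smoothTransition
        (deriv Real.smoothTransition (4 * ρ ^ 2 / r ^ 2 - 1)) (4 * ρ ^ 2 / r ^ 2 - 1) :=
      ((Real.smoothTransition.contDiff (n := 1)).differentiable (by norm_num) _).hasDerivAt
    have hi : HasDerivAt (fun ρ : ℝ => 4 * ρ ^ 2 / r ^ 2 - 1) (4 * (2 * ρ) / r ^ 2) ρ := by
      simpa using (((hasDerivAt_pow 2 ρ).const_mul 4).div_const (r ^ 2)).sub_const 1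
    exact (HasDerivAt.comp (h := fun ρ : ℝ => 4 * ρ ^ 2 / r ^ 2 - 1) ρ hS hi).congr_deriv (by ring)
  have hc : Continuous fun ρ : ℝ =>
      ρ * (8 / r ^ 2 * deriv Real.smoothTransition (4 * ρ ^ 2 / r ^ 2 - 1)) :=
    continuous_id.mul (continuous_const.mul (continuous_deriv_smoothTransition.comp (by fun_prop)))
  rw [setIntegral_eq_of_subset_of_forall_sdiff_eq_zero measurableSet_Ioi
    (Set.Ioc_subset_Ioi_self (a := r) (b := (0 : ℝ))), ← intervalIntegral.integral_of_le hr.le,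
    intervalIntegral.integral_eq_sub_of_hasDerivAt (fun x _ => hd x) (hc.intervalIntegrable _ _)]
  · rw [Real.smoothTransition.one_of_one_le, Real.smoothTransition.zero_of_nonpos] <;>
      field_simp <;> norm_num
    positivity
  · rintro ρ ⟨h1, h2⟩
    rw [Set.mem_Ioi] at h1
    have h3 : r < ρ := by by_contra hcon; exact h2 ⟨h1, not_lt.1 hcon⟩
    rw [deriv_smoothTransition_eq_zero (Or.inr _), mul_zero, mul_zero]
    rw [le_sub_iff_add_le, le_div_iff₀ (by positivity)]
    nlinarith

lemma integral_circle_eq {F : ℂ → ℂ} {z₀ : ℂ} {ρ : ℝ} (hρ : 0 < ρ)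
    (hF : DifferentiableOn ℂ F (Metric.closedBall z₀ ρ)) :
    ∫ t in Set.Ioo (-Real.pi) Real.pi, F (circleMap z₀ ρ t) = 2 * Real.pi * F z₀ := by
  have h1 : Real.circleAverage F z₀ ρ = F z₀ :=
    DiffContOnCl.circleAverage (hF.diffContOnCl_ball (by rw [abs_of_pos hρ]))
  have h2 : Function.Periodic (fun t => F (circleMap z₀ ρ t)) (2 * Real.pi) := fun t => by
    simp only [periodic_circleMap z₀ ρ t]
  have h3 := h2.intervalIntegral_add_eq (-Real.pi) 0
  rw [show -Real.pi + 2 * Real.pi = Real.pi by ring, zero_add,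
    intervalIntegral.integral_of_le (by linarith [Real.pi_pos]), integral_Ioc_eq_integral_Ioo] at h3
  rw [h3, ← h1, Real.circleAverage]
  have : (Real.pi : ℂ) ≠ 0 := by exact_mod_cast Real.pi_ne_zero
  simp
  field_simp

/-- The mean value property in integrated form. -/
theorem integral_radialSlope_mul {F : ℂ → ℂ} {z₀ : ℂ} {r : ℝ} (hr : 0 < r)
    (hF : DifferentiableOn ℂ F (Metric.closedBall z₀ r)) :
    ∫ z, (radialSlope z₀ r z : ℂ) * F z = 2 * Real.pi * F z₀ := by
  set k : ℝ → ℝ := fun ρ => 8 / r ^ 2 * deriv Real.smoothTransition (4 * ρ ^ 2 / r ^ 2 - 1) with hk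
  have hkc : Continuous k :=
    continuous_const.mul (continuous_deriv_smoothTransition.comp (by fun_prop))
  have hk0 : ∀ ρ, r < ρ → k ρ = 0 := fun ρ h3 => by
    rw [hk]
    dsimp only
    rw [deriv_smoothTransition_eq_zero (Or.inr _), mul_zero]
    rw [le_sub_iff_add_le, le_div_iff₀ (by positivity)]
    nlinarith
  -- In polar coordinates about `z₀` the slope depends on the radius alone, so the angular integral
  -- is a mean value of `F` over a circle.
  have hpt : ∀ p : ℝ × ℝ, (radialSlope z₀ r (Complex.polarCoord.symm p + z₀) : ℂ) *
      F (Complex.polarCoord.symm p + z₀) = (k p.1 : ℂ) * F (circleMap z₀ p.1 p.2) := fun p => by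
    have hz : Complex.polarCoord.symm p + z₀ = circleMap z₀ p.1 p.2 := by
      rw [Complex.polarCoord_symm_apply, circleMap, Complex.exp_mul_I]
      push_cast; ring
    have hs : (p.1 * Real.cos p.2) ^ 2 + (p.1 * Real.sin p.2) ^ 2 = p.1 ^ 2 := by
      have := Real.sin_sq_add_cos_sq p.2
      linear_combination p.1 ^ 2 * this
    rw [← hz]
    congr 2
    rw [radialSlope, hk]
    simp [Complex.polarCoord_symm_apply, Complex.cos_ofReal_re, Complex.sin_ofReal_re, hs]
  rw [← integral_add_right_eq_self _ z₀, ← Complex.integral_comp_polarCoord_symm]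
  simp only [hpt]
  have hint : IntegrableOn (fun p : ℝ × ℝ => p.1 • ((k p.1 : ℂ) * F (circleMap z₀ p.1 p.2)))
      (Set.Ioi 0 ×ˢ Set.Ioo (-Real.pi) Real.pi) := by
    have hK : IsCompact (Set.Icc 0 r ×ˢ Set.Icc (-Real.pi) Real.pi) :=
      isCompact_Icc.prod isCompact_Icc
    refine IntegrableOn.of_forall_sdiff_eq_zero (s := Set.Icc 0 r ×ˢ Set.Icc (-Real.pi) Real.pi)
      (ContinuousOn.integrableOn_compact hK ?_) (measurableSet_Ioi.prod measurableSet_Ioo) ?_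
    · have hm : ContinuousOn (fun p : ℝ × ℝ => F (circleMap z₀ p.1 p.2))
          (Set.Icc 0 r ×ˢ Set.Icc (-Real.pi) Real.pi) := by
        refine hF.continuousOn.comp (Continuous.continuousOn ?_) fun p hp => ?_
        · unfold circleMap; fun_prop
        · rw [mem_closedBall_iff_norm, circleMap_sub_center, norm_circleMap_zero, abs_of_nonneg hp.1.1]
          exact hp.1.2
      have hk2 : Continuous fun p : ℝ × ℝ => ((k p.1 : ℝ) : ℂ) :=
        Complex.continuous_ofReal.comp (hkc.comp continuous_fst)
      exact continuous_fst.continuousOn.smul (hk2.continuousOn.mul hm)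
    · rintro p ⟨⟨h1, h2⟩, h3⟩
      have : r < p.1 := by
        by_contra hcon
        exact h3 ⟨⟨le_of_lt h1, not_lt.1 hcon⟩, ⟨h2.1.le, h2.2.le⟩⟩
      simp [hk0 _ this]
  rw [polarCoord_target, Measure.volume_eq_prod, setIntegral_prod _ (by exact hint)]
  have hin : ∀ ρ ∈ Set.Ioi (0 : ℝ), ∫ t in Set.Ioo (-Real.pi) Real.pi,
      ρ • ((k ρ : ℂ) * F (circleMap z₀ ρ t)) = ((ρ * k ρ : ℝ) : ℂ) * (2 * Real.pi * F z₀) := by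
    intro ρ hρ
    rcases le_or_gt ρ r with h | h
    · rw [integral_smul, integral_const_mul, integral_circle_eq hρ
        (hF.mono (Metric.closedBall_subset_closedBall h))]
      simp only [Complex.real_smul]
      push_cast; ring
    · simp [hk0 ρ h]
  rw [setIntegral_congr_fun measurableSet_Ioi hin, integral_mul_const, integral_complex_ofReal,
    integral_radialProfile hr]
  simp


lemma integrable_mul_of_hasCompactSupport {f g : ℂ → ℝ} (hg : Continuous g)
    (hg' : HasCompactSupport g) (hf : ∀ z ∈ tsupport g, ContinuousAt f z) :
    Integrable fun z => f z * g z := by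
  have h1 : IntegrableOn (fun z => f z * g z) (tsupport g) :=
    ContinuousOn.integrableOn_compact hg' fun z hz =>
      ((hf z hz).mul hg.continuousAt).continuousWithinAt
  refine (integrableOn_iff_integrable_of_support_subset fun z hz => ?_).1 h1
  exact subset_tsupport _ (right_ne_zero_of_mul hz)

/-- The Cauchy–Riemann equations, read off from the complex derivative. -/
lemma hasFDerivAt_re_comp {f : ℂ → ℂ} {f' z : ℂ} (hf : HasDerivAt f f' z) :
    dX (fun z => (f z).re) z = f'.re ∧ dY (fun z => (f z).re) z = -f'.im ∧
    dX (fun z => (f z).im) z = f'.im ∧ dY (fun z => (f z).im) z = f'.re := by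
  have h1 := hf.hasFDerivAt.restrictScalars ℝ
  have h2 : HasFDerivAt (fun z => (f z).re) _ z := Complex.reCLM.hasFDerivAt.comp z h1
  have h3 : HasFDerivAt (fun z => (f z).im) _ z := Complex.imCLM.hasFDerivAt.comp z h1
  rw [dX, dY, dX, dY, h2.fderiv, h3.fderiv]
  simp

/-- The rotated gradient of `β` is divergence free: both integrals equal minus the integral of `W`
against the mixed second derivative of `β`. Regularity of `W` is needed only where the gradient of
`β` lives, so `W` may be singular at the vortex. -/
lemma integral_rot_eq_zero {W β : ℂ → ℝ} (hβ : ContDiff ℝ 2 β) (hβx : HasCompactSupport (dX β))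
    (hβy : HasCompactSupport (dY β)) (hWx : ∀ z ∈ tsupport (dX β), ContDiffAt ℝ 2 W z)
    (hWy : ∀ z ∈ tsupport (dY β), ContDiffAt ℝ 2 W z) :
    Integrable (fun z => dY W z * dX β z) ∧ Integrable (fun z => dX W z * dY β z) ∧
    ∫ z, dY W z * dX β z = ∫ z, dX W z * dY β z := by
  have hf' : ContDiff ℝ 1 (fderiv ℝ β) := hβ.fderiv_right (by norm_num)
  have hX : ContDiff ℝ 1 (dX β) := hf'.clm_apply contDiff_const
  have hY : ContDiff ℝ 1 (dY β) := hf'.clm_apply contDiff_const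
  have hXX : Continuous (dY (dX β)) := (hX.continuous_fderiv (by norm_num)).clm_apply continuous_const
  have hYY : Continuous (dX (dY β)) := (hY.continuous_fderiv (by norm_num)).clm_apply continuous_const
  have hXs : tsupport (dY (dX β)) ⊆ tsupport (dX β) := tsupport_fderiv_apply_subset ℝ Complex.I
  have hYs : tsupport (dX (dY β)) ⊆ tsupport (dY β) := tsupport_fderiv_apply_subset ℝ 1
  have i1 : Integrable fun z => dY W z * dX β z :=
    integrable_mul_of_hasCompactSupport hX.continuous hβx fun z hz =>
      (differentiableAt_dY (hWx z hz)).continuousAt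
  have i2 : Integrable fun z => dX W z * dY β z :=
    integrable_mul_of_hasCompactSupport hY.continuous hβy fun z hz =>
      (differentiableAt_dX (hWy z hz)).continuousAt
  have i3 : Integrable fun z => W z * dY (dX β) z :=
    integrable_mul_of_hasCompactSupport hXX (hβx.of_isClosed_subset (isClosed_tsupport _) hXs)
      fun z hz => (hWx z (hXs hz)).continuousAt
  have i4 : Integrable fun z => W z * dX (dY β) z :=
    integrable_mul_of_hasCompactSupport hYY (hβy.of_isClosed_subset (isClosed_tsupport _) hYs)
      fun z hz => (hWy z (hYs hz)).continuousAt
  have i5 : Integrable fun z => W z * dX β z :=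
    integrable_mul_of_hasCompactSupport hX.continuous hβx fun z hz => (hWx z hz).continuousAt
  have i6 : Integrable fun z => W z * dY β z :=
    integrable_mul_of_hasCompactSupport hY.continuous hβy fun z hz => (hWy z hz).continuousAt
  refine ⟨i1, i2, ?_⟩
  have e1 : ∫ z, W z * dY (dX β) z = -∫ z, dY W z * dX β z :=
    integral_mul_fderiv_eq_neg_fderiv_mul_of_integrable i1 i3 i5
      (fun z hz => (hWx z hz).differentiableAt (by norm_num))
      (fun z _ => hX.differentiable (by norm_num) z)
  have e2 : ∫ z, W z * dX (dY β) z = -∫ z, dX W z * dY β z :=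
    integral_mul_fderiv_eq_neg_fderiv_mul_of_integrable i2 i4 i6
      (fun z hz => (hWy z hz).differentiableAt (by norm_num))
      (fun z _ => hY.differentiable (by norm_num) z)
  have e3 : (fun z => W z * dX (dY β) z) = fun z => W z * dY (dX β) z :=
    funext fun z => by rw [dX_dY_comm hβ.contDiffAt]
  rw [e3] at e2
  linarith

/-- The flux through a cutoff around a simple pole of the kernel. -/
theorem integral_gradient_radialCutoff {ψ : ℂ → ℝ} {K G : ℂ → ℂ} {z₀ : ℂ} {r : ℝ} (hr : 0 < r)
    (hψ : ∀ z ∈ Metric.closedBall z₀ r, HarmonicAt ψ z)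
    (hK : ∀ z ∈ Metric.closedBall z₀ r, z ≠ z₀ → DifferentiableAt ℂ K z)
    (hG : DifferentiableOn ℂ G (Metric.closedBall z₀ r))
    (hGK : ∀ z ∈ Metric.closedBall z₀ r, z ≠ z₀ → (z - z₀) * K z = G z) :
    ∫ z, (dX (radialCutoff z₀ r) z * (ψ z * dX (fun z => (K z).im) z - (K z).im * dX ψ z) +
      dY (radialCutoff z₀ r) z * (ψ z * dY (fun z => (K z).im) z - (K z).im * dY ψ z)) =
    2 * Real.pi * ((G z₀).re * dY ψ z₀ - (G z₀).im * dX ψ z₀) := by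
  have hβ : ContDiff ℝ 2 (radialCutoff z₀ r) := contDiff_infty.1 (contDiff_radialCutoff z₀ r) 2
  have hsX : Function.support (dX (radialCutoff z₀ r)) ⊆ Function.support (radialSlope z₀ r) :=
    fun z hz => by
      rw [Function.mem_support, dX_radialCutoff] at hz
      exact left_ne_zero_of_mul hz
  have hsY : Function.support (dY (radialCutoff z₀ r)) ⊆ Function.support (radialSlope z₀ r) :=
    fun z hz => by
      rw [Function.mem_support, dY_radialCutoff] at hz
      exact left_ne_zero_of_mul hz
  have hcs := hasCompactSupport_radialSlope (z₀ := z₀) hr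
  have hann : ∀ z ∈ tsupport (radialSlope z₀ r), z ∈ Metric.ball z₀ r ∧ z ≠ z₀ := fun z hz => by
    obtain ⟨h1, h2⟩ := tsupport_radialSlope_subset hr hz
    refine ⟨by rw [mem_ball_iff_norm]; linarith, fun hzz => ?_⟩
    rw [hzz, sub_self, norm_zero] at h1
    linarith
  have hKc : ∀ z ∈ tsupport (radialSlope z₀ r), ContDiffAt ℝ 2 K z := fun z hz => by
    obtain ⟨h1, h2⟩ := hann z hz
    have hev : ∀ᶠ w in 𝓝 z, DifferentiableAt ℂ K w := by
      filter_upwards [Metric.isOpen_ball.mem_nhds h1, isOpen_ne.mem_nhds h2] with w hw1 hw2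
      exact hK w (Metric.ball_subset_closedBall hw1) hw2
    exact ((Complex.analyticAt_iff_eventually_differentiableAt.2 hev).contDiffAt (n := 2)).restrict_scalars ℝ
  have hψc : ∀ z ∈ tsupport (radialSlope z₀ r), ContDiffAt ℝ 2 ψ z := fun z hz =>
    (hψ z (Metric.ball_subset_closedBall (hann z hz).1)).1
  have hW : ∀ z ∈ tsupport (radialSlope z₀ r), ContDiffAt ℝ 2 (fun z => (K z).re * ψ z) z :=
    fun z hz => (Complex.reCLM.contDiff.contDiffAt.comp z (hKc z hz)).mul (hψc z hz)
  obtain ⟨i1, i2, hrot⟩ := integral_rot_eq_zero (W := fun z => (K z).re * ψ z) hβ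
    (hcs.mono hsX) (hcs.mono hsY) (fun z hz => hW z (closure_mono hsX hz))
    (fun z hz => hW z (closure_mono hsY hz))
  -- `ψ_y + iψ_x = i(ψ_x - iψ_y)` is holomorphic because `ψ` is harmonic.
  have hg : DifferentiableOn ℂ (fun z => G z * ((dY ψ z : ℂ) + Complex.I * (dX ψ z : ℂ)))
      (Metric.closedBall z₀ r) := by
    refine hG.mul fun z hz => DifferentiableAt.differentiableWithinAt ?_
    refine ((HarmonicAt.differentiableAt_complex_partial (hψ z hz)).const_mul Complex.I).congr_of_eventuallyEq
      (Eventually.of_forall fun w => ?_)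
    simp only [dX, dY]
    linear_combination ((fderiv ℝ ψ w Complex.I : ℝ) : ℂ) * Complex.I_mul_I
  have hmv := integral_radialSlope_mul hr hg
  have i3 : Integrable fun z => (radialSlope z₀ r z : ℂ) *
      (G z * ((dY ψ z : ℂ) + Complex.I * (dX ψ z : ℂ))) := by
    refine (integrableOn_iff_integrable_of_support_subset (s := Metric.closedBall z₀ r)
      fun z hz => ?_).1 (ContinuousOn.integrableOn_compact (isCompact_closedBall z₀ r) ?_)
    · refine Metric.ball_subset_closedBall (hann z (subset_tsupport _ ?_)).1
      exact fun h0 => hz (by simp [h0])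
    · exact (Complex.continuous_ofReal.comp (contDiff_radialSlope z₀ r).continuous).continuousOn.mul
        hg.continuousOn
  -- By Cauchy–Riemann, `ψ∇(Im K)` is a rotated gradient of `(Re K)ψ` plus terms without derivatives
  -- of `K`. The latter combine with `(Im K)∇ψ` into the real part of slope times `(z - z₀)K(ψ_y +
  -- iψ_x)`, to which the mean value property applies; the rotated gradient integrates to zero.
  have hpt : ∀ z, dX (radialCutoff z₀ r) z * (ψ z * dX (fun z => (K z).im) z - (K z).im * dX ψ z) +
      dY (radialCutoff z₀ r) z * (ψ z * dY (fun z => (K z).im) z - (K z).im * dY ψ z) =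
      ((radialSlope z₀ r z : ℂ) * (G z * ((dY ψ z : ℂ) + Complex.I * (dX ψ z : ℂ)))).re -
      (dY (fun z => (K z).re * ψ z) z * dX (radialCutoff z₀ r) z -
        dX (fun z => (K z).re * ψ z) z * dY (radialCutoff z₀ r) z) := by
    intro z
    by_cases hz : radialSlope z₀ r z = 0
    · rw [dX_radialCutoff, dY_radialCutoff, hz]; simp
    have hz' := subset_tsupport _ hz
    obtain ⟨h1, h2⟩ := hann z hz'
    have hd := (hK z (Metric.ball_subset_closedBall h1) h2).hasDerivAt
    obtain ⟨e1, e2, e3, e4⟩ := hasFDerivAt_re_comp hd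
    have hdr : DifferentiableAt ℝ (fun z => (K z).re) z :=
      (Complex.reCLM.contDiff.contDiffAt.comp z (hKc z hz')).differentiableAt (by norm_num)
    have hdψ := (hψc z hz').differentiableAt (by norm_num)
    rw [dX_mul hdr hdψ, dY_mul hdr hdψ, e1, e2, e3, e4, dX_radialCutoff, dY_radialCutoff,
      ← hGK z (Metric.ball_subset_closedBall h1) h2]
    simp
    ring
  have i4 : Integrable fun z => ((radialSlope z₀ r z : ℂ) *
      (G z * ((dY ψ z : ℂ) + Complex.I * (dX ψ z : ℂ)))).re := i3.re
  have hre : ∫ z, ((radialSlope z₀ r z : ℂ) *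
      (G z * ((dY ψ z : ℂ) + Complex.I * (dX ψ z : ℂ)))).re = _ := integral_re i3
  rw [integral_congr_ae (Eventually.of_forall hpt), integral_sub i4 (by exact i1.sub i2), integral_sub i1 i2,
    hrot, sub_self, sub_zero, hre, hmv]
  simp

end PointVortex
end

/-! ### The dipole kernel of the strip -/

noncomputable section
namespace PointVortex

lemma cosh_mul_eq (κ : ℝ) (z : ℂ) : Complex.cosh (κ * z) =
    ((Real.cosh (κ * z.re) * Real.cos (κ * z.im) : ℝ) : ℂ) +
      ((Real.sinh (κ * z.re) * Real.sin (κ * z.im) : ℝ) : ℂ) * Complex.I := by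
  conv_lhs => rw [← Complex.re_add_im z, mul_add, ← mul_assoc, Complex.cosh_add, Complex.cosh_mul_I,
    Complex.sinh_mul_I]
  push_cast
  ring

lemma sinh_mul_eq (κ : ℝ) (z : ℂ) : Complex.sinh (κ * z) =
    ((Real.sinh (κ * z.re) * Real.cos (κ * z.im) : ℝ) : ℂ) +
      ((Real.cosh (κ * z.re) * Real.sin (κ * z.im) : ℝ) : ℂ) * Complex.I := by
  conv_lhs => rw [← Complex.re_add_im z, mul_add, ← mul_assoc, Complex.sinh_add, Complex.cosh_mul_I,
    Complex.sinh_mul_I]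
  push_cast
  ring

lemma re_ofReal_add_mul_I (a b : ℝ) : ((a : ℂ) + (b : ℂ) * Complex.I).re = a := by simp

lemma im_ofReal_add_mul_I (a b : ℝ) : ((a : ℂ) + (b : ℂ) * Complex.I).im = b := by simp

lemma cosh_re (κ : ℝ) (z : ℂ) :
    (Complex.cosh (κ * z)).re = Real.cosh (κ * z.re) * Real.cos (κ * z.im) := by
  rw [cosh_mul_eq, re_ofReal_add_mul_I]

lemma cosh_im (κ : ℝ) (z : ℂ) :
    (Complex.cosh (κ * z)).im = Real.sinh (κ * z.re) * Real.sin (κ * z.im) := by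
  rw [cosh_mul_eq, im_ofReal_add_mul_I]

lemma sinh_re (κ : ℝ) (z : ℂ) :
    (Complex.sinh (κ * z)).re = Real.sinh (κ * z.re) * Real.cos (κ * z.im) := by
  rw [sinh_mul_eq, re_ofReal_add_mul_I]

lemma sinh_im (κ : ℝ) (z : ℂ) :
    (Complex.sinh (κ * z)).im = Real.cosh (κ * z.re) * Real.sin (κ * z.im) := by
  rw [sinh_mul_eq, im_ofReal_add_mul_I]

lemma norm_cosh_le (κ : ℝ) (z : ℂ) : ‖Complex.cosh (κ * z)‖ ≤ Real.cosh (κ * z.re) := by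
  refine abs_le_of_sq_le_sq' ?_ (Real.cosh_pos _).le |>.2
  rw [← Complex.normSq_eq_norm_sq, Complex.normSq_apply, cosh_re, cosh_im]
  have h1 := Real.sin_sq_add_cos_sq (κ * z.im)
  have h2 := Real.cosh_sq (κ * z.re)
  nlinarith [sq_nonneg (Real.sin (κ * z.im)), sq_nonneg (Real.sinh (κ * z.re))]

lemma norm_sinh_le (κ : ℝ) (z : ℂ) : ‖Complex.sinh (κ * z)‖ ≤ Real.cosh (κ * z.re) := by
  refine abs_le_of_sq_le_sq' ?_ (Real.cosh_pos _).le |>.2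
  rw [← Complex.normSq_eq_norm_sq, Complex.normSq_apply, sinh_re, sinh_im]
  have h1 := Real.sin_sq_add_cos_sq (κ * z.im)
  have h2 := Real.cosh_sq (κ * z.re)
  nlinarith [sq_nonneg (Real.cos (κ * z.im)), sq_nonneg (Real.sinh (κ * z.re))]

lemma norm_cosh_sq (κ : ℝ) (z : ℂ) :
    ‖Complex.cosh (κ * z)‖ ^ 2 = Real.cosh (κ * z.re) ^ 2 - Real.sin (κ * z.im) ^ 2 := by
  rw [← Complex.normSq_eq_norm_sq, Complex.normSq_apply, cosh_re, cosh_im]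
  have h1 := Real.sin_sq_add_cos_sq (κ * z.im)
  have h2 := Real.cosh_sq (κ * z.re)
  linear_combination (Real.cosh (κ * z.re)) ^ 2 * h1 - Real.sin (κ * z.im) ^ 2 * h2

lemma le_norm_cosh (κ : ℝ) (z : ℂ) : Real.cosh (κ * z.re) - 1 ≤ ‖Complex.cosh (κ * z)‖ := by
  refine le_of_sq_le_sq ?_ (norm_nonneg _)
  rw [norm_cosh_sq]
  nlinarith [Real.one_le_cosh (κ * z.re), Real.sin_sq_le_one (κ * z.im)]

lemma one_add_sq_le_cosh_sq (x : ℝ) : 1 + x ^ 2 ≤ Real.cosh x ^ 2 := by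
  rw [Real.cosh_sq', add_le_add_iff_left, ← sq_abs x, ← sq_abs (Real.sinh x), Real.abs_sinh]
  exact pow_le_pow_left₀ (abs_nonneg x) (Real.self_le_sinh_iff.2 (abs_nonneg x)) 2

lemma memLp_inv_cosh {κ : ℝ} (hκ : 0 < κ) : MemLp (fun x : ℝ => 1 / Real.cosh (κ * x)) 2 := by
  have hc : Continuous fun x : ℝ => 1 / Real.cosh (κ * x) :=
    continuous_const.div (Real.continuous_cosh.comp (by fun_prop)) fun x => (Real.cosh_pos _).ne'
  rw [memLp_two_iff_integrable_sq hc.aestronglyMeasurable]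
  have h1 : Integrable fun x : ℝ => (1 + (κ * x) ^ 2)⁻¹ :=
    integrable_inv_one_add_sq.comp_mul_left' hκ.ne'
  refine h1.mono' (hc.pow 2).aestronglyMeasurable (Eventually.of_forall fun x => ?_)
  rw [Real.norm_of_nonneg (by positivity), div_pow, one_pow, one_div]
  exact inv_anti₀ (by positivity) (one_add_sq_le_cosh_sq _)

/-- The denominator of the vortex kernel. -/
def kernelDen (κ q : ℝ) (z : ℂ) : ℂ := Complex.cosh (κ * z) + q

/-- The kernel whose imaginary part is the Green function with a dipole at the vortex. -/
def kernel (κ q : ℝ) (z : ℂ) : ℂ := 2 * Complex.sinh (κ * z) / kernelDen κ q z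

/-- The derivative of the vortex kernel. -/
def kernelDeriv (κ q : ℝ) (z : ℂ) : ℂ :=
  2 * κ * (1 + q * Complex.cosh (κ * z)) / kernelDen κ q z ^ 2

/-- The second derivative of the vortex kernel. -/
def kernelDeriv₂ (κ q : ℝ) (z : ℂ) : ℂ :=
  2 * κ ^ 2 * Complex.sinh (κ * z) * (q * kernelDen κ q z - 2 * (1 + q * Complex.cosh (κ * z))) /
    kernelDen κ q z ^ 3

section
variable {κ q : ℝ} {z : ℂ}

lemma hasDerivAt_sinh_mul (κ : ℝ) (z : ℂ) :
    HasDerivAt (fun z : ℂ => Complex.sinh (κ * z)) (κ * Complex.cosh (κ * z)) z := by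
  have h1 : HasDerivAt (fun z : ℂ => (κ : ℂ) * z) κ z := by
    simpa using (hasDerivAt_id z).const_mul (κ : ℂ)
  exact h1.csinh.congr_deriv (mul_comm _ _)

lemma hasDerivAt_cosh_mul (κ : ℝ) (z : ℂ) :
    HasDerivAt (fun z : ℂ => Complex.cosh (κ * z)) (κ * Complex.sinh (κ * z)) z := by
  have h1 : HasDerivAt (fun z : ℂ => (κ : ℂ) * z) κ z := by
    simpa using (hasDerivAt_id z).const_mul (κ : ℂ)
  exact h1.ccosh.congr_deriv (mul_comm _ _)

lemma hasDerivAt_kernelDen (κ q : ℝ) (z : ℂ) :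
    HasDerivAt (kernelDen κ q) (κ * Complex.sinh (κ * z)) z :=
  (hasDerivAt_cosh_mul κ z).add_const _

lemma hasDerivAt_kernel (hz : kernelDen κ q z ≠ 0) :
    HasDerivAt (kernel κ q) (kernelDeriv κ q z) z := by
  refine (((hasDerivAt_sinh_mul κ z).const_mul 2).div (hasDerivAt_kernelDen κ q z) hz).congr_deriv ?_
  rw [kernelDeriv]
  congr 1
  have h1 := Complex.cosh_sq (κ * z)
  simp only [kernelDen]
  linear_combination (2 * κ : ℂ) * h1

lemma hasDerivAt_kernelDeriv (hz : kernelDen κ q z ≠ 0) :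
    HasDerivAt (kernelDeriv κ q) (kernelDeriv₂ κ q z) z := by
  refine (((((hasDerivAt_cosh_mul κ z).const_mul (q : ℂ)).const_add 1).const_mul (2 * κ : ℂ)).div
    ((hasDerivAt_kernelDen κ q z).pow 2) (pow_ne_zero 2 hz)).congr_deriv ?_
  rw [kernelDeriv₂, Pi.pow_apply]
  field_simp
  ring

/-- The kernel is real on the real axis and, because `cosh` and `sinh` change sign under a shift by
`πi`, also on the bottom. So its imaginary part has zero Dirichlet data on the flat strip. -/
lemma kernel_im_of_im_eq_zero (hz : z.im = 0) : (kernel κ q z).im = 0 := by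
  have h1 : z = (z.re : ℂ) := by apply Complex.ext <;> simp [hz]
  rw [h1, kernel, kernelDen, ← Complex.ofReal_mul, ← Complex.ofReal_sinh, ← Complex.ofReal_cosh]
  norm_cast

lemma kernel_im_of_bottom (hz : κ * z.im = -Real.pi) : (kernel κ q z).im = 0 := by
  have h1 : Complex.sinh (κ * z) = ((-Real.sinh (κ * z.re) : ℝ) : ℂ) := by
    rw [sinh_mul_eq, hz]; simp
  have h2 : Complex.cosh (κ * z) = ((-Real.cosh (κ * z.re) : ℝ) : ℂ) := by
    rw [cosh_mul_eq, hz]; simp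
  rw [kernel, kernelDen, h1, h2]
  norm_cast

lemma kernelDeriv_ofReal (κ q x : ℝ) : kernelDeriv κ q x =
    ((2 * κ * (1 + q * Real.cosh (κ * x)) / (Real.cosh (κ * x) + q) ^ 2 : ℝ) : ℂ) := by
  rw [kernelDeriv, kernelDen]
  push_cast
  rfl

/-- The numerator grows at most like `cosh` and the squared denominator at least like `cosh²`; the
remaining decay `1/cosh` gives square integrability over the strip. -/
lemma norm_kernelDeriv_le {c : ℝ} (hc : 0 < c) (hκ : 0 < κ) (hq : |q| ≤ 1)
    (hz : c * Real.cosh (κ * z.re) ≤ ‖kernelDen κ q z‖) :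
    ‖kernelDeriv κ q z‖ ≤ 4 * κ / c ^ 2 * (1 / Real.cosh (κ * z.re)) := by
  have hC := Real.cosh_pos (κ * z.re)
  have hC1 := Real.one_le_cosh (κ * z.re)
  have hD : 0 < ‖kernelDen κ q z‖ := lt_of_lt_of_le (by positivity) hz
  have h1 : ‖(1 : ℂ) + q * Complex.cosh (κ * z)‖ ≤ 2 * Real.cosh (κ * z.re) := by
    refine (norm_add_le _ _).trans ?_
    rw [norm_mul, norm_one, Complex.norm_real, Real.norm_eq_abs]
    nlinarith [norm_cosh_le κ z, norm_nonneg (Complex.cosh (κ * z)), abs_nonneg q]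
  rw [kernelDeriv, norm_div, norm_mul, norm_mul, norm_pow, Complex.norm_two, Complex.norm_real,
    Real.norm_of_nonneg hκ.le, div_mul_div_comm, mul_one, div_le_div_iff₀ (by positivity) (by positivity)]
  have h2 : (c * Real.cosh (κ * z.re)) ^ 2 ≤ ‖kernelDen κ q z‖ ^ 2 :=
    pow_le_pow_left₀ (by positivity) hz 2
  calc 2 * κ * ‖(1 : ℂ) + q * Complex.cosh (κ * z)‖ * (c ^ 2 * Real.cosh (κ * z.re))
      ≤ 2 * κ * (2 * Real.cosh (κ * z.re)) * (c ^ 2 * Real.cosh (κ * z.re)) := by gcongr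
    _ = 4 * κ * (c * Real.cosh (κ * z.re)) ^ 2 := by ring
    _ ≤ _ := by gcongr

lemma norm_kernelDeriv₂_le {c : ℝ} (hc : 0 < c) (hκ : 0 < κ) (hq : |q| ≤ 1)
    (hz : c * Real.cosh (κ * z.re) ≤ ‖kernelDen κ q z‖) :
    ‖kernelDeriv₂ κ q z‖ ≤ 12 * κ ^ 2 / c ^ 3 * (1 / Real.cosh (κ * z.re)) := by
  have hC := Real.cosh_pos (κ * z.re)
  have hC1 := Real.one_le_cosh (κ * z.re)
  have hD : 0 < ‖kernelDen κ q z‖ := lt_of_lt_of_le (by positivity) hz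
  have h1 : ‖(q * kernelDen κ q z - 2 * (1 + q * Complex.cosh (κ * z)) : ℂ)‖ ≤
      6 * Real.cosh (κ * z.re) := by
    have hcn := norm_cosh_le κ z
    have hq' : ‖(q : ℂ)‖ ≤ 1 := by rwa [Complex.norm_real, Real.norm_eq_abs]
    have h3 : ‖kernelDen κ q z‖ ≤ 2 * Real.cosh (κ * z.re) :=
      (norm_add_le _ _).trans (by linarith)
    have h4 : ‖(1 : ℂ) + q * Complex.cosh (κ * z)‖ ≤ 2 * Real.cosh (κ * z.re) := by
      refine (norm_add_le _ _).trans ?_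
      rw [norm_mul, norm_one]
      nlinarith [norm_nonneg (Complex.cosh (κ * z)), norm_nonneg (q : ℂ)]
    refine (norm_sub_le _ _).trans ?_
    rw [norm_mul, norm_mul, Complex.norm_two]
    nlinarith [norm_nonneg (q : ℂ)]
  have h0 := norm_sinh_le κ z
  rw [kernelDeriv₂, norm_div, norm_mul, norm_mul, norm_mul, norm_pow, norm_pow, Complex.norm_two,
    Complex.norm_real, Real.norm_of_nonneg hκ.le, div_mul_div_comm, mul_one,
    div_le_div_iff₀ (by positivity) (by positivity)]
  have h2 : (c * Real.cosh (κ * z.re)) ^ 3 ≤ ‖kernelDen κ q z‖ ^ 3 :=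
    pow_le_pow_left₀ (by positivity) hz 3
  calc 2 * κ ^ 2 * ‖Complex.sinh (κ * z)‖ *
        ‖(q * kernelDen κ q z - 2 * (1 + q * Complex.cosh (κ * z)) : ℂ)‖ *
        (c ^ 3 * Real.cosh (κ * z.re))
      ≤ 2 * κ ^ 2 * Real.cosh (κ * z.re) * (6 * Real.cosh (κ * z.re)) *
        (c ^ 3 * Real.cosh (κ * z.re)) := by gcongr
    _ = 12 * κ ^ 2 * (c * Real.cosh (κ * z.re)) ^ 3 := by ring
    _ ≤ _ := by gcongr

end

section
variable {h θ : ℝ}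

/-- A zero requires `sinh(κx) sin(κy) = 0`. If `sin(κy) = 0`, then `cosh(κx) = ∓q`, which is
impossible since `0 ≤ q < 1`. If `x = 0`, then `cos(κy) = -q` forces `y = ±(1-θ)h`: the lower sign
is the vortex, and the upper one lies above the height `h/8` because `θ ≤ 1/2`. -/
lemma kernelDen_ne_zero (hh : 0 < h) (hθ : 0 < θ) (hθ' : θ ≤ 1 / 2) {z : ℂ} (h1 : -h ≤ z.im)
    (h2 : z.im ≤ h / 8) (hz : z ≠ vortexPoint h θ) :
    kernelDen (Real.pi / h) (Real.cos (Real.pi * θ)) z ≠ 0 := by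
  intro h0
  have hre := congrArg Complex.re h0
  have him := congrArg Complex.im h0
  rw [kernelDen, Complex.add_re, cosh_re, Complex.ofReal_re, Complex.zero_re] at hre
  rw [kernelDen, Complex.add_im, cosh_im, Complex.ofReal_im, Complex.zero_im, add_zero] at him
  have hpi := Real.pi_pos
  have hY1 : -Real.pi ≤ Real.pi / h * z.im := by
    rw [div_mul_eq_mul_div, le_div_iff₀ hh]; nlinarith
  have hY2 : Real.pi / h * z.im ≤ Real.pi / 8 := by
    rw [div_mul_eq_mul_div, div_le_iff₀ hh]; nlinarith
  have hq0 : 0 ≤ Real.cos (Real.pi * θ) :=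
    Real.cos_nonneg_of_mem_Icc ⟨by nlinarith, by nlinarith⟩
  have hq1 : Real.cos (Real.pi * θ) < 1 := by
    rw [← Real.cos_zero]
    exact Real.cos_lt_cos_of_nonneg_of_le_pi le_rfl (by nlinarith) (by positivity)
  rcases mul_eq_zero.1 him with hX | hX
  · rw [Real.sinh_eq_zero] at hX
    rw [hX, Real.cosh_zero, one_mul] at hre
    have hX' : z.re = 0 := by
      rcases mul_eq_zero.1 hX with h3 | h3
      · exact absurd h3 (by positivity)
      · exact h3
    have hcos : Real.cos (Real.pi / h * z.im) = Real.cos (Real.pi - Real.pi * θ) := by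
      rw [Real.cos_pi_sub]; linarith
    rw [← Real.cos_abs] at hcos
    have := Real.injOn_cos ⟨abs_nonneg _, abs_le.2 ⟨hY1, by linarith⟩⟩
      ⟨by nlinarith, by nlinarith⟩ hcos
    rcases abs_choice (Real.pi / h * z.im) with h3 | h3
    · rw [h3] at this; nlinarith
    · rw [h3] at this
      apply hz
      apply Complex.ext
      · simp [vortexPoint, hX']
      · simp only [vortexPoint]
        field_simp at this
        nlinarith
  · have h3 := Real.sin_sq_add_cos_sq (Real.pi / h * z.im)
    have h4 := Real.one_le_cosh (Real.pi / h * z.re)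
    rw [hX] at h3
    have h5 : Real.cos (Real.pi / h * z.im) ^ 2 = 1 := by linarith
    rcases mul_self_eq_one_iff.1 ((pow_two _).symm.trans h5) with h6 | h6 <;> rw [h6] at hre <;> linarith

/-- Compactness handles bounded `x`, where the denominator is continuous and has no zero; for large
`|x|` the growth of `cosh` dominates the constant `q`. -/
lemma exists_kernelDen_lower_bound (hh : 0 < h) (hθ : 0 < θ) (hθ' : θ ≤ 1 / 2) {r : ℝ} (hr : 0 < r) :
    ∃ c, 0 < c ∧ ∀ z : ℂ, -h ≤ z.im → z.im ≤ h / 8 → r ≤ ‖z - vortexPoint h θ‖ →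
      c * Real.cosh (Real.pi / h * z.re) ≤
        ‖kernelDen (Real.pi / h) (Real.cos (Real.pi * θ)) z‖ := by
  set R : ℝ := 2 / (Real.pi / h) with hR
  have hκ : 0 < Real.pi / h := by have := Real.pi_pos; positivity
  have hK : IsCompact (Set.Icc (-R) R ×ℂ Set.Icc (-h) (h / 8) ∩ {z | r ≤ ‖z - vortexPoint h θ‖}) := by
    refine (isCompact_Icc.reProdIm isCompact_Icc).inter_right ?_
    have h1 : Continuous fun z : ℂ => ‖z - vortexPoint h θ‖ := by fun_prop
    exact isClosed_le continuous_const h1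
  have hcc : Continuous fun z : ℂ => Real.cosh (Real.pi / h * z.re) :=
    Real.continuous_cosh.comp (continuous_const.mul Complex.continuous_re)
  have hDc : Continuous (kernelDen (Real.pi / h) (Real.cos (Real.pi * θ))) :=
    continuous_iff_continuousAt.2 fun z => (hasDerivAt_kernelDen _ _ z).continuousAt
  obtain ⟨a, ha, haK⟩ := hK.exists_forall_le' (a := 0)
    (f := fun z => ‖kernelDen (Real.pi / h) (Real.cos (Real.pi * θ)) z‖ /
      Real.cosh (Real.pi / h * z.re))
    (hDc.norm.div hcc fun z => (Real.cosh_pos _).ne').continuousOn (by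
      rintro z ⟨⟨-, h2⟩, h3⟩
      refine div_pos (norm_pos_iff.2 (kernelDen_ne_zero hh hθ hθ' h2.1 h2.2 fun hz => ?_))
        (Real.cosh_pos _)
      rw [Set.mem_ofPred_eq, hz, sub_self, norm_zero] at h3
      linarith)
  -- For `κ|x| > 2` one has `cosh(κx) ≥ 2.23`, and the denominator is at least `cosh(κx) - 2`, which
  -- exceeds a tenth of `cosh(κx)`.
  refine ⟨min a (1 / 10), by positivity, fun z h1 h2 h3 => ?_⟩
  have hC := Real.cosh_pos (Real.pi / h * z.re)
  by_cases hx : |z.re| ≤ R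
  · have := haK z ⟨⟨abs_le.1 hx, h1, h2⟩, h3⟩
    rw [le_div_iff₀ hC] at this
    exact (mul_le_mul_of_nonneg_right (min_le_left _ _) hC.le).trans this
  · have h4 : 2 < |Real.pi / h * z.re| := by
      rw [not_le, hR, div_lt_iff₀ hκ] at hx
      rwa [abs_mul, abs_of_pos hκ, mul_comm]
    have h5 : 4 ≤ (Real.pi / h * z.re) ^ 2 := by
      rw [← sq_abs]; nlinarith
    have h6 := one_add_sq_le_cosh_sq (Real.pi / h * z.re)
    have h7 : 2.23 ≤ Real.cosh (Real.pi / h * z.re) := by nlinarith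
    have h8 := le_norm_cosh (Real.pi / h) z
    have h9 : ‖Complex.cosh ((Real.pi / h : ℝ) * z)‖ - 1 ≤
        ‖kernelDen (Real.pi / h) (Real.cos (Real.pi * θ)) z‖ := by
      rw [kernelDen]
      have := norm_sub_le_norm_add (Complex.cosh ((Real.pi / h : ℝ) * z)) (Real.cos (Real.pi * θ) : ℂ)
      have h10 := Real.abs_cos_le_one (Real.pi * θ)
      rw [Complex.norm_real, Real.norm_eq_abs] at this
      linarith
    have := mul_le_mul_of_nonneg_right (min_le_right a (1 / 10)) hC.le
    linarith

end

end PointVortex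
end

/-! ### The kernel cut off near the vortex -/

noncomputable section
namespace PointVortex

section
variable {κ q : ℝ} {z : ℂ}

lemma kernel_im_eq (κ q : ℝ) (z : ℂ) : (kernel κ q z).im =
    2 * Real.sin (κ * z.im) * (Real.cos (κ * z.im) + q * Real.cosh (κ * z.re)) /
      ‖kernelDen κ q z‖ ^ 2 := by
  rw [kernel, Complex.div_im, ← Complex.normSq_eq_norm_sq, ← sub_div]
  congr 1
  rw [mul_comm (2 : ℂ), Complex.mul_im, Complex.mul_re, kernelDen, Complex.add_re, Complex.add_im,
    cosh_re, cosh_im, sinh_re, sinh_im]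
  simp
  have h2 := Real.cosh_sq (κ * z.re)
  linear_combination (2 * Real.sin (κ * z.im) * Real.cos (κ * z.im)) * h2

/-- The kernel itself tends to `±2` at infinity; only its imaginary part decays. `kernel_im_eq`
exhibits the cancellation: the numerator of the imaginary part grows like `cosh` instead of `cosh²`.
-/
lemma abs_kernel_im_le {c : ℝ} (hc : 0 < c) (hq : |q| ≤ 1)
    (hz : c * Real.cosh (κ * z.re) ≤ ‖kernelDen κ q z‖) :
    |(kernel κ q z).im| ≤ 4 / c ^ 2 * (1 / Real.cosh (κ * z.re)) := by
  have hC := Real.cosh_pos (κ * z.re)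
  have hC1 := Real.one_le_cosh (κ * z.re)
  have hD : 0 < ‖kernelDen κ q z‖ := lt_of_lt_of_le (by positivity) hz
  rw [kernel_im_eq, abs_div, abs_mul, abs_mul, abs_two, abs_of_pos (pow_pos hD 2),
    div_mul_div_comm, mul_one, div_le_div_iff₀ (by positivity) (by positivity)]
  have h1 : |Real.cos (κ * z.im) + q * Real.cosh (κ * z.re)| ≤ 2 * Real.cosh (κ * z.re) := by
    refine (abs_add_le _ _).trans ?_
    rw [abs_mul, abs_of_pos hC]
    nlinarith [Real.abs_cos_le_one (κ * z.im), abs_nonneg q]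
  have h2 : (c * Real.cosh (κ * z.re)) ^ 2 ≤ ‖kernelDen κ q z‖ ^ 2 :=
    pow_le_pow_left₀ (by positivity) hz 2
  calc 2 * |Real.sin (κ * z.im)| * |Real.cos (κ * z.im) + q * Real.cosh (κ * z.re)| *
        (c ^ 2 * Real.cosh (κ * z.re))
      ≤ 2 * 1 * (2 * Real.cosh (κ * z.re)) * (c ^ 2 * Real.cosh (κ * z.re)) := by
        gcongr
        exact Real.abs_sin_le_one _
    _ = 4 * (c * Real.cosh (κ * z.re)) ^ 2 := by ring
    _ ≤ _ := by gcongr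

end

section
variable {z₀ z : ℂ} {r : ℝ} {f : ℂ → ℝ}

lemma radialCutoff_mul_eventuallyEq (hr : 0 < r) (f : ℂ → ℝ) (hz : ‖z - z₀‖ < r / 2) :
    (fun z => radialCutoff z₀ r z * f z) =ᶠ[𝓝 z] fun _ => 0 := by
  have h1 : Continuous fun z : ℂ => ‖z - z₀‖ := by fun_prop
  filter_upwards [(isOpen_lt h1 continuous_const).mem_nhds hz] with w hw
  rw [radialCutoff_eq_zero hr (le_of_lt hw), zero_mul]

lemma differentiableAt_radialCutoff (z₀ : ℂ) (r : ℝ) (z : ℂ) :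
    DifferentiableAt ℝ (radialCutoff z₀ r) z := (hasFDerivAt_radialCutoff z₀ r z).differentiableAt

/-- Near the vortex the product vanishes identically, so the singularity of `f` there, and the value
that Lean assigns to it, are irrelevant. -/
lemma differentiableAt_radialCutoff_mul (hr : 0 < r) (hf : z ≠ z₀ → DifferentiableAt ℝ f z) :
    DifferentiableAt ℝ (fun z => radialCutoff z₀ r z * f z) z := by
  by_cases hz : z = z₀
  · refine (differentiableAt_const (0 : ℝ)).congr_of_eventuallyEq
      (radialCutoff_mul_eventuallyEq hr f ?_)
    rw [hz, sub_self, norm_zero]; positivity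
  · exact (differentiableAt_radialCutoff z₀ r z).fun_mul (hf hz)

lemma abs_radialCutoff_mul_le (hr : 0 < r) {E : ℝ} (hE : 0 ≤ E)
    (hf : r / 2 ≤ ‖z - z₀‖ → |f z| ≤ E) : |radialCutoff z₀ r z * f z| ≤ E := by
  rcases le_or_gt (r / 2) ‖z - z₀‖ with hz | hz
  · rw [abs_mul]
    exact (mul_le_of_le_one_left (abs_nonneg _) (abs_radialCutoff_le z₀ r z)).trans (hf hz)
  · rw [radialCutoff_eq_zero hr hz.le, zero_mul, abs_zero]
    exact hE

lemma exists_bound_dX_radialCutoff (z₀ : ℂ) (hr : 0 < r) :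
    ∃ M, 0 < M ∧ ∀ z, |dX (radialCutoff z₀ r) z| ≤ M ∧ |dY (radialCutoff z₀ r) z| ≤ M := by
  have hs := contDiff_radialSlope z₀ r
  have h1 : Continuous fun z : ℂ => |radialSlope z₀ r z| := hs.continuous.abs
  obtain ⟨M, hM⟩ := hs.continuous.bounded_above_of_compact_support (hasCompactSupport_radialSlope hr)
  refine ⟨|M| * r + 1, by positivity, fun z => ?_⟩
  by_cases hz : radialSlope z₀ r z = 0
  · rw [dX_radialCutoff, dY_radialCutoff, hz]
    simp; positivity
  have hz' : ‖z - z₀‖ ≤ r := by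
    have := (tsupport_radialSlope_subset hr (subset_tsupport _ hz)).2
    linarith
  have h2 : |radialSlope z₀ r z| ≤ |M| := (hM z).trans (le_abs_self M)
  have h3 := Complex.abs_re_le_norm (z - z₀)
  have h4 := Complex.abs_im_le_norm (z - z₀)
  rw [Complex.sub_re] at h3
  rw [Complex.sub_im] at h4
  rw [dX_radialCutoff, dY_radialCutoff, abs_mul, abs_mul]
  constructor
  · nlinarith [abs_nonneg (z.re - z₀.re), abs_nonneg (radialSlope z₀ r z), abs_nonneg M,
      mul_le_mul h2 (h3.trans hz') (abs_nonneg _) (abs_nonneg M)]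
  · nlinarith [abs_nonneg (z.im - z₀.im), abs_nonneg (radialSlope z₀ r z), abs_nonneg M,
      mul_le_mul h2 (h4.trans hz') (abs_nonneg _) (abs_nonneg M)]

lemma abs_dX_radialCutoff_mul_le (hr : 0 < r) {M E E' : ℝ} (hE : 0 ≤ E) (hE' : 0 ≤ E') (hM0 : 0 ≤ M)
    (hM : ∀ z, |dX (radialCutoff z₀ r) z| ≤ M ∧ |dY (radialCutoff z₀ r) z| ≤ M)
    (hd : z ≠ z₀ → DifferentiableAt ℝ f z)
    (hf : r / 2 ≤ ‖z - z₀‖ → |f z| ≤ E ∧ |dX f z| ≤ E' ∧ |dY f z| ≤ E') :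
    |dX (fun z => radialCutoff z₀ r z * f z) z| ≤ M * E + E' ∧
      |dY (fun z => radialCutoff z₀ r z * f z) z| ≤ M * E + E' := by
  rcases le_or_gt (r / 2) ‖z - z₀‖ with hz | hz
  · have hzz : z ≠ z₀ := by
      rintro rfl
      rw [sub_self, norm_zero] at hz
      linarith
    obtain ⟨h1, h2, h3⟩ := hf hz
    obtain ⟨h4, h5⟩ := hM z
    have h6 := abs_radialCutoff_le z₀ r z
    rw [dX_mul (differentiableAt_radialCutoff z₀ r z) (hd hzz),
      dY_mul (differentiableAt_radialCutoff z₀ r z) (hd hzz)]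
    refine ⟨(abs_add_le _ _).trans (add_le_add ?_ ?_), (abs_add_le _ _).trans (add_le_add ?_ ?_)⟩ <;>
      rw [abs_mul]
    · exact mul_le_mul h4 h1 (abs_nonneg _) hM0
    · exact (mul_le_of_le_one_left (abs_nonneg _) h6).trans h2
    · exact mul_le_mul h5 h1 (abs_nonneg _) hM0
    · exact (mul_le_of_le_one_left (abs_nonneg _) h6).trans h3
  · have h0 := (radialCutoff_mul_eventuallyEq hr f hz).fderiv_eq (𝕜 := ℝ)
    rw [dX, dY, h0]
    simp
    positivity

end


section
variable {h θ : ℝ} {η ζ : ℝ → ℝ} {ψ : ℂ → ℝ}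

lemma exists_kernel_bound (hh : 0 < h) (hθ : 0 < θ) (hθ' : θ ≤ 1 / 2) {r : ℝ} (hr : 0 < r) :
    ∃ C, 0 < C ∧ ∀ z : ℂ, -h ≤ z.im → z.im ≤ h / 8 → r ≤ ‖z - vortexPoint h θ‖ →
      |(kernel (Real.pi / h) (Real.cos (Real.pi * θ)) z).im| ≤
        C * (1 / Real.cosh (Real.pi / h * z.re)) ∧
      ‖kernelDeriv (Real.pi / h) (Real.cos (Real.pi * θ)) z‖ ≤
        C * (1 / Real.cosh (Real.pi / h * z.re)) ∧
      ‖kernelDeriv₂ (Real.pi / h) (Real.cos (Real.pi * θ)) z‖ ≤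
        C * (1 / Real.cosh (Real.pi / h * z.re)) := by
  obtain ⟨c, hc, hcz⟩ := exists_kernelDen_lower_bound hh hθ hθ' hr
  have hκ : 0 < Real.pi / h := div_pos Real.pi_pos hh
  have hq := Real.abs_cos_le_one (Real.pi * θ)
  refine ⟨4 / c ^ 2 + 4 * (Real.pi / h) / c ^ 2 + 12 * (Real.pi / h) ^ 2 / c ^ 3, by positivity,
    fun z h1 h2 h3 => ?_⟩
  have hz := hcz z h1 h2 h3
  have hC : 0 ≤ 1 / Real.cosh (Real.pi / h * z.re) := by
    have := Real.cosh_pos (Real.pi / h * z.re); positivity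
  have p1 : 0 ≤ 4 / c ^ 2 := by positivity
  have p2 : 0 ≤ 4 * (Real.pi / h) / c ^ 2 := by positivity
  have p3 : 0 ≤ 12 * (Real.pi / h) ^ 2 / c ^ 3 := by positivity
  refine ⟨(abs_kernel_im_le hc hq hz).trans (mul_le_mul_of_nonneg_right (by linarith) hC),
    (norm_kernelDeriv_le hc hκ hq hz).trans (mul_le_mul_of_nonneg_right (by linarith) hC),
    (norm_kernelDeriv₂_le hc hκ hq hz).trans (mul_le_mul_of_nonneg_right (by linarith) hC)⟩

lemma memLp_of_le_inv_cosh {κ C : ℝ} (hκ : 0 < κ) (hh : 0 < h) (hη : Continuous η)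
    (hη0 : ∀ x, η x ≤ h / 8) {f : ℂ → ℝ}
    (hf : AEStronglyMeasurable f (volume.restrict (fluidDomain h η)))
    (hle : ∀ z ∈ fluidDomain h η, |f z| ≤ C * (1 / Real.cosh (κ * z.re))) :
    MemLp f 2 (volume.restrict (fluidDomain h η)) := by
  have hc : Continuous fun z : ℂ => 1 / Real.cosh (κ * z.re) :=
    continuous_const.div (Real.continuous_cosh.comp (by fun_prop)) fun x => (Real.cosh_pos _).ne'
  have h1 : MemLp (fun z : ℂ => 1 / Real.cosh (κ * z.re)) 2 (volume.restrict (fluidDomain h η)) := by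
    rw [memLp_two_iff_integrable_sq hc.aestronglyMeasurable]
    exact (integrableOn_comp_re hη0 (memLp_inv_cosh hκ).integrable_sq (fun x => sq_nonneg _)
      (by linarith)).1
  refine h1.of_le_mul (c := C) hf ?_
  filter_upwards [ae_restrict_mem (isOpen_fluidDomain hη).measurableSet] with z hz
  rw [Real.norm_eq_abs, Real.norm_of_nonneg (by have := Real.cosh_pos (κ * z.re); positivity)]
  exact hle z hz

/-- The Green function with a dipole at the vortex, cut off near the vortex. -/
def cutKernel (h θ : ℝ) (z : ℂ) : ℝ :=
  radialCutoff (vortexPoint h θ) (θ * h / 4) z *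
    (kernel (Real.pi / h) (Real.cos (Real.pi * θ)) z).im

/-- The horizontal derivative of the kernel, cut off near the vortex. -/
def cutKernelX (h θ : ℝ) (z : ℂ) : ℝ :=
  radialCutoff (vortexPoint h θ) (θ * h / 4) z *
    (kernelDeriv (Real.pi / h) (Real.cos (Real.pi * θ)) z).im

/-- The vertical derivative of the kernel, cut off near the vortex. -/
def cutKernelY (h θ : ℝ) (z : ℂ) : ℝ :=
  radialCutoff (vortexPoint h θ) (θ * h / 4) z *
    (kernelDeriv (Real.pi / h) (Real.cos (Real.pi * θ)) z).re

/-- The properties of the cut-off kernel that are used in the divergence theorem. -/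
structure IsCutKernelTriple (h : ℝ) (C : ℝ) (V V₁ V₂ : ℂ → ℝ) : Prop where
  differentiable : ∀ z : ℂ, -h ≤ z.im → z.im ≤ h / 8 →
    DifferentiableAt ℝ V z ∧ DifferentiableAt ℝ V₁ z ∧ DifferentiableAt ℝ V₂ z
  bound : ∀ z : ℂ, -h ≤ z.im → z.im ≤ h / 8 → ∀ f ∈ [V, V₁, V₂, dX V, dY V, dX V₁, dY V₂],
    |f z| ≤ C * (1 / Real.cosh (Real.pi / h * z.re))

/-- Leibniz's rule: `M` bounds the gradient of the cutoff, and `C` bounds the kernel and its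
derivatives at distance at least half the cutoff radius, hence `MC + C`. -/
lemma exists_isCutKernelTriple (hh : 0 < h) (hθ : 0 < θ) (hθ' : θ ≤ 1 / 2) :
    ∃ C, 0 < C ∧ IsCutKernelTriple h C (cutKernel h θ) (cutKernelX h θ) (cutKernelY h θ) := by
  have hr : 0 < θ * h / 4 := by positivity
  obtain ⟨C, hC, hCz⟩ := exists_kernel_bound hh hθ hθ' (half_pos hr)
  obtain ⟨M, hM0, hM⟩ := exists_bound_dX_radialCutoff (vortexPoint h θ) hr
  have hd : ∀ z : ℂ, -h ≤ z.im → z.im ≤ h / 8 → z ≠ vortexPoint h θ →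
      kernelDen (Real.pi / h) (Real.cos (Real.pi * θ)) z ≠ 0 :=
    fun z h1 h2 => kernelDen_ne_zero hh hθ hθ' h1 h2
  have hre : ∀ {f : ℂ → ℂ} {f' z : ℂ}, HasDerivAt f f' z →
      DifferentiableAt ℝ (fun z => (f z).re) z ∧ DifferentiableAt ℝ (fun z => (f z).im) z :=
    fun hf => ⟨(Complex.reCLM.hasFDerivAt.comp _ (hf.hasFDerivAt.restrictScalars ℝ)).differentiableAt,
      (Complex.imCLM.hasFDerivAt.comp _ (hf.hasFDerivAt.restrictScalars ℝ)).differentiableAt⟩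
  refine ⟨M * C + C, by positivity, ⟨fun z h1 h2 => ⟨?_, ?_, ?_⟩, fun z h1 h2 => ?_⟩⟩
  · exact differentiableAt_radialCutoff_mul hr fun hz => (hre (hasDerivAt_kernel (hd z h1 h2 hz))).2
  · exact differentiableAt_radialCutoff_mul hr fun hz =>
      (hre (hasDerivAt_kernelDeriv (hd z h1 h2 hz))).2
  · exact differentiableAt_radialCutoff_mul hr fun hz =>
      (hre (hasDerivAt_kernelDeriv (hd z h1 h2 hz))).1
  have he0 : 0 ≤ 1 / Real.cosh (Real.pi / h * z.re) := by
    have := Real.cosh_pos (Real.pi / h * z.re); positivity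
  have hE : 0 ≤ C * (1 / Real.cosh (Real.pi / h * z.re)) := by positivity
  have hE1 : C * (1 / Real.cosh (Real.pi / h * z.re)) ≤
      (M * C + C) * (1 / Real.cosh (Real.pi / h * z.re)) :=
    mul_le_mul_of_nonneg_right (by nlinarith) he0
  have hE2 : (M * C + C) * (1 / Real.cosh (Real.pi / h * z.re)) =
    M * (C * (1 / Real.cosh (Real.pi / h * z.re))) + C * (1 / Real.cosh (Real.pi / h * z.re)) := by
    ring
  have hfar : θ * h / 4 / 2 ≤ ‖z - vortexPoint h θ‖ → z ≠ vortexPoint h θ := by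
    rintro h3 rfl
    rw [sub_self, norm_zero] at h3
    linarith
  have b1 := abs_dX_radialCutoff_mul_le (z := z) (z₀ := vortexPoint h θ)
    (f := fun z => (kernel (Real.pi / h) (Real.cos (Real.pi * θ)) z).im) hr hE hE hM0.le hM
    (fun hz => (hre (hasDerivAt_kernel (hd z h1 h2 hz))).2) fun h3 => by
      obtain ⟨-, -, e3, e4⟩ := hasFDerivAt_re_comp (hasDerivAt_kernel (hd z h1 h2 (hfar h3)))
      rw [e3, e4]
      exact ⟨(hCz z h1 h2 h3).1, (Complex.abs_im_le_norm _).trans (hCz z h1 h2 h3).2.1,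
        (Complex.abs_re_le_norm _).trans (hCz z h1 h2 h3).2.1⟩
  have b2 := abs_dX_radialCutoff_mul_le (z := z) (z₀ := vortexPoint h θ)
    (f := fun z => (kernelDeriv (Real.pi / h) (Real.cos (Real.pi * θ)) z).im) hr hE hE hM0.le hM
    (fun hz => (hre (hasDerivAt_kernelDeriv (hd z h1 h2 hz))).2) fun h3 => by
      obtain ⟨-, -, e3, e4⟩ := hasFDerivAt_re_comp (hasDerivAt_kernelDeriv (hd z h1 h2 (hfar h3)))
      rw [e3, e4]
      exact ⟨(Complex.abs_im_le_norm _).trans (hCz z h1 h2 h3).2.1,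
        (Complex.abs_im_le_norm _).trans (hCz z h1 h2 h3).2.2,
        (Complex.abs_re_le_norm _).trans (hCz z h1 h2 h3).2.2⟩
  have b3 := abs_dX_radialCutoff_mul_le (z := z) (z₀ := vortexPoint h θ)
    (f := fun z => (kernelDeriv (Real.pi / h) (Real.cos (Real.pi * θ)) z).re) hr hE hE hM0.le hM
    (fun hz => (hre (hasDerivAt_kernelDeriv (hd z h1 h2 hz))).1) fun h3 => by
      obtain ⟨e1, e2, -, -⟩ := hasFDerivAt_re_comp (hasDerivAt_kernelDeriv (hd z h1 h2 (hfar h3)))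
      rw [e1, e2, abs_neg]
      exact ⟨(Complex.abs_re_le_norm _).trans (hCz z h1 h2 h3).2.1,
        (Complex.abs_re_le_norm _).trans (hCz z h1 h2 h3).2.2,
        (Complex.abs_im_le_norm _).trans (hCz z h1 h2 h3).2.2⟩
  rw [← hE2] at b1 b2 b3
  have a1 := (abs_radialCutoff_mul_le (z := z) (z₀ := vortexPoint h θ)
    (f := fun z => (kernel (Real.pi / h) (Real.cos (Real.pi * θ)) z).im) hr hE
    fun h3 => (hCz z h1 h2 h3).1).trans hE1
  have a2 := (abs_radialCutoff_mul_le (z := z) (z₀ := vortexPoint h θ)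
    (f := fun z => (kernelDeriv (Real.pi / h) (Real.cos (Real.pi * θ)) z).im) hr hE
    fun h3 => (Complex.abs_im_le_norm _).trans (hCz z h1 h2 h3).2.1).trans hE1
  have a3 := (abs_radialCutoff_mul_le (z := z) (z₀ := vortexPoint h θ)
    (f := fun z => (kernelDeriv (Real.pi / h) (Real.cos (Real.pi * θ)) z).re) hr hE
    fun h3 => (Complex.abs_re_le_norm _).trans (hCz z h1 h2 h3).2.1).trans hE1
  simp only [List.mem_cons, List.not_mem_nil, or_false, forall_eq_or_imp, forall_eq]
  exact ⟨a1, a2, a3, b1.1, b1.2, b2.1, b3.2⟩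

end

end PointVortex
end

/-! ### The vertical velocity at the vortex in terms of boundary data -/

noncomputable section
namespace PointVortex

section
variable {h θ : ℝ} {η ζ : ℝ → ℝ} {ψ : ℂ → ℝ}

lemma closure_fluidDomain_subset (hη0 : ∀ x, |η x| ≤ h / 8) :
    closure (fluidDomain h η) ⊆ {z : ℂ | -h ≤ z.im ∧ z.im ≤ h / 8} :=
  closure_minimal (fun z hz => ⟨hz.1.le, hz.2.le.trans (abs_le.1 (hη0 z.re)).2⟩)
    ((isClosed_le continuous_const Complex.continuous_im).inter
      (isClosed_le Complex.continuous_im continuous_const))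

/-- The vortex is `θh` above the bottom and at least `h/2` below the level of rest, so the radius
`θh/4` leaves room on both sides of the ball. -/
lemma mem_vortexBall (hh : 0 < h) (hθ : 0 < θ) (hθ' : θ ≤ 1 / 2) {z : ℂ}
    (hz : ‖z - vortexPoint h θ‖ ≤ θ * h / 4) : -h < z.im ∧ z.im < -h / 8 := by
  have h1 := (Complex.abs_im_le_norm (z - vortexPoint h θ)).trans hz
  rw [Complex.sub_im, abs_le] at h1
  simp only [vortexPoint] at h1
  constructor <;> nlinarith

lemma closedBall_vortexPoint_subset (hh : 0 < h) (hθ : 0 < θ) (hθ' : θ ≤ 1 / 2)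
    (hη0 : ∀ x, |η x| ≤ h / 8) :
    Metric.closedBall (vortexPoint h θ) (θ * h / 4) ⊆ fluidDomain h η := fun z hz => by
  obtain ⟨h1, h2⟩ := mem_vortexBall hh hθ hθ' (mem_closedBall_iff_norm.1 hz)
  exact ⟨h1, by linarith [(abs_le.1 (hη0 z.re)).1]⟩

lemma radialCutoff_eq_one_of_im (hh : 0 < h) (hθ : 0 < θ) (hθ' : θ ≤ 1 / 2) {z : ℂ}
    (hz : z.im ≤ -h ∨ -h / 8 ≤ z.im) : radialCutoff (vortexPoint h θ) (θ * h / 4) z = 1 := by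
  apply radialCutoff_eq_one (by positivity)
  by_contra hcon
  have h1 : 0 < θ * h := by positivity
  obtain ⟨h2, h3⟩ := mem_vortexBall hh hθ hθ' (z := z) (by linarith)
  rcases hz with hz | hz <;> linarith

/-- The derivative of the denominator does not vanish at the vortex, so the kernel has a simple pole
there. -/
lemma sinh_vortexPoint_ne_zero (hh : 0 < h) (hθ : 0 < θ) (hθ' : θ ≤ 1 / 2) :
    Complex.sinh ((Real.pi / h : ℝ) * vortexPoint h θ) ≠ 0 := by
  intro h0
  have := congrArg Complex.im h0
  rw [sinh_im] at this
  simp only [vortexPoint, mul_zero, Real.cosh_zero, one_mul, Complex.zero_im] at this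
  rw [show Real.pi / h * -((1 - θ) * h) = -(Real.pi - Real.pi * θ) by field_simp,
    Real.sin_neg, Real.sin_pi_sub, neg_eq_zero] at this
  exact (Real.sin_pos_of_pos_of_lt_pi (by positivity) (by nlinarith [Real.pi_pos])).ne' this

lemma kernelDen_vortexPoint (hh : 0 < h) :
    kernelDen (Real.pi / h) (Real.cos (Real.pi * θ)) (vortexPoint h θ) = 0 := by
  have h1 : Real.pi / h * (vortexPoint h θ).im = -(Real.pi - Real.pi * θ) := by
    simp only [vortexPoint]; field_simp
  have h2 : (vortexPoint h θ).re = 0 := rfl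
  apply Complex.ext
  · rw [kernelDen, Complex.add_re, cosh_re, h1, h2, Real.cos_neg, Real.cos_pi_sub, Complex.ofReal_re]; simp
  · rw [kernelDen, Complex.add_im, cosh_im, h1, h2, Complex.ofReal_im]; simp

/-- The flux identity around the vortex. -/
lemma integral_vortex_flux (hh : 0 < h) (hθ : 0 < θ) (hθ' : θ ≤ 1 / 2)
    (hη0 : ∀ x, |η x| ≤ h / 8) (hψ : IsHarmonicExtension h η ζ ψ) :
    ∫ z, (dX (radialCutoff (vortexPoint h θ) (θ * h / 4)) z *
        (ψ z * dX (fun z => (kernel (Real.pi / h) (Real.cos (Real.pi * θ)) z).im) z -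
          (kernel (Real.pi / h) (Real.cos (Real.pi * θ)) z).im * dX ψ z) +
      dY (radialCutoff (vortexPoint h θ) (θ * h / 4)) z *
        (ψ z * dY (fun z => (kernel (Real.pi / h) (Real.cos (Real.pi * θ)) z).im) z -
          (kernel (Real.pi / h) (Real.cos (Real.pi * θ)) z).im * dY ψ z)) =
    4 * h * dY ψ (vortexPoint h θ) := by
  set z₀ := vortexPoint h θ with hz₀
  set D : ℂ → ℂ := kernelDen (Real.pi / h) (Real.cos (Real.pi * θ)) with hD
  have hr : 0 < θ * h / 4 := by positivity
  have hsub := closedBall_vortexPoint_subset hh hθ hθ' hη0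
  -- `dslope` divides the zero out of the denominator: it is holomorphic and has no zero on the
  -- ball, so `(z - z₀)K` extends holomorphically over the pole.
  have hDd : DifferentiableOn ℂ (dslope D z₀) Set.univ :=
    (Complex.differentiableOn_dslope univ_mem).2 fun z _ =>
      (hasDerivAt_kernelDen _ _ z).differentiableAt.differentiableWithinAt
  have hD0 : D z₀ = 0 := kernelDen_vortexPoint hh
  have hs : ∀ z ≠ z₀, dslope D z₀ z = D z / (z - z₀) := fun z hz => by
    rw [dslope_of_ne _ hz, slope_def_field, hD0, sub_zero]
  have hs0 : dslope D z₀ z₀ = (Real.pi / h : ℝ) * Complex.sinh ((Real.pi / h : ℝ) * z₀) := by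
    rw [dslope_same, (hasDerivAt_kernelDen _ _ z₀).deriv]
  have hsinh := sinh_vortexPoint_ne_zero hh hθ hθ'
  have hκ : ((Real.pi / h : ℝ) : ℂ) ≠ 0 := by
    exact_mod_cast (div_pos Real.pi_pos hh).ne'
  have hne : ∀ z ∈ Metric.closedBall z₀ (θ * h / 4), z ≠ z₀ → D z ≠ 0 := fun z hz hzz => by
    have h1 := (hsub hz)
    exact kernelDen_ne_zero hh hθ hθ' h1.1.le (h1.2.le.trans (abs_le.1 (hη0 _)).2) hzz
  have hdne : ∀ z ∈ Metric.closedBall z₀ (θ * h / 4), dslope D z₀ z ≠ 0 := fun z hz => by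
    by_cases hzz : z = z₀
    · rw [hzz, hs0]; exact mul_ne_zero hκ hsinh
    · rw [hs z hzz]; exact div_ne_zero (hne z hz hzz) (sub_ne_zero.2 hzz)
  have key := integral_gradient_radialCutoff (ψ := ψ)
    (K := kernel (Real.pi / h) (Real.cos (Real.pi * θ)))
    (G := fun z => 2 * Complex.sinh ((Real.pi / h : ℝ) * z) / dslope D z₀ z) hr
    (fun z hz => hψ.harmonic.harmonicOnNhd z (hsub hz))
    (fun z hz hzz => (hasDerivAt_kernel (hne z hz hzz)).differentiableAt)
    (fun z hz => ((((hasDerivAt_sinh_mul _ z).differentiableAt.const_mul 2).div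
      ((hDd z trivial).differentiableAt univ_mem) (hdne z hz)).differentiableWithinAt))
    (fun z hz hzz => by
      have h1 := hne z hz hzz
      have h2 := sub_ne_zero.2 hzz
      rw [hs z hzz, kernel, ← hD, ← hz₀]
      field_simp)
  rw [key]
  -- The residue is `2/κ = 2h/π`; the factor `2π` of the flux identity turns it into `4h`.
  have hG : 2 * Complex.sinh ((Real.pi / h : ℝ) * z₀) / dslope D z₀ z₀ =
      ((2 * h / Real.pi : ℝ) : ℂ) := by
    have hpi : (Real.pi : ℂ) ≠ 0 := by exact_mod_cast Real.pi_ne_zero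
    have hh' : (h : ℂ) ≠ 0 := by exact_mod_cast hh.ne'
    rw [hs0]
    rw [mul_div_mul_right _ _ hsinh]
    push_cast
    field_simp
  rw [hG, Complex.ofReal_re, Complex.ofReal_im]
  have := Real.pi_ne_zero
  field_simp
  ring

/-- The vertical velocity at the vortex in terms of boundary data: the general form. -/
theorem dY_vortexPoint_eq_sub (hh : 0 < h) (hθ : 0 < θ) (hθ' : θ ≤ 1 / 2) (hη : ContDiff ℝ 1 η)
    (hη' : ∀ x, |deriv η x| ≤ 1) (hη0 : ∀ x, |η x| ≤ h / 8) (hζ : MemLp ζ 2)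
    (hψ : IsHarmonicExtension h η ζ ψ) :
    4 * h * dY ψ (vortexPoint h θ) =
      (∫ x, ζ x * (-deriv η x *
          (kernelDeriv (Real.pi / h) (Real.cos (Real.pi * θ)) ⟨x, η x⟩).im +
        (kernelDeriv (Real.pi / h) (Real.cos (Real.pi * θ)) ⟨x, η x⟩).re)) -
      ∫ z in fluidDomain h η, (dX (cutKernel h θ) z * dX ψ z + dY (cutKernel h θ) z * dY ψ z) := by
  have hS := isTameSurface_of_abs_le hh hη hη' hη0
  obtain ⟨C, hC, hT⟩ := exists_isCutKernelTriple hh hθ hθ'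
  have hκ : 0 < Real.pi / h := div_pos Real.pi_pos hh
  have hr : 0 < θ * h / 4 := by positivity
  have hin : ∀ z ∈ fluidDomain h η, -h ≤ z.im ∧ z.im ≤ h / 8 := fun z hz =>
    closure_fluidDomain_subset hη0 (subset_closure hz)
  have hup : ∀ x, η x ≤ h / 8 := fun x => (abs_le.1 (hη0 x)).2
  have hLc : ∀ f : ℂ → ℝ, (∀ z : ℂ, -h ≤ z.im → z.im ≤ h / 8 → DifferentiableAt ℝ f z) →
      f ∈ [cutKernel h θ, cutKernelX h θ, cutKernelY h θ, dX (cutKernel h θ), dY (cutKernel h θ),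
        dX (cutKernelX h θ), dY (cutKernelY h θ)] →
      MemLp f 2 (volume.restrict (fluidDomain h η)) := fun f hf hm =>
    memLp_of_le_inv_cosh hκ hh hS.continuous hup
      (continuousOn_aestronglyMeasurable hS.isOpen fun z hz =>
        (hf z (hin z hz).1 (hin z hz).2).continuousAt.continuousWithinAt)
      fun z hz => hT.bound z (hin z hz).1 (hin z hz).2 f hm
  have hLm : ∀ f : ℂ → ℝ, Measurable f →
      f ∈ [cutKernel h θ, cutKernelX h θ, cutKernelY h θ, dX (cutKernel h θ), dY (cutKernel h θ),
        dX (cutKernelX h θ), dY (cutKernelY h θ)] →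
      MemLp f 2 (volume.restrict (fluidDomain h η)) := fun f hf hm =>
    memLp_of_le_inv_cosh hκ hh hS.continuous hup hf.aestronglyMeasurable
      fun z hz => hT.bound z (hin z hz).1 (hin z hz).2 f hm
  have m1 := hLc _ (fun z h1 h2 => (hT.differentiable z h1 h2).2.1) (by simp)
  have m2 := hLc _ (fun z h1 h2 => (hT.differentiable z h1 h2).2.2) (by simp)
  have mX := hLm _ (measurable_dX (cutKernel h θ)) (by simp)
  have mY := hLm _ (measurable_dY (cutKernel h θ)) (by simp)
  have m1X := hLm _ (measurable_dX (cutKernelX h θ)) (by simp)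
  have m2Y := hLm _ (measurable_dY (cutKernelY h θ)) (by simp)
  have hd₁ : ∀ z ∈ fluidDomain h η, DifferentiableAt ℝ (cutKernelX h θ) z := fun z hz =>
    (hT.differentiable z (hin z hz).1 (hin z hz).2).2.1
  have hd₂ : ∀ z ∈ fluidDomain h η, DifferentiableAt ℝ (cutKernelY h θ) z := fun z hz =>
    (hT.differentiable z (hin z hz).1 (hin z hz).2).2.2
  have hsurf : ∀ x, -h ≤ η x ∧ η x ≤ h / 8 := fun x => ⟨by linarith [(abs_le.1 (hη0 x)).1], hup x⟩
  have hβs : ∀ x, radialCutoff (vortexPoint h θ) (θ * h / 4) (⟨x, η x⟩ : ℂ) = 1 := fun x =>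
    radialCutoff_eq_one_of_im hh hθ hθ' (Or.inr (by
      have := (abs_le.1 (hη0 x)).1
      simp only; linarith))
  have hnc : ∀ z ∈ {z : ℂ | -h ≤ z.im ∧ z.im ≤ h / 8},
      ContinuousAt (fun z => -deriv η z.re * cutKernelX h θ z + cutKernelY h θ z) z := fun z hz =>
    ((hS.continuous_deriv.comp Complex.continuous_re).neg.continuousAt.mul
      (hT.differentiable z hz.1 hz.2).2.1.continuousAt).add
      (hT.differentiable z hz.1 hz.2).2.2.continuousAt
  have hsc : Continuous fun x : ℝ => (⟨x, η x⟩ : ℂ) := by simpa using continuous_mk_sub hS.continuous 0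
  have hQ : IsSurfaceTrace η (fun z => -deriv η z.re * cutKernelX h θ z + cutKernelY h θ z)
      (fun x => -deriv η x * (kernelDeriv (Real.pi / h) (Real.cos (Real.pi * θ)) ⟨x, η x⟩).im +
        (kernelDeriv (Real.pi / h) (Real.cos (Real.pi * θ)) ⟨x, η x⟩).re) := by
    have hval : (fun x => -deriv η x *
          (kernelDeriv (Real.pi / h) (Real.cos (Real.pi * θ)) ⟨x, η x⟩).im +
        (kernelDeriv (Real.pi / h) (Real.cos (Real.pi * θ)) ⟨x, η x⟩).re) =
        fun x => (fun z => -deriv η z.re * cutKernelX h θ z + cutKernelY h θ z) ⟨x, η x⟩ :=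
      funext fun x => by simp only [cutKernelX, cutKernelY, hβs, one_mul]
    rw [hval]
    refine hS.isSurfaceTrace_of_le (e := fun x => (2 * C) * (1 / Real.cosh (Real.pi / h * x)))
      (fun z hz => (hnc z (hin z hz)).continuousWithinAt) ((memLp_inv_cosh hκ).const_mul _)
      (continuous_iff_continuousAt.2 fun x => ContinuousAt.comp (f := fun x : ℝ => (⟨x, η x⟩ : ℂ))
        (g := fun z => -deriv η z.re * cutKernelX h θ z + cutKernelY h θ z)
        (hnc _ (hsurf x)) hsc.continuousAt)
      (fun x => ?_) fun z hz => ?_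
    · have hcd : Continuous fun d : ℝ => (⟨x, η x - d⟩ : ℂ) := by
        have : (fun d : ℝ => (⟨x, η x - d⟩ : ℂ)) = fun d : ℝ => (x : ℂ) + (η x - d : ℝ) * Complex.I :=
          funext fun d => by apply Complex.ext <;> simp
        rw [this]; fun_prop
      have h1 : ContinuousAt (fun d : ℝ => (fun z => -deriv η z.re * cutKernelX h θ z +
          cutKernelY h θ z) (⟨x, η x - d⟩ : ℂ)) 0 :=
        ContinuousAt.comp (f := fun d : ℝ => (⟨x, η x - d⟩ : ℂ))
          (g := fun z => -deriv η z.re * cutKernelX h θ z + cutKernelY h θ z)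
          (by simp only [sub_zero]; exact hnc _ (hsurf x)) hcd.continuousAt
      have h2 := h1.tendsto
      simp only [sub_zero] at h2
      exact h2.mono_left nhdsWithin_le_nhds
    · obtain ⟨h1, h2⟩ := hin z hz
      have b1 := hT.bound z h1 h2 (cutKernelX h θ) (by simp)
      have b2 := hT.bound z h1 h2 (cutKernelY h θ) (by simp)
      refine (abs_add_le _ _).trans ?_
      rw [abs_mul, abs_neg]
      have := mul_le_of_le_one_left (abs_nonneg (cutKernelX h θ z)) (hη' z.re)
      linarith
  -- The divergence theorem for `ψ` times the field `β∇(Im K)`, where `β` is the radial cutoff.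
  have hD1 := hS.integral_field_mul_grad hψ hζ hd₁ hd₂ m1 m2 m1X m2Y hQ
  have i1 : IntegrableOn (fun z => dX ψ z * cutKernelX h θ z + dY ψ z * cutKernelY h θ z +
      ψ z * (dX (cutKernelX h θ) z + dY (cutKernelY h θ) z)) (fluidDomain h η) :=
    ((hψ.memLp_dX.integrable_mul m1).add (hψ.memLp_dY.integrable_mul m2)).add
      (hψ.memLp.integrable_mul (m1X.add m2Y))
  have i2 : IntegrableOn (fun z => dX (cutKernel h θ) z * dX ψ z + dY (cutKernel h θ) z * dY ψ z)
      (fluidDomain h η) := (mX.integrable_mul hψ.memLp_dX).add (mY.integrable_mul hψ.memLp_dY)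
  rw [← hD1, ← integral_sub i1 i2, ← integral_vortex_flux hh hθ hθ' hη0 hψ]
  rw [← setIntegral_eq_integral_of_forall_compl_eq_zero (s := fluidDomain h η)]
  · refine setIntegral_congr_ae hS.measurableSet ?_
    -- Away from the pole `Im K` is harmonic, so the two integrands differ exactly by `∇β·(ψ∇Im K -
    -- Im K ∇ψ)`, the flux around the vortex. The pole is a null set.
    have hae : ∀ᵐ z : ℂ, z ≠ vortexPoint h θ := compl_mem_ae_iff.2 (measure_singleton _)
    filter_upwards [hae] with z hz hzΩ
    have hne := kernelDen_ne_zero hh hθ hθ' (hin z hzΩ).1 (hin z hzΩ).2 hz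
    have hK := hasDerivAt_kernel hne
    have hK' := hasDerivAt_kernelDeriv hne
    obtain ⟨-, -, e3, e4⟩ := hasFDerivAt_re_comp hK
    obtain ⟨-, f2, f3, -⟩ := hasFDerivAt_re_comp hK'
    have hd1 : DifferentiableAt ℝ
        (fun z => (kernel (Real.pi / h) (Real.cos (Real.pi * θ)) z).im) z :=
      (Complex.imCLM.hasFDerivAt.comp _ (hK.hasFDerivAt.restrictScalars ℝ)).differentiableAt
    have hd2 : DifferentiableAt ℝ
        (fun z => (kernelDeriv (Real.pi / h) (Real.cos (Real.pi * θ)) z).im) z :=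
      (Complex.imCLM.hasFDerivAt.comp _ (hK'.hasFDerivAt.restrictScalars ℝ)).differentiableAt
    have hd3 : DifferentiableAt ℝ
        (fun z => (kernelDeriv (Real.pi / h) (Real.cos (Real.pi * θ)) z).re) z :=
      (Complex.reCLM.hasFDerivAt.comp _ (hK'.hasFDerivAt.restrictScalars ℝ)).differentiableAt
    have hβd := differentiableAt_radialCutoff (vortexPoint h θ) (θ * h / 4) z
    unfold cutKernel cutKernelX cutKernelY
    rw [dX_mul hβd hd1, dY_mul hβd hd1, dX_mul hβd hd2, dY_mul hβd hd3, e3, e4, f2, f3]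
    ring
  · intro z hz
    have : radialSlope (vortexPoint h θ) (θ * h / 4) z = 0 := by
      by_contra hcon
      have h1 := (tsupport_radialSlope_subset hr (subset_tsupport _ hcon)).2
      exact hz (closedBall_vortexPoint_subset hh hθ hθ' hη0 (mem_closedBall_iff_norm.2 (by linarith)))
    rw [dX_radialCutoff, dY_radialCutoff, this]
    simp


lemma cutKernel_surface (hh : 0 < h) (hθ : 0 < θ) (hθ' : θ ≤ 1 / 2) {x y : ℝ} (hy : -h / 8 ≤ y) :
    cutKernel h θ ⟨x, y⟩ = (kernel (Real.pi / h) (Real.cos (Real.pi * θ)) ⟨x, y⟩).im := by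
  rw [cutKernel, radialCutoff_eq_one_of_im hh hθ hθ' (Or.inr hy), one_mul]

lemma cutKernel_bottom (hh : 0 < h) (x : ℝ) : cutKernel h θ ⟨x, -h⟩ = 0 := by
  rw [cutKernel, kernel_im_of_bottom, mul_zero]
  field_simp

lemma exists_cutKernel_memLp (hh : 0 < h) (hθ : 0 < θ) (hθ' : θ ≤ 1 / 2) (hη : Continuous η)
    (hη0 : ∀ x, |η x| ≤ h / 8) :
    ContinuousOn (cutKernel h θ) (closure (fluidDomain h η)) ∧
    (∀ z ∈ fluidDomain h η, DifferentiableAt ℝ (cutKernel h θ) z) ∧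
    MemLp (cutKernel h θ) 2 (volume.restrict (fluidDomain h η)) ∧
    MemLp (dX (cutKernel h θ)) 2 (volume.restrict (fluidDomain h η)) ∧
    MemLp (dY (cutKernel h θ)) 2 (volume.restrict (fluidDomain h η)) := by
  obtain ⟨C, hC, hT⟩ := exists_isCutKernelTriple hh hθ hθ'
  have hκ : 0 < Real.pi / h := div_pos Real.pi_pos hh
  have hin : ∀ z ∈ closure (fluidDomain h η), -h ≤ z.im ∧ z.im ≤ h / 8 := fun z hz =>
    closure_fluidDomain_subset hη0 hz
  have hup : ∀ x, η x ≤ h / 8 := fun x => (abs_le.1 (hη0 x)).2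
  have hc : ContinuousOn (cutKernel h θ) (closure (fluidDomain h η)) := fun z hz =>
    (hT.differentiable z (hin z hz).1 (hin z hz).2).1.continuousAt.continuousWithinAt
  refine ⟨hc, fun z hz => (hT.differentiable z (hin z (subset_closure hz)).1
      (hin z (subset_closure hz)).2).1, ?_, ?_, ?_⟩
  · exact memLp_of_le_inv_cosh hκ hh hη hup
      (continuousOn_aestronglyMeasurable (isOpen_fluidDomain hη) (hc.mono subset_closure))
      fun z hz => hT.bound z (hin z (subset_closure hz)).1 (hin z (subset_closure hz)).2 _ (by simp)
  · exact memLp_of_le_inv_cosh hκ hh hη hup (measurable_dX _).aestronglyMeasurable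
      fun z hz => hT.bound z (hin z (subset_closure hz)).1 (hin z (subset_closure hz)).2 _ (by simp)
  · exact memLp_of_le_inv_cosh hκ hh hη hup (measurable_dY _).aestronglyMeasurable
      fun z hz => hT.bound z (hin z (subset_closure hz)).1 (hin z (subset_closure hz)).2 _ (by simp)

/-- The vertical velocity at the vortex below a flat surface. -/
theorem dY_vortexPoint_flat (hh : 0 < h) (hθ : 0 < θ) (hθ' : θ ≤ 1 / 2) (hζ : MemLp ζ 2)
    (hψ : IsHarmonicExtension h (fun _ => 0) ζ ψ) :
    4 * h * dY ψ (vortexPoint h θ) = ∫ x, ζ x * (2 * (Real.pi / h) *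
      (1 + Real.cos (Real.pi * θ) * Real.cosh (Real.pi / h * x)) /
        (Real.cosh (Real.pi / h * x) + Real.cos (Real.pi * θ)) ^ 2) := by
  have h0 : ∀ x : ℝ, |(fun _ : ℝ => (0 : ℝ)) x| ≤ h / 8 := fun x => by simp; positivity
  have h1 : ∀ x : ℝ, |deriv (fun _ : ℝ => (0 : ℝ)) x| ≤ 1 := fun x => by simp
  have hS := isTameSurface_of_abs_le hh contDiff_const h1 h0
  obtain ⟨a1, a2, a3, a4, a5⟩ := exists_cutKernel_memLp hh hθ hθ' hS.continuous h0
  -- Over a flat surface the cut-off kernel vanishes on the whole boundary, so Green's first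
  -- identity removes the second integral.
  rw [dY_vortexPoint_eq_sub hh hθ hθ' contDiff_const h1 h0 hζ hψ,
    hS.integral_grad_mul_grad_eq_zero hψ a1 a2 (cutKernel_bottom hh) (fun x => ?_) a3 a4 a5, sub_zero]
  · refine integral_congr_ae (Eventually.of_forall fun x => ?_)
    have : (⟨x, 0⟩ : ℂ) = (x : ℂ) := rfl
    simp only [this, kernelDeriv_ofReal, Complex.ofReal_re, Complex.ofReal_im, mul_zero, zero_add]
  · rw [cutKernel_surface hh hθ hθ' (by linarith), kernel_im_of_im_eq_zero rfl]

/-- The vertical velocity at the vortex in terms of the boundary values and of the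
Dirichlet-to-Neumann data. -/
theorem dY_vortexPoint_eq (hh : 0 < h) (hθ : 0 < θ) (hθ' : θ ≤ 1 / 2) (hη : ContDiff ℝ 1 η)
    (hη' : ∀ x, |deriv η x| ≤ 1) (hη0 : ∀ x, |η x| ≤ h / 8) (hζ : MemLp ζ 2)
    (hψ : IsHarmonicExtension h η ζ ψ) {w : ℝ → ℝ}
    (hw : IsSurfaceTrace η (fun z => -deriv η z.re * dX ψ z + dY ψ z) w) :
    4 * h * dY ψ (vortexPoint h θ) =
      (∫ x, ζ x * (-deriv η x *
          (kernelDeriv (Real.pi / h) (Real.cos (Real.pi * θ)) ⟨x, η x⟩).im +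
        (kernelDeriv (Real.pi / h) (Real.cos (Real.pi * θ)) ⟨x, η x⟩).re)) -
      ∫ x, (kernel (Real.pi / h) (Real.cos (Real.pi * θ)) ⟨x, η x⟩).im * w x := by
  have hS := isTameSurface_of_abs_le hh hη hη' hη0
  obtain ⟨a1, a2, a3, a4, a5⟩ := exists_cutKernel_memLp hh hθ hθ' hS.continuous hη0
  obtain ⟨C, hC, hT⟩ := exists_isCutKernelTriple hh hθ hθ'
  have hκ : 0 < Real.pi / h := div_pos Real.pi_pos hh
  have hlow : ∀ x, -h / 8 ≤ η x := fun x => by have := (abs_le.1 (hη0 x)).1; linarith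
  have hsc : Continuous fun x : ℝ => (⟨x, η x⟩ : ℂ) := by simpa using continuous_mk_sub hS.continuous 0
  have hval : (fun x => (kernel (Real.pi / h) (Real.cos (Real.pi * θ)) ⟨x, η x⟩).im) =
      fun x => cutKernel h θ ⟨x, η x⟩ :=
    funext fun x => (cutKernel_surface hh hθ hθ' (hlow x)).symm
  have hmem : ∀ x, (⟨x, η x⟩ : ℂ) ∈ closure (fluidDomain h η) := fun x =>
    hS.mem_closure (by have := hlow x; simp only; linarith) le_rfl
  have hνc : Continuous fun x => cutKernel h θ ⟨x, η x⟩ := a1.comp_continuous hsc hmem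
  have hν : IsSurfaceTrace η (cutKernel h θ)
      (fun x => (kernel (Real.pi / h) (Real.cos (Real.pi * θ)) ⟨x, η x⟩).im) := by
    rw [hval]
    refine hS.isSurfaceTrace_of_continuousOn a1 a2 a5 ?_ fun x => rfl
    refine MemLp.of_le_mul (c := C) (memLp_inv_cosh hκ) hνc.aestronglyMeasurable
      (Eventually.of_forall fun x => ?_)
    have h1 := closure_fluidDomain_subset hη0 (hmem x)
    rw [Real.norm_eq_abs, Real.norm_of_nonneg (by have := Real.cosh_pos (Real.pi / h * x); positivity)]
    exact hT.bound _ h1.1 h1.2 _ (by simp)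
  rw [dY_vortexPoint_eq_sub hh hθ hθ' hη hη' hη0 hζ hψ,
    hS.integral_grad_mul_grad_eq_trace hψ a1 a2 (cutKernel_bottom hh) a3 a4 a5 hν hw]

end

end PointVortex
end

/-! ### Plancherel's theorem and the Sobolev embedding -/

noncomputable section
namespace PointVortex

section Plancherel

lemma continuous_fourierInv {F : ℝ → ℂ} (hF : Integrable F) : Continuous (𝓕⁻ F) := by
  have h1 : Continuous (𝓕 F) := VectorFourier.fourierIntegral_continuous Real.continuous_fourierChar
    (by exact continuous_inner) hF
  have h2 : 𝓕⁻ F = fun x => 𝓕 F (-x) := funext fun x => Real.fourierInv_eq_fourier_neg F x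
  rw [h2]
  exact h1.comp continuous_neg

lemma norm_fourierInv_le (F : ℝ → ℂ) (x : ℝ) : ‖𝓕⁻ F x‖ ≤ ∫ ξ, ‖F ξ‖ := by
  rw [Real.fourierInv_eq_fourier_neg]
  exact VectorFourier.norm_fourierIntegral_le_integral_norm _ _ _ _ _

lemma hasDerivAt_fourierInv {F : ℝ → ℂ} (hF : Integrable F) (hF' : Integrable fun ξ : ℝ => ξ * F ξ)
    (x : ℝ) : HasDerivAt (𝓕⁻ F) (𝓕⁻ (fun ξ : ℝ => 2 * Real.pi * Complex.I * ξ * F ξ) x) x := by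
  have h2 : 𝓕⁻ F = fun x => 𝓕 F (-x) := funext fun x => Real.fourierInv_eq_fourier_neg F x
  have h1 := Real.hasDerivAt_fourier hF (by simpa using hF') (-x)
  rw [h2, Real.fourierInv_eq_fourier_neg]
  have h3 := HasDerivAt.scomp x h1 (hasDerivAt_neg x)
  refine h3.congr_deriv ?_
  rw [Real.fourier_eq, Real.fourier_eq, neg_one_smul, ← integral_neg]
  congr 1
  ext v
  simp only [smul_eq_mul, Circle.smul_def]
  ring

/-- The `L²` inverse Fourier transform of a function in `L¹ ∩ L²` is given by the integral. -/
theorem fourierInv_toLp_ae_eq {F : ℝ → ℂ} (hF1 : Integrable F) (hF2 : MemLp F 2) :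
    ((𝓕⁻ (hF2.toLp F) : Lp ℂ 2 (volume : Measure ℝ)) : ℝ → ℂ) =ᵐ[volume] 𝓕⁻ F := by
  have hc := continuous_fourierInv hF1
  refine ae_eq_of_integral_contDiff_smul_eq ((Lp.memLp _).locallyIntegrable (by norm_num))
    hc.locallyIntegrable fun g hg hgc => ?_
  have hg₁ : HasCompactSupport (Complex.ofRealCLM ∘ g) := hgc.comp_left rfl
  have hg₂ : ContDiff ℝ ∞ (Complex.ofRealCLM ∘ g) := by fun_prop
  set G : 𝓢(ℝ, ℂ) := hg₁.toSchwartzMap hg₂ with hG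
  have hGa : ∀ x, G x = (g x : ℂ) := fun x => rfl
  -- Both candidates are paired with a test function; each pairing equals the integral of `F`
  -- against the inverse transform of the test function.
  have e1 : (((𝓕⁻ (hF2.toLp F) : Lp ℂ 2 (volume : Measure ℝ)) : 𝓢'(ℝ, ℂ))) G =
      ∫ x, (𝓕⁻ G) x • F x := by
    rw [← Lp.fourierInv_toTemperedDistribution_eq, TemperedDistribution.fourierInv_apply,
      Lp.toTemperedDistribution_apply]
    refine integral_congr_ae ?_
    filter_upwards [hF2.coeFn_toLp] with x hx
    rw [hx]
  rw [Lp.toTemperedDistribution_apply] at e1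
  have e2 : ∫ x, (𝓕⁻ G) x • F x = ∫ x, G x • 𝓕⁻ F x := by
    have h1 := VectorFourier.integral_fourierIntegral_smul_eq_flip (𝕜 := ℝ) (e := Real.fourierChar)
      (μ := volume) (ν := volume)
      (L := -innerₗ ℝ) (f := (G : ℝ → ℂ)) (g := F) Real.continuous_fourierChar
      (by simp only [LinearMap.neg_apply]; exact continuous_inner.neg) G.integrable hF1
    have h3 : (-innerₗ ℝ : ℝ →ₗ[ℝ] ℝ →ₗ[ℝ] ℝ).flip = -innerₗ ℝ := by
      ext; simp
    rw [h3] at h1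
    have h4 : ∀ x, (𝓕⁻ G) x = VectorFourier.fourierIntegral Real.fourierChar volume (-innerₗ ℝ) G x :=
      fun x => by rw [SchwartzMap.fourierInv_coe]; rfl
    simp only [h4]
    exact h1
  rw [e2] at e1
  exact e1

/-- Plancherel for the inverse transform given by an integral, as needed for pointwise defined
functions such as slices and derivatives. -/
theorem eLpNorm_fourierInv_eq {F : ℝ → ℂ} (hF1 : Integrable F) (hF2 : MemLp F 2) :
    eLpNorm (𝓕⁻ F) 2 volume = eLpNorm F 2 volume := by
  rw [← eLpNorm_congr_ae (fourierInv_toLp_ae_eq hF1 hF2), ← eLpNorm_congr_ae hF2.coeFn_toLp]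
  have h2 : ‖(𝓕⁻ (hF2.toLp F) : Lp ℂ 2 (volume : Measure ℝ))‖ = ‖hF2.toLp F‖ :=
    (Lp.fourierTransformₗᵢ ℝ ℂ).symm.norm_map _
  rw [Lp.norm_def, Lp.norm_def, ENNReal.toReal_eq_toReal_iff' (Lp.eLpNorm_ne_top _)
    (Lp.eLpNorm_ne_top _)] at h2
  exact h2

end Plancherel

section Sobolev

lemma toTemperedDistribution_injective {u v : Lp ℂ 2 (volume : Measure ℝ)}
    (huv : (u : 𝓢'(ℝ, ℂ)) = (v : 𝓢'(ℝ, ℂ))) : u = v := by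
  have h1 := Lp.ker_toTemperedDistributionCLM_eq_bot (E := ℝ) (F := ℂ) (μ := volume) (p := 2)
  exact LinearMap.ker_eq_bot.1 h1 huv

lemma rpow_symbol_hasTemperateGrowth (s : ℝ) :
    (fun ξ : ℝ => (((1 + ‖ξ‖ ^ 2) ^ (s / 2) : ℝ) : ℂ)).HasTemperateGrowth := by fun_prop

/-- The Fourier representation of a Sobolev function. -/
lemma MemHs.exists_symbol {s : ℝ} (hs : 0 ≤ s) {f : ℝ → ℝ} (hf : MemHs s f) :
    ∃ (φ : ℝ → ℂ) (hφ : MemLp φ 2) (hF : MemLp (fun ξ : ℝ => (((1 + ‖ξ‖ ^ 2) ^ (-s / 2) : ℝ) : ℂ) * φ ξ) 2)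
      (hf2 : MemLp (fun x => (f x : ℂ)) 2),
      ‖hφ.toLp φ‖ = hsNorm s f ∧ hf2.toLp (fun x => (f x : ℂ)) =
        (𝓕⁻ (hF.toLp _ : Lp ℂ 2 (volume : Measure ℝ)) : Lp ℂ 2 (volume : Measure ℝ)) := by
  obtain ⟨-, hf2, u, hu⟩ := hf
  -- `L²` embeds injectively into tempered distributions, so the set in the definition of the norm
  -- is a singleton.
  have hnorm : hsNorm s f = ‖u‖ := by
    have : {r : ℝ | ∃ (hf : MemLp (fun x => (f x : ℂ)) 2 (volume : Measure ℝ))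
        (u : Lp ℂ 2 (volume : Measure ℝ)),
        TemperedDistribution.besselPotential ℝ ℂ s
          ((hf.toLp _ : Lp ℂ 2 (volume : Measure ℝ)) : 𝓢'(ℝ, ℂ)) = (u : 𝓢'(ℝ, ℂ)) ∧ r = ‖u‖} =
        {‖u‖} := by
      ext r
      constructor
      · rintro ⟨hf3, v, hv, rfl⟩
        rw [Set.mem_singleton_iff, toTemperedDistribution_injective (hv.symm.trans hu)]
      · rintro rfl
        exact ⟨hf2, u, hu, rfl⟩
    rw [hsNorm, this, csInf_singleton]
  set v : Lp ℂ 2 (volume : Measure ℝ) := 𝓕 u with hv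
  have hvn : ‖v‖ = ‖u‖ := Lp.norm_fourier_eq u
  have hw : MemLp (fun ξ : ℝ => (((1 + ‖ξ‖ ^ 2) ^ (-s / 2) : ℝ) : ℂ)) ∞ := by
    refine memLp_top_of_bound (rpow_symbol_hasTemperateGrowth (-s)).1.continuous.aestronglyMeasurable 1
      (Eventually.of_forall fun ξ => ?_)
    rw [Complex.norm_real, Real.norm_of_nonneg (by positivity)]
    exact Real.rpow_le_one_of_one_le_of_nonpos (by nlinarith [sq_nonneg ‖ξ‖]) (by linarith)
  -- The Bessel potential multiplies the transform by `(1+|ξ|²)^{s/2}`; multiplying by the inverse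
  -- symbol recovers the transform of `f`.
  have h1 : (𝓕 (hf2.toLp (fun x => (f x : ℂ)) : Lp ℂ 2 (volume : Measure ℝ)) :
      Lp ℂ 2 (volume : Measure ℝ)) = ((hw.toLp _) • v : Lp ℂ 2 (volume : Measure ℝ)) := by
    apply toTemperedDistribution_injective
    rw [← Lp.fourier_toTemperedDistribution_eq, Lp.toTemperedDistribution_smul_eq
      (rpow_symbol_hasTemperateGrowth (-s)), hv, ← Lp.fourier_toTemperedDistribution_eq, ← hu,
      TemperedDistribution.fourier_besselPotential_eq_smulLeftCLM_fourier_apply,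
      TemperedDistribution.smulLeftCLM_smulLeftCLM_apply (rpow_symbol_hasTemperateGrowth s)
        (rpow_symbol_hasTemperateGrowth (-s))]
    convert! (TemperedDistribution.smulLeftCLM_const 1
      (𝓕 ((hf2.toLp _ : Lp ℂ 2 (volume : Measure ℝ)) : 𝓢'(ℝ, ℂ)))).symm using 1
    · simp
    · congr
      ext ξ
      rw [Pi.mul_apply]
      norm_cast
      rw [← Real.rpow_add (by positivity)]
      ring_nf
      simp
  have h2 : (((hw.toLp _) • v : Lp ℂ 2 (volume : Measure ℝ)) : ℝ → ℂ) =ᵐ[volume]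
      fun ξ : ℝ => (((1 + ‖ξ‖ ^ 2) ^ (-s / 2) : ℝ) : ℂ) * v ξ := by
    filter_upwards [Lp.coeFn_lpSMul (r := 2) (hw.toLp _) v, hw.coeFn_toLp] with x hg hg'
    rw [hg, Pi.smul_apply', hg', smul_eq_mul]
  have hF : MemLp (fun ξ : ℝ => (((1 + ‖ξ‖ ^ 2) ^ (-s / 2) : ℝ) : ℂ) * v ξ) 2 :=
    (memLp_congr_ae h2).1 (Lp.memLp _)
  refine ⟨v, Lp.memLp v, hF, hf2, ?_, ?_⟩
  · rw [Lp.toLp_coeFn, hvn, hnorm]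
  · have h3 : (hF.toLp _ : Lp ℂ 2 (volume : Measure ℝ)) = ((hw.toLp _) • v : Lp ℂ 2 (volume : Measure ℝ)) := by
      apply Lp.ext
      filter_upwards [hF.coeFn_toLp, h2] with x hx1 hx2
      rw [hx1, hx2]
    rw [h3, ← h1, FourierTransform.fourierInv_fourier_eq]

/-- The Sobolev embedding of `H^s(ℝ)` for `s > 3/2`. -/
theorem exists_sobolev_bound {s : ℝ} (hs : 3 / 2 < s) : ∃ C, 0 < C ∧ ∀ f : ℝ → ℝ, MemHs s f →
    ContDiff ℝ 1 f ∧ MemLp f 2 ∧ MemLp (deriv f) 2 ∧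
    ∀ x, |f x| ≤ C * hsNorm s f ∧ |deriv f x| ≤ C * hsNorm s f := by
  -- Integrability needs `2(s-1) > 1`, which is exactly `s > 3/2`. By Cauchy–Schwarz, `ξ` times the
  -- transform of `f` is then integrable.
  have hwi : Integrable fun ξ : ℝ => (1 + ‖ξ‖ ^ 2) ^ (-(2 * (s - 1)) / 2) :=
    integrable_rpow_neg_one_add_norm_sq (E := ℝ) (μ := volume) (r := 2 * (s - 1)) (by simp; linarith)
  have hgc : Continuous fun ξ : ℝ => (1 + ‖ξ‖ ^ 2) ^ (-(s - 1) / 2) := by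
    refine Continuous.rpow_const (by fun_prop) fun ξ => Or.inl (by positivity)
  have hg2 : MemLp (fun ξ : ℝ => (1 + ‖ξ‖ ^ 2) ^ (-(s - 1) / 2)) 2 := by
    rw [memLp_two_iff_integrable_sq hgc.aestronglyMeasurable]
    refine hwi.congr (Eventually.of_forall fun ξ => ?_)
    dsimp only
    rw [← Real.rpow_mul_natCast (by positivity)]
    congr 1
    push_cast; ring
  set A : ℝ := ∫ ξ : ℝ, ((1 + ‖ξ‖ ^ 2) ^ (-(s - 1) / 2)) ^ 2 with hA
  refine ⟨2 * Real.pi * Real.sqrt A + 1, by positivity, fun f hf => ?_⟩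
  obtain ⟨φ, hφ, hF, hf2, hnorm, hfe⟩ := hf.exists_symbol (by linarith)
  set F : ℝ → ℂ := fun ξ : ℝ => (((1 + ‖ξ‖ ^ 2) ^ (-s / 2) : ℝ) : ℂ) * φ ξ with hFd
  have hle : ∀ ξ : ℝ, ‖F ξ‖ ≤ (1 + ‖ξ‖ ^ 2) ^ (-(s - 1) / 2) * ‖φ ξ‖ ∧
      ‖(ξ : ℂ) * F ξ‖ ≤ (1 + ‖ξ‖ ^ 2) ^ (-(s - 1) / 2) * ‖φ ξ‖ ∧ ‖(ξ : ℂ) * F ξ‖ ≤ ‖φ ξ‖ := by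
    intro ξ
    have h1 : (1 : ℝ) ≤ 1 + ‖ξ‖ ^ 2 := by nlinarith [sq_nonneg ‖ξ‖]
    have h2 : (1 + ‖ξ‖ ^ 2) ^ (-s / 2) ≤ (1 + ‖ξ‖ ^ 2) ^ (-(s - 1) / 2) :=
      Real.rpow_le_rpow_of_exponent_le h1 (by linarith)
    have h3 : ‖ξ‖ * (1 + ‖ξ‖ ^ 2) ^ (-s / 2) ≤ (1 + ‖ξ‖ ^ 2) ^ (-(s - 1) / 2) := by
      have h4 : ‖ξ‖ ≤ (1 + ‖ξ‖ ^ 2) ^ (1 / 2 : ℝ) := by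
        rw [← Real.sqrt_eq_rpow]
        exact Real.le_sqrt_of_sq_le (by linarith)
      calc ‖ξ‖ * (1 + ‖ξ‖ ^ 2) ^ (-s / 2)
          ≤ (1 + ‖ξ‖ ^ 2) ^ (1 / 2 : ℝ) * (1 + ‖ξ‖ ^ 2) ^ (-s / 2) := by gcongr
        _ = _ := by rw [← Real.rpow_add (by positivity)]; congr 1; ring
    have h5 : (1 + ‖ξ‖ ^ 2) ^ (-(s - 1) / 2) ≤ 1 :=
      Real.rpow_le_one_of_one_le_of_nonpos h1 (by linarith)
    have h6 : ‖F ξ‖ = (1 + ‖ξ‖ ^ 2) ^ (-s / 2) * ‖φ ξ‖ := by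
      rw [hFd]
      simp only [norm_mul, Complex.norm_real]
      rw [Real.norm_of_nonneg (by positivity)]
    have h7 : ‖(ξ : ℂ) * F ξ‖ ≤ (1 + ‖ξ‖ ^ 2) ^ (-(s - 1) / 2) * ‖φ ξ‖ := by
      rw [norm_mul, h6, Complex.norm_real, ← mul_assoc]
      exact mul_le_mul_of_nonneg_right h3 (norm_nonneg _)
    refine ⟨?_, h7, h7.trans (mul_le_of_le_one_left (norm_nonneg _) h5)⟩
    rw [h6]
    exact mul_le_mul_of_nonneg_right h2 (norm_nonneg _)
  have hξF : AEStronglyMeasurable (fun ξ : ℝ => (ξ : ℂ) * F ξ) volume :=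
    Complex.continuous_ofReal.aestronglyMeasurable.mul hF.aestronglyMeasurable
  have hprod : Integrable fun ξ : ℝ => (1 + ‖ξ‖ ^ 2) ^ (-(s - 1) / 2) * ‖φ ξ‖ :=
    hg2.integrable_mul hφ.norm
  have hF1 : Integrable F := hprod.mono' hF.aestronglyMeasurable (Eventually.of_forall fun ξ => (hle ξ).1)
  have hξF1 : Integrable fun ξ : ℝ => (ξ : ℂ) * F ξ :=
    hprod.mono' hξF (Eventually.of_forall fun ξ => (hle ξ).2.1)
  have hξF2 : MemLp (fun ξ : ℝ => (ξ : ℂ) * F ξ) 2 :=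
    hφ.of_le hξF (Eventually.of_forall fun ξ => (hle ξ).2.2)
  have hφn : Real.sqrt (∫ ξ, ‖φ ξ‖ ^ 2) = hsNorm s f := by
    rw [← hnorm, Lp.norm_toLp, hφ.eLpNorm_eq_integral_rpow_norm (by norm_num) (by norm_num),
      ENNReal.toReal_ofReal (by positivity), Real.sqrt_eq_rpow]
    simp
  have hCS : ∫ ξ : ℝ, (1 + ‖ξ‖ ^ 2) ^ (-(s - 1) / 2) * ‖φ ξ‖ ≤ Real.sqrt A * hsNorm s f := by
    have := integral_mul_le_Lp_mul_Lq_of_nonneg (μ := (volume : Measure ℝ)) (p := 2) (q := 2)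
      Real.HolderConjugate.two_two (f := fun ξ : ℝ => (1 + ‖ξ‖ ^ 2) ^ (-(s - 1) / 2))
      (g := fun ξ => ‖φ ξ‖)
      (Eventually.of_forall fun ξ => by simp only [Pi.zero_apply]; positivity)
      (Eventually.of_forall fun ξ => by simp)
      (by simpa using hg2) (by simpa using hφ.norm)
    rw [← hφn, hA, Real.sqrt_eq_rpow, Real.sqrt_eq_rpow]
    simpa using this
  have hcF := continuous_fourierInv hF1
  have heq : (fun x => (f x : ℂ)) = 𝓕⁻ F := by
    have hfc : Continuous fun x => (f x : ℂ) := Complex.continuous_ofReal.comp hf.1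
    refine Continuous.ae_eq_iff_eq volume hfc hcF |>.1 ?_
    have h1 := fourierInv_toLp_ae_eq hF1 hF
    rw [← hfe] at h1
    exact hf2.coeFn_toLp.symm.trans h1
  -- The symbol of `f'`. It lies in `L¹`, which makes `f'` continuous and bounded, and in `L²`,
  -- which makes `f'` square integrable.
  set F' : ℝ → ℂ := fun ξ : ℝ => 2 * Real.pi * Complex.I * ξ * F ξ with hF'd
  have hF'e : F' = fun ξ : ℝ => (2 * Real.pi * Complex.I) * ((ξ : ℂ) * F ξ) :=
    funext fun ξ => by rw [hF'd]; ring
  have hF'1 : Integrable F' := by rw [hF'e]; exact hξF1.const_mul _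
  have hF'2 : MemLp F' 2 := by rw [hF'e]; exact hξF2.const_mul _
  have hd : ∀ x, HasDerivAt f ((𝓕⁻ F' x).re) x := fun x => by
    have h1 := hasDerivAt_fourierInv hF1 hξF1 x
    rw [← heq] at h1
    have h2 := Complex.reCLM.hasFDerivAt.comp_hasDerivAt x h1
    exact h2
  have hder : deriv f = fun x => (𝓕⁻ F' x).re := funext fun x => (hd x).deriv
  have hc' : Continuous fun x => (𝓕⁻ F' x).re := Complex.continuous_re.comp (continuous_fourierInv hF'1)
  have hfd : ∀ x, f x = (𝓕⁻ F x).re := fun x => by rw [← heq]; simp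
  refine ⟨contDiff_one_iff_deriv.2 ⟨fun x => (hd x).differentiableAt, by rwa [hder]⟩, ?_, ?_, fun x => ⟨?_, ?_⟩⟩
  · have := hf2.re
    simpa using this
  · rw [hder]
    have h1 : MemLp (𝓕⁻ F') 2 :=
      ⟨(continuous_fourierInv hF'1).aestronglyMeasurable, by
        rw [eLpNorm_fourierInv_eq hF'1 hF'2]; exact hF'2.2⟩
    exact h1.re
  · have hn0 : 0 ≤ hsNorm s f := by rw [← hnorm]; exact norm_nonneg _
    have hA0 : 0 ≤ Real.sqrt A * hsNorm s f := by positivity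
    rw [hfd]
    refine (Complex.abs_re_le_norm _).trans ((norm_fourierInv_le F x).trans ?_)
    refine (integral_mono hF1.norm hprod fun ξ => (hle ξ).1).trans (hCS.trans ?_)
    nlinarith [Real.pi_gt_three]
  · have hn0 : 0 ≤ hsNorm s f := by rw [← hnorm]; exact norm_nonneg _
    rw [hder]
    refine (Complex.abs_re_le_norm _).trans ((norm_fourierInv_le F' x).trans ?_)
    have h1 : ∫ ξ, ‖F' ξ‖ = 2 * Real.pi * ∫ ξ : ℝ, ‖(ξ : ℂ) * F ξ‖ := by
      rw [← integral_const_mul]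
      congr 1
      ext ξ
      rw [hF'e]
      simp only [norm_mul, Complex.norm_I, Complex.norm_real, Complex.norm_two, mul_one]
      rw [Real.norm_of_nonneg Real.pi_pos.le]
    rw [h1]
    have h2 := (integral_mono hξF1.norm hprod fun ξ => (hle ξ).2.1).trans hCS
    nlinarith [Real.pi_gt_three]

end Sobolev

end PointVortex
end

/-! ### Schwartz functions from strips of holomorphy; the Helmholtz operator -/

noncomputable section
namespace PointVortex

section Strip

/-- Real derivatives of the restriction are restrictions of complex derivatives, which opens the way
to Cauchy's estimates. -/
lemma hasDerivAt_iteratedDeriv_ofReal {F : ℂ → ℂ} (hF : ∀ x : ℝ, AnalyticAt ℂ F x) (n : ℕ) :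
    (iteratedDeriv n fun x : ℝ => F x) = fun x : ℝ => iteratedDeriv n F x := by
  induction n with
  | zero => simp
  | succ n ih =>
    ext x
    rw [iteratedDeriv_succ, ih, iteratedDeriv_succ]
    have h1 : AnalyticAt ℂ (iteratedDeriv n F) (x : ℂ) := by
      rw [iteratedDeriv_eq_iterate]
      exact (hF x).iterated_deriv n
    exact h1.differentiableAt.hasDerivAt.comp_ofReal.deriv

/-- A function that is holomorphic and rapidly decreasing in a strip restricts to a Schwartz
function. -/
theorem exists_schwartz_of_strip {F : ℂ → ℂ} {r : ℝ} (hr : 0 < r)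
    (hF : ∀ z : ℂ, |z.im| ≤ r → DifferentiableAt ℂ F z)
    (hdec : ∀ k : ℕ, ∃ C, ∀ z : ℂ, |z.im| ≤ r → |z.re| ^ k * ‖F z‖ ≤ C) :
    ∃ f : 𝓢(ℝ, ℂ), ∀ x : ℝ, f x = F x := by
  have hball : ∀ (x : ℝ) (z : ℂ), z ∈ Metric.closedBall (x : ℂ) r → |z.im| ≤ r ∧ |z.re - x| ≤ r := by
    intro x z hz
    rw [mem_closedBall_iff_norm] at hz
    have h1 := Complex.abs_im_le_norm (z - x)
    have h2 := Complex.abs_re_le_norm (z - x)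
    rw [Complex.sub_im, Complex.ofReal_im, sub_zero] at h1
    rw [Complex.sub_re, Complex.ofReal_re] at h2
    exact ⟨h1.trans hz, h2.trans hz⟩
  have hd : ∀ x : ℝ, DifferentiableOn ℂ F (Metric.closedBall (x : ℂ) r) := fun x z hz =>
    (hF z (hball x z hz).1).differentiableWithinAt
  have han : ∀ x : ℝ, AnalyticAt ℂ F x := fun x =>
    (hd x).analyticAt (Metric.closedBall_mem_nhds _ hr)
  refine ⟨⟨fun x => F x, ?_, fun k n => ?_⟩, fun x => rfl⟩
  · refine contDiff_iff_contDiffAt.2 fun x => ?_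
    have h1 : ContDiffAt ℝ ∞ F (x : ℂ) := ((han x).contDiffAt (n := ∞)).restrict_scalars ℝ
    exact h1.comp x Complex.ofRealCLM.contDiff.contDiffAt
  · obtain ⟨C, hC⟩ := hdec k
    obtain ⟨C', hC'⟩ := hdec 0
    have hCpos : 0 ≤ |C| + r ^ k * |C'| := by positivity
    refine ⟨2 ^ k * (n.factorial * (|C| + r ^ k * |C'|) / r ^ n), fun x => ?_⟩
    rw [norm_iteratedFDeriv_eq_norm_iteratedDeriv, hasDerivAt_iteratedDeriv_ofReal han,
      Real.norm_eq_abs]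
    -- In this case the weight `|x|^k` is zero; otherwise it is positive and may be divided by.
    by_cases hx : x = 0 ∧ k ≠ 0
    · rw [hx.1, abs_zero, zero_pow hx.2, zero_mul]
      positivity
    have hxk : 0 < |x| ^ k := by
      by_cases hk : k = 0
      · simp [hk]
      · exact pow_pos (abs_pos.2 fun h0 => hx ⟨h0, hk⟩) k
    -- On the circle of radius `r` about `x` one has `|x| ≤ |Re z| + r`, so the decay of `F` in the
    -- strip becomes decay in `x`, with the uniform constant that Cauchy's estimate requires.
    have hs : ∀ z ∈ Metric.sphere (x : ℂ) r, ‖F z‖ ≤ 2 ^ k * (|C| + r ^ k * |C'|) / |x| ^ k := by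
      intro z hz
      obtain ⟨h1, h2⟩ := hball x z (Metric.sphere_subset_closedBall hz)
      have h3 := hC z h1
      have h4 := hC' z h1
      rw [pow_zero, one_mul] at h4
      rw [le_div_iff₀ hxk]
      have h5 : |x| ≤ |z.re| + r := by
        have := abs_sub_abs_le_abs_sub x z.re
        rw [abs_sub_comm] at this
        linarith
      have h6 : |x| ^ k ≤ 2 ^ k * (|z.re| ^ k + r ^ k) := by
        refine (pow_le_pow_left₀ (abs_nonneg x) h5 k).trans ?_
        refine (add_pow_le (abs_nonneg _) hr.le k).trans ?_
        gcongr
        · norm_num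
        · omega
      calc ‖F z‖ * |x| ^ k ≤ ‖F z‖ * (2 ^ k * (|z.re| ^ k + r ^ k)) := by gcongr
        _ = 2 ^ k * (|z.re| ^ k * ‖F z‖ + r ^ k * ‖F z‖) := by ring
        _ ≤ 2 ^ k * (|C| + r ^ k * |C'|) := by
          gcongr
          · exact h3.trans (le_abs_self C)
          · exact h4.trans (le_abs_self C')
    have hcl : DiffContOnCl ℂ F (Metric.ball (x : ℂ) r) := (hd x).diffContOnCl_ball subset_rfl
    have := Complex.norm_iteratedDeriv_le_of_forall_mem_sphere_norm_le n hr hcl hs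
    calc |x| ^ k * ‖iteratedDeriv n F x‖
        ≤ |x| ^ k * (n.factorial * (2 ^ k * (|C| + r ^ k * |C'|) / |x| ^ k) / r ^ n) := by gcongr
      _ = _ := by field_simp

lemma exists_pow_le_cosh (κ : ℝ) (hκ : 0 < κ) (k : ℕ) :
    ∃ C, 0 ≤ C ∧ ∀ x : ℝ, |x| ^ k * (1 / Real.cosh (κ * x)) ≤ C := by
  refine ⟨2 * k.factorial / κ ^ k, by positivity, fun x => ?_⟩
  have h1 := Real.pow_div_factorial_le_exp (x := |κ * x|) (abs_nonneg _) k
  have h2 : Real.exp |κ * x| ≤ 2 * Real.cosh (κ * x) := by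
    rw [← Real.cosh_abs (κ * x), Real.cosh_eq]
    have := Real.exp_pos (-|κ * x|)
    linarith
  rw [div_le_iff₀ (by positivity), abs_mul, abs_of_pos hκ, mul_pow] at h1
  have hc := Real.cosh_pos (κ * x)
  rw [mul_one_div, div_le_div_iff₀ hc (by positivity)]
  rw [abs_mul, abs_of_pos hκ] at h2
  have hf : (0 : ℝ) < k.factorial := by exact_mod_cast k.factorial_pos
  nlinarith

end Strip

section Helmholtz

/-- The symbol is `g⁻¹(1 + |aξ|²)⁻¹` with `a = 2πα/√g`, a dilated Bessel symbol. -/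
lemma hasTemperateGrowth_helmholtz {g α : ℝ} (hg : 0 < g) :
    (fun ξ : ℝ => 1 / ((g + α ^ 2 * (2 * Real.pi * ξ) ^ 2 : ℝ) : ℂ)).HasTemperateGrowth := by
  have h1 := Function.hasTemperateGrowth_one_add_norm_sq_rpow ℝ (-1)
  have h2 : (fun ξ : ℝ => α / Real.sqrt g * (2 * Real.pi) * ξ).HasTemperateGrowth := by fun_prop
  have h3 := h1.comp h2
  have h4 : (fun ξ : ℝ => (((g⁻¹ * (1 + ‖α / Real.sqrt g * (2 * Real.pi) * ξ‖ ^ 2) ^ (-1 : ℝ) : ℝ)) : ℂ)).HasTemperateGrowth :=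
    Function.HasTemperateGrowth.comp (Complex.ofRealCLM).hasTemperateGrowth
      ((Function.HasTemperateGrowth.const g⁻¹).mul h3)
  convert h4 using 2 with ξ
  rw [Real.rpow_neg_one, ← mul_inv, Real.norm_eq_abs, sq_abs, one_div, ← Complex.ofReal_inv]
  congr 2
  rw [show (α / √g * (2 * Real.pi) * ξ) ^ 2 = α ^ 2 / √g ^ 2 * (2 * Real.pi * ξ) ^ 2 by ring,
    Real.sq_sqrt hg.le]
  field_simp

/-- The Helmholtz operator is inverted on Schwartz functions by `invHelmholtz`. -/
theorem exists_schwartz_invHelmholtz {g α : ℝ} (hg : 0 < g) {f : ℝ → ℝ} (fS : 𝓢(ℝ, ℂ))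
    (hf : ∀ x, fS x = (f x : ℂ)) : ∃ V : 𝓢(ℝ, ℝ), (∀ x, V x = invHelmholtz g α f x) ∧
      ∀ x, g * V x - α ^ 2 * deriv (deriv V) x = f x := by
  have hm := hasTemperateGrowth_helmholtz (α := α) hg
  set m : ℝ → ℂ := fun ξ : ℝ => 1 / ((g + α ^ 2 * (2 * Real.pi * ξ) ^ 2 : ℝ) : ℂ) with hmd
  set U : 𝓢(ℝ, ℂ) := SchwartzMap.fourierMultiplierCLM ℂ m fS with hU
  have hfS : (fS : ℝ → ℂ) = fun y => (f y : ℂ) := funext hf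
  have hUx : ∀ x, (U x).re = invHelmholtz g α f x := fun x => by
    rw [hU, SchwartzMap.fourierMultiplierCLM_apply, SchwartzMap.fourierInv_coe, invHelmholtz, ← hfS,
      SchwartzMap.smulLeftCLM_apply hm, SchwartzMap.fourier_coe]
    have : (fun ξ => m ξ • 𝓕 (fS : ℝ → ℂ) ξ) = fun ξ => 𝓕 (fS : ℝ → ℂ) ξ /
        ((g + α ^ 2 * (2 * Real.pi * ξ) ^ 2 : ℝ) : ℂ) := funext fun ξ => by
      simp only [hmd, smul_eq_mul]; ring
    rw [this]
  have hI : (fun ξ : ℝ => ((inner ℝ ξ (1 : ℝ) : ℝ) : ℂ)).HasTemperateGrowth := by fun_prop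
  -- Both sides are Fourier multipliers applied to `fS`; each derivative contributes `2πiξ`, and the
  -- product of the two symbols is one.
  have heq : g • U - α ^ 2 • LineDeriv.lineDerivOp (1 : ℝ) (LineDeriv.lineDerivOp (1 : ℝ) U) = fS := by
    have hL : ∀ W : 𝓢(ℝ, ℂ), LineDeriv.lineDerivOp (1 : ℝ) W = (2 * Real.pi * Complex.I) •
        SchwartzMap.fourierMultiplierCLM ℂ (fun ξ : ℝ => ((inner ℝ ξ (1 : ℝ) : ℝ) : ℂ)) W := fun W => by
      rw [SchwartzMap.lineDeriv_eq_fourierMultiplierCLM]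
      congr 1
      exact (SchwartzMap.fourierMultiplierCLM_ofReal ℂ (by fun_prop) W).symm
    rw [hL, hL, map_smul, smul_smul, hU,
      SchwartzMap.fourierMultiplierCLM_fourierMultiplierCLM_apply hI hm,
      SchwartzMap.fourierMultiplierCLM_fourierMultiplierCLM_apply hI (hI.mul hm)]
    have h1 : fS = SchwartzMap.fourierMultiplierCLM ℂ (fun _ : ℝ => (1 : ℂ)) fS := by
      rw [SchwartzMap.fourierMultiplierCLM_const]; simp
    conv_rhs => rw [h1]
    simp only [SchwartzMap.fourierMultiplierCLM_apply]
    rw [← FourierTransform.fourierInv_smul, sub_eq_add_neg, ← neg_smul,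
      ← FourierTransform.fourierInv_smul,
      ← FourierTransform.fourierInv_smul, ← FourierTransform.fourierInv_add]
    congr 1
    ext ξ
    have hne : ((g + α ^ 2 * (2 * Real.pi * ξ) ^ 2 : ℝ) : ℂ) ≠ 0 := by
      exact_mod_cast (by positivity : (g + α ^ 2 * (2 * Real.pi * ξ) ^ 2 : ℝ) ≠ 0)
    have hin : inner ℝ ξ (1 : ℝ) = ξ := by simp
    rw [_root_.add_apply, _root_.smul_apply, _root_.smul_apply, _root_.smul_apply,
      SchwartzMap.smulLeftCLM_apply_apply hm,
      SchwartzMap.smulLeftCLM_apply_apply (hI.mul (hI.mul hm)),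
      SchwartzMap.smulLeftCLM_apply_apply (by fun_prop)]
    simp only [Pi.mul_apply, hin, hmd, smul_eq_mul, Complex.real_smul]
    rw [show (2 * Real.pi * Complex.I * (2 * Real.pi * Complex.I) : ℂ) = -(2 * Real.pi) ^ 2 by
      ring_nf; rw [Complex.I_sq]; ring]
    have h5 := mul_one_div_cancel hne
    push_cast at h5 ⊢
    linear_combination ((𝓕 fS) ξ) * h5
  have hd1 : ∀ (W : 𝓢(ℝ, ℂ)) (x : ℝ), HasDerivAt (fun x => (W x).re)
      ((LineDeriv.lineDerivOp (1 : ℝ) W) x).re x := fun W x => by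
    rw [SchwartzMap.lineDerivOp_apply_eq_fderiv]
    have h2 := (W.differentiableAt (x := x)).hasDerivAt
    exact Complex.reCLM.hasFDerivAt.comp_hasDerivAt x h2
  refine ⟨SchwartzMap.postcompCLM Complex.reCLM U, fun x => ?_, fun x => ?_⟩
  · rw [SchwartzMap.postcompCLM_apply]; exact hUx x
  · have e0 : ((SchwartzMap.postcompCLM Complex.reCLM U : 𝓢(ℝ, ℝ)) : ℝ → ℝ) = fun x => (U x).re := rfl
    have e1 : deriv (fun x => (U x).re) = fun x => ((LineDeriv.lineDerivOp (1 : ℝ) U) x).re :=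
      funext fun x => (hd1 U x).deriv
    rw [e0, e1, (hd1 _ x).deriv]
    have h3 := congrArg (fun W : 𝓢(ℝ, ℂ) => (W x).re) heq
    simp only [hf, Complex.ofReal_re] at h3
    rw [← h3]
    simp [-Complex.ofReal_pow]

/-- If the second derivative were negative, the minimum would also be a local maximum, so `u` would
be constant near the point and its second derivative zero. -/
lemma deriv_deriv_nonneg_of_forall_le {u : ℝ → ℝ} (hu : Differentiable ℝ u) {x₀ : ℝ}
    (hmin : ∀ x, u x₀ ≤ u x) : 0 ≤ deriv (deriv u) x₀ := by
  have hlm : IsLocalMin u x₀ := Eventually.of_forall hmin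
  have h0 : deriv u x₀ = 0 := hlm.deriv_eq_zero
  by_contra hcon
  have hmax := isLocalMax_of_deriv_deriv_neg (not_le.1 hcon) h0 hu.continuous.continuousAt
  have hconst : u =ᶠ[𝓝 x₀] fun _ => u x₀ := by
    filter_upwards [hmax] with x hx
    exact le_antisymm hx (hmin x)
  have h1 : deriv u =ᶠ[𝓝 x₀] fun _ => 0 := by
    have := hconst.deriv
    simpa using this
  rw [h1.deriv_eq] at hcon
  simp at hcon

/-- The maximum principle for the Helmholtz operator on the line. -/
theorem pos_of_helmholtz_pos {g α : ℝ} (hg : 0 < g) (V : 𝓢(ℝ, ℝ))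
    (hV : ∀ x, 0 < g * V x - α ^ 2 * deriv (deriv V) x) (x : ℝ) : 0 < V x := by
  by_contra hcon
  rw [not_lt] at hcon
  -- If `V` is negative somewhere, it attains its minimum since it tends to zero at infinity. If
  -- not, the given point, where `V ≤ 0`, is itself a minimum point.
  obtain ⟨x₀, hx₀, hmin⟩ : ∃ x₀, V x₀ ≤ 0 ∧ ∀ x, V x₀ ≤ V x := by
    by_cases hneg : ∃ y, V y < 0
    · obtain ⟨y, hy⟩ := hneg
      obtain ⟨x₀, hx₀⟩ := V.continuous.exists_forall_le' (x₀ := y) (by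
        have := (V.tendsto_cocompact).eventually (lt_mem_nhds hy)
        exact this.mono fun z hz => hz.le)
      exact ⟨x₀, (hx₀ y).trans hy.le, hx₀⟩
    · simp only [not_exists, not_lt] at hneg
      exact ⟨x, hcon, fun z => hcon.trans (hneg z)⟩
  have h1 := deriv_deriv_nonneg_of_forall_le V.differentiable hmin
  have h2 := hV x₀
  nlinarith [mul_nonneg (sq_nonneg α) h1, mul_nonneg hg.le (neg_nonneg.2 hx₀)]

end Helmholtz

end PointVortex
end

/-! ### The vortex stream function on the undisturbed surface; sign of the third-order trace -/

noncomputable section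
namespace PointVortex

section Stream

variable {h θ x y : ℝ}

lemma hasDerivAt_vortexStream_snd
    (hA : 0 < Real.cosh (Real.pi * x / h) + Real.cos (Real.pi * (y / h - θ)))
    (hB : 0 < Real.cosh (Real.pi * x / h) + Real.cos (Real.pi * (y / h + θ))) :
    HasDerivAt (fun y => vortexStream h θ x y) (1 / (4 * h) *
      (Real.sin (Real.pi * (y / h + θ)) / (Real.cosh (Real.pi * x / h) + Real.cos (Real.pi * (y / h + θ)))
      - Real.sin (Real.pi * (y / h - θ)) /
        (Real.cosh (Real.pi * x / h) + Real.cos (Real.pi * (y / h - θ))))) y := by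
  have l1 : HasDerivAt (fun y => Real.pi * (y / h - θ)) (Real.pi * (1 / h)) y :=
    (((hasDerivAt_id y).div_const h).sub_const θ).const_mul _
  have l2 : HasDerivAt (fun y => Real.pi * (y / h + θ)) (Real.pi * (1 / h)) y :=
    (((hasDerivAt_id y).div_const h).add_const θ).const_mul _
  have d1 := l1.cos.const_add (Real.cosh (Real.pi * x / h))
  have d2 := l2.cos.const_add (Real.cosh (Real.pi * x / h))
  have d3 := ((d1.fun_div d2 hB.ne').log (div_pos hA hB).ne').const_mul (1 / (4 * Real.pi))
  refine d3.congr_deriv ?_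
  have := Real.pi_ne_zero
  field_simp
  ring

lemma hasDerivAt_vortexStream_fst
    (hA : 0 < Real.cosh (Real.pi * x / h) + Real.cos (Real.pi * (y / h - θ)))
    (hB : 0 < Real.cosh (Real.pi * x / h) + Real.cos (Real.pi * (y / h + θ))) :
    HasDerivAt (fun x => vortexStream h θ x y) (1 / (4 * h) * Real.sinh (Real.pi * x / h) *
      (1 / (Real.cosh (Real.pi * x / h) + Real.cos (Real.pi * (y / h - θ)))
      - 1 / (Real.cosh (Real.pi * x / h) + Real.cos (Real.pi * (y / h + θ))))) x := by
  have l1 : HasDerivAt (fun x => Real.pi * x / h) (Real.pi * 1 / h) x :=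
    ((hasDerivAt_id x).const_mul _).div_const h
  have d1 := l1.cosh.add_const (Real.cos (Real.pi * (y / h - θ)))
  have d2 := l1.cosh.add_const (Real.cos (Real.pi * (y / h + θ)))
  have d3 := ((d1.fun_div d2 hB.ne').log (div_pos hA hB).ne').const_mul (1 / (4 * Real.pi))
  refine d3.congr_deriv ?_
  have := Real.pi_ne_zero
  field_simp

lemma cosh_add_cos_pos (hθ : 0 < θ) (hθ' : θ ≤ 1 / 2) (x : ℝ) :
    0 < Real.cosh x + Real.cos (Real.pi * θ) := by
  have h1 : 0 ≤ Real.cos (Real.pi * θ) := Real.cos_nonneg_of_mem_Icc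
    ⟨by nlinarith [Real.pi_pos], by nlinarith [Real.pi_pos]⟩
  linarith [Real.cosh_pos x]

/-- At `y = 0` the two denominators coincide and the two sines add up. The result is manifestly
positive for `θ ≤ 1/2`. -/
lemma vortexStreamY_zero (hh : 0 < h) (hθ : 0 < θ) (hθ' : θ ≤ 1 / 2) (x : ℝ) :
    vortexStreamY h θ x 0 = Real.sin (Real.pi * θ) / (2 * h) /
      (Real.cosh (Real.pi / h * x) + Real.cos (Real.pi * θ)) := by
  have hp := cosh_add_cos_pos hθ hθ' (Real.pi * x / h)
  rw [vortexStreamY, (hasDerivAt_vortexStream_snd (x := x) (y := 0) (h := h) (θ := θ)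
    (by simpa using hp) (by simpa using hp)).deriv]
  simp only [zero_div, zero_sub, zero_add, mul_neg, Real.sin_neg, Real.cos_neg]
  rw [show Real.pi / h * x = Real.pi * x / h by ring]
  field_simp
  ring

/-- `Φ_y(·, 0)` is a Schwartz function. -/
lemma exists_schwartz_vortexStreamY (hh : 0 < h) (hθ : 0 < θ) (hθ' : θ ≤ 1 / 2) :
    ∃ f : 𝓢(ℝ, ℂ), ∀ x, f x = (vortexStreamY h θ x 0 : ℂ) := by
  obtain ⟨c, hc, hlow⟩ := exists_kernelDen_lower_bound hh hθ hθ' (r := h / 4) (by positivity)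
  have hκ : 0 < Real.pi / h := div_pos Real.pi_pos hh
  -- The vortex is at depth at least `h/2`, so the complex strip `|y| ≤ h/8` keeps distance at least
  -- `h/4` from it. There the reciprocal of `kernelDen` continues `Φ_y(·,0)` holomorphically, up to
  -- a constant.
  have key : ∀ z : ℂ, |z.im| ≤ h / 8 →
      c * Real.cosh (Real.pi / h * z.re) ≤ ‖kernelDen (Real.pi / h) (Real.cos (Real.pi * θ)) z‖ := by
    intro z hz
    have hz' := abs_le.1 hz
    refine hlow z (by linarith) hz'.2 ?_
    have h1 := Complex.abs_im_le_norm (z - vortexPoint h θ)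
    have h2 : (z - vortexPoint h θ).im = z.im + (1 - θ) * h := by simp [vortexPoint]
    rw [h2] at h1
    have := le_abs_self (z.im + (1 - θ) * h)
    nlinarith
  have hne : ∀ z : ℂ, |z.im| ≤ h / 8 →
      kernelDen (Real.pi / h) (Real.cos (Real.pi * θ)) z ≠ 0 := fun z hz => by
    have h1 := key z hz
    have h2 := mul_pos hc (Real.cosh_pos (Real.pi / h * z.re))
    exact norm_pos_iff.1 (h2.trans_le h1)
  obtain ⟨f, hf⟩ := exists_schwartz_of_strip (r := h / 8) (by positivity)
    (F := fun z => ((Real.sin (Real.pi * θ) / (2 * h) : ℝ) : ℂ) /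
      kernelDen (Real.pi / h) (Real.cos (Real.pi * θ)) z)
    (fun z hz => (differentiableAt_const _).fun_div
      (hasDerivAt_kernelDen _ _ z).differentiableAt (hne z hz))
    (fun k => by
      obtain ⟨M, -, hM⟩ := exists_pow_le_cosh (Real.pi / h) hκ k
      refine ⟨|Real.sin (Real.pi * θ) / (2 * h)| / c * M, fun z hz => ?_⟩
      rw [norm_div, Complex.norm_real, Real.norm_eq_abs]
      have h0 := Real.cosh_pos (Real.pi / h * z.re)
      calc |z.re| ^ k * (|Real.sin (Real.pi * θ) / (2 * h)| /
            ‖kernelDen (Real.pi / h) (Real.cos (Real.pi * θ)) z‖)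
          ≤ |z.re| ^ k * (|Real.sin (Real.pi * θ) / (2 * h)| / (c * Real.cosh (Real.pi / h * z.re))) := by
            gcongr
            exact key z hz
        _ = |Real.sin (Real.pi * θ) / (2 * h)| / c *
            (|z.re| ^ k * (1 / Real.cosh (Real.pi / h * z.re))) := by field_simp
        _ ≤ _ := by gcongr; exact hM z.re)
  refine ⟨f, fun x => ?_⟩
  rw [hf, vortexStreamY_zero hh hθ hθ', kernelDen]
  push_cast
  rfl

end Stream

section Coefficients

variable {g α h θ : ℝ}

lemma c₁_nonneg (hh : 0 < h) (hθ : 0 < θ) (hθ' : θ ≤ 1 / 2) : 0 ≤ c₁ h θ := by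
  have h1 : 0 ≤ Real.cos (Real.pi * θ) := Real.cos_nonneg_of_mem_Icc
    ⟨by nlinarith [Real.pi_pos], by nlinarith [Real.pi_pos]⟩
  have h2 : 0 < Real.sin (Real.pi * θ) := Real.sin_pos_of_pos_of_lt_pi
    (by nlinarith [Real.pi_pos]) (by nlinarith [Real.pi_pos])
  rw [c₁, Real.cot_eq_cos_div_sin]
  positivity

lemma vortexStreamY_zero_pos (hh : 0 < h) (hθ : 0 < θ) (hθ' : θ ≤ 1 / 2) (x : ℝ) :
    0 < vortexStreamY h θ x 0 := by
  have h2 : 0 < Real.sin (Real.pi * θ) := Real.sin_pos_of_pos_of_lt_pi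
    (by nlinarith [Real.pi_pos]) (by nlinarith [Real.pi_pos])
  have h3 := cosh_add_cos_pos hθ hθ' (Real.pi / h * x)
  rw [vortexStreamY_zero hh hθ hθ']
  positivity

/-- For `θ ≤ 1/2`, the second-order trace `ζ₃` is a positive Schwartz function. -/
theorem exists_schwartz_ζ₃ (hg : 0 < g) (hh : 0 < h) (hθ : 0 < θ) (hθ' : θ ≤ 1 / 2) :
    ∃ f : 𝓢(ℝ, ℂ), (∀ x, f x = (ζ₃ g α h θ x : ℂ)) ∧ ∀ x, 0 < ζ₃ g α h θ x := by
  obtain ⟨b, hb⟩ := exists_schwartz_vortexStreamY hh hθ hθ'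
  have hc := c₁_nonneg hh hθ hθ'
  have hpos := vortexStreamY_zero_pos hh hθ hθ'
  have hbt : (b : ℝ → ℂ).HasTemperateGrowth := b.hasTemperateGrowth
  obtain ⟨V, hV, hV'⟩ := exists_schwartz_invHelmholtz (α := α) hg (f := χ h θ)
    ((c₁ h θ : ℂ) • b + (1 / 2 : ℂ) • SchwartzMap.smulLeftCLM ℂ b b) (fun x => by
      rw [_root_.add_apply, _root_.smul_apply, _root_.smul_apply,
        SchwartzMap.smulLeftCLM_apply_apply hbt, hb, χ]
      simp only [smul_eq_mul]
      push_cast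
      ring)
  -- `χ > 0`, since `c₁ ≥ 0` and `Φ_y(·,0) > 0`; the maximum principle gives `-η₂ > 0`.
  have hVpos := pos_of_helmholtz_pos hg V (fun x => by
    rw [hV', χ]
    have := hpos x
    positivity)
  have hct : (fun x => (c₁ h θ : ℂ) + b x).HasTemperateGrowth :=
    (Function.HasTemperateGrowth.const _).add hbt
  refine ⟨SchwartzMap.smulLeftCLM ℂ (fun x => (c₁ h θ : ℂ) + b x)
    (SchwartzMap.postcompCLM Complex.ofRealCLM V), fun x => ?_, fun x => ?_⟩
  · rw [SchwartzMap.smulLeftCLM_apply_apply hct, SchwartzMap.postcompCLM_apply, hb, ζ₃, η₂, ← hV]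
    simp only [Complex.ofRealCLM_apply, smul_eq_mul]
    push_cast
    ring
  · rw [ζ₃, η₂, ← hV, neg_neg]
    have := hpos x
    have := hVpos x
    positivity

end Coefficients

end PointVortex
end

/-! ### Bounds for the Fourier kernel of the flat strip -/

noncomputable section
namespace PointVortex

section Strip

variable {h : ℝ}

lemma isTameSurface_zero (hh : 0 < h) : IsTameSurface h h 0 (fun _ => 0) where
  contDiff := contDiff_const
  abs_deriv_le x := by simp
  pos := hh
  above x := by simp

/-- A function on the flat strip is square integrable if its horizontal slices are, uniformly. -/
lemma memLp_strip (hh : 0 < h) {F : ℂ → ℂ} (hF : ContinuousOn F (fluidDomain h (fun _ => 0)))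
    {B : ℝ≥0∞} (hB : B ≠ ⊤)
    (hs : ∀ y, -h < y → y < 0 → eLpNorm (fun x : ℝ => F ⟨x, y⟩) 2 volume ≤ B) :
    MemLp F 2 (volume.restrict (fluidDomain h (fun _ => 0))) := by
  have hS := isTameSurface_zero hh
  have hm : AEStronglyMeasurable F (volume.restrict (fluidDomain h (fun _ => 0))) :=
    hF.aestronglyMeasurable hS.measurableSet
  refine ⟨hm, ?_⟩
  have hA : topLayer h (fun _ => 0) h = fluidDomain h (fun _ => 0) := by
    ext z
    simp only [topLayer, fluidDomain, Set.mem_ofPred_eq]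
    constructor
    · exact fun H => H.1
    · exact fun H => ⟨H, by linarith [H.1]⟩
  rw [eLpNorm_lt_top_iff_lintegral_rpow_enorm_lt_top (by norm_num) (by norm_num)]
  simp only [ENNReal.toReal_ofNat]
  have hm2 : AEMeasurable (fun z => ‖F z‖ₑ ^ (2 : ℝ)) (volume.restrict (topLayer h (fun _ => 0) h)) := by
    rw [hA]; exact hm.enorm.pow_const _
  have hch := hS.isLayerChart_top
  rw [← hA, hch.lintegral_eq le_rfl _ hm2]
  have hswap : ∫⁻ x, ∫⁻ d in Set.Ioo 0 h, ‖F (shear (fun _ => 0) hS.continuous (x, d))‖ₑ ^ (2 : ℝ) =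
      ∫⁻ d in Set.Ioo 0 h, ∫⁻ x, ‖F (shear (fun _ => 0) hS.continuous (x, d))‖ₑ ^ (2 : ℝ) := by
    refine lintegral_lintegral_swap ?_
    have h1 := hm2.comp_quasiMeasurePreserving
      (hch.measurePreserving.restrict_preimage_emb
        (shear (fun _ => 0) hS.continuous).measurableEmbedding
        (topLayer h (fun _ => 0) h)).quasiMeasurePreserving
    rw [hch.preimage h le_rfl, Measure.volume_eq_prod, ← Measure.prod_restrict,
      Measure.restrict_univ] at h1
    exact h1
  rw [hswap]
  calc ∫⁻ d in Set.Ioo 0 h, ∫⁻ x, ‖F (shear (fun _ => 0) hS.continuous (x, d))‖ₑ ^ (2 : ℝ)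
      ≤ ∫⁻ _ in Set.Ioo 0 h, B ^ (2 : ℝ) := by
        refine setLIntegral_mono measurable_const fun d hd => ?_
        have h2 := hs (-d) (by linarith [hd.2]) (by linarith [hd.1])
        rw [eLpNorm_eq_lintegral_rpow_enorm_toReal (by norm_num) (by norm_num)] at h2
        simp only [ENNReal.toReal_ofNat, one_div] at h2
        rw [ENNReal.rpow_inv_le_iff (by norm_num)] at h2
        refine le_trans (le_of_eq ?_) h2
        refine lintegral_congr fun x => ?_
        rw [shear_apply]
        simp
    _ < ⊤ := by
        rw [setLIntegral_const]
        exact ENNReal.mul_lt_top (ENNReal.rpow_lt_top_of_nonneg (by norm_num) hB) (by simp)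

/-- Equivalent to `1 + 2t ≤ exp(2t)`. It controls `exp/sinh` at low frequencies, where it behaves
like `1/t`, and at high frequencies, where it is bounded. -/
lemma mul_exp_le_mul_sinh (t : ℝ) : t * Real.exp t ≤ (1 + 2 * t) * Real.sinh t := by
  rw [Real.sinh_eq]
  have h1 := Real.add_one_le_exp (2 * t)
  have h2 : Real.exp (2 * t) * Real.exp (-t) = Real.exp t := by rw [← Real.exp_add]; ring_nf
  have h3 := Real.exp_pos (-t)
  nlinarith

/-- The `k`-th derivative of `exp (2πiξ (z + ih)) / sinh (2πξh)` in `z`. -/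
def stripKernel (h : ℝ) (k : ℕ) (z : ℂ) (ξ : ℝ) : ℂ :=
  (2 * Real.pi * ξ * Complex.I) ^ k * Complex.exp (2 * Real.pi * ξ * Complex.I * (z + h * Complex.I)) /
    (Real.sinh (2 * Real.pi * ξ * h) : ℝ)

lemma norm_exp_strip_le {z : ℂ} (h1 : -h ≤ z.im) (h2 : z.im ≤ 0) (ξ : ℝ) :
    Real.exp (2 * Real.pi * ξ * Complex.I * (z + h * Complex.I)).re ≤
      Real.exp (|2 * Real.pi * ξ| * h) := by
  have e1 : (2 * Real.pi * ξ * Complex.I * (z + h * Complex.I)).re = -(2 * Real.pi * ξ) * (z.im + h) := by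
    simp [Complex.mul_re, Complex.mul_im]
  rw [e1]
  have h3 := neg_le_abs (2 * Real.pi * ξ)
  exact Real.exp_le_exp.2 (mul_le_mul h3 (by linarith) (by linarith) (abs_nonneg _))

lemma abs_mul_exp_div_sinh_le (hh : 0 < h) (a : ℝ) :
    |a| * (Real.exp (|a| * h) / |Real.sinh (a * h)|) ≤ (1 + 2 * (|a| * h)) / h := by
  rcases eq_or_ne a 0 with rfl | ha
  · simp; positivity
  have ha' : 0 < |a| := abs_pos.2 ha
  have h1 : |Real.sinh (a * h)| = Real.sinh (|a| * h) := by
    rw [Real.abs_sinh, abs_mul, abs_of_pos hh]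
  have h2 : 0 < Real.sinh (|a| * h) := Real.sinh_pos_iff.2 (by positivity)
  have h3 := mul_exp_le_mul_sinh (|a| * h)
  rw [h1, ← mul_div_assoc, div_le_div_iff₀ h2 hh]
  linarith

/-- The bound starts with one derivative because the kernel has a singularity `1/ξ` at frequency
zero, which one factor `ξ` removes. -/
lemma norm_stripKernel_le (hh : 0 < h) (k : ℕ) {z : ℂ} (h1 : -h ≤ z.im) (h2 : z.im ≤ 0) (ξ : ℝ) :
    ‖stripKernel h (k + 1) z ξ‖ ≤
      |2 * Real.pi * ξ| ^ k * ((1 + 2 * (|2 * Real.pi * ξ| * h)) / h) := by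
  have e : ‖(2 * Real.pi * ξ * Complex.I : ℂ)‖ = |2 * Real.pi * ξ| := by
    rw [norm_mul, Complex.norm_I, mul_one, ← Real.norm_eq_abs, ← Complex.norm_real]
    push_cast; rfl
  rw [stripKernel, norm_div, norm_mul, norm_pow, e, Complex.norm_exp, Complex.norm_real, Real.norm_eq_abs]
  have h3 := norm_exp_strip_le h1 h2 ξ
  calc |2 * Real.pi * ξ| ^ (k + 1) * Real.exp (2 * Real.pi * ξ * Complex.I * (z + h * Complex.I)).re /
        |Real.sinh (2 * Real.pi * ξ * h)|
      ≤ |2 * Real.pi * ξ| ^ (k + 1) * Real.exp (|2 * Real.pi * ξ| * h) /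
        |Real.sinh (2 * Real.pi * ξ * h)| := by gcongr
    _ = |2 * Real.pi * ξ| ^ k * (|2 * Real.pi * ξ| * (Real.exp (|2 * Real.pi * ξ| * h) /
        |Real.sinh (2 * Real.pi * ξ * h)|)) := by ring
    _ ≤ _ := by gcongr; exact abs_mul_exp_div_sinh_le hh _

lemma norm_exp_sub_one_le (w : ℂ) : ‖Complex.exp w - 1‖ ≤ ‖w‖ * Real.exp (max w.re 0) := by
  have hconv : Convex ℝ {v : ℂ | v.re ≤ max w.re 0} := convex_halfSpace_re_le _
  have h1 := hconv.norm_image_sub_le_of_norm_hasDerivWithin_le (f := Complex.exp) (f' := Complex.exp)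
    (C := Real.exp (max w.re 0)) (x := 0) (y := w)
    (fun v _ => (Complex.hasDerivAt_exp v).hasDerivWithinAt)
    (fun v hv => by rw [Complex.norm_exp]; exact Real.exp_le_exp.2 hv)
    (by simp) (by simp)
  simpa [mul_comm] using h1

/-- Subtracting the constant `1` cancels the singularity at frequency zero. It changes the
holomorphic function only by a formal constant, so its derivatives are those of the kernel. -/
lemma norm_exp_sub_one_div_sinh_le (hh : 0 < h) {z : ℂ} (h1 : -h ≤ z.im) (h2 : z.im ≤ 0) (ξ : ℝ) :
    ‖(Complex.exp (2 * Real.pi * ξ * Complex.I * (z + h * Complex.I)) - 1) /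
      (Real.sinh (2 * Real.pi * ξ * h) : ℝ)‖ ≤
      ‖z + h * Complex.I‖ * ((1 + 2 * (|2 * Real.pi * ξ| * h)) / h) := by
  have e : ‖(2 * Real.pi * ξ * Complex.I : ℂ)‖ = |2 * Real.pi * ξ| := by
    rw [norm_mul, Complex.norm_I, mul_one, ← Real.norm_eq_abs, ← Complex.norm_real]
    push_cast; rfl
  have h3 := norm_exp_strip_le h1 h2 ξ
  have h4 := norm_exp_sub_one_le (2 * Real.pi * ξ * Complex.I * (z + h * Complex.I))
  have h5 : Real.exp (max (2 * Real.pi * ξ * Complex.I * (z + h * Complex.I)).re 0) ≤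
      Real.exp (|2 * Real.pi * ξ| * h) := by
    refine Real.exp_le_exp.2 (max_le (Real.exp_le_exp.1 h3) (by positivity))
  rw [norm_mul, e] at h4
  rw [norm_div, Complex.norm_real, Real.norm_eq_abs]
  calc _ ≤ |2 * Real.pi * ξ| * ‖z + h * Complex.I‖ * Real.exp (|2 * Real.pi * ξ| * h) /
        |Real.sinh (2 * Real.pi * ξ * h)| := by
        gcongr
        exact h4.trans (by gcongr)
    _ = ‖z + h * Complex.I‖ * (|2 * Real.pi * ξ| * (Real.exp (|2 * Real.pi * ξ| * h) /
        |Real.sinh (2 * Real.pi * ξ * h)|)) := by ring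
    _ ≤ _ := by gcongr; exact abs_mul_exp_div_sinh_le hh _

lemma hasDerivAt_stripKernel (h : ℝ) (k : ℕ) (z : ℂ) (ξ : ℝ) :
    HasDerivAt (fun z => stripKernel h k z ξ) (stripKernel h (k + 1) z ξ) z := by
  have h1 : HasDerivAt (fun z : ℂ => 2 * Real.pi * ξ * Complex.I * (z + h * Complex.I))
      (2 * Real.pi * ξ * Complex.I * 1) z := ((hasDerivAt_id z).add_const _).const_mul _
  have h2 := (h1.cexp.const_mul ((2 * Real.pi * ξ * Complex.I : ℂ) ^ k)).div_const
    ((Real.sinh (2 * Real.pi * ξ * h) : ℝ) : ℂ)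
  refine h2.congr_deriv ?_
  rw [stripKernel]
  ring

lemma measurable_stripKernel (h : ℝ) (k : ℕ) (z : ℂ) : Measurable (stripKernel h k z) := by
  unfold stripKernel
  refine Measurable.div (Continuous.measurable (by fun_prop)) ?_
  exact (Complex.continuous_ofReal.comp (Real.continuous_sinh.comp (by fun_prop))).measurable

/-- A weight dominating a Schwartz function and its first two moments. -/
lemma exists_dominating (hh : 0 < h) (u : 𝓢(ℝ, ℂ)) : ∃ G : ℝ → ℝ, Integrable G ∧ MemLp G 2 ∧
    (∀ ξ, ‖u ξ‖ ≤ G ξ) ∧ (∀ ξ, ‖u ξ‖ * ((1 + 2 * (|2 * Real.pi * ξ| * h)) / h) ≤ G ξ) ∧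
    ∀ ξ, ‖u ξ‖ * (|2 * Real.pi * ξ| * ((1 + 2 * (|2 * Real.pi * ξ| * h)) / h)) ≤ G ξ := by
  have hp : ∀ k : ℕ, ∃ v : 𝓢(ℝ, ℂ), ∀ ξ, ‖v ξ‖ = |2 * Real.pi * ξ| ^ k * ‖u ξ‖ := fun k => by
    have ht : (fun ξ : ℝ => (2 * Real.pi * ξ) ^ k).HasTemperateGrowth := by fun_prop
    have ht' : (fun ξ : ℝ => (((2 * Real.pi * ξ) ^ k : ℝ) : ℂ)).HasTemperateGrowth :=
      Function.HasTemperateGrowth.comp (Complex.ofRealCLM).hasTemperateGrowth ht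
    refine ⟨SchwartzMap.smulLeftCLM ℂ (fun ξ : ℝ => (((2 * Real.pi * ξ) ^ k : ℝ) : ℂ)) u, fun ξ => ?_⟩
    rw [SchwartzMap.smulLeftCLM_apply_apply ht', norm_smul, Complex.norm_real, Real.norm_eq_abs, abs_pow]
  choose v hv using hp
  have hi : ∀ k, Integrable fun ξ => ‖v k ξ‖ := fun k => (v k).integrable.norm
  have hm : ∀ k, MemLp (fun ξ => ‖v k ξ‖) 2 := fun k => ((v k).memLp 2 volume).norm
  refine ⟨fun ξ => (1 + 1 / h) * ‖v 0 ξ‖ + (2 + 1 / h) * ‖v 1 ξ‖ + 2 * ‖v 2 ξ‖,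
    (((hi 0).const_mul _).add ((hi 1).const_mul _)).add ((hi 2).const_mul _),
    (((hm 0).const_mul _).add ((hm 1).const_mul _)).add ((hm 2).const_mul _), ?_, ?_, ?_⟩
  all_goals
    intro ξ
    simp only [hv]
    have h1 := norm_nonneg (u ξ)
    have h2 := abs_nonneg (2 * Real.pi * ξ)
    generalize ‖u ξ‖ = U at *
    generalize |2 * Real.pi * ξ| = a at *
    rw [← sub_nonneg]
  · have : (1 + 1 / h) * (a ^ 0 * U) + (2 + 1 / h) * (a ^ 1 * U) + 2 * (a ^ 2 * U) - U =
      1 / h * U + (2 + 1 / h) * (a * U) + 2 * (a ^ 2 * U) := by ring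
    rw [this]; positivity
  · have : (1 + 1 / h) * (a ^ 0 * U) + (2 + 1 / h) * (a ^ 1 * U) + 2 * (a ^ 2 * U) -
      U * ((1 + 2 * (a * h)) / h) = U + 1 / h * (a * U) + 2 * (a ^ 2 * U) := by field_simp; ring
    rw [this]; positivity
  · have : (1 + 1 / h) * (a ^ 0 * U) + (2 + 1 / h) * (a ^ 1 * U) + 2 * (a ^ 2 * U) -
      U * (a * ((1 + 2 * (a * h)) / h)) = (1 + 1 / h) * U + 2 * (a * U) := by field_simp; ring
    rw [this]; positivity

end Strip

end PointVortex
end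

/-! ### The harmonic extension of a Schwartz function to the flat strip -/

noncomputable section
namespace PointVortex

section Extension

variable {h : ℝ}

/-- The Fourier multiplier of the harmonic extension to the flat strip. -/
def stripMultiplier (h y ξ : ℝ) : ℝ := Real.sinh (2 * Real.pi * ξ * (y + h)) / Real.sinh (2 * Real.pi * ξ * h)

lemma abs_stripMultiplier_le {y : ℝ} (h1 : -h ≤ y) (h2 : y ≤ 0) (ξ : ℝ) : |stripMultiplier h y ξ| ≤ 1 := by
  rw [stripMultiplier, abs_div, Real.abs_sinh, Real.abs_sinh]
  refine div_le_one_of_le₀ (Real.sinh_le_sinh.2 ?_) (Real.sinh_nonneg_iff.2 (abs_nonneg _))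
  rw [abs_mul _ (y + h), abs_mul _ h, abs_of_nonneg (by linarith : 0 ≤ y + h),
    abs_of_nonneg (by linarith : 0 ≤ h)]
  gcongr
  linarith

lemma measurable_stripMultiplier (h y : ℝ) : Measurable (stripMultiplier h y) := by
  unfold stripMultiplier
  exact (Real.continuous_sinh.comp (by fun_prop)).measurable.div
    (Real.continuous_sinh.comp (by fun_prop)).measurable

/-- The harmonic extension to the flat strip of the inverse Fourier transform of `u`. -/
def stripExtension (h : ℝ) (u : 𝓢(ℝ, ℂ)) (z : ℂ) : ℂ :=
  ∫ ξ : ℝ, Complex.exp (2 * Real.pi * ξ * Complex.I * z.re) * (u ξ * stripMultiplier h z.im ξ)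

lemma norm_exp_real_mul_I (ξ x : ℝ) : ‖Complex.exp (2 * Real.pi * ξ * Complex.I * x)‖ = 1 := by
  rw [Complex.norm_exp]; simp

lemma stripExtension_eq_fourierInv (h : ℝ) (u : 𝓢(ℝ, ℂ)) (x y : ℝ) :
    stripExtension h u ⟨x, y⟩ = 𝓕⁻ (fun ξ => u ξ * stripMultiplier h y ξ) x := by
  rw [stripExtension, Real.fourierInv_eq']
  refine integral_congr_ae (Eventually.of_forall fun ξ => ?_)
  simp only [smul_eq_mul]
  congr 2
  simp
  ring

lemma closure_fluidDomain_zero_subset (h : ℝ) :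
    closure (fluidDomain h (fun _ => 0)) ⊆ {z : ℂ | -h ≤ z.im ∧ z.im ≤ 0} := by
  refine closure_minimal (fun z hz => ⟨hz.1.le, hz.2.le⟩) ?_
  exact (isClosed_le continuous_const Complex.continuous_im).inter
    (isClosed_le Complex.continuous_im continuous_const)

lemma norm_mul_stripMultiplier_le (u : 𝓢(ℝ, ℂ)) {y : ℝ} (h1 : -h ≤ y) (h2 : y ≤ 0) (ξ : ℝ) :
    ‖u ξ * stripMultiplier h y ξ‖ ≤ ‖u ξ‖ := by
  rw [norm_mul, Complex.norm_real, Real.norm_eq_abs]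
  exact mul_le_of_le_one_right (norm_nonneg _) (abs_stripMultiplier_le h1 h2 ξ)

lemma aestronglyMeasurable_mul_stripMultiplier (u : 𝓢(ℝ, ℂ)) (y : ℝ) :
    AEStronglyMeasurable (fun ξ => u ξ * stripMultiplier h y ξ) volume :=
  (u.continuous.measurable.mul (Complex.measurable_ofReal.comp
    (measurable_stripMultiplier h y))).aestronglyMeasurable

lemma continuousOn_stripExtension (h : ℝ) (u : 𝓢(ℝ, ℂ)) :
    ContinuousOn (stripExtension h u) {z : ℂ | -h ≤ z.im ∧ z.im ≤ 0} := by
  refine continuousOn_of_dominated (bound := fun ξ => ‖u ξ‖) (fun z _ => ?_) (fun z hz => ?_)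
    u.integrable.norm ?_
  · exact (Continuous.aestronglyMeasurable (by fun_prop)).mul
      (aestronglyMeasurable_mul_stripMultiplier u z.im)
  · refine Eventually.of_forall fun ξ => ?_
    rw [norm_mul, norm_exp_real_mul_I, one_mul]
    exact norm_mul_stripMultiplier_le u hz.1 hz.2 ξ
  · refine Eventually.of_forall fun ξ => Continuous.continuousOn ?_
    have e1 : Continuous fun z : ℂ => stripMultiplier h z.im ξ := by
      unfold stripMultiplier
      exact (Real.continuous_sinh.comp (by fun_prop)).div_const _
    have e2 := Complex.continuous_re
    fun_prop

/-- Plancherel on each horizontal slice, where the multiplier is at most one; the strip has finite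
height. -/
lemma memLp_stripExtension (hh : 0 < h) (u : 𝓢(ℝ, ℂ)) :
    MemLp (stripExtension h u) 2 (volume.restrict (fluidDomain h (fun _ => 0))) := by
  have hu := u.memLp 2 volume
  refine memLp_strip hh ((continuousOn_stripExtension h u).mono fun z hz => ⟨hz.1.le, hz.2.le⟩)
    (B := eLpNorm u 2 volume) hu.eLpNorm_ne_top fun y h1 h2 => ?_
  simp only [stripExtension_eq_fourierInv]
  have hle : ∀ᵐ ξ, ‖u ξ * stripMultiplier h y ξ‖ ≤ ‖u ξ‖ :=
    Eventually.of_forall (norm_mul_stripMultiplier_le u h1.le h2.le)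
  have hm := aestronglyMeasurable_mul_stripMultiplier (h := h) u y
  refine (le_of_eq (eLpNorm_fourierInv_eq (u.integrable.mono hm hle) (hu.mono hm hle))).trans ?_
  exact eLpNorm_mono_ae hle

/-- The complex derivatives of the harmonic extension. -/
def stripPotential (h : ℝ) (u : 𝓢(ℝ, ℂ)) (k : ℕ) (z : ℂ) : ℂ := ∫ ξ, u ξ * stripKernel h k z ξ

lemma norm_mul_stripKernel_le (hh : 0 < h) (u : 𝓢(ℝ, ℂ)) (k : ℕ) {z : ℂ} (h1 : -h ≤ z.im)
    (h2 : z.im ≤ 0) (ξ : ℝ) : ‖u ξ * stripKernel h (k + 1) z ξ‖ ≤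
      ‖u ξ‖ * (|2 * Real.pi * ξ| ^ k * ((1 + 2 * (|2 * Real.pi * ξ| * h)) / h)) := by
  rw [norm_mul]
  gcongr
  exact norm_stripKernel_le hh k h1 h2 ξ

lemma aestronglyMeasurable_mul_stripKernel (u : 𝓢(ℝ, ℂ)) (k : ℕ) (z : ℂ) :
    AEStronglyMeasurable (fun ξ => u ξ * stripKernel h k z ξ) volume :=
  (u.continuous.measurable.mul (measurable_stripKernel h k z)).aestronglyMeasurable

lemma hasDerivAt_stripPotential_one (hh : 0 < h) (u : 𝓢(ℝ, ℂ)) {z : ℂ}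
    (hz : z ∈ fluidDomain h (fun _ => 0)) :
    HasDerivAt (stripPotential h u 1) (stripPotential h u 2 z) z := by
  obtain ⟨G, hG, -, -, hG1, hG2⟩ := exists_dominating hh u
  refine (hasDerivAt_integral_of_dominated_loc_of_deriv_le
    ((isOpen_fluidDomain continuous_const).mem_nhds hz) (bound := G)
    (F' := fun z ξ => u ξ * stripKernel h 2 z ξ)
    (Eventually.of_forall fun w => aestronglyMeasurable_mul_stripKernel u 1 w) ?_
    (aestronglyMeasurable_mul_stripKernel u 2 z) ?_ hG ?_).2
  · refine hG.mono' (aestronglyMeasurable_mul_stripKernel u 1 z) (Eventually.of_forall fun ξ => ?_)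
    refine (norm_mul_stripKernel_le hh u 0 hz.1.le hz.2.le ξ).trans ?_
    simpa using hG1 ξ
  · refine Eventually.of_forall fun ξ w hw => ?_
    refine (norm_mul_stripKernel_le hh u 1 hw.1.le hw.2.le ξ).trans ?_
    simpa using hG2 ξ
  · exact Eventually.of_forall fun ξ w _ => (hasDerivAt_stripKernel h 1 w ξ).const_mul _

/-- A holomorphic function whose real part is the harmonic extension. -/
def stripPrimitive (h : ℝ) (u : 𝓢(ℝ, ℂ)) (z : ℂ) : ℂ :=
  ∫ ξ : ℝ, u ξ * ((Complex.exp (2 * Real.pi * ξ * Complex.I * (z + h * Complex.I)) - 1) /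
      (Real.sinh (2 * Real.pi * ξ * h) : ℝ))

lemma integrable_stripPrimitive (hh : 0 < h) (u : 𝓢(ℝ, ℂ)) {z : ℂ}
    (hz : z ∈ fluidDomain h (fun _ => 0)) :
    Integrable fun ξ : ℝ => u ξ * ((Complex.exp (2 * Real.pi * ξ * Complex.I * (z + h * Complex.I)) - 1) /
      (Real.sinh (2 * Real.pi * ξ * h) : ℝ)) := by
  obtain ⟨G, hG, -, -, hG1, hG2⟩ := exists_dominating hh u
  refine (hG.const_mul ‖z + h * Complex.I‖).mono' ?_ (Eventually.of_forall fun ξ => ?_)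
  · refine (u.continuous.measurable.mul (Measurable.div (Continuous.measurable (by fun_prop)) ?_)).aestronglyMeasurable
    exact (Complex.continuous_ofReal.comp (Real.continuous_sinh.comp (by fun_prop))).measurable
  · rw [norm_mul]
    calc _ ≤ ‖u ξ‖ * (‖z + h * Complex.I‖ * ((1 + 2 * (|2 * Real.pi * ξ| * h)) / h)) := by
          gcongr
          exact norm_exp_sub_one_div_sinh_le hh hz.1.le hz.2.le ξ
      _ = ‖z + h * Complex.I‖ * (‖u ξ‖ * ((1 + 2 * (|2 * Real.pi * ξ| * h)) / h)) := by ring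
      _ ≤ _ := by gcongr; exact hG1 ξ

lemma hasDerivAt_stripPrimitive (hh : 0 < h) (u : 𝓢(ℝ, ℂ)) {z : ℂ}
    (hz : z ∈ fluidDomain h (fun _ => 0)) :
    HasDerivAt (stripPrimitive h u) (stripPotential h u 1 z) z := by
  obtain ⟨G, hG, -, -, hG1, -⟩ := exists_dominating hh u
  refine (hasDerivAt_integral_of_dominated_loc_of_deriv_le
    ((isOpen_fluidDomain continuous_const).mem_nhds hz) (bound := G)
    (F' := fun z ξ => u ξ * stripKernel h 1 z ξ)
    ?_ (integrable_stripPrimitive hh u hz)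
    (aestronglyMeasurable_mul_stripKernel u 1 z) ?_ hG ?_).2
  · filter_upwards [(isOpen_fluidDomain continuous_const).mem_nhds hz] with w hw
    exact (integrable_stripPrimitive hh u hw).aestronglyMeasurable
  · refine Eventually.of_forall fun ξ w hw => ?_
    refine (norm_mul_stripKernel_le hh u 0 hw.1.le hw.2.le ξ).trans ?_
    simpa using hG1 ξ
  · refine Eventually.of_forall fun ξ w _ => HasDerivAt.const_mul _ ?_
    have h1 : HasDerivAt (fun z : ℂ => 2 * Real.pi * ξ * Complex.I * (z + h * Complex.I))
      (2 * Real.pi * ξ * Complex.I * 1) w := ((hasDerivAt_id w).add_const _).const_mul _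
    refine ((h1.cexp.sub_const 1).div_const _).congr_deriv ?_
    rw [stripKernel]
    ring

/-- The horizontal coordinate enters only as a modulation, so every slice is an inverse Fourier
transform and Plancherel applies. -/
lemma stripPotential_slice_eq (u : 𝓢(ℝ, ℂ)) (k : ℕ) (x y : ℝ) :
    stripPotential h u k ⟨x, y⟩ = 𝓕⁻ (fun ξ => u ξ * stripKernel h k ⟨0, y⟩ ξ) x := by
  rw [stripPotential, Real.fourierInv_eq']
  refine integral_congr_ae (Eventually.of_forall fun ξ => ?_)
  simp only [smul_eq_mul, stripKernel]
  rw [show (2 * Real.pi * ξ * Complex.I * ((⟨x, y⟩ : ℂ) + h * Complex.I) : ℂ) =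
    ((2 * Real.pi * inner ℝ ξ x : ℝ) : ℂ) * Complex.I +
      2 * Real.pi * ξ * Complex.I * ((⟨0, y⟩ : ℂ) + h * Complex.I) by
    rw [Complex.mk_eq_add_mul_I x y, Complex.mk_eq_add_mul_I 0 y]
    simp
    ring, Complex.exp_add]
  ring

lemma memLp_stripPotential (hh : 0 < h) (u : 𝓢(ℝ, ℂ)) {k : ℕ} (hk : k < 2)
    (hc : ContinuousOn (stripPotential h u (k + 1)) (fluidDomain h (fun _ => 0))) :
    MemLp (stripPotential h u (k + 1)) 2 (volume.restrict (fluidDomain h (fun _ => 0))) := by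
  obtain ⟨G, hG, hG', -, hG1, hG2⟩ := exists_dominating hh u
  refine memLp_strip hh hc (B := eLpNorm G 2 volume) hG'.eLpNorm_ne_top fun y h1 h2 => ?_
  simp only [stripPotential_slice_eq]
  have hle : ∀ ξ, ‖u ξ * stripKernel h (k + 1) ⟨0, y⟩ ξ‖ ≤ G ξ := fun ξ => by
    refine (norm_mul_stripKernel_le hh u k (z := ⟨0, y⟩) h1.le h2.le ξ).trans ?_
    interval_cases k
    · simpa using hG1 ξ
    · simpa using hG2 ξ
  have hle' : ∀ᵐ ξ, ‖u ξ * stripKernel h (k + 1) ⟨0, y⟩ ξ‖ ≤ ‖G ξ‖ :=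
    Eventually.of_forall fun ξ => (hle ξ).trans (le_abs_self _)
  have hm := aestronglyMeasurable_mul_stripKernel (h := h) u (k + 1) ⟨0, y⟩
  refine (le_of_eq (eLpNorm_fourierInv_eq (hG.mono hm hle') (hG'.mono hm hle'))).trans ?_
  exact eLpNorm_mono_ae hle'

end Extension

end PointVortex
end

/-! ### Existence of the flat harmonic extension and the sign of the third-order coefficient -/

noncomputable section
namespace PointVortex

section Flat

variable {h : ℝ}

lemma conj_fourier_of_real {f : 𝓢(ℝ, ℂ)} {ζ : ℝ → ℝ} (hf : ∀ x, f x = (ζ x : ℂ)) (ξ : ℝ) :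
    (starRingEnd ℂ) ((𝓕 f : 𝓢(ℝ, ℂ)) ξ) = (𝓕 f : 𝓢(ℝ, ℂ)) (-ξ) := by
  simp only [SchwartzMap.fourier_coe, Real.fourier_eq', hf, smul_eq_mul]
  rw [← integral_conj]
  refine integral_congr_ae (Eventually.of_forall fun x => ?_)
  simp only [map_mul, Complex.conj_ofReal, ← Complex.exp_conj, Complex.conj_I]
  congr 2
  simp

/-- The primitive is added to its conjugate, in which `ξ` is replaced by `-ξ`. As `sinh` is odd, the
constants `-1` cancel and the two exponentials combine to `-2 sinh(2πξ(y+h))`. This links the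
formula with good boundary values to the one that is visibly harmonic. -/
lemma stripExtension_eq_neg_re (hh : 0 < h) {u : 𝓢(ℝ, ℂ)} (hu : ∀ ξ, (starRingEnd ℂ) (u ξ) = u (-ξ))
    {z : ℂ} (hz : z ∈ fluidDomain h (fun _ => 0)) :
    stripExtension h u z = ((-(stripPrimitive h u z).re : ℝ) : ℂ) := by
  have hp := integrable_stripPrimitive hh u hz
  have hconj : (starRingEnd ℂ) (stripPrimitive h u z) = ∫ ξ : ℝ, (starRingEnd ℂ) (u (-ξ) *
      ((Complex.exp (2 * Real.pi * (-ξ : ℝ) * Complex.I * (z + h * Complex.I)) - 1) /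
      (Real.sinh (2 * Real.pi * (-ξ) * h) : ℝ))) := by
    rw [stripPrimitive, ← integral_conj]
    exact (integral_neg_eq_self (fun ξ : ℝ => (starRingEnd ℂ) (u ξ *
      ((Complex.exp (2 * Real.pi * ξ * Complex.I * (z + h * Complex.I)) - 1) /
      (Real.sinh (2 * Real.pi * ξ * h) : ℝ)))) volume).symm
  have hp' : Integrable fun ξ : ℝ => (starRingEnd ℂ) (u (-ξ) *
      ((Complex.exp (2 * Real.pi * (-ξ : ℝ) * Complex.I * (z + h * Complex.I)) - 1) /
      (Real.sinh (2 * Real.pi * (-ξ) * h) : ℝ))) :=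
    (Complex.conjCLE.toContinuousLinearMap.integrable_comp hp.comp_neg)
  have hsum : stripPrimitive h u z + (starRingEnd ℂ) (stripPrimitive h u z) =
      -2 * stripExtension h u z := by
    rw [hconj, stripPrimitive, ← integral_add hp hp', stripExtension, ← integral_const_mul]
    refine integral_congr_ae (Eventually.of_forall fun ξ => ?_)
    simp only [map_mul, map_div₀, map_sub, map_one, Complex.conj_ofReal, ← Complex.exp_conj, hu, neg_neg,
      map_add, Complex.conj_I, stripMultiplier]
    have e1 : Real.sinh (2 * Real.pi * -ξ * h) = -Real.sinh (2 * Real.pi * ξ * h) := by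
      rw [← Real.sinh_neg]; ring_nf
    have e2 : (2 * Real.pi * ξ * Complex.I * (z + h * Complex.I) : ℂ) =
        2 * Real.pi * ξ * Complex.I * z.re + ((-(2 * Real.pi * ξ * (z.im + h)) : ℝ) : ℂ) := by
      conv_lhs => rw [← Complex.re_add_im z]
      push_cast
      linear_combination (2 * Real.pi * ξ * (z.im + h)) * Complex.I_sq
    have e3 : ((starRingEnd ℂ) 2 * Real.pi * (-ξ : ℝ) * -Complex.I *
        ((starRingEnd ℂ) z + h * -Complex.I) : ℂ) =
        2 * Real.pi * ξ * Complex.I * z.re + ((2 * Real.pi * ξ * (z.im + h) : ℝ) : ℂ) := by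
      conv_lhs => rw [← Complex.re_add_im z]
      simp only [map_add, map_mul, Complex.conj_ofReal, Complex.conj_I, map_ofNat]
      push_cast
      linear_combination (-2 * Real.pi * ξ * (z.im + h)) * Complex.I_sq
    rw [e1, e2, e3, Complex.exp_add, Complex.exp_add, ← Complex.ofReal_exp, ← Complex.ofReal_exp,
      Real.sinh_eq (2 * Real.pi * ξ * (z.im + h))]
    push_cast
    ring
  have h2 : stripPrimitive h u z + (starRingEnd ℂ) (stripPrimitive h u z) =
      ((2 * (stripPrimitive h u z).re : ℝ) : ℂ) := Complex.add_conj _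
  rw [h2] at hsum
  push_cast at hsum ⊢
  linear_combination (1 / 2 : ℂ) * hsum

lemma norm_fderiv_restrictScalars {W : ℂ → ℂ} {W' z : ℂ} (hW : HasDerivAt W W' z) :
    fderiv ℝ W z = ContinuousLinearMap.mul ℝ ℂ W' := by
  have h1 := hW.hasFDerivAt.restrictScalars ℝ
  rw [h1.fderiv]
  ext
  simp [mul_comm]

/-- The derivatives of order at most two of the real part of a holomorphic function. -/
lemma norm_iteratedFDeriv_re_le {U : Set ℂ} (hU : IsOpen U) {W W' W'' : ℂ → ℂ}
    (hW : ∀ z ∈ U, HasDerivAt W (W' z) z) (hW' : ∀ z ∈ U, HasDerivAt W' (W'' z) z) {z : ℂ} (hz : z ∈ U) :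
    ‖iteratedFDeriv ℝ 1 (fun z => (W z).re) z‖ ≤ ‖W' z‖ ∧
      ‖iteratedFDeriv ℝ 2 (fun z => (W z).re) z‖ ≤ ‖W'' z‖ := by
  have hWa : ContDiffAt ℝ 2 W z :=
    ((DifferentiableOn.analyticAt (fun w hw => (hW w hw).differentiableAt.differentiableWithinAt)
      (hU.mem_nhds hz)).contDiffAt (n := 2)).restrict_scalars ℝ
  have hn : ‖Complex.reCLM‖ ≤ 1 := by rw [Complex.reCLM_norm]
  have hred : ∀ k : ℕ, k ≤ 2 → ‖iteratedFDeriv ℝ k (fun z => (W z).re) z‖ ≤ ‖iteratedFDeriv ℝ k W z‖ :=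
    fun k hk => by
      have h1 := Complex.reCLM.norm_iteratedFDeriv_comp_left hWa (n := k) (by exact_mod_cast hk)
      exact h1.trans (mul_le_of_le_one_left (norm_nonneg _) hn)
  have hmul : ∀ w : ℂ, ‖ContinuousLinearMap.mul ℝ ℂ w‖ ≤ ‖w‖ := fun w =>
    ContinuousLinearMap.opNorm_mul_apply_le ℝ ℂ w
  refine ⟨(hred 1 (by norm_num)).trans ?_, (hred 2 le_rfl).trans ?_⟩
  · rw [norm_iteratedFDeriv_one, norm_fderiv_restrictScalars (hW z hz)]
    exact hmul _
  · rw [← norm_iteratedFDeriv_fderiv, norm_iteratedFDeriv_one]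
    have h1 : fderiv ℝ W =ᶠ[𝓝 z] fun w => ContinuousLinearMap.mul ℝ ℂ (W' w) := by
      filter_upwards [hU.mem_nhds hz] with w hw
      exact norm_fderiv_restrictScalars (hW w hw)
    rw [h1.fderiv_eq]
    have h2 := (ContinuousLinearMap.mul ℝ ℂ).hasFDerivAt.comp z
      ((hW' z hz).differentiableAt.restrictScalars ℝ).hasFDerivAt
    have h3 : fderiv ℝ (fun w => ContinuousLinearMap.mul ℝ ℂ (W' w)) z = _ := h2.fderiv
    rw [h3, norm_fderiv_restrictScalars (hW' z hz)]
    refine ContinuousLinearMap.opNorm_le_bound _ (norm_nonneg _) fun v => ?_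
    rw [ContinuousLinearMap.comp_apply, ContinuousLinearMap.mul_apply']
    exact (hmul _).trans (norm_mul_le _ _)

/-- Schwartz functions have harmonic extensions to the flat strip. -/
theorem exists_isHarmonicExtension_flat (hh : 0 < h) {ζ : ℝ → ℝ} (f : 𝓢(ℝ, ℂ))
    (hf : ∀ x, f x = (ζ x : ℂ)) : ∃ ψ, IsHarmonicExtension h (fun _ => 0) ζ ψ := by
  set u : 𝓢(ℝ, ℂ) := 𝓕 f with hu
  have hD : IsOpen (fluidDomain h (fun _ => 0)) := isOpen_fluidDomain continuous_const
  have hconj : ∀ ξ, (starRingEnd ℂ) (u ξ) = u (-ξ) := conj_fourier_of_real hf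
  have hEq : ∀ z ∈ fluidDomain h (fun _ => 0),
      (fun z => (stripExtension h u z).re) =ᶠ[𝓝 z] fun z => (-stripPrimitive h u z).re := fun z hz => by
    filter_upwards [hD.mem_nhds hz] with w hw
    rw [stripExtension_eq_neg_re hh hconj hw]
    simp
  have hW : ∀ z ∈ fluidDomain h (fun _ => 0), HasDerivAt (fun z => -stripPrimitive h u z)
      (-stripPotential h u 1 z) z := fun z hz => (hasDerivAt_stripPrimitive hh u hz).neg
  have hW' : ∀ z ∈ fluidDomain h (fun _ => 0), HasDerivAt (fun z => -stripPotential h u 1 z)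
      (-stripPotential h u 2 z) z := fun z hz => (hasDerivAt_stripPotential_one hh u hz).neg
  have hharm : HarmonicOnNhd (fun z => (stripExtension h u z).re) (fluidDomain h (fun _ => 0)) :=
    fun z hz => by
      rw [harmonicAt_congr_nhds (hEq z hz)]
      exact AnalyticAt.harmonicAt_re
        (DifferentiableOn.analyticAt (fun w hw => (hW w hw).differentiableAt.differentiableWithinAt)
          (hD.mem_nhds hz))
  have hm : ∀ k : ℕ, k ≤ 2 → AEStronglyMeasurable
      (iteratedFDeriv ℝ k fun z => (stripExtension h u z).re)
      (volume.restrict (fluidDomain h (fun _ => 0))) := fun k hk => by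
    refine ContinuousOn.aestronglyMeasurable (fun z hz => ?_) hD.measurableSet
    have h1 : ContDiffAt ℝ 2 (fun z => (stripExtension h u z).re) z := (hharm z hz).1
    exact (h1.continuousAt_iteratedFDeriv (by exact_mod_cast hk)).continuousWithinAt
  -- It is the complex derivative of a holomorphic function, hence continuous.
  have hc2 : ContinuousOn (stripPotential h u 2) (fluidDomain h (fun _ => 0)) := by
    have h1 : DifferentiableOn ℂ (stripPotential h u 1) (fluidDomain h (fun _ => 0)) := fun z hz =>
      (hasDerivAt_stripPotential_one hh u hz).differentiableAt.differentiableWithinAt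
    refine (h1.deriv hD).continuousOn.congr fun z hz => ?_
    exact (hasDerivAt_stripPotential_one hh u hz).deriv.symm
  refine ⟨fun z => (stripExtension h u z).re, ⟨hharm, ?_⟩, fun k hk => ?_, fun x => ?_, fun x => ?_⟩
  · exact (Complex.continuous_re.comp_continuousOn (continuousOn_stripExtension h u)).mono
      (closure_fluidDomain_zero_subset h)
  · have hbd : ∀ z ∈ fluidDomain h (fun _ => 0), ‖iteratedFDeriv ℝ 1 (fun z => (stripExtension h u z).re) z‖ ≤
        ‖stripPotential h u 1 z‖ ∧ ‖iteratedFDeriv ℝ 2 (fun z => (stripExtension h u z).re) z‖ ≤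
        ‖stripPotential h u 2 z‖ := fun z hz => by
      have h1 := norm_iteratedFDeriv_re_le hD hW hW' hz
      rw [((hEq z hz).iteratedFDeriv ℝ 1).eq_of_nhds, ((hEq z hz).iteratedFDeriv ℝ 2).eq_of_nhds]
      simpa using h1
    interval_cases k
    · refine (memLp_stripExtension hh u).mono (hm 0 hk) (Eventually.of_forall fun z => ?_)
      rw [norm_iteratedFDeriv_zero]
      exact Complex.abs_re_le_norm _
    · refine (memLp_stripPotential hh u (k := 0) (by norm_num) fun z hz =>
        (hasDerivAt_stripPotential_one hh u hz).continuousAt.continuousWithinAt).mono (hm 1 hk) ?_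
      exact (ae_restrict_iff' hD.measurableSet).2 (Eventually.of_forall fun z hz => (hbd z hz).1)
    · refine (memLp_stripPotential hh u (k := 1) (by norm_num) hc2).mono (hm 2 hk) ?_
      exact (ae_restrict_iff' hD.measurableSet).2 (Eventually.of_forall fun z hz => (hbd z hz).2)
  · simp only [stripExtension_eq_fourierInv]
    have h1 : 𝓕⁻ (fun ξ => u ξ * stripMultiplier h 0 ξ) x = 𝓕⁻ (u : ℝ → ℂ) x := by
      simp only [Real.fourierInv_eq']
      refine integral_congr_ae ?_
      -- At `ξ = 0` the multiplier is `0/0`, which Lean evaluates to zero; elsewhere it equals one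
      -- on the surface.
      filter_upwards [Measure.ae_ne volume (0 : ℝ)] with ξ hξ
      have h2 : Real.sinh (2 * Real.pi * ξ * h) ≠ 0 := by
        rw [Ne, Real.sinh_eq_zero]
        have := Real.pi_ne_zero
        positivity
      rw [stripMultiplier, zero_add, div_self h2]
      simp
    rw [h1, ← SchwartzMap.fourierInv_coe, hu, FourierTransform.fourierInv_fourier_eq, hf,
      Complex.ofReal_re]
  · simp [stripExtension, stripMultiplier]

/-- For `θ ≤ 1/2`, the coefficient `c₃` is negative. -/
theorem c₃_neg {g α θ : ℝ} (hg : 0 < g) (hh : 0 < h) (hθ : 0 < θ) (hθ' : θ ≤ 1 / 2) : c₃ g α h θ < 0 := by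
  obtain ⟨f, hf, hpos⟩ := exists_schwartz_ζ₃ (α := α) hg hh hθ hθ'
  -- Without an extension `harmonicExtension` would be zero and so would `c₃`; strict negativity
  -- depends on this existence.
  have H := exists_isHarmonicExtension_flat hh f hf
  have hζ : MemLp (ζ₃ g α h θ) 2 := by
    have h1 := (f.memLp 2 volume).re
    refine (memLp_congr_ae (Eventually.of_forall fun x => ?_)).1 h1
    simp [hf]
  have hζc : Continuous (ζ₃ g α h θ) := by
    have h1 := Complex.continuous_re.comp f.continuous
    refine h1.congr fun x => ?_
    simp [hf]
  have hζi : Integrable (ζ₃ g α h θ) := by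
    have h1 := f.integrable (μ := volume).re
    refine h1.congr (Eventually.of_forall fun x => ?_)
    simp [hf]
  have hψ := H.choose_spec
  have key := dY_vortexPoint_flat hh hθ hθ' hζ hψ
  have hcos : 0 ≤ Real.cos (Real.pi * θ) := Real.cos_nonneg_of_mem_Icc
    ⟨by nlinarith [Real.pi_pos], by nlinarith [Real.pi_pos]⟩
  have hcos1 := Real.cos_le_one (Real.pi * θ)
  have hκ : 0 < Real.pi / h := div_pos Real.pi_pos hh
  have hK : ∀ x, 0 < 2 * (Real.pi / h) * (1 + Real.cos (Real.pi * θ) * Real.cosh (Real.pi / h * x)) /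
      (Real.cosh (Real.pi / h * x) + Real.cos (Real.pi * θ)) ^ 2 := fun x => by
    have := Real.cosh_pos (Real.pi / h * x)
    positivity
  have hKb : ∀ x, 2 * (Real.pi / h) * (1 + Real.cos (Real.pi * θ) * Real.cosh (Real.pi / h * x)) /
      (Real.cosh (Real.pi / h * x) + Real.cos (Real.pi * θ)) ^ 2 ≤ 4 * (Real.pi / h) := fun x => by
    have h1 := Real.one_le_cosh (Real.pi / h * x)
    rw [div_le_iff₀ (by positivity)]
    have h2 : 1 + Real.cos (Real.pi * θ) * Real.cosh (Real.pi / h * x) ≤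
        2 * (Real.cosh (Real.pi / h * x) + Real.cos (Real.pi * θ)) ^ 2 := by nlinarith
    nlinarith
  have hKc : Continuous fun x => 2 * (Real.pi / h) *
      (1 + Real.cos (Real.pi * θ) * Real.cosh (Real.pi / h * x)) /
      (Real.cosh (Real.pi / h * x) + Real.cos (Real.pi * θ)) ^ 2 := by
    have h1 : Continuous fun x => Real.cosh (Real.pi / h * x) := Real.continuous_cosh.comp (by fun_prop)
    refine Continuous.div (by fun_prop) (by fun_prop) fun x => ?_
    have := Real.cosh_pos (Real.pi / h * x)
    positivity
  have hI : 0 < ∫ x, ζ₃ g α h θ x * (2 * (Real.pi / h) *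
      (1 + Real.cos (Real.pi * θ) * Real.cosh (Real.pi / h * x)) /
      (Real.cosh (Real.pi / h * x) + Real.cos (Real.pi * θ)) ^ 2) := by
    rw [integral_pos_iff_support_of_nonneg (fun x => (mul_pos (hpos x) (hK x)).le)]
    · rw [Function.support_eq_univ fun x => (mul_pos (hpos x) (hK x)).ne']
      simp
    · refine hζi.mul_bdd (c := 4 * (Real.pi / h)) hKc.aestronglyMeasurable (Eventually.of_forall fun x => ?_)
      rw [Real.norm_eq_abs, abs_of_pos (hK x)]
      exact hKb x
  have e : c₃ g α h θ = -dY H.choose (vortexPoint h θ) := by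
    rw [c₃, harmonicExtension, dif_pos H]
  rw [e]
  rw [← key] at hI
  nlinarith

end Flat

end PointVortex
end

/-! ### Explicit bounds for a vortex at half depth -/

noncomputable section
namespace PointVortex

section HalfDepth

variable {h x y : ℝ}

/-- The horizontal velocity at the undisturbed surface induced by a vortex at half depth. -/
def surfaceVelocity (h x : ℝ) : ℝ := 1 / (2 * h) / Real.cosh (Real.pi / h * x)

lemma surfaceVelocity_pos (hh : 0 < h) (x : ℝ) : 0 < surfaceVelocity h x :=
  div_pos (by positivity) (Real.cosh_pos _)

lemma surfaceVelocity_le (hh : 0 < h) (x : ℝ) : surfaceVelocity h x ≤ 1 / (2 * h) :=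
  div_le_self (by positivity) (Real.one_le_cosh _)

lemma vortexStreamY_half_zero (hh : 0 < h) (x : ℝ) :
    vortexStreamY h (1 / 2) x 0 = surfaceVelocity h x := by
  rw [vortexStreamY_zero hh (by norm_num) le_rfl, show Real.pi * (1 / 2) = Real.pi / 2 by ring,
    Real.sin_pi_div_two, Real.cos_pi_div_two, add_zero, surfaceVelocity]

lemma abs_sin_le_of_abs_le (hh : 0 < h) (hy : |y| ≤ h / 8) :
    |Real.sin (Real.pi / h * y)| ≤ Real.pi / h * |y| ∧ |Real.sin (Real.pi / h * y)| ≤ 1 / 2 ∧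
      1 - Real.cos (Real.pi / h * y) ≤ Real.pi / h * |y| ∧ 1 / 2 ≤ Real.cos (Real.pi / h * y) := by
  have hκ : 0 < Real.pi / h := div_pos Real.pi_pos hh
  have h1 : |Real.pi / h * y| = Real.pi / h * |y| := by rw [abs_mul, abs_of_pos hκ]
  have h2 : Real.pi / h * |y| ≤ 1 / 2 := by
    calc Real.pi / h * |y| ≤ Real.pi / h * (h / 8) := by gcongr
      _ = Real.pi / 8 := by field_simp
      _ ≤ 1 / 2 := by linarith [Real.pi_lt_four]
  have h3 := Real.abs_sin_le_abs (x := Real.pi / h * y)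
  rw [h1] at h3
  have h4 := Real.one_sub_sq_div_two_le_cos (x := Real.pi / h * y)
  rw [← sq_abs, h1] at h4
  have h5 : 0 ≤ Real.pi / h * |y| := by positivity
  refine ⟨h3, h3.trans h2, ?_, ?_⟩ <;> nlinarith

lemma cos_half_shift (h y : ℝ) : Real.cos (Real.pi * (y / h - 1 / 2)) = Real.sin (Real.pi / h * y) ∧
    Real.cos (Real.pi * (y / h + 1 / 2)) = -Real.sin (Real.pi / h * y) ∧
    Real.sin (Real.pi * (y / h - 1 / 2)) = -Real.cos (Real.pi / h * y) ∧
    Real.sin (Real.pi * (y / h + 1 / 2)) = Real.cos (Real.pi / h * y) := by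
  have e1 : Real.pi * (y / h - 1 / 2) = Real.pi / h * y - Real.pi / 2 := by ring
  have e2 : Real.pi * (y / h + 1 / 2) = Real.pi / h * y + Real.pi / 2 := by ring
  rw [e1, e2]
  exact ⟨Real.cos_sub_pi_div_two _, Real.cos_add_pi_div_two _, Real.sin_sub_pi_div_two _,
    Real.sin_add_pi_div_two _⟩

lemma half_arguments_pos (hh : 0 < h) (hy : |y| ≤ h / 8) (x : ℝ) :
    0 < Real.cosh (Real.pi * x / h) + Real.cos (Real.pi * (y / h - 1 / 2)) ∧
      0 < Real.cosh (Real.pi * x / h) + Real.cos (Real.pi * (y / h + 1 / 2)) := by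
  obtain ⟨e1, e2, -, -⟩ := cos_half_shift h y
  obtain ⟨-, h2, -, -⟩ := abs_sin_le_of_abs_le hh hy
  have h3 := Real.one_le_cosh (Real.pi * x / h)
  have h4 := abs_le.1 h2
  rw [e1, e2]
  constructor <;> linarith

lemma vortexStreamY_half (hh : 0 < h) (hy : |y| ≤ h / 8) (x : ℝ) :
    vortexStreamY h (1 / 2) x y = 1 / (2 * h) * (Real.cos (Real.pi / h * y) * Real.cosh (Real.pi / h * x)) /
      (Real.cosh (Real.pi / h * x) ^ 2 - Real.sin (Real.pi / h * y) ^ 2) := by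
  obtain ⟨hA, hB⟩ := half_arguments_pos hh hy x
  rw [vortexStreamY, (hasDerivAt_vortexStream_snd hA hB).deriv]
  obtain ⟨e1, e2, e3, e4⟩ := cos_half_shift h y
  rw [e1] at hA
  rw [e2] at hB
  rw [e1, e2, e3, e4]
  rw [show Real.pi * x / h = Real.pi / h * x by ring] at *
  have h1 : Real.cosh (Real.pi / h * x) ^ 2 - Real.sin (Real.pi / h * y) ^ 2 =
      (Real.cosh (Real.pi / h * x) + Real.sin (Real.pi / h * y)) *
        (Real.cosh (Real.pi / h * x) + -Real.sin (Real.pi / h * y)) := by ring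
  rw [h1]
  generalize Real.cosh (Real.pi / h * x) = C at *
  generalize Real.sin (Real.pi / h * y) = S at *
  have hA' := hA.ne'
  have hB' := hB.ne'
  field_simp
  ring

lemma vortexStreamX_half (hh : 0 < h) (hy : |y| ≤ h / 8) (x : ℝ) :
    vortexStreamX h (1 / 2) x y = -(1 / (2 * h) * (Real.sinh (Real.pi / h * x) * Real.sin (Real.pi / h * y)) /
      (Real.cosh (Real.pi / h * x) ^ 2 - Real.sin (Real.pi / h * y) ^ 2)) := by
  obtain ⟨hA, hB⟩ := half_arguments_pos hh hy x
  rw [vortexStreamX, (hasDerivAt_vortexStream_fst hA hB).deriv]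
  obtain ⟨e1, e2, -, -⟩ := cos_half_shift h y
  rw [e1] at hA
  rw [e2] at hB
  rw [e1, e2]
  rw [show Real.pi * x / h = Real.pi / h * x by ring] at *
  have h1 : Real.cosh (Real.pi / h * x) ^ 2 - Real.sin (Real.pi / h * y) ^ 2 =
      (Real.cosh (Real.pi / h * x) + Real.sin (Real.pi / h * y)) *
        (Real.cosh (Real.pi / h * x) + -Real.sin (Real.pi / h * y)) := by ring
  rw [h1]
  generalize Real.cosh (Real.pi / h * x) = C at *
  generalize Real.sin (Real.pi / h * y) = S at *
  have hA' := hA.ne'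
  have hB' := hB.ne'
  field_simp
  ring

lemma cosh_sq_sub_sin_sq_ge (hh : 0 < h) (hy : |y| ≤ h / 8) (x : ℝ) :
    3 / 4 * Real.cosh (Real.pi / h * x) ^ 2 ≤
      Real.cosh (Real.pi / h * x) ^ 2 - Real.sin (Real.pi / h * y) ^ 2 := by
  obtain ⟨-, h2, -, -⟩ := abs_sin_le_of_abs_le hh hy
  have h3 := Real.one_le_cosh (Real.pi / h * x)
  have h4 := abs_le.1 h2
  nlinarith

/-- `Φ_x` contains the factor `sin(κy)` because `Φ(·,0)` vanishes, so it is of first order in `y`.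
-/
lemma abs_vortexStreamX_half_le (hh : 0 < h) (hy : |y| ≤ h / 8) (x : ℝ) :
    |vortexStreamX h (1 / 2) x y| ≤ 2 * (Real.pi / h) * |y| * surfaceVelocity h x := by
  have hκ : 0 < Real.pi / h := div_pos Real.pi_pos hh
  obtain ⟨h1, -, -, -⟩ := abs_sin_le_of_abs_le hh hy
  have h2 := cosh_sq_sub_sin_sq_ge hh hy x
  have h3 := Real.cosh_pos (Real.pi / h * x)
  have h4 : |Real.sinh (Real.pi / h * x)| ≤ Real.cosh (Real.pi / h * x) :=
    abs_le.2 ⟨by linarith [Real.cosh_add_sinh (Real.pi / h * x), Real.exp_pos (Real.pi / h * x)],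
      (Real.sinh_lt_cosh _).le⟩
  have h5 : 0 < Real.cosh (Real.pi / h * x) ^ 2 - Real.sin (Real.pi / h * y) ^ 2 :=
    lt_of_lt_of_le (by positivity) h2
  rw [vortexStreamX_half hh hy, abs_neg, abs_div, abs_of_pos h5, abs_mul, abs_mul,
    abs_of_pos (by positivity : 0 < 1 / (2 * h)), surfaceVelocity]
  calc 1 / (2 * h) * (|Real.sinh (Real.pi / h * x)| * |Real.sin (Real.pi / h * y)|) /
        (Real.cosh (Real.pi / h * x) ^ 2 - Real.sin (Real.pi / h * y) ^ 2)
      ≤ 1 / (2 * h) * (Real.cosh (Real.pi / h * x) * (Real.pi / h * |y|)) /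
        (3 / 4 * Real.cosh (Real.pi / h * x) ^ 2) := by gcongr
    _ = 4 / 3 * ((Real.pi / h) * |y| * (1 / (2 * h) / Real.cosh (Real.pi / h * x))) := by field_simp
    _ ≤ 2 * ((Real.pi / h) * |y| * (1 / (2 * h) / Real.cosh (Real.pi / h * x))) := by
        gcongr; norm_num
    _ = _ := by ring

/-- For `|y| ≤ h/8` one has `cos(κy) ≥ 1/2` and `sin²(κy) ≤ 1/4`, so the denominator lies between
`(3/4) cosh²` and `cosh²`. This gives comparability with the velocity at `y = 0`; expanding to first
order in `y` gives the last bound. -/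
lemma vortexStreamY_half_bounds (hh : 0 < h) (hy : |y| ≤ h / 8) (x : ℝ) :
    1 / 2 * surfaceVelocity h x ≤ vortexStreamY h (1 / 2) x y ∧
      vortexStreamY h (1 / 2) x y ≤ 2 * surfaceVelocity h x ∧
      |vortexStreamY h (1 / 2) x y - surfaceVelocity h x| ≤ 2 * (Real.pi / h) / h * |y| := by
  have hκ : 0 < Real.pi / h := div_pos Real.pi_pos hh
  obtain ⟨h1, h1', h1'', h1'''⟩ := abs_sin_le_of_abs_le hh hy
  have h2 := cosh_sq_sub_sin_sq_ge hh hy x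
  have h3 := Real.cosh_pos (Real.pi / h * x)
  have h3' := Real.one_le_cosh (Real.pi / h * x)
  have h5 : 0 < Real.cosh (Real.pi / h * x) ^ 2 - Real.sin (Real.pi / h * y) ^ 2 :=
    lt_of_lt_of_le (by positivity) h2
  have hc := Real.cos_le_one (Real.pi / h * y)
  have hs2 : Real.sin (Real.pi / h * y) ^ 2 ≤ Real.pi / h * |y| := by
    rw [← sq_abs]; nlinarith [abs_nonneg (Real.sin (Real.pi / h * y))]
  have hs0 := sq_nonneg (Real.sin (Real.pi / h * y))
  rw [vortexStreamY_half hh hy, surfaceVelocity]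
  have hz : 0 ≤ Real.pi / h * |y| := by positivity
  generalize Real.cos (Real.pi / h * y) = k at *
  generalize Real.sin (Real.pi / h * y) ^ 2 = s at *
  generalize Real.cosh (Real.pi / h * x) = C at *
  refine ⟨?_, ?_, ?_⟩
  · calc 1 / 2 * (1 / (2 * h) / C) = 1 / (2 * h) * (1 / 2 * C) / C ^ 2 := by field_simp
      _ ≤ 1 / (2 * h) * (k * C) / (C ^ 2 - s) := by
        gcongr
        linarith
  · calc 1 / (2 * h) * (k * C) / (C ^ 2 - s) ≤ 1 / (2 * h) * (1 * C) / (3 / 4 * C ^ 2) := by gcongr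
      _ = 4 / 3 * (1 / (2 * h) / C) := by field_simp
      _ ≤ 2 * (1 / (2 * h) / C) := by gcongr; norm_num
  · have e : 1 / (2 * h) * (k * C) / (C ^ 2 - s) - 1 / (2 * h) / C =
        1 / (2 * h) * ((k * C ^ 2 - C ^ 2 + s) / (C * (C ^ 2 - s))) := by
      have := h5.ne'
      field_simp
      ring
    have hn : |k * C ^ 2 - C ^ 2 + s| ≤ 2 * (Real.pi / h * |y|) * C ^ 2 := by
      have hC1 : 1 ≤ C ^ 2 := one_le_pow₀ h3'
      rw [abs_le]
      constructor <;> nlinarith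
    rw [e, abs_mul, abs_of_pos (by positivity : 0 < 1 / (2 * h)), abs_div, abs_of_pos (mul_pos h3 h5)]
    calc 1 / (2 * h) * (|k * C ^ 2 - C ^ 2 + s| / (C * (C ^ 2 - s)))
        ≤ 1 / (2 * h) * (2 * (Real.pi / h * |y|) * C ^ 2 / (1 * (3 / 4 * C ^ 2))) := by gcongr
      _ = 4 / 3 * (Real.pi / h / h * |y|) := by field_simp
      _ ≤ 2 * (Real.pi / h / h * |y|) := by gcongr; norm_num
      _ = _ := by ring

/-- `Φ` vanishes at `y = 0`; the mean value inequality in `y` is applied to `Φ`, and to `Φ` minus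
its linear part. -/
lemma vortexStream_half_bounds (hh : 0 < h) (hy : |y| ≤ h / 8) (x : ℝ) :
    |vortexStream h (1 / 2) x y| ≤ 1 / h * |y| ∧
      |vortexStream h (1 / 2) x y - surfaceVelocity h x * y| ≤ 2 * (Real.pi / h) / h * |y| ^ 2 := by
  have hd : ∀ t, |t| ≤ h / 8 → HasDerivAt (fun t => vortexStream h (1 / 2) x t)
      (vortexStreamY h (1 / 2) x t) t := fun t ht => by
    obtain ⟨hA, hB⟩ := half_arguments_pos hh ht x
    exact (hasDerivAt_vortexStream_snd hA hB).differentiableAt.hasDerivAt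
  have h0 : vortexStream h (1 / 2) x 0 = 0 := by
    obtain ⟨e1, e2, -, -⟩ := cos_half_shift h 0
    rw [vortexStream, e1, e2]
    simp
  have hsub : ∀ t ∈ Set.uIcc 0 y, |t| ≤ |y| := fun t ht => by
    have := Set.abs_sub_left_of_mem_uIcc ht
    simpa using this
  have hs := surfaceVelocity_pos hh x
  have hs' := surfaceVelocity_le hh x
  constructor
  · have h1 := (convex_uIcc 0 y).norm_image_sub_le_of_norm_hasDerivWithin_le
      (f := fun t => vortexStream h (1 / 2) x t) (C := 1 / h)
      (fun t ht => (hd t ((hsub t ht).trans hy)).hasDerivWithinAt) (fun t ht => by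
        obtain ⟨b1, b2, -⟩ := vortexStreamY_half_bounds hh ((hsub t ht).trans hy) x
        rw [Real.norm_eq_abs, abs_of_pos (by linarith)]
        refine b2.trans ((mul_le_mul_of_nonneg_left hs' (by norm_num)).trans (le_of_eq ?_))
        field_simp) Set.left_mem_uIcc Set.right_mem_uIcc
    simpa only [h0, sub_zero, Real.norm_eq_abs] using h1
  · have h1 := (convex_uIcc 0 y).norm_image_sub_le_of_norm_hasDerivWithin_le
      (f := fun t => vortexStream h (1 / 2) x t - surfaceVelocity h x * t)
      (C := 2 * (Real.pi / h) / h * |y|)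
      (fun t ht => ((hd t ((hsub t ht).trans hy)).sub
        ((hasDerivAt_id t).const_mul (surfaceVelocity h x))).hasDerivWithinAt) (fun t ht => by
        obtain ⟨-, -, b3⟩ := vortexStreamY_half_bounds hh ((hsub t ht).trans hy) x
        rw [Real.norm_eq_abs, mul_one]
        have := Real.pi_pos
        exact b3.trans (mul_le_mul_of_nonneg_left (hsub t ht) (by positivity)))
        Set.left_mem_uIcc Set.right_mem_uIcc
    simp only [h0, mul_zero, sub_zero, Real.norm_eq_abs] at h1
    rw [sq, ← mul_assoc]
    exact h1

/-- The chain rule for the stream function along the surface. -/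
lemma hasDerivAt_vortexStream_surface (hh : 0 < h) {η : ℝ → ℝ} (hη : Differentiable ℝ η)
    (hy : |η x| ≤ h / 8) : HasDerivAt (fun x => vortexStream h (1 / 2) x (η x))
      (vortexStreamX h (1 / 2) x (η x) + deriv η x * vortexStreamY h (1 / 2) x (η x)) x := by
  obtain ⟨hA, hB⟩ := half_arguments_pos hh hy x
  rw [vortexStreamX, vortexStreamY, (hasDerivAt_vortexStream_fst hA hB).deriv,
    (hasDerivAt_vortexStream_snd hA hB).deriv]
  have l0 : HasDerivAt (fun x => Real.pi * x / h) (Real.pi * 1 / h) x :=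
    ((hasDerivAt_id x).const_mul _).div_const h
  have l1 : HasDerivAt (fun x => Real.pi * (η x / h - 1 / 2)) (Real.pi * (deriv η x / h)) x :=
    (((hη x).hasDerivAt.div_const h).sub_const _).const_mul _
  have l2 : HasDerivAt (fun x => Real.pi * (η x / h + 1 / 2)) (Real.pi * (deriv η x / h)) x :=
    (((hη x).hasDerivAt.div_const h).add_const _).const_mul _
  have d1 := l0.cosh.fun_add l1.cos
  have d2 := l0.cosh.fun_add l2.cos
  have d3 := ((d1.fun_div d2 hB.ne').log (div_pos hA hB).ne').const_mul (1 / (4 * Real.pi))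
  refine d3.congr_deriv ?_
  have := Real.pi_ne_zero
  generalize Real.cosh (Real.pi * x / h) = C at *
  generalize Real.cos (Real.pi * (η x / h - 1 / 2)) = A at *
  generalize Real.cos (Real.pi * (η x / h + 1 / 2)) = B at *
  generalize Real.sin (Real.pi * (η x / h - 1 / 2)) = A₁ at *
  generalize Real.sin (Real.pi * (η x / h + 1 / 2)) = B₁ at *
  have hA' := hA.ne'
  have hB' := hB.ne'
  field_simp
  ring

end HalfDepth

end PointVortex
end

/-! ### The kernel near the surface, and admissible test functions for weak equations -/

noncomputable section
namespace PointVortex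

section KernelSurface

variable {h θ : ℝ}

/-- The kernel close to the undisturbed surface. -/
lemma exists_kernel_surface_bound (hh : 0 < h) (hθ : 0 < θ) (hθ' : θ ≤ 1 / 2) :
    ∃ C, 0 < C ∧ ∀ x y : ℝ, |y| ≤ h / 8 →
      |(kernel (Real.pi / h) (Real.cos (Real.pi * θ)) ⟨x, y⟩).im| ≤ C * |y| ∧
      ‖kernelDeriv (Real.pi / h) (Real.cos (Real.pi * θ)) ⟨x, y⟩ -
        kernelDeriv (Real.pi / h) (Real.cos (Real.pi * θ)) x‖ ≤ C * |y| := by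
  obtain ⟨C, hC, hCz⟩ := exists_kernel_bound hh hθ hθ' (r := h / 4) (by positivity)
  -- The vortex is at depth at least `h/2`, and `h/2 - h/8` exceeds `h/4`.
  have hdist : ∀ z : ℂ, |z.im| ≤ h / 8 → h / 4 ≤ ‖z - vortexPoint h θ‖ := fun z hz => by
    have hz' := abs_le.1 hz
    have h1 := Complex.abs_im_le_norm (z - vortexPoint h θ)
    have h2 : (z - vortexPoint h θ).im = z.im + (1 - θ) * h := by simp [vortexPoint]
    rw [h2] at h1
    have := le_abs_self (z.im + (1 - θ) * h)
    nlinarith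
  have hne : ∀ z : ℂ, |z.im| ≤ h / 8 → kernelDen (Real.pi / h) (Real.cos (Real.pi * θ)) z ≠ 0 := by
    intro z hz
    refine kernelDen_ne_zero hh hθ hθ' (by linarith [(abs_le.1 hz).1]) (abs_le.1 hz).2 ?_
    rintro rfl
    have := hdist _ hz
    rw [sub_self, norm_zero] at this
    linarith
  have hb : ∀ z : ℂ, |z.im| ≤ h / 8 →
      ‖kernelDeriv (Real.pi / h) (Real.cos (Real.pi * θ)) z‖ ≤ C ∧
      ‖kernelDeriv₂ (Real.pi / h) (Real.cos (Real.pi * θ)) z‖ ≤ C := fun z hz => by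
    have hc := hCz z (by linarith [(abs_le.1 hz).1]) (abs_le.1 hz).2 (hdist z hz)
    have h1 : C * (1 / Real.cosh (Real.pi / h * z.re)) ≤ C := by
      rw [mul_one_div]; exact div_le_self hC.le (Real.one_le_cosh _)
    exact ⟨hc.2.1.trans h1, hc.2.2.trans h1⟩
  have hconv : Convex ℝ {z : ℂ | |z.im| ≤ h / 8} := by
    have e : {z : ℂ | |z.im| ≤ h / 8} = {z : ℂ | -(h / 8) ≤ z.im} ∩ {z : ℂ | z.im ≤ h / 8} := by
      ext z
      simp only [Set.mem_inter_iff, Set.mem_ofPred_eq, abs_le]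
    rw [e]
    exact (convex_halfSpace_im_ge _).inter (convex_halfSpace_im_le _)
  refine ⟨C, hC, fun x y hy => ?_⟩
  have hx : (x : ℂ) ∈ {z : ℂ | |z.im| ≤ h / 8} := by
    show |(x : ℂ).im| ≤ h / 8
    simp; positivity
  have hz : (⟨x, y⟩ : ℂ) ∈ {z : ℂ | |z.im| ≤ h / 8} := hy
  have hdiff : ‖(⟨x, y⟩ : ℂ) - x‖ = |y| := by
    rw [show (⟨x, y⟩ : ℂ) - x = y * Complex.I by
      rw [Complex.mk_eq_add_mul_I]; ring, norm_mul, Complex.norm_I, mul_one, Complex.norm_real,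
      Real.norm_eq_abs]
  constructor
  · have h1 := hconv.norm_image_sub_le_of_norm_hasDerivWithin_le
      (fun z hz => (hasDerivAt_kernel (hne z hz)).hasDerivWithinAt) (fun z hz => (hb z hz).1) hx hz
    rw [hdiff] at h1
    have h2 := Complex.abs_im_le_norm (kernel (Real.pi / h) (Real.cos (Real.pi * θ)) ⟨x, y⟩ -
      kernel (Real.pi / h) (Real.cos (Real.pi * θ)) x)
    rw [Complex.sub_im, kernel_im_of_im_eq_zero (z := (x : ℂ)) (by simp), sub_zero] at h2
    exact h2.trans h1
  · have h1 := hconv.norm_image_sub_le_of_norm_hasDerivWithin_le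
      (fun z hz => (hasDerivAt_kernelDeriv (hne z hz)).hasDerivWithinAt) (fun z hz => (hb z hz).2) hx hz
    rwa [hdiff] at h1

end KernelSurface

section TestFunctions

/-- Mollification at a scale below the moduli of uniform continuity of `φ` and `φ'`; differentiation
commutes with the convolution, and a scale of at most one enlarges the support by at most one. -/
lemma exists_smooth_approx {φ : ℝ → ℝ} (hφ : ContDiff ℝ 1 φ) {r : ℝ}
    (hs : ∀ x, r < |x| → φ x = 0) {ε : ℝ} (hε : 0 < ε) :
    ∃ ψ : ℝ → ℝ, ContDiff ℝ ∞ ψ ∧ (∀ x, r + 1 < |x| → ψ x = 0) ∧ (∀ x, |ψ x - φ x| ≤ ε) ∧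
      ∀ x, |deriv ψ x - deriv φ x| ≤ ε := by
  have hcs : HasCompactSupport φ := HasCompactSupport.intro (isCompact_closedBall (0 : ℝ) r)
    fun x hx => hs x (by simpa using hx)
  have hφ' : Continuous (deriv φ) := hφ.continuous_deriv le_rfl
  have u1 := hcs.uniformContinuous_of_continuous hφ.continuous
  have u2 := hcs.deriv.uniformContinuous_of_continuous hφ'
  obtain ⟨δ₁, hδ₁, H1⟩ := Metric.uniformContinuous_iff.1 u1 ε hε
  obtain ⟨δ₂, hδ₂, H2⟩ := Metric.uniformContinuous_iff.1 u2 ε hε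
  set d : ℝ := min (min δ₁ δ₂) 1 with hd
  have hd0 : 0 < d := by positivity
  let b : ContDiffBump (0 : ℝ) := ⟨d / 2, d, by positivity, by linarith⟩
  have hbi : LocallyIntegrable (b.normed volume) := (b.continuous_normed).locallyIntegrable
  have hder : ∀ x, HasDerivAt (MeasureTheory.convolution (b.normed volume) φ (ContinuousLinearMap.lsmul ℝ ℝ) volume)
      (MeasureTheory.convolution (b.normed volume) (deriv φ) (ContinuousLinearMap.lsmul ℝ ℝ) volume x) x :=
    fun x => hcs.hasDerivAt_convolution_right _ hbi hφ x
  refine ⟨MeasureTheory.convolution (b.normed volume) φ (ContinuousLinearMap.lsmul ℝ ℝ) volume,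
    b.hasCompactSupport_normed.contDiff_convolution_left _ b.contDiff_normed
      hφ.continuous.locallyIntegrable, fun x hx => ?_, fun x => ?_, fun x => ?_⟩
  · by_contra hne
    have h1 := support_convolution_subset (L := ContinuousLinearMap.lsmul ℝ ℝ) (μ := volume) hne
    obtain ⟨a, ha, c, hc, hac⟩ := h1
    rw [b.support_normed_eq] at ha
    have ha' : |a| < d := by simpa using ha
    have hc' : |c| ≤ r := by
      by_contra hcon
      exact hc (hs c (not_le.1 hcon))
    have : |x| ≤ |a| + |c| := by rw [← hac]; exact abs_add_le a c
    have : d ≤ 1 := min_le_right _ _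
    linarith
  · have := b.dist_normed_convolution_le (μ := volume) (g := φ) (x₀ := x) (ε := ε)
      hφ.continuous.aestronglyMeasurable (fun y hy => (H1 (lt_of_lt_of_le hy
        ((min_le_left _ _).trans (min_le_left _ _)))).le)
    rwa [Real.dist_eq] at this
  · rw [(hder x).deriv]
    have := b.dist_normed_convolution_le (μ := volume) (g := deriv φ) (x₀ := x) (ε := ε)
      hφ'.aestronglyMeasurable (fun y hy => (H2 (lt_of_lt_of_le hy
        ((min_le_left _ _).trans (min_le_right _ _)))).le)
    rwa [Real.dist_eq] at this

/-- A distributional equation extends to continuously differentiable functions of compact support. -/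
lemma weak_equation_of_compactSupport {R S : ℝ → ℝ} {a : ℝ} (hR : LocallyIntegrable R)
    (hS : LocallyIntegrable S)
    (H : ∀ φ : ℝ → ℝ, ContDiff ℝ ∞ φ → HasCompactSupport φ →
      (∫ x, R x * φ x) + a * ∫ x, S x * deriv φ x = 0)
    {φ : ℝ → ℝ} (hφ : ContDiff ℝ 1 φ) (hc : HasCompactSupport φ) :
    (∫ x, R x * φ x) + a * ∫ x, S x * deriv φ x = 0 := by
  obtain ⟨r, hs⟩ : ∃ r, ∀ x, r < |x| → φ x = 0 := by
    obtain ⟨r, hr⟩ := hc.isCompact.isBounded.subset_closedBall (0 : ℝ)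
    refine ⟨r, fun x hx => ?_⟩
    refine image_eq_zero_of_notMem_tsupport fun hx' => ?_
    have := hr hx'
    rw [mem_closedBall_zero_iff, Real.norm_eq_abs] at this
    linarith
  set K : Set ℝ := Metric.closedBall (0 : ℝ) (r + 1) with hK
  have hRK : IntegrableOn R K := hR.integrableOn_isCompact (isCompact_closedBall _ _)
  have hSK : IntegrableOn S K := hS.integrableOn_isCompact (isCompact_closedBall _ _)
  set B : ℝ := (∫ x in K, |R x|) + |a| * ∫ x in K, |S x| with hB
  have hB0 : 0 ≤ B := by
    have h1 : 0 ≤ ∫ x in K, |R x| := integral_nonneg fun x => abs_nonneg _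
    have h2 : 0 ≤ ∫ x in K, |S x| := integral_nonneg fun x => abs_nonneg _
    positivity
  have hdiff : ∀ {T u v : ℝ → ℝ} {ε : ℝ}, LocallyIntegrable T → Continuous u → Continuous v →
      (∀ x, r + 1 < |x| → u x = 0 ∧ v x = 0) → (∀ x, |u x - v x| ≤ ε) →
      |(∫ x, T x * u x) - ∫ x, T x * v x| ≤ ε * ∫ x in K, |T x| := by
    intro T u v ε hT hu hv huv hle
    have hTK : IntegrableOn T K := hT.integrableOn_isCompact (isCompact_closedBall _ _)
    have hred : ∀ u : ℝ → ℝ, (∀ x, r + 1 < |x| → u x = 0) → ∫ x, T x * u x = ∫ x in K, T x * u x :=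
      fun u hu => (setIntegral_eq_integral_of_forall_compl_eq_zero fun x hx => by
        rw [hu x (by simpa [hK] using hx), mul_zero]).symm
    have hi : ∀ u : ℝ → ℝ, Continuous u → IntegrableOn (fun x => T x * u x) K := fun u hu =>
      hTK.mul_continuousOn hu.continuousOn (isCompact_closedBall _ _)
    rw [hred u fun x hx => (huv x hx).1, hred v fun x hx => (huv x hx).2, ← integral_sub (hi u hu) (hi v hv),
      ← integral_const_mul]
    refine (abs_integral_le_integral_abs).trans (integral_mono_of_nonneg
      (Eventually.of_forall fun x => abs_nonneg _) (hTK.abs.const_mul ε) (Eventually.of_forall fun x => ?_))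
    simp only
    rw [← mul_sub, abs_mul, mul_comm]
    exact mul_le_mul_of_nonneg_right (hle x) (abs_nonneg _)
  have hsd : ∀ {u : ℝ → ℝ} {ρ : ℝ}, (∀ x, ρ < |x| → u x = 0) → ∀ x, ρ < |x| → deriv u x = 0 := by
    intro u ρ hu x hx
    have : u =ᶠ[𝓝 x] fun _ => 0 := by
      filter_upwards [(isOpen_lt continuous_const continuous_abs).mem_nhds hx] with y hy using hu y hy
    rw [this.deriv_eq, deriv_const]
  -- The equation holds exactly for the mollified function; replacing it by `φ` costs at most `ε`
  -- times local `L¹` norms of `R` and `S`.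
  have key : ∀ ε > 0, |(∫ x, R x * φ x) + a * ∫ x, S x * deriv φ x| ≤ ε * B := by
    intro ε hε
    obtain ⟨ψ, hψ, hψs, hψ1, hψ2⟩ := exists_smooth_approx hφ hs hε
    have hψc : HasCompactSupport ψ := HasCompactSupport.intro (isCompact_closedBall (0 : ℝ) (r + 1))
      fun x hx => hψs x (by simpa using hx)
    have h0 := H ψ hψ hψc
    have h1 := hdiff hR hψ.continuous hφ.continuous
      (fun x hx => ⟨hψs x hx, hs x (by linarith)⟩) hψ1
    have h2 := hdiff hS (hψ.continuous_deriv (by simp)) (hφ.continuous_deriv le_rfl)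
      (fun x hx => ⟨hsd hψs x hx, hsd hs x (by linarith)⟩) hψ2
    have e : (∫ x, R x * φ x) + a * ∫ x, S x * deriv φ x =
        -((∫ x, R x * ψ x) - ∫ x, R x * φ x) - a * ((∫ x, S x * deriv ψ x) - ∫ x, S x * deriv φ x) := by
      linear_combination h0
    rw [e, hB]
    refine (abs_sub _ _).trans ?_
    rw [abs_neg, abs_mul]
    have := mul_le_mul_of_nonneg_left h2 (abs_nonneg a)
    linarith
  rw [← abs_eq_zero]
  refine le_antisymm (le_of_forall_pos_le_add fun ε hε => ?_) (abs_nonneg _)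
  have h1 := key (ε / (B + 1)) (by positivity)
  refine h1.trans ?_
  rw [zero_add, div_mul_eq_mul_div, div_le_iff₀ (by positivity)]
  nlinarith

/-- A distributional equation extends to continuously differentiable functions for which all
integrals converge. -/
theorem weak_equation_extend {R S : ℝ → ℝ} {a : ℝ} (hR : LocallyIntegrable R)
    (hS : LocallyIntegrable S)
    (H : ∀ φ : ℝ → ℝ, ContDiff ℝ ∞ φ → HasCompactSupport φ →
      (∫ x, R x * φ x) + a * ∫ x, S x * deriv φ x = 0)
    {φ : ℝ → ℝ} (hφ : ContDiff ℝ 1 φ) (hRφ : Integrable fun x => R x * φ x)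
    (hSφ : Integrable fun x => S x * φ x) (hSφ' : Integrable fun x => S x * deriv φ x) :
    (∫ x, R x * φ x) + a * ∫ x, S x * deriv φ x = 0 := by
  -- Dilates of this bump serve as cutoffs that tend to one while their derivatives tend to zero
  -- uniformly.
  let b : ContDiffBump (0 : ℝ) := ⟨1, 2, by norm_num, by norm_num⟩
  have hbc : ContDiff ℝ 1 b := b.contDiff
  have hbd : ∀ x, HasDerivAt b (deriv b x) x := fun x =>
    (hbc.differentiable (by simp) x).hasDerivAt
  obtain ⟨M, hM⟩ := (b.hasCompactSupport.deriv).exists_bound_of_continuous (hbc.continuous_deriv le_rfl)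
  set χ : ℕ → ℝ → ℝ := fun n x => b (x / (n + 1)) with hχ
  have hχd : ∀ n x, HasDerivAt (χ n) (deriv b (x / (n + 1)) * (1 / (n + 1))) x := fun n x =>
    HasDerivAt.comp (h₂ := (b : ℝ → ℝ)) (h := fun x : ℝ => x / (n + 1)) x (hbd (x / (n + 1)))
      ((hasDerivAt_id x).div_const _)
  have hχc : ∀ n, ContDiff ℝ 1 (χ n) := fun n => hbc.comp (contDiff_id.div_const _)
  have hχ1 : ∀ n x, |χ n x| ≤ 1 := fun n x => by
    rw [abs_of_nonneg b.nonneg]; exact b.le_one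
  have htd : ∀ x : ℝ, Tendsto (fun n : ℕ => x / ((n : ℝ) + 1)) atTop (𝓝 0) := fun x => by
    have := tendsto_one_div_add_atTop_nhds_zero_nat (𝕜 := ℝ).const_mul x
    simpa only [mul_one_div, mul_zero] using this
  have hχt : ∀ x, Tendsto (fun n => χ n x) atTop (𝓝 1) := fun x => by
    have h1 := (hbc.continuous.tendsto 0).comp (htd x)
    rwa [b.one_of_mem_closedBall (x := 0) (by simp [b])] at h1
  have hχs : ∀ n, HasCompactSupport (χ n) := fun n => by
    refine HasCompactSupport.intro (isCompact_closedBall (0 : ℝ) (2 * (n + 1))) fun x hx => ?_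
    refine b.zero_of_le_dist ?_
    have hn : (0 : ℝ) < n + 1 := by positivity
    have hx' : 2 * ((n : ℝ) + 1) < |x| := by simpa using hx
    rw [dist_zero_right, Real.norm_eq_abs, abs_div, abs_of_pos hn, le_div_iff₀ hn]
    exact hx'.le
  have hφd : ∀ x, HasDerivAt φ (deriv φ x) x := fun x => (hφ.differentiable (by simp) x).hasDerivAt
  have hn0 : ∀ n, (∫ x, R x * φ x * χ n x) + a * ((∫ x, S x * deriv φ x * χ n x) +
      ∫ x, S x * φ x * (deriv b (x / (n + 1)) * (1 / (n + 1)))) = 0 := fun n => by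
    have h1 := weak_equation_of_compactSupport hR hS H (hφ.mul (hχc n)) ((hχs n).mul_left)
    have hb1 : Continuous fun x : ℝ => deriv b (x / (n + 1)) * (1 / (n + 1)) := by
      have := hbc.continuous_deriv le_rfl
      fun_prop
    have i1 : Integrable fun x => S x * deriv φ x * χ n x :=
      hSφ'.mul_bdd (c := 1) (hχc n).continuous.aestronglyMeasurable (Eventually.of_forall fun x => hχ1 n x)
    have i2 : Integrable fun x => S x * φ x * (deriv b (x / (n + 1)) * (1 / (n + 1))) := by
      refine hSφ.mul_bdd (c := M * (1 / (n + 1))) hb1.aestronglyMeasurable (Eventually.of_forall fun x => ?_)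
      rw [norm_mul, Real.norm_of_nonneg (by positivity : (0 : ℝ) ≤ 1 / (n + 1))]
      exact mul_le_mul_of_nonneg_right (hM _) (by positivity)
    rw [← integral_add i1 i2]
    refine Eq.trans ?_ h1
    congr 1
    · exact integral_congr_ae (Eventually.of_forall fun x => by simp [mul_assoc])
    · congr 1
      refine integral_congr_ae (Eventually.of_forall fun x => ?_)
      have := ((hφd x).fun_mul (hχd n x)).deriv
      simp only
      rw [this]
      ring
  have t1 : Tendsto (fun n => ∫ x, R x * φ x * χ n x) atTop (𝓝 (∫ x, R x * φ x)) := by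
    refine tendsto_integral_of_dominated_convergence (fun x => |R x * φ x|)
      (fun n => hRφ.aestronglyMeasurable.mul (hχc n).continuous.aestronglyMeasurable) hRφ.abs
      (fun n => Eventually.of_forall fun x => ?_) (Eventually.of_forall fun x => ?_)
    · rw [norm_mul, Real.norm_eq_abs, Real.norm_eq_abs]
      exact mul_le_of_le_one_right (abs_nonneg _) (hχ1 n x)
    · simpa using (hχt x).const_mul (R x * φ x)
  have t2 : Tendsto (fun n => ∫ x, S x * deriv φ x * χ n x) atTop (𝓝 (∫ x, S x * deriv φ x)) := by
    refine tendsto_integral_of_dominated_convergence (fun x => |S x * deriv φ x|)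
      (fun n => hSφ'.aestronglyMeasurable.mul (hχc n).continuous.aestronglyMeasurable) hSφ'.abs
      (fun n => Eventually.of_forall fun x => ?_) (Eventually.of_forall fun x => ?_)
    · rw [norm_mul, Real.norm_eq_abs, Real.norm_eq_abs]
      exact mul_le_of_le_one_right (abs_nonneg _) (hχ1 n x)
    · simpa using (hχt x).const_mul (S x * deriv φ x)
  -- The commutator with the cutoff is `O(1/n)` times `∫ |Sφ|`, which is where integrability of `Sφ`
  -- enters.
  have t3 : Tendsto (fun n : ℕ => ∫ x, S x * φ x * (deriv b (x / (n + 1)) * (1 / (n + 1)))) atTop (𝓝 0) := by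
    have hz : Tendsto (fun n : ℕ => (M * ∫ x, |S x * φ x|) * (1 / ((n : ℝ) + 1))) atTop (𝓝 0) := by
      simpa using (tendsto_one_div_add_atTop_nhds_zero_nat (𝕜 := ℝ)).const_mul (M * ∫ x, |S x * φ x|)
    refine squeeze_zero_norm (fun n => ?_) hz
    have e : M * (∫ x, |S x * φ x|) * (1 / ((n : ℝ) + 1)) = ∫ x, |S x * φ x| * (M * (1 / ((n : ℝ) + 1))) := by
      rw [integral_mul_const]; ring
    rw [e]
    refine (norm_integral_le_integral_norm _).trans (integral_mono_of_nonneg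
      (Eventually.of_forall fun x => norm_nonneg _) (hSφ.abs.mul_const _) (Eventually.of_forall fun x => ?_))
    simp only
    rw [norm_mul (S x * φ x), norm_mul (deriv b _), Real.norm_eq_abs (S x * φ x),
      Real.norm_of_nonneg (by positivity : (0 : ℝ) ≤ 1 / (n + 1))]
    gcongr
    exact hM _
  have t4 := t1.add ((t2.add t3).const_mul a)
  simp only [hn0, add_zero] at t4
  exact (tendsto_nhds_unique t4 tendsto_const_nhds)

end TestFunctions

end PointVortex
end

/-! ### Small surfaces and the dynamic head -/

noncomputable section
namespace PointVortex

lemma integral_abs_mul_le {f g : ℝ → ℝ} (hf : MemLp f 2) (hg : MemLp g 2) :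
    ∫ x, |f x * g x| ≤ Real.sqrt (∫ x, f x ^ 2) * Real.sqrt (∫ x, g x ^ 2) := by
  have h1 := integral_mul_norm_le_Lp_mul_Lq (μ := volume) (f := f) (g := g) (p := 2) (q := 2)
    Real.HolderConjugate.two_two (by simpa using hf) (by simpa using hg)
  simp only [Real.norm_eq_abs, ← abs_mul] at h1
  refine h1.trans (le_of_eq ?_)
  rw [Real.sqrt_eq_rpow, Real.sqrt_eq_rpow]
  simp

section SmallSurface

variable {h m c ε g α : ℝ} {η w : ℝ → ℝ}

/-- A profile of size at most `m` in `C¹` that is square integrable together with its slope. -/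
structure IsSmallSurface (h m : ℝ) (η : ℝ → ℝ) : Prop where
  contDiff : ContDiff ℝ 1 η
  memLp : MemLp η 2
  memLp_deriv : MemLp (deriv η) 2
  abs_le : ∀ x, |η x| ≤ m
  abs_deriv_le : ∀ x, |deriv η x| ≤ m
  le_depth : m ≤ h / 32
  le_one : m ≤ 1

/-- The velocity of the vortex flow at the surface in the direction of `(-η', 1)`. -/
def normalVelocity (h : ℝ) (η : ℝ → ℝ) (x : ℝ) : ℝ :=
  -deriv η x * vortexStreamX h (1 / 2) x (η x) + vortexStreamY h (1 / 2) x (η x)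

/-- The dynamic head of the wave in a frame moving with it. -/
def dynamicHead (h : ℝ) (η w : ℝ → ℝ) (c ε x : ℝ) : ℝ :=
  ((w x + ε * normalVelocity h η x) ^ 2 + 2 * c * (w x + ε * normalVelocity h η x) -
    c ^ 2 * deriv η x ^ 2) / (2 * bracket (deriv η x) ^ 2)

lemma bracket_sq (x : ℝ) : bracket x ^ 2 = 1 + x ^ 2 := Real.sq_sqrt (by positivity)

lemma one_le_bracket (x : ℝ) : 1 ≤ bracket x := by
  rw [bracket, Real.one_le_sqrt]; nlinarith [sq_nonneg x]

lemma bracket_le {x : ℝ} (hx : |x| ≤ 1) : bracket x ≤ 2 := by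
  rw [bracket, Real.sqrt_le_left (by norm_num)]
  nlinarith [sq_abs x, abs_nonneg x]

lemma continuous_bracket : Continuous bracket := by
  unfold bracket
  fun_prop

lemma memLp_surfaceVelocity (hh : 0 < h) : MemLp (surfaceVelocity h) 2 := by
  have h1 := (memLp_inv_cosh (div_pos Real.pi_pos hh)).const_mul (1 / (2 * h))
  refine (memLp_congr_ae (Eventually.of_forall fun x => ?_)).1 h1
  simp [surfaceVelocity, div_eq_mul_inv]

namespace IsSmallSurface

lemma nonneg (hη : IsSmallSurface h m η) : 0 ≤ m := (abs_nonneg _).trans (hη.abs_le 0)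

lemma abs_le_depth (hη : IsSmallSurface h m η) (hh : 0 < h) (x : ℝ) : |η x| ≤ h / 8 := by
  linarith [hη.abs_le x, hη.le_depth]

lemma continuous (hη : IsSmallSurface h m η) : Continuous η := hη.contDiff.continuous

lemma continuous_deriv (hη : IsSmallSurface h m η) : Continuous (deriv η) :=
  hη.contDiff.continuous_deriv le_rfl

lemma differentiable (hη : IsSmallSurface h m η) : Differentiable ℝ η :=
  hη.contDiff.differentiable (by simp)

lemma continuous_vortexStream (hη : IsSmallSurface h m η) (hh : 0 < h) :
    (Continuous fun x => vortexStreamX h (1 / 2) x (η x)) ∧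
      Continuous fun x => vortexStreamY h (1 / 2) x (η x) := by
  have hc := hη.continuous
  have e1 : Continuous fun x => Real.cosh (Real.pi / h * x) := Real.continuous_cosh.comp (by fun_prop)
  have e2 : Continuous fun x => Real.sinh (Real.pi / h * x) := Real.continuous_sinh.comp (by fun_prop)
  have hne : ∀ x, Real.cosh (Real.pi / h * x) ^ 2 - Real.sin (Real.pi / h * η x) ^ 2 ≠ 0 := fun x => by
    have h1 := cosh_sq_sub_sin_sq_ge hh (hη.abs_le_depth hh x) x
    have h2 := Real.cosh_pos (Real.pi / h * x)
    have h3 : 0 < 3 / 4 * Real.cosh (Real.pi / h * x) ^ 2 := by positivity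
    linarith
  constructor
  · refine Continuous.congr ?_ fun x => (vortexStreamX_half hh (hη.abs_le_depth hh x) x).symm
    exact (Continuous.div (by fun_prop) (by fun_prop) hne).neg
  · refine Continuous.congr ?_ fun x => (vortexStreamY_half hh (hη.abs_le_depth hh x) x).symm
    exact Continuous.div (by fun_prop) (by fun_prop) hne

lemma continuous_normalVelocity (hη : IsSmallSurface h m η) (hh : 0 < h) :
    Continuous (normalVelocity h η) := by
  obtain ⟨h1, h2⟩ := hη.continuous_vortexStream hh
  have h3 := hη.continuous_deriv
  unfold normalVelocity
  fun_prop

/-- Since `|η| ≤ h/32`, `Φ_x` is at most a quarter of the surface velocity, and the slope is at most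
one; `Φ_y` lies between one half and twice the surface velocity. The lower bound later produces the
strictly negative leading term. -/
lemma normalVelocity_bounds (hη : IsSmallSurface h m η) (hh : 0 < h) (x : ℝ) :
    1 / 4 * surfaceVelocity h x ≤ normalVelocity h η x ∧
      normalVelocity h η x ≤ 3 * surfaceVelocity h x := by
  have h1 := abs_vortexStreamX_half_le hh (hη.abs_le_depth hh x) x
  obtain ⟨h2, h3, -⟩ := vortexStreamY_half_bounds hh (hη.abs_le_depth hh x) x
  have h4 := surfaceVelocity_pos hh x
  have h5 : 2 * (Real.pi / h) * |η x| ≤ 1 / 4 := by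
    have h6 : |η x| ≤ h / 32 := (hη.abs_le x).trans hη.le_depth
    have h7 : 0 ≤ Real.pi / h := by have := Real.pi_pos; positivity
    calc 2 * (Real.pi / h) * |η x| ≤ 2 * (Real.pi / h) * (h / 32) := by gcongr
      _ = Real.pi / 16 := by field_simp; ring
      _ ≤ 1 / 4 := by linarith [Real.pi_lt_four]
  have h6 : |-deriv η x * vortexStreamX h (1 / 2) x (η x)| ≤ 1 / 4 * surfaceVelocity h x := by
    rw [abs_mul, abs_neg]
    have h7 : |vortexStreamX h (1 / 2) x (η x)| ≤ 1 / 4 * surfaceVelocity h x :=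
      h1.trans (mul_le_mul_of_nonneg_right h5 h4.le)
    have h8 := (hη.abs_deriv_le x).trans hη.le_one
    calc _ ≤ 1 * (1 / 4 * surfaceVelocity h x) := by gcongr
      _ = _ := one_mul _
  have h7 := _root_.abs_le.1 h6
  rw [normalVelocity]
  constructor <;> linarith

lemma memLp_normalVelocity (hη : IsSmallSurface h m η) (hh : 0 < h) : MemLp (normalVelocity h η) 2 := by
  refine ((memLp_surfaceVelocity hh).const_mul 3).mono
    (hη.continuous_normalVelocity hh).aestronglyMeasurable (Eventually.of_forall fun x => ?_)
  obtain ⟨h1, h2⟩ := hη.normalVelocity_bounds hh x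
  have h3 := surfaceVelocity_pos hh x
  rw [Real.norm_eq_abs, Real.norm_eq_abs, abs_of_pos (by linarith), abs_of_pos (by linarith)]
  exact h2

lemma memLp_div_bracket (hη : IsSmallSurface h m η) :
    MemLp (fun x => deriv η x / bracket (deriv η x)) 2 := by
  have hb : Continuous fun x => bracket (deriv η x) := continuous_bracket.comp hη.continuous_deriv
  have hc : Continuous fun x => deriv η x / bracket (deriv η x) :=
    hη.continuous_deriv.div hb fun x => (lt_of_lt_of_le one_pos (one_le_bracket _)).ne'
  refine hη.memLp_deriv.mono hc.aestronglyMeasurable (Eventually.of_forall fun x => ?_)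
  rw [norm_div, Real.norm_eq_abs (bracket _), abs_of_pos (lt_of_lt_of_le one_pos (one_le_bracket _))]
  exact div_le_self (norm_nonneg _) (one_le_bracket _)

lemma abs_dynamicHead_le (x : ℝ) :
    |dynamicHead h η w c ε x| ≤ (w x + ε * normalVelocity h η x) ^ 2 +
      |c| * |w x + ε * normalVelocity h η x| + c ^ 2 * deriv η x ^ 2 := by
  have hb : 1 ≤ bracket (deriv η x) ^ 2 := one_le_pow₀ (one_le_bracket _)
  rw [dynamicHead, abs_div, abs_of_pos (by positivity : 0 < 2 * bracket (deriv η x) ^ 2),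
    div_le_iff₀ (by positivity)]
  generalize w x + ε * normalVelocity h η x = p
  have h1 : |p ^ 2 + 2 * c * p - c ^ 2 * deriv η x ^ 2| ≤ p ^ 2 + 2 * (|c| * |p|) + c ^ 2 * deriv η x ^ 2 := by
    refine (abs_sub _ _).trans (add_le_add ((abs_add_le _ _).trans (add_le_add ?_ ?_)) ?_)
    · rw [abs_of_nonneg (sq_nonneg p)]
    · rw [abs_mul, abs_mul, abs_two, mul_assoc]
    · rw [abs_of_nonneg (by positivity)]
  have h2 : 0 ≤ |c| * |p| := by positivity
  nlinarith [sq_nonneg p, mul_nonneg (sq_nonneg c) (sq_nonneg (deriv η x))]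

lemma aestronglyMeasurable_dynamicHead (hη : IsSmallSurface h m η) (hh : 0 < h) (hw : MemLp w 2) :
    AEStronglyMeasurable (dynamicHead h η w c ε) volume := by
  have hp : AEStronglyMeasurable (fun x => w x + ε * normalVelocity h η x) volume :=
    hw.aestronglyMeasurable.add ((hη.continuous_normalVelocity hh).const_mul ε |>.aestronglyMeasurable)
  have hb : Continuous fun x => 1 / (2 * bracket (deriv η x) ^ 2) := by
    have hb : Continuous fun x => bracket (deriv η x) := continuous_bracket.comp hη.continuous_deriv
    refine Continuous.div (by fun_prop) (by fun_prop) fun x => ?_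
    have := one_le_bracket (deriv η x)
    positivity
  have hd : Continuous fun x => c ^ 2 * deriv η x ^ 2 := by have := hη.continuous_deriv; fun_prop
  have := (((hp.pow 2).add (hp.const_mul (2 * c))).sub hd.aestronglyMeasurable).mul hb.aestronglyMeasurable
  refine this.congr (Eventually.of_forall fun x => ?_)
  simp [dynamicHead, div_eq_mul_inv]

lemma memLp_total (hη : IsSmallSurface h m η) (hh : 0 < h) (hw : MemLp w 2) :
    MemLp (fun x => w x + ε * normalVelocity h η x) 2 :=
  hw.add ((hη.memLp_normalVelocity hh).const_mul ε)

/-- The square of the total velocity is only in `L¹`, so `φ` has to be bounded as well as square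
integrable. -/
lemma integrable_dynamicHead_mul (hη : IsSmallSurface h m η) (hh : 0 < h) (hw : MemLp w 2) {φ : ℝ → ℝ}
    (hφ : MemLp φ 2) {M : ℝ} (hM : ∀ x, |φ x| ≤ M) :
    Integrable fun x => dynamicHead h η w c ε x * φ x := by
  have hp := hη.memLp_total (ε := ε) hh hw
  have hM0 : 0 ≤ M := (abs_nonneg _).trans (hM 0)
  have i : Integrable fun x => M * (w x + ε * normalVelocity h η x) ^ 2 +
      |c| * |(w x + ε * normalVelocity h η x) * φ x| + c ^ 2 * M * deriv η x ^ 2 :=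
    ((hp.integrable_sq.const_mul M).add ((hp.integrable_mul hφ).abs.const_mul |c|)).add
      (hη.memLp_deriv.integrable_sq.const_mul (c ^ 2 * M))
  refine i.mono' ((hη.aestronglyMeasurable_dynamicHead hh hw).mul hφ.aestronglyMeasurable)
    (Eventually.of_forall fun x => ?_)
  rw [Real.norm_eq_abs, abs_mul]
  have h1 := abs_dynamicHead_le (h := h) (η := η) (w := w) (c := c) (ε := ε) x
  rw [abs_mul (w x + ε * normalVelocity h η x)]
  generalize w x + ε * normalVelocity h η x = p at *
  have h2 := mul_le_mul_of_nonneg_right h1 (abs_nonneg (φ x))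
  have h3 := mul_le_mul_of_nonneg_left (hM x) (sq_nonneg p)
  have h4 := mul_le_mul_of_nonneg_left (hM x) (mul_nonneg (sq_nonneg c) (sq_nonneg (deriv η x)))
  nlinarith

lemma locallyIntegrable_dynamicHead (hη : IsSmallSurface h m η) (hh : 0 < h) (hw : MemLp w 2) :
    LocallyIntegrable (dynamicHead h η w c ε) := by
  have hp := hη.memLp_total (ε := ε) hh hw
  have i : LocallyIntegrable fun x => (w x + ε * normalVelocity h η x) ^ 2 +
      |c| * |w x + ε * normalVelocity h η x| + c ^ 2 * deriv η x ^ 2 := by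
    refine (hp.integrable_sq.locallyIntegrable.add ?_).add
      (hη.memLp_deriv.integrable_sq.const_mul (c ^ 2)).locallyIntegrable
    exact ((hp.norm.const_mul |c|).locallyIntegrable (by norm_num))
  exact i.mono (hη.aestronglyMeasurable_dynamicHead hh hw) (Eventually.of_forall fun x => by
    rw [Real.norm_eq_abs, Real.norm_eq_abs]
    exact (abs_dynamicHead_le x).trans (le_abs_self _))

end IsSmallSurface

end SmallSurface

end PointVortex
end

/-! ### Reduction of the wave equations to a weak form -/

noncomputable section
namespace PointVortex

section Reduction

variable {h m c ε g α s : ℝ} {η ζ w : ℝ → ℝ}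

/-- At half depth the leading velocity coefficient vanishes, so the sign of `c` is decided at third
order. -/
lemma c₁_half (h : ℝ) : c₁ h (1 / 2) = 0 := by
  rw [c₁, Real.cot_eq_cos_div_sin, show Real.pi * (1 / 2) = Real.pi / 2 by ring, Real.cos_pi_div_two]
  simp

lemma IsSmallSurface.deriv_trace (hη : IsSmallSurface h m η) (hh : 0 < h)
    (hk : ∀ x, c * η x + ζ x + ε * vortexStream h (1 / 2) x (η x) = 0) (x : ℝ) :
    deriv ζ x = -(c * deriv η x) - ε * (vortexStreamX h (1 / 2) x (η x) +
      deriv η x * vortexStreamY h (1 / 2) x (η x)) := by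
  have e : ζ = fun x => -(c * η x) - ε * vortexStream h (1 / 2) x (η x) :=
    funext fun x => by linear_combination hk x
  rw [e]
  exact (((hη.differentiable x).hasDerivAt.const_mul c).fun_neg.fun_sub
    ((hasDerivAt_vortexStream_surface hh hη.differentiable (hη.abs_le_depth hh x)).const_mul ε)).deriv

/-- By the differentiated kinematic equation the total tangential velocity is `-cη'`. Substituting
it leaves an expression in `w + εn`, `c` and `η'` only, where `n` is `normalVelocity`. -/
lemma IsSmallSurface.bernoulliRegular_eq (hη : IsSmallSurface h m η) (hh : 0 < h)
    (hk : ∀ x, c * η x + ζ x + ε * vortexStream h (1 / 2) x (η x) = 0) (x : ℝ) :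
    bernoulliRegular g h (1 / 2) η ζ w c ε x = dynamicHead h η w c ε x + g * η x := by
  rw [bernoulliRegular, dynamicHead, normalVelocity, hη.deriv_trace hh hk x, bracket_sq]
  have : (1 + deriv η x ^ 2) ≠ 0 := by positivity
  field_simp
  ring

/-- `ζ = -cη - εΦ(·,η)`, and `Φ` vanishes at `y = 0`. So `ζ` is smaller than `η` by the factor `|c|
+ |ε|`, pointwise and with one derivative; this is the source of all smallness of `w`. -/
lemma IsSmallSurface.trace_sq_le (hη : IsSmallSurface h m η) (hh : 0 < h)
    (hk : ∀ x, c * η x + ζ x + ε * vortexStream h (1 / 2) x (η x) = 0) (x : ℝ) :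
    ζ x ^ 2 + deriv ζ x ^ 2 ≤ (2 + 6 / h ^ 2 + 4 * (Real.pi / h) ^ 2 / h ^ 2) * (|c| + |ε|) ^ 2 *
      (η x ^ 2 + deriv η x ^ 2) := by
  have hy := hη.abs_le_depth hh x
  obtain ⟨h1, -⟩ := vortexStream_half_bounds hh hy x
  have h2 := abs_vortexStreamX_half_le hh hy x
  obtain ⟨h3, h4, -⟩ := vortexStreamY_half_bounds hh hy x
  have h5 := surfaceVelocity_pos hh x
  have h6 := surfaceVelocity_le hh x
  have hκ : 0 < Real.pi / h := div_pos Real.pi_pos hh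
  have e1 : ζ x = -(c * η x) - ε * vortexStream h (1 / 2) x (η x) := by linear_combination hk x
  rw [hη.deriv_trace hh hk x, e1]
  have b1 : vortexStream h (1 / 2) x (η x) ^ 2 ≤ 1 / h ^ 2 * η x ^ 2 := by
    rw [← sq_abs, ← sq_abs (η x), ← one_div_pow, ← mul_pow]
    exact pow_le_pow_left₀ (abs_nonneg _) h1 2
  have b2 : vortexStreamX h (1 / 2) x (η x) ^ 2 ≤ (Real.pi / h) ^ 2 / h ^ 2 * η x ^ 2 := by
    rw [← sq_abs, ← sq_abs (η x), ← div_pow, ← mul_pow]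
    refine pow_le_pow_left₀ (abs_nonneg _) (h2.trans ?_) 2
    calc 2 * (Real.pi / h) * |η x| * surfaceVelocity h x ≤ 2 * (Real.pi / h) * |η x| * (1 / (2 * h)) := by
          gcongr
      _ = _ := by field_simp
  have b3 : vortexStreamY h (1 / 2) x (η x) ^ 2 ≤ 1 / h ^ 2 := by
    rw [← one_div_pow]
    refine pow_le_pow_left₀ (by linarith) (h4.trans ?_) 2
    calc 2 * surfaceVelocity h x ≤ 2 * (1 / (2 * h)) := by gcongr
      _ = _ := by field_simp
  have b4 : (deriv η x * vortexStreamY h (1 / 2) x (η x)) ^ 2 ≤ 1 / h ^ 2 * deriv η x ^ 2 := by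
    rw [mul_pow, mul_comm]
    exact mul_le_mul_of_nonneg_right b3 (sq_nonneg _)
  have c1 : c ^ 2 ≤ (|c| + |ε|) ^ 2 := by
    rw [← sq_abs c]; exact pow_le_pow_left₀ (abs_nonneg _) (by linarith [abs_nonneg ε]) 2
  have c2 : ε ^ 2 ≤ (|c| + |ε|) ^ 2 := by
    rw [← sq_abs ε]; exact pow_le_pow_left₀ (abs_nonneg _) (by linarith [abs_nonneg c]) 2
  generalize vortexStream h (1 / 2) x (η x) = F at *
  generalize vortexStreamX h (1 / 2) x (η x) = FX at *
  generalize deriv η x * vortexStreamY h (1 / 2) x (η x) = FY at *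
  generalize (|c| + |ε|) ^ 2 = Q at *
  have hB : 6 / h ^ 2 = 6 * (1 / h ^ 2) := by ring
  have hA : 4 * (Real.pi / h) ^ 2 / h ^ 2 = 4 * ((Real.pi / h) ^ 2 / h ^ 2) := by ring
  rw [hB, hA]
  have hB0 : 0 ≤ 1 / h ^ 2 := by positivity
  have hA0 : 0 ≤ (Real.pi / h) ^ 2 / h ^ 2 := by positivity
  generalize 1 / h ^ 2 = B at *
  generalize (Real.pi / h) ^ 2 / h ^ 2 = A at *
  have d1 : c ^ 2 * η x ^ 2 ≤ Q * η x ^ 2 := mul_le_mul_of_nonneg_right c1 (sq_nonneg _)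
  have d2 : c ^ 2 * deriv η x ^ 2 ≤ Q * deriv η x ^ 2 := mul_le_mul_of_nonneg_right c1 (sq_nonneg _)
  have hQ : 0 ≤ Q := (sq_nonneg c).trans c1
  have d3 : ε ^ 2 * F ^ 2 ≤ Q * (B * η x ^ 2) := mul_le_mul c2 b1 (sq_nonneg _) hQ
  have d4 : ε ^ 2 * FX ^ 2 ≤ Q * (A * η x ^ 2) := mul_le_mul c2 b2 (sq_nonneg _) hQ
  have d5 : ε ^ 2 * FY ^ 2 ≤ Q * (B * deriv η x ^ 2) := mul_le_mul c2 b4 (sq_nonneg _) hQ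
  have d6 : 0 ≤ Q * (B * η x ^ 2) := by positivity
  have d7 : 0 ≤ Q * (B * deriv η x ^ 2) := by positivity
  have d8 : 0 ≤ Q * (A * deriv η x ^ 2) := by positivity
  have q1 : (-(c * η x) - ε * F) ^ 2 ≤ 2 * (c ^ 2 * η x ^ 2) + 2 * (ε ^ 2 * F ^ 2) := by
    nlinarith [sq_nonneg (c * η x - ε * F)]
  have q2 : (-(c * deriv η x) - ε * (FX + FY)) ^ 2 ≤ 2 * (c ^ 2 * deriv η x ^ 2) +
      4 * (ε ^ 2 * FX ^ 2) + 4 * (ε ^ 2 * FY ^ 2) := by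
    nlinarith [sq_nonneg (c * deriv η x - ε * (FX + FY)), sq_nonneg (ε * FX - ε * FY)]
  linarith

/-- The weak form of the governing equations for a small wave. -/
theorem exists_wave_reduction (hh : 0 < h) : ∃ C, 0 < C ∧ ∀ {g α s m c ε : ℝ} {η ζ : ℝ → ℝ},
    IsWave g α h (1 / 2) s η ζ c ε → IsSmallSurface h m η →
    ContDiff ℝ 1 ζ → MemLp ζ 2 → MemLp (deriv ζ) 2 → ∃ w : ℝ → ℝ, MemLp w 2 ∧
      (∫ x, w x ^ 2) ≤ C * (|c| + |ε|) ^ 2 * ((∫ x, η x ^ 2) + ∫ x, deriv η x ^ 2) ∧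
      (∀ (φ : ℝ → ℝ) (M : ℝ), ContDiff ℝ 1 φ → MemLp φ 2 → MemLp (deriv φ) 2 → (∀ x, |φ x| ≤ M) →
        (∫ x, dynamicHead h η w c ε x * φ x) + g * (∫ x, η x * φ x) +
          α ^ 2 * ∫ x, deriv η x / bracket (deriv η x) * deriv φ x = 0) ∧
      4 * h * c = (∫ x, (c * η x + ε * vortexStream h (1 / 2) x (η x)) * (-deriv η x *
          (kernelDeriv (Real.pi / h) (Real.cos (Real.pi * (1 / 2))) ⟨x, η x⟩).im +
        (kernelDeriv (Real.pi / h) (Real.cos (Real.pi * (1 / 2))) ⟨x, η x⟩).re)) +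
      ∫ x, (kernel (Real.pi / h) (Real.cos (Real.pi * (1 / 2))) ⟨x, η x⟩).im * w x := by
  obtain ⟨C, hC, hCb⟩ := exists_trace_bound hh
  refine ⟨2 * C * (2 + 6 / h ^ 2 + 4 * (Real.pi / h) ^ 2 / h ^ 2), by positivity, ?_⟩
  intro g α s m c ε η ζ hW hη hζ hζ2 hζ2'
  obtain ⟨ψ, w, hψ, ⟨p, q, hp, hq, hw⟩, hB, hc⟩ := hW.dynamic
  have hk := hW.kinematic
  have hη' : ∀ x, |deriv η x| ≤ 1 := fun x => (hη.abs_deriv_le x).trans hη.le_one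
  have hη0 := hη.abs_le_depth hh
  have hS := isTameSurface_of_abs_le hh hη.contDiff hη' hη0
  have hwtr : IsSurfaceTrace η (fun z => -deriv η z.re * dX ψ z + dY ψ z) w := by
    have h1 := IsSurfaceTrace.mul_left (u := fun x => -deriv η x) (C := 1) (by
      exact hη.continuous_deriv.neg.aestronglyMeasurable) (fun x => by rw [abs_neg]; exact hη' x) hp
    have h2 := IsSurfaceTrace.add hS ?_ hψ.continuousOn_dY h1 hq
    · have e : w = fun x => -deriv η x * p x + q x := funext hw
      rw [e]
      exact h2
    · exact ((hη.continuous_deriv.comp Complex.continuous_re).neg.continuousOn).mul hψ.continuousOn_dX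
  have hw2 : MemLp w 2 := hwtr.1
  refine ⟨w, hw2, ?_, ?_, ?_⟩
  · have h1 := hCb η ζ ψ p q hη.contDiff hη' hη0 hζ hζ2 hζ2' hψ hp hq
    -- `w = -η'p + q` with `|η'| ≤ 1`, so the trace bound for the gradient controls `w`.
    have h2 : (∫ x, w x ^ 2) ≤ 2 * ((∫ x, p x ^ 2) + ∫ x, q x ^ 2) := by
      rw [← integral_add hp.1.integrable_sq hq.1.integrable_sq, ← integral_const_mul]
      refine integral_mono hw2.integrable_sq
        ((hp.1.integrable_sq.add hq.1.integrable_sq).const_mul 2) fun x => ?_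
      simp only [hw]
      have h3 : deriv η x ^ 2 ≤ 1 := by rw [← sq_abs]; exact pow_le_one₀ (abs_nonneg _) (hη' x)
      have h4 : (deriv η x * p x) ^ 2 ≤ p x ^ 2 := by
        rw [mul_pow]; exact mul_le_of_le_one_left (sq_nonneg _) h3
      nlinarith [sq_nonneg (deriv η x * p x + q x)]
    have h3 : (∫ x, ζ x ^ 2) + (∫ x, deriv ζ x ^ 2) ≤
        (2 + 6 / h ^ 2 + 4 * (Real.pi / h) ^ 2 / h ^ 2) * (|c| + |ε|) ^ 2 *
          ((∫ x, η x ^ 2) + ∫ x, deriv η x ^ 2) := by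
      rw [← integral_add hζ2.integrable_sq hζ2'.integrable_sq,
        ← integral_add hη.memLp.integrable_sq hη.memLp_deriv.integrable_sq, ← integral_const_mul]
      exact integral_mono (hζ2.integrable_sq.add hζ2'.integrable_sq)
        ((hη.memLp.integrable_sq.add hη.memLp_deriv.integrable_sq).const_mul _)
        fun x => hη.trace_sq_le hh hk x
    calc (∫ x, w x ^ 2) ≤ 2 * (C * ((∫ x, ζ x ^ 2) + ∫ x, deriv ζ x ^ 2)) := by linarith
      _ ≤ 2 * (C * ((2 + 6 / h ^ 2 + 4 * (Real.pi / h) ^ 2 / h ^ 2) * (|c| + |ε|) ^ 2 *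
          ((∫ x, η x ^ 2) + ∫ x, deriv η x ^ 2))) := by gcongr
      _ = _ := by ring
  · intro φ M hφ hφ2 hφ2' hM
    have hl : LocallyIntegrable fun x => dynamicHead h η w c ε x + g * η x :=
      (hη.locallyIntegrable_dynamicHead hh hw2).add (hη.continuous.const_mul g).locallyIntegrable
    have hSl := hη.memLp_div_bracket
    have i1 := hη.integrable_dynamicHead_mul (c := c) (ε := ε) hh hw2 hφ2 hM
    have i2 : Integrable fun x => g * (η x * φ x) := (hη.memLp.integrable_mul hφ2).const_mul g
    -- The equation is needed for `η` itself and for a Schwartz function, neither of which has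
    -- compact support in general.
    have e := weak_equation_extend (a := α ^ 2) hl (hSl.locallyIntegrable (by norm_num)) (fun φ hφ hφc => by
        have := hB φ hφ hφc
        simpa only [hη.bernoulliRegular_eq hh hk] using this) hφ
      ((i1.add i2).congr (Eventually.of_forall fun x => by simp only [Pi.add_apply]; ring))
      (hSl.integrable_mul hφ2) (hSl.integrable_mul hφ2')
    rw [← e, ← integral_const_mul, ← integral_add i1 i2]
    congr 1
    exact integral_congr_ae (Eventually.of_forall fun x => by simp only; ring)
  · have h1 := dY_vortexPoint_eq hh (by norm_num) le_rfl hη.contDiff hη' hη0 hζ2 hψ hwtr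
    -- With `c₁ = 0` the vorticity equation says that `c` is minus the vertical derivative of `ψ` at
    -- the vortex, and the representation formula applies.
    rw [c₁_half, zero_mul, sub_zero] at hc
    have h2 : 4 * h * c = -(4 * h * dY ψ (vortexPoint h (1 / 2))) := by linear_combination 4 * h * hc
    rw [h2, h1, neg_sub, sub_eq_add_neg, add_comm, ← integral_neg]
    congr 1
    refine integral_congr_ae (Eventually.of_forall fun x => ?_)
    simp only
    have e1 : c * η x + ε * vortexStream h (1 / 2) x (η x) = -ζ x := by linear_combination hk x
    rw [e1]
    ring

end Reduction

end PointVortex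
end

/-! ### Energy estimate and the estimate with a positive test function -/

noncomputable section
namespace PointVortex

section Estimates

variable {h m c ε g α M : ℝ} {η w φ : ℝ → ℝ}

/-- The energy norm of the profile. -/
def energyNorm (η : ℝ → ℝ) : ℝ := Real.sqrt ((∫ x, η x ^ 2) + ∫ x, deriv η x ^ 2)

lemma energyNorm_nonneg (η : ℝ → ℝ) : 0 ≤ energyNorm η := Real.sqrt_nonneg _

lemma energyNorm_sq (η : ℝ → ℝ) : energyNorm η ^ 2 = (∫ x, η x ^ 2) + ∫ x, deriv η x ^ 2 :=
  Real.sq_sqrt (add_nonneg (integral_nonneg fun _ => sq_nonneg _) (integral_nonneg fun _ => sq_nonneg _))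

lemma sqrt_integral_sq_le_energyNorm (η : ℝ → ℝ) : Real.sqrt (∫ x, η x ^ 2) ≤ energyNorm η :=
  Real.sqrt_le_sqrt (le_add_of_nonneg_right (integral_nonneg fun _ => sq_nonneg _))

lemma integral_sq_le_energyNorm_sq (η : ℝ → ℝ) :
    (∫ x, η x ^ 2) ≤ energyNorm η ^ 2 ∧ (∫ x, deriv η x ^ 2) ≤ energyNorm η ^ 2 := by
  have h1 : 0 ≤ ∫ x, η x ^ 2 := integral_nonneg fun _ => sq_nonneg _
  have h2 : 0 ≤ ∫ x, deriv η x ^ 2 := integral_nonneg fun _ => sq_nonneg _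
  rw [energyNorm_sq]
  constructor <;> linarith

/-- The `L²` norm of the velocity of the vortex flow on the surface, up to a factor. -/
def surfaceVelocityNorm (h : ℝ) : ℝ := Real.sqrt (∫ x, (3 * surfaceVelocity h x) ^ 2)

lemma integrable_mul_of_memLp_two {f g : ℝ → ℝ} (hf : MemLp f 2) (hg : MemLp g 2) :
    Integrable fun x => f x * g x := hf.integrable_mul hg

namespace IsSmallSurface

lemma sqrt_integral_normalVelocity_le (hη : IsSmallSurface h m η) (hh : 0 < h) :
    Real.sqrt (∫ x, normalVelocity h η x ^ 2) ≤ surfaceVelocityNorm h := by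
  refine Real.sqrt_le_sqrt (integral_mono (hη.memLp_normalVelocity hh).integrable_sq
    ((memLp_surfaceVelocity hh).const_mul 3).integrable_sq fun x => ?_)
  obtain ⟨h1, h2⟩ := hη.normalVelocity_bounds hh x
  have h3 := surfaceVelocity_pos hh x
  exact pow_le_pow_left₀ (by linarith) h2 2

/-- The terms of the dynamic head that are linear in the velocity. -/
lemma integral_abs_total_mul_le (hη : IsSmallSurface h m η) (hh : 0 < h) (hw : MemLp w 2)
    (hφ : MemLp φ 2) : ∫ x, |(w x + ε * normalVelocity h η x) * φ x| ≤
      (Real.sqrt (∫ x, w x ^ 2) + |ε| * surfaceVelocityNorm h) * Real.sqrt (∫ x, φ x ^ 2) := by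
  have hb := hη.memLp_normalVelocity hh
  have i1 := (integrable_mul_of_memLp_two hw hφ).abs
  have i2 := (integrable_mul_of_memLp_two hb hφ).abs
  have h1 := integral_abs_mul_le hw hφ
  have h2 := integral_abs_mul_le hb hφ
  have h3 : ∫ x, |(w x + ε * normalVelocity h η x) * φ x| ≤
      (∫ x, |w x * φ x|) + |ε| * ∫ x, |normalVelocity h η x * φ x| := by
    rw [← integral_const_mul, ← integral_add i1 (i2.const_mul _)]
    refine integral_mono (integrable_mul_of_memLp_two (hη.memLp_total hh hw) hφ).abs (i1.add (i2.const_mul _)) fun x => ?_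
    simp only
    rw [add_mul, mul_assoc]
    refine (abs_add_le _ _).trans (le_of_eq ?_)
    rw [abs_mul ε]
  have h4 := mul_le_mul_of_nonneg_right (hη.sqrt_integral_normalVelocity_le hh)
    (Real.sqrt_nonneg (∫ x, φ x ^ 2))
  have h5 := mul_le_mul_of_nonneg_left (h2.trans h4) (abs_nonneg ε)
  linarith

lemma total_sq_integral_le (hη : IsSmallSurface h m η) (hh : 0 < h) (hw : MemLp w 2) :
    ∫ x, (w x + ε * normalVelocity h η x) ^ 2 ≤
      2 * (∫ x, w x ^ 2) + 2 * (ε ^ 2 * surfaceVelocityNorm h ^ 2) := by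
  have hb := hη.memLp_normalVelocity hh
  have h1 : ∫ x, (w x + ε * normalVelocity h η x) ^ 2 ≤
      2 * (∫ x, w x ^ 2) + 2 * ε ^ 2 * ∫ x, normalVelocity h η x ^ 2 := by
    rw [← integral_const_mul, ← integral_const_mul,
      ← integral_add (hw.integrable_sq.const_mul _) (hb.integrable_sq.const_mul _)]
    refine integral_mono (hη.memLp_total hh hw).integrable_sq
      ((hw.integrable_sq.const_mul _).add (hb.integrable_sq.const_mul _)) fun x => ?_
    simp only
    nlinarith [sq_nonneg (w x - ε * normalVelocity h η x)]
  have h2 : ∫ x, normalVelocity h η x ^ 2 ≤ surfaceVelocityNorm h ^ 2 := by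
    have h3 := hη.sqrt_integral_normalVelocity_le hh
    exact (Real.sqrt_le_left (Real.sqrt_nonneg _)).1 h3
  nlinarith [sq_nonneg ε]

/-- The energy estimate for a small wave. -/
theorem energy_estimate (hη : IsSmallSurface h m η) (hh : 0 < h) (hw : MemLp w 2) {k : ℝ}
    (hkg : k ≤ g) (hkα : k ≤ α ^ 2 / 2)
    (H : (∫ x, dynamicHead h η w c ε x * η x) + g * (∫ x, η x * η x) +
      α ^ 2 * ∫ x, deriv η x / bracket (deriv η x) * deriv η x = 0) :
    k * energyNorm η ^ 2 ≤ m * (2 * (∫ x, w x ^ 2) + 2 * (ε ^ 2 * surfaceVelocityNorm h ^ 2)) +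
      |c| * ((Real.sqrt (∫ x, w x ^ 2) + |ε| * surfaceVelocityNorm h) * energyNorm η) +
      c ^ 2 * m * energyNorm η ^ 2 := by
  have hm := hη.nonneg
  have hp := hη.memLp_total (ε := ε) hh hw
  have i1 := hp.integrable_sq.const_mul m
  have i2 := (integrable_mul_of_memLp_two hp hη.memLp).abs.const_mul |c|
  have i3 := hη.memLp_deriv.integrable_sq.const_mul (c ^ 2 * m)
  -- Quadratic terms carry the factor `m ≥ |η|`. The term linear in the velocity is kept as a
  -- product with `η`, so that Cauchy–Schwarz yields a factor `energyNorm η`.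
  have e1 : -(∫ x, dynamicHead h η w c ε x * η x) ≤ m * (∫ x, (w x + ε * normalVelocity h η x) ^ 2) +
      |c| * (∫ x, |(w x + ε * normalVelocity h η x) * η x|) + c ^ 2 * m * ∫ x, deriv η x ^ 2 := by
    rw [← integral_const_mul, ← integral_const_mul, ← integral_const_mul, ← integral_neg,
      ← integral_add i1 i2, ← integral_add (i1.fun_add i2) i3]
    refine integral_mono (hη.integrable_dynamicHead_mul hh hw hη.memLp hη.abs_le).neg
      ((i1.fun_add i2).fun_add i3) fun x => ?_
    simp only
    refine (neg_le_abs _).trans ?_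
    rw [abs_mul, abs_mul (w x + ε * normalVelocity h η x)]
    have h1 := mul_le_mul_of_nonneg_right (abs_dynamicHead_le (h := h) (η := η) (w := w) (c := c)
      (ε := ε) x) (abs_nonneg (η x))
    have h2 := mul_le_mul_of_nonneg_left (hη.abs_le x) (sq_nonneg (w x + ε * normalVelocity h η x))
    have h3 := mul_le_mul_of_nonneg_left (hη.abs_le x) (mul_nonneg (sq_nonneg c) (sq_nonneg (deriv η x)))
    linarith
  have e2 : (∫ x, η x * η x) = ∫ x, η x ^ 2 := integral_congr_ae (Eventually.of_forall fun x => (sq _).symm)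
  -- `⟨η'⟩ ≤ 2` because `|η'| ≤ 1`; hence the coercivity constant `α²/2`.
  have e3 : 1 / 2 * (∫ x, deriv η x ^ 2) ≤ ∫ x, deriv η x / bracket (deriv η x) * deriv η x := by
    rw [← integral_const_mul]
    refine integral_mono (hη.memLp_deriv.integrable_sq.const_mul _)
      (integrable_mul_of_memLp_two hη.memLp_div_bracket hη.memLp_deriv) fun x => ?_
    simp only
    have hb := one_le_bracket (deriv η x)
    have hb' := bracket_le ((hη.abs_deriv_le x).trans hη.le_one)
    rw [div_mul_eq_mul_div (deriv η x), ← sq, le_div_iff₀ (by linarith)]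
    nlinarith [sq_nonneg (deriv η x)]
  have a1 := mul_le_mul_of_nonneg_left (hη.total_sq_integral_le (ε := ε) hh hw) hm
  have a2 := mul_le_mul_of_nonneg_left ((hη.integral_abs_total_mul_le (ε := ε) hh hw hη.memLp).trans
    (mul_le_mul_of_nonneg_left (sqrt_integral_sq_le_energyNorm η) (by
      have := Real.sqrt_nonneg (∫ x, w x ^ 2)
      have := Real.sqrt_nonneg (∫ x, (3 * surfaceVelocity h x) ^ 2)
      unfold surfaceVelocityNorm
      positivity))) (abs_nonneg c)
  have a3 := mul_le_mul_of_nonneg_left (integral_sq_le_energyNorm_sq η).2 (mul_nonneg (sq_nonneg c) hm)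
  have n1 : 0 ≤ ∫ x, η x ^ 2 := integral_nonneg fun _ => sq_nonneg _
  have n2 : 0 ≤ ∫ x, deriv η x ^ 2 := integral_nonneg fun _ => sq_nonneg _
  rw [e2] at H
  have a4 := mul_le_mul_of_nonneg_left e3 (sq_nonneg α)
  have a5 := mul_le_mul_of_nonneg_right hkg n1
  have a6 := mul_le_mul_of_nonneg_right hkα n2
  have a7 : k * energyNorm η ^ 2 = k * (∫ x, η x ^ 2) + k * ∫ x, deriv η x ^ 2 := by
    rw [energyNorm_sq]; ring
  rw [a7]
  linarith

/-- Testing the Bernoulli equation with a positive solution of a Helmholtz equation. -/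
theorem test_estimate (hη : IsSmallSurface h m η) (hh : 0 < h) (hw : MemLp w 2) (V : 𝓢(ℝ, ℝ))
    {F : ℝ → ℝ} (hV : ∀ x, g * V x - α ^ 2 * deriv (deriv V) x = F x) (hpos : ∀ x, 0 < V x)
    (hM : ∀ x, V x ≤ M) (hM' : ∀ x, |deriv V x| ≤ M)
    (H : (∫ x, dynamicHead h η w c ε x * V x) + g * (∫ x, η x * V x) +
      α ^ 2 * ∫ x, deriv η x / bracket (deriv η x) * deriv V x = 0) :
    ∫ x, η x * F x ≤ -(ε ^ 2 / 128 * ∫ x, surfaceVelocity h x ^ 2 * V x) + M * (∫ x, w x ^ 2) +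
      |c| * ((Real.sqrt (∫ x, w x ^ 2) + |ε| * surfaceVelocityNorm h) * Real.sqrt (∫ x, V x ^ 2)) +
      c ^ 2 * M * energyNorm η ^ 2 + α ^ 2 * M * energyNorm η ^ 2 := by
  have hM0 : 0 ≤ M := (hpos 0).le.trans (hM 0)
  have hV2 : MemLp V 2 := V.memLp 2 volume
  set V' : 𝓢(ℝ, ℝ) := SchwartzMap.derivCLM ℝ ℝ V with hV'd
  set V'' : 𝓢(ℝ, ℝ) := SchwartzMap.derivCLM ℝ ℝ V' with hV''d
  have dV : deriv V = V' := funext fun x => (SchwartzMap.derivCLM_apply ℝ V x).symm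
  have dV' : deriv V' = V'' := funext fun x => (SchwartzMap.derivCLM_apply ℝ V' x).symm
  rw [dV] at H hM'
  simp only [dV, dV'] at hV
  have hV'2 : MemLp V' 2 := V'.memLp 2 volume
  have hV''2 : MemLp V'' 2 := V''.memLp 2 volume
  have hβ := memLp_surfaceVelocity hh
  have hp := hη.memLp_total (ε := ε) hh hw
  have hVa : ∀ x, |V x| ≤ M := fun x => by rw [abs_of_pos (hpos x)]; exact hM x
  -- integration by parts
  have hibp : ∫ x, deriv η x * V' x = -∫ x, η x * V'' x := by
    have h1 := integral_mul_deriv_eq_deriv_mul_of_integrable (u := η) (v := V') (u' := deriv η) (v' := V'')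
      (fun x _ => (hη.differentiable x).hasDerivAt)
      (fun x _ => by rw [← dV']; exact (V'.differentiableAt).hasDerivAt)
      (integrable_mul_of_memLp_two hη.memLp hV''2) (integrable_mul_of_memLp_two hη.memLp_deriv hV'2) (integrable_mul_of_memLp_two hη.memLp hV'2)
    linarith
  have e1 : ∫ x, η x * F x = g * (∫ x, η x * V x) + α ^ 2 * ∫ x, deriv η x * V' x := by
    rw [hibp, ← integral_const_mul, mul_neg, ← integral_const_mul, ← sub_eq_add_neg,
      ← integral_sub ((integrable_mul_of_memLp_two hη.memLp hV2).const_mul g)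
        ((integrable_mul_of_memLp_two hη.memLp hV''2).const_mul (α ^ 2))]
    refine integral_congr_ae (Eventually.of_forall fun x => ?_)
    simp only [← hV]
    ring
  -- the curvature correction
  have e2 : (∫ x, deriv η x * V' x) - (∫ x, deriv η x / bracket (deriv η x) * V' x) ≤
      M * ∫ x, deriv η x ^ 2 := by
    rw [← integral_sub (integrable_mul_of_memLp_two hη.memLp_deriv hV'2) (integrable_mul_of_memLp_two hη.memLp_div_bracket hV'2),
      ← integral_const_mul]
    refine integral_mono ((integrable_mul_of_memLp_two hη.memLp_deriv hV'2).sub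
      (integrable_mul_of_memLp_two hη.memLp_div_bracket hV'2)) (hη.memLp_deriv.integrable_sq.const_mul _) fun x => ?_
    simp only
    have hb := one_le_bracket (deriv η x)
    have hb2 : bracket (deriv η x) - 1 ≤ |deriv η x| * bracket (deriv η x) := by
      have h1 : bracket (deriv η x) ≤ 1 + |deriv η x| := by
        rw [bracket, Real.sqrt_le_left (by positivity)]
        nlinarith [sq_abs (deriv η x), abs_nonneg (deriv η x)]
      nlinarith [abs_nonneg (deriv η x)]
    have h2 : |1 - 1 / bracket (deriv η x)| ≤ |deriv η x| := by
      have h3 : 1 / bracket (deriv η x) ≤ 1 := by rw [div_le_one (by linarith)]; exact hb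
      rw [abs_of_nonneg (by linarith), sub_le_iff_le_add, ← sub_le_iff_le_add', le_div_iff₀ (by linarith)]
      linarith
    calc deriv η x * V' x - deriv η x / bracket (deriv η x) * V' x
        = deriv η x * (1 - 1 / bracket (deriv η x)) * V' x := by ring
      _ ≤ |deriv η x * (1 - 1 / bracket (deriv η x)) * V' x| := le_abs_self _
      _ = |deriv η x| * |1 - 1 / bracket (deriv η x)| * |V' x| := by rw [abs_mul, abs_mul]
      _ ≤ |deriv η x| * |deriv η x| * M := by gcongr; exact hM' x
      _ = M * deriv η x ^ 2 := by rw [← sq_abs (deriv η x)]; ring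
  -- the dynamic head
  have i0 : Integrable fun x => surfaceVelocity h x ^ 2 * V x := by
    refine hβ.integrable_sq.mul_bdd (c := M) V.continuous.aestronglyMeasurable (Eventually.of_forall hVa)
  have i1 := i0.const_mul (ε ^ 2 / 128)
  have i2 := hw.integrable_sq.const_mul M
  have i3 := (integrable_mul_of_memLp_two hp hV2).abs.const_mul |c|
  have i4 := hη.memLp_deriv.integrable_sq.const_mul (c ^ 2 * M)
  have e3 : -(∫ x, dynamicHead h η w c ε x * V x) ≤
      -(ε ^ 2 / 128 * ∫ x, surfaceVelocity h x ^ 2 * V x) + M * (∫ x, w x ^ 2) +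
      |c| * (∫ x, |(w x + ε * normalVelocity h η x) * V x|) + c ^ 2 * M * ∫ x, deriv η x ^ 2 := by
    rw [← integral_const_mul, ← integral_const_mul, ← integral_const_mul, ← integral_const_mul,
      ← integral_neg, ← integral_neg, ← integral_add i1.fun_neg i2, ← integral_add (i1.fun_neg.fun_add i2) i3,
      ← integral_add ((i1.fun_neg.fun_add i2).fun_add i3) i4]
    refine integral_mono (hη.integrable_dynamicHead_mul hh hw hV2 hVa).neg
      (((i1.fun_neg.fun_add i2).fun_add i3).fun_add i4) fun x => ?_
    simp only
    have hb := one_le_bracket (deriv η x)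
    have hJ : 1 ≤ bracket (deriv η x) ^ 2 := one_le_pow₀ hb
    have hJ' : bracket (deriv η x) ^ 2 ≤ 2 := by
      have h1 := pow_le_one₀ (n := 2) (abs_nonneg _) ((hη.abs_deriv_le x).trans hη.le_one)
      rw [sq_abs] at h1
      rw [bracket_sq]
      linarith
    obtain ⟨n1, -⟩ := hη.normalVelocity_bounds hh x
    have n0 := surfaceVelocity_pos hh x
    have n2 : 1 / 16 * surfaceVelocity h x ^ 2 ≤ normalVelocity h η x ^ 2 := by nlinarith
    have hVx := hpos x
    have hVM := hM x
    rw [dynamicHead, abs_mul, abs_of_pos hVx]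
    -- The square of the total velocity contains half that of the vortex flow up to `w²`.
    have q0 : 1 / 2 * (ε * normalVelocity h η x) ^ 2 - w x ^ 2 ≤ (w x + ε * normalVelocity h η x) ^ 2 := by
      nlinarith [sq_nonneg (2 * w x + ε * normalVelocity h η x)]
    -- `n² ≥ b²/16` gives `1/32`; division by `2⟨η'⟩² ≤ 4` gives the `1/128` of the statement.
    have q1 : 1 / 32 * ε ^ 2 * surfaceVelocity h x ^ 2 ≤ 1 / 2 * (ε * normalVelocity h η x) ^ 2 := by
      rw [mul_pow]
      nlinarith [mul_le_mul_of_nonneg_left n2 (sq_nonneg ε)]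
    generalize w x + ε * normalVelocity h η x = p at *
    generalize bracket (deriv η x) ^ 2 = J at *
    have q2 : -(c * p) ≤ |c| * |p| := by rw [← abs_mul]; exact neg_le_abs _
    have q3 : 0 ≤ |c| * |p| := by positivity
    have hT : -((p ^ 2 + 2 * c * p - c ^ 2 * deriv η x ^ 2) / (2 * J)) ≤
        -(ε ^ 2 / 128 * surfaceVelocity h x ^ 2) + w x ^ 2 + |c| * |p| + c ^ 2 * deriv η x ^ 2 := by
      rw [← neg_div, div_le_iff₀ (by linarith)]
      have z1 := mul_nonneg (sub_nonneg.2 hJ) (sq_nonneg (w x))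
      have z2 := mul_nonneg (sub_nonneg.2 hJ) q3
      have z3 := mul_nonneg (sub_nonneg.2 hJ) (mul_nonneg (sq_nonneg c) (sq_nonneg (deriv η x)))
      have z4 := mul_nonneg (sub_nonneg.2 hJ') (mul_nonneg (sq_nonneg ε) (sq_nonneg (surfaceVelocity h x)))
      have z5 := sq_nonneg (w x)
      have z6 := mul_nonneg (sq_nonneg c) (sq_nonneg (deriv η x))
      linarith
    have y1 := mul_le_mul_of_nonneg_right hT hVx.le
    have y2 := mul_le_mul_of_nonneg_left hVM (sq_nonneg (w x))
    have y3 := mul_le_mul_of_nonneg_left hVM (mul_nonneg (sq_nonneg c) (sq_nonneg (deriv η x)))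
    linarith
  have a1 := mul_le_mul_of_nonneg_left (hη.integral_abs_total_mul_le (ε := ε) hh hw hV2) (abs_nonneg c)
  have a2 := mul_le_mul_of_nonneg_left (integral_sq_le_energyNorm_sq η).2 (mul_nonneg (sq_nonneg c) hM0)
  have a3 := mul_le_mul_of_nonneg_left (e2.trans (mul_le_mul_of_nonneg_left
    (integral_sq_le_energyNorm_sq η).2 hM0)) (sq_nonneg α)
  rw [e1]
  linarith

end IsSmallSurface

end Estimates

end PointVortex
end

/-! ### The leading term of the velocity -/

noncomputable section
namespace PointVortex

section Speed

variable {h m c ε g α : ℝ} {η w : ℝ → ℝ}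

/-- The derivative of the kernel at the undisturbed surface. -/
def surfaceKernel (h x : ℝ) : ℝ := 2 * (Real.pi / h) / Real.cosh (Real.pi / h * x) ^ 2

lemma kernelDeriv_half (h x : ℝ) : kernelDeriv (Real.pi / h) (Real.cos (Real.pi * (1 / 2))) x =
    (surfaceKernel h x : ℂ) := by
  rw [kernelDeriv_ofReal, show Real.pi * (1 / 2) = Real.pi / 2 by ring, Real.cos_pi_div_two]
  simp [surfaceKernel]

lemma surfaceKernel_pos (hh : 0 < h) (x : ℝ) : 0 < surfaceKernel h x := by
  have := Real.cosh_pos (Real.pi / h * x)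
  have := Real.pi_pos
  unfold surfaceKernel
  positivity

lemma surfaceKernel_le (hh : 0 < h) (x : ℝ) : surfaceKernel h x ≤ 2 * (Real.pi / h) := by
  have := Real.pi_pos
  exact div_le_self (by positivity) (one_le_pow₀ (Real.one_le_cosh _))

lemma continuous_surfaceVelocity (h : ℝ) : Continuous (surfaceVelocity h) :=
  continuous_const.div (Real.continuous_cosh.comp (by fun_prop)) fun x => (Real.cosh_pos _).ne'

lemma continuous_surfaceKernel (h : ℝ) : Continuous (surfaceKernel h) :=
  continuous_const.div ((Real.continuous_cosh.comp (by fun_prop)).pow 2) fun x =>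
    (pow_pos (Real.cosh_pos _) 2).ne'

lemma memLp_surfaceKernel (hh : 0 < h) : MemLp (surfaceKernel h) 2 := by
  refine ((memLp_surfaceVelocity hh).const_mul (4 * Real.pi)).mono
    (continuous_surfaceKernel h).aestronglyMeasurable (Eventually.of_forall fun x => ?_)
  have h1 := Real.one_le_cosh (Real.pi / h * x)
  have h2 := Real.pi_pos
  have h3 := surfaceVelocity_pos hh x
  rw [Real.norm_of_nonneg (surfaceKernel_pos hh x).le, Real.norm_of_nonneg (by positivity), surfaceKernel,
    surfaceVelocity]
  calc 2 * (Real.pi / h) / Real.cosh (Real.pi / h * x) ^ 2 ≤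
      2 * (Real.pi / h) / Real.cosh (Real.pi / h * x) := by
        gcongr
        exact le_self_pow₀ h1 (by norm_num)
    _ = _ := by field_simp; ring

lemma memLp_surfaceVelocity_mul_surfaceKernel (hh : 0 < h) :
    MemLp (fun x => surfaceVelocity h x * surfaceKernel h x) 2 := by
  refine ((memLp_surfaceKernel hh).const_mul (1 / (2 * h))).mono
    ((continuous_surfaceVelocity h).mul (continuous_surfaceKernel h)).aestronglyMeasurable
    (Eventually.of_forall fun x => ?_)
  have h1 := surfaceKernel_pos hh x
  have h2 := surfaceVelocity_pos hh x
  rw [Real.norm_of_nonneg (by positivity), Real.norm_of_nonneg (by positivity)]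
  exact mul_le_mul_of_nonneg_right (surfaceVelocity_le hh x) h1.le

/-- The Schwartz solution of the Helmholtz equation that is used as a test function. -/
lemma exists_test_function (hg : 0 < g) (hh : 0 < h) : ∃ V : 𝓢(ℝ, ℝ),
    (∀ x, g * V x - α ^ 2 * deriv (deriv V) x = surfaceVelocity h x * surfaceKernel h x) ∧ ∀ x, 0 < V x := by
  obtain ⟨b, hb⟩ := exists_schwartz_vortexStreamY (θ := 1 / 2) hh (by norm_num) le_rfl
  have hbt : (b : ℝ → ℂ).HasTemperateGrowth := b.hasTemperateGrowth
  have hpos : ∀ x, 0 < surfaceVelocity h x * surfaceKernel h x := fun x =>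
    mul_pos (surfaceVelocity_pos hh x) (surfaceKernel_pos hh x)
  obtain ⟨V, -, hV⟩ := exists_schwartz_invHelmholtz (α := α) hg
    (f := fun x => surfaceVelocity h x * surfaceKernel h x)
    ((8 * Real.pi * h : ℂ) • SchwartzMap.smulLeftCLM ℂ b (SchwartzMap.smulLeftCLM ℂ b b)) (fun x => by
      rw [_root_.smul_apply, SchwartzMap.smulLeftCLM_apply_apply hbt, SchwartzMap.smulLeftCLM_apply_apply hbt,
        hb, vortexStreamY_half_zero hh]
      -- The right-hand side is a multiple of the cube of `Φ_y(·,0)`, hence a Schwartz function.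
      have e : surfaceKernel h x = 8 * Real.pi * h * surfaceVelocity h x ^ 2 := by
        have := (Real.cosh_pos (Real.pi / h * x)).ne'
        rw [surfaceKernel, surfaceVelocity]
        field_simp
        ring
      rw [e]
      simp only [smul_eq_mul]
      push_cast
      ring)
  exact ⟨V, hV, pos_of_helmholtz_pos hg V fun x => by rw [hV]; exact hpos x⟩

lemma measurable_kernelDeriv (κ q : ℝ) : Measurable (kernelDeriv κ q) := by
  unfold kernelDeriv kernelDen
  have h1 : Measurable fun z : ℂ => Complex.cosh (κ * z) :=
    (Complex.continuous_cosh.comp (by fun_prop)).measurable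
  exact Measurable.div (by fun_prop) (by fun_prop)

/-- The leading term of the velocity of a small wave. -/
theorem exists_speed_estimate (hh : 0 < h) : ∃ C, 0 < C ∧ ∀ {m c ε : ℝ} {η w : ℝ → ℝ},
    IsSmallSurface h m η → MemLp w 2 →
    4 * h * c = (∫ x, (c * η x + ε * vortexStream h (1 / 2) x (η x)) * (-deriv η x *
          (kernelDeriv (Real.pi / h) (Real.cos (Real.pi * (1 / 2))) ⟨x, η x⟩).im +
        (kernelDeriv (Real.pi / h) (Real.cos (Real.pi * (1 / 2))) ⟨x, η x⟩).re)) +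
      (∫ x, (kernel (Real.pi / h) (Real.cos (Real.pi * (1 / 2))) ⟨x, η x⟩).im * w x) →
    |4 * h * c - ε * ∫ x, η x * (surfaceVelocity h x * surfaceKernel h x)| ≤
      C * (|c| * energyNorm η + (|c| + |ε|) * energyNorm η ^ 2 +
        energyNorm η * Real.sqrt (∫ x, w x ^ 2)) ∧
    |∫ x, η x * (surfaceVelocity h x * surfaceKernel h x)| ≤ C * energyNorm η := by
  obtain ⟨A, hA, hAb⟩ := exists_kernel_surface_bound (θ := 1 / 2) hh (by norm_num) le_rfl
  set N₁ := Real.sqrt (∫ x, surfaceKernel h x ^ 2) with hN₁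
  set N₂ := Real.sqrt (∫ x, (surfaceVelocity h x * surfaceKernel h x) ^ 2) with hN₂
  have hN₁0 : 0 ≤ N₁ := Real.sqrt_nonneg _
  have hN₂0 : 0 ≤ N₂ := Real.sqrt_nonneg _
  have hκ : 0 < Real.pi / h := div_pos Real.pi_pos hh
  set B := 2 * A + 2 * (Real.pi / h) / h * (2 * (Real.pi / h)) + 1 / h * (2 * A) with hB
  have hB0 : 0 < B := by positivity
  refine ⟨N₁ + N₂ + B + A, by positivity, ?_⟩
  intro m c ε η w hη hw hc
  have hk₁ := memLp_surfaceKernel hh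
  have hk₂ := memLp_surfaceVelocity_mul_surfaceKernel hh
  have hE := energyNorm_nonneg η
  have hW := Real.sqrt_nonneg (∫ x, w x ^ 2)
  have hdep := hη.abs_le_depth hh
  have hηE := sqrt_integral_sq_le_energyNorm η
  have j1 : (∫ x, |η x * surfaceKernel h x|) ≤ energyNorm η * N₁ :=
    (integral_abs_mul_le hη.memLp hk₁).trans (mul_le_mul_of_nonneg_right hηE hN₁0)
  have j2 : (∫ x, |η x * (surfaceVelocity h x * surfaceKernel h x)|) ≤ energyNorm η * N₂ :=
    (integral_abs_mul_le hη.memLp hk₂).trans (mul_le_mul_of_nonneg_right hηE hN₂0)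
  have j3 : (∫ x, |η x * w x|) ≤ energyNorm η * Real.sqrt (∫ x, w x ^ 2) :=
    (integral_abs_mul_le hη.memLp hw).trans (mul_le_mul_of_nonneg_right hηE hW)
  have i1 := (integrable_mul_of_memLp_two hη.memLp hk₁).abs
  have i2 := integrable_mul_of_memLp_two hη.memLp hk₂
  have i3 := (integrable_mul_of_memLp_two hη.memLp hw).abs
  set G : ℝ → ℝ := fun x => |c| * |η x * surfaceKernel h x| + (|c| + |ε|) * B * η x ^ 2 with hG
  have iG : Integrable G := (i1.const_mul _).add (hη.memLp.integrable_sq.const_mul _)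
  set K : ℝ → ℝ := fun x => -deriv η x *
      (kernelDeriv (Real.pi / h) (Real.cos (Real.pi * (1 / 2))) ⟨x, η x⟩).im +
    (kernelDeriv (Real.pi / h) (Real.cos (Real.pi * (1 / 2))) ⟨x, η x⟩).re with hK
  -- On the flat surface `K'` is real, so its imaginary part on the curved surface is also of order
  -- `|η|`.
  have hKb : ∀ x, |K x - surfaceKernel h x| ≤ 2 * A * |η x| := fun x => by
    obtain ⟨-, h2⟩ := hAb x (η x) (hdep x)
    rw [kernelDeriv_half] at h2
    simp only [hK]
    generalize kernelDeriv (Real.pi / h) (Real.cos (Real.pi * (1 / 2))) ⟨x, η x⟩ = k at *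
    have h3 := (Complex.abs_im_le_norm (k - surfaceKernel h x)).trans h2
    have h4 := (Complex.abs_re_le_norm (k - surfaceKernel h x)).trans h2
    rw [Complex.sub_im, Complex.ofReal_im, sub_zero] at h3
    rw [Complex.sub_re, Complex.ofReal_re] at h4
    have h5 : |-deriv η x * k.im| ≤ A * |η x| := by
      rw [abs_mul, abs_neg]
      calc |deriv η x| * |k.im| ≤ 1 * (A * |η x|) := by
            gcongr
            exact (hη.abs_deriv_le x).trans hη.le_one
        _ = _ := one_mul _
    calc |-deriv η x * k.im + k.re - surfaceKernel h x| =
        |-deriv η x * k.im + (k.re - surfaceKernel h x)| := by ring_nf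
      _ ≤ _ := abs_add_le _ _
      _ ≤ 2 * A * |η x| := by linarith
  have hKm : AEStronglyMeasurable K volume := by
    have h1 : Measurable fun x : ℝ => kernelDeriv (Real.pi / h) (Real.cos (Real.pi * (1 / 2))) ⟨x, η x⟩ := by
      refine (measurable_kernelDeriv _ _).comp ?_
      simpa using (continuous_mk_sub hη.continuous 0).measurable
    exact ((hη.continuous_deriv.measurable.neg.mul (Complex.measurable_im.comp h1)).add
      (Complex.measurable_re.comp h1)).aestronglyMeasurable
  have hΦc : Continuous fun x => vortexStream h (1 / 2) x (η x) :=
    continuous_iff_continuousAt.2 fun x =>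
      (hasDerivAt_vortexStream_surface hh hη.differentiable (hdep x)).continuousAt
  -- `Φ(x,η)` is replaced by its linear part `bη` and `K` by its value at the flat surface. Each
  -- replacement costs a further factor `η`, and the term `cηk` is counted as an error as well.
  have hpt : ∀ x, |(c * η x + ε * vortexStream h (1 / 2) x (η x)) * K x -
      ε * (η x * (surfaceVelocity h x * surfaceKernel h x))| ≤ G x := fun x => by
    obtain ⟨f1, f2⟩ := vortexStream_half_bounds hh (hdep x) x
    have f3 := hKb x
    have f4 := surfaceKernel_pos hh x
    have f5 := surfaceKernel_le hh x
    simp only [hG]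
    generalize vortexStream h (1 / 2) x (η x) = F at *
    generalize K x = k at *
    have e : (c * η x + ε * F) * k - ε * (η x * (surfaceVelocity h x * surfaceKernel h x)) =
        c * (η x * surfaceKernel h x) + (c * η x * (k - surfaceKernel h x) +
        (ε * ((F - surfaceVelocity h x * η x) * surfaceKernel h x) +
          ε * (F * (k - surfaceKernel h x)))) := by ring
    have g1 : |c * η x * (k - surfaceKernel h x)| ≤ |c| * (2 * A * η x ^ 2) := by
      rw [abs_mul, abs_mul, ← sq_abs (η x), mul_assoc]
      calc |c| * (|η x| * |k - surfaceKernel h x|) ≤ |c| * (|η x| * (2 * A * |η x|)) := by gcongr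
        _ = _ := by ring
    have g2 : |ε * ((F - surfaceVelocity h x * η x) * surfaceKernel h x)| ≤
        |ε| * (2 * (Real.pi / h) / h * (2 * (Real.pi / h)) * η x ^ 2) := by
      rw [abs_mul, abs_mul, abs_of_pos f4, ← sq_abs (η x)]
      calc |ε| * (|F - surfaceVelocity h x * η x| * surfaceKernel h x) ≤
          |ε| * (2 * (Real.pi / h) / h * |η x| ^ 2 * (2 * (Real.pi / h))) := by gcongr
        _ = _ := by ring
    have g3 : |ε * (F * (k - surfaceKernel h x))| ≤ |ε| * (1 / h * (2 * A) * η x ^ 2) := by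
      rw [abs_mul, abs_mul, ← sq_abs (η x)]
      calc |ε| * (|F| * |k - surfaceKernel h x|) ≤ |ε| * (1 / h * |η x| * (2 * A * |η x|)) := by gcongr
        _ = _ := by ring
    rw [e]
    refine (abs_add_le _ _).trans (add_le_add (abs_mul _ _).le ?_)
    refine (abs_add_le _ _).trans ((add_le_add g1 ((abs_add_le _ _).trans (add_le_add g2 g3))).trans ?_)
    have z1 : 0 ≤ |c| * ((2 * (Real.pi / h) / h * (2 * (Real.pi / h)) + 1 / h * (2 * A)) * η x ^ 2) := by
      positivity
    have z2 : 0 ≤ |ε| * (2 * A * η x ^ 2) := by positivity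
    rw [hB]
    linarith
  have hGi : ∫ x, G x ≤ |c| * (energyNorm η * N₁) + (|c| + |ε|) * B * energyNorm η ^ 2 := by
    simp only [hG]
    rw [integral_add (i1.const_mul _) (hη.memLp.integrable_sq.const_mul _), integral_const_mul,
      integral_const_mul]
    have := (integral_sq_le_energyNorm_sq η).1
    gcongr
  have iD : Integrable fun x => (c * η x + ε * vortexStream h (1 / 2) x (η x)) * K x -
      ε * (η x * (surfaceVelocity h x * surfaceKernel h x)) := by
    refine iG.mono' ?_ (Eventually.of_forall hpt)
    refine AEStronglyMeasurable.sub (AEStronglyMeasurable.mul ?_ hKm) (i2.const_mul ε).aestronglyMeasurable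
    exact ((hη.continuous.const_mul c).add (hΦc.const_mul ε)).aestronglyMeasurable
  have iF : Integrable fun x => (c * η x + ε * vortexStream h (1 / 2) x (η x)) * K x :=
    (iD.add (i2.const_mul ε)).congr (Eventually.of_forall fun x => by simp)
  -- `Im K` vanishes on the flat surface, so on the curved one it is of order `|η|`.
  have hI2 : |∫ x, (kernel (Real.pi / h) (Real.cos (Real.pi * (1 / 2))) ⟨x, η x⟩).im * w x| ≤
      A * (energyNorm η * Real.sqrt (∫ x, w x ^ 2)) := by
    rw [← Real.norm_eq_abs]
    refine (norm_integral_le_of_norm_le (i3.const_mul A) (Eventually.of_forall fun x => ?_)).trans ?_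
    · rw [norm_mul, Real.norm_eq_abs, Real.norm_eq_abs, abs_mul, ← mul_assoc]
      exact mul_le_mul_of_nonneg_right (hAb x (η x) (hdep x)).1 (abs_nonneg _)
    · rw [integral_const_mul]
      gcongr
  have hI1 : |∫ x, ((c * η x + ε * vortexStream h (1 / 2) x (η x)) * K x -
      ε * (η x * (surfaceVelocity h x * surfaceKernel h x)))| ≤
      |c| * (energyNorm η * N₁) + (|c| + |ε|) * B * energyNorm η ^ 2 := by
    rw [← Real.norm_eq_abs]
    exact (norm_integral_le_of_norm_le iG (Eventually.of_forall hpt)).trans hGi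
  rw [integral_sub iF (i2.const_mul ε), integral_const_mul] at hI1
  have t1 : 0 ≤ |c| * energyNorm η := by positivity
  have t2 : 0 ≤ (|c| + |ε|) * energyNorm η ^ 2 := by positivity
  have t3 : 0 ≤ energyNorm η * Real.sqrt (∫ x, w x ^ 2) := by positivity
  constructor
  · rw [hc, add_sub_right_comm]
    refine (abs_add_le _ _).trans ((add_le_add hI1 hI2).trans ?_)
    nlinarith [mul_nonneg hN₁0 t2, mul_nonneg hN₁0 t3, mul_nonneg hN₂0 t1, mul_nonneg hN₂0 t2,
      mul_nonneg hN₂0 t3, mul_nonneg hB0.le t1, mul_nonneg hB0.le t3, mul_nonneg hA.le t1,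
      mul_nonneg hA.le t2]
  · refine (abs_integral_le_integral_abs).trans (j2.trans ?_)
    nlinarith [mul_nonneg hE hN₁0, mul_nonneg hE hB0.le, mul_nonneg hE hA.le]

end Speed

end PointVortex
end

/-! ### Combination of the estimates: the sign of the velocity -/

noncomputable section
namespace PointVortex

section Sign

variable {h C D K σ δ k a e m E W T L : ℝ}

/-- With all parameters below `δ` the energy inequality becomes `E² ≤ C³δ(8E² + 2e²)`. The choice of
`δ` makes this `E² ≤ E²/2 + σ²e²/8`, and the first term is absorbed. -/
lemma energy_le_of_estimates (hC : 1 ≤ C) (hσ0 : 0 < σ) (hσ1 : σ ≤ 1) (hδC : C ^ 3 * δ = σ ^ 2 / 16)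
    (hδ0 : 0 < δ) (hδ1 : δ ≤ 1) (ha0 : 0 ≤ a) (he0 : 0 ≤ e) (hmδ : m < δ) (hcδ : a < δ)
    (hεδ : e < δ) (hE : 0 ≤ E) (hW : 0 ≤ W) (h1 : W ≤ C * (a + e) * E)
    (h2 : E ^ 2 ≤ C * (m * (W ^ 2 + e ^ 2) + a * ((W + e) * E) + a ^ 2 * m * E ^ 2)) : E ≤ σ * e := by
  have hC0 : 0 < C := by linarith
  have hσ2 : σ ^ 2 ≤ 1 := pow_le_one₀ hσ0.le hσ1
  have hWE : W ≤ 2 * C * δ * E := by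
    refine h1.trans (mul_le_mul_of_nonneg_right ?_ hE)
    nlinarith
  have s1 : W ^ 2 ≤ 4 * C ^ 2 * E ^ 2 := by
    have : W ≤ 2 * C * E := hWE.trans (by
      refine mul_le_mul_of_nonneg_right ?_ hE
      nlinarith)
    calc W ^ 2 ≤ (2 * C * E) ^ 2 := pow_le_pow_left₀ hW this 2
      _ = _ := by ring
  have s2 : m * (W ^ 2 + e ^ 2) ≤ δ * (4 * C ^ 2 * E ^ 2 + e ^ 2) :=
    mul_le_mul hmδ.le (by linarith) (by positivity) hδ0.le
  have s3 : (W + e) * E ≤ 2 * C * E ^ 2 + (e ^ 2 + E ^ 2) / 2 := by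
    have : W * E ≤ 2 * C * δ * E * E := mul_le_mul_of_nonneg_right hWE hE
    have : C * δ * E ^ 2 ≤ C * 1 * E ^ 2 := by gcongr
    nlinarith [sq_nonneg (e - E)]
  have s4 : a * ((W + e) * E) ≤ δ * (2 * C * E ^ 2 + (e ^ 2 + E ^ 2) / 2) :=
    mul_le_mul hcδ.le s3 (by positivity) hδ0.le
  have s5 : a ^ 2 * m * E ^ 2 ≤ δ * E ^ 2 := by
    refine mul_le_mul_of_nonneg_right ?_ (sq_nonneg E)
    have : a ^ 2 ≤ 1 := pow_le_one₀ ha0 (by linarith)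
    nlinarith
  have s6 : E ^ 2 ≤ C * δ * (4 * C ^ 2 * E ^ 2 + e ^ 2 + 2 * C * E ^ 2 + (e ^ 2 + E ^ 2) / 2 + E ^ 2) := by
    refine h2.trans ?_
    rw [mul_assoc C δ]
    refine mul_le_mul_of_nonneg_left ?_ hC0.le
    linarith
  have s7 : 4 * C ^ 2 * E ^ 2 + e ^ 2 + 2 * C * E ^ 2 + (e ^ 2 + E ^ 2) / 2 + E ^ 2 ≤
      C ^ 2 * (8 * E ^ 2 + 2 * e ^ 2) := by
    have : C ≤ C ^ 2 := by nlinarith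
    nlinarith [sq_nonneg E, sq_nonneg e]
  have s8 : E ^ 2 ≤ σ ^ 2 / 16 * (8 * E ^ 2 + 2 * e ^ 2) := by
    rw [← hδC]
    refine s6.trans ((mul_le_mul_of_nonneg_left s7 (by positivity)).trans (le_of_eq (by ring)))
  have s9 : E ^ 2 ≤ (σ * e) ^ 2 := by
    rw [mul_pow]
    nlinarith [sq_nonneg E, sq_nonneg e]
  exact (pow_le_pow_iff_left₀ hE (by positivity) (by norm_num)).1 s9

/-- Inserting the bounds for `L`, `T` and `W` gives `4ha ≤ 3C²(eE + aE)`. Since `DE ≤ 1`, the last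
term is at most `2ha` and is absorbed, which explains `D`. -/
lemma velocity_le_of_estimates (hh : 0 < h) (hC : 1 ≤ C) (hD : D = 3 * C ^ 2 / (2 * h)) (hσD : D * σ ≤ 1)
    (hσ1 : σ ≤ 1) (ha0 : 0 ≤ a) (he0 : 0 ≤ e) (hE : 0 ≤ E) (hE1 : E ≤ σ) (hW : 0 ≤ W)
    (h1 : W ≤ C * (a + e) * E) (h3 : T ≤ C * (a * E + (a + e) * E ^ 2 + E * W)) (h4 : |L| ≤ C * E)
    (hTc : 4 * h * a ≤ e * |L| + T) : a ≤ D * (e * E) := by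
  have hC0 : 0 < C := by linarith
  have hD0 : 0 < D := by rw [hD]; positivity
  have hE1' : E ≤ 1 := hE1.trans hσ1
  have hEE : E ^ 2 ≤ E := by nlinarith
  have t1 : E * W ≤ C * (a + e) * E := by
    have : E * W ≤ 1 * W := mul_le_mul_of_nonneg_right hE1' hW
    linarith
  have t2 : (a + e) * E ^ 2 ≤ (a + e) * E := mul_le_mul_of_nonneg_left hEE (by positivity)
  have t3 : e * |L| ≤ e * (C * E) := mul_le_mul_of_nonneg_left h4 he0
  have t4 : 4 * h * a ≤ C * (e * E) + C * (a * E + (a + e) * E + C * (a + e) * E) := by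
    have : C * (a * E + (a + e) * E ^ 2 + E * W) ≤ C * (a * E + (a + e) * E + C * (a + e) * E) := by
      gcongr
    linarith
  have t5 : C ≤ C ^ 2 := by nlinarith
  have aE : 0 ≤ a * E := by positivity
  have eE : 0 ≤ e * E := by positivity
  have t6 : 4 * h * a ≤ 3 * C ^ 2 * (e * E) + 3 * C ^ 2 * (a * E) := by nlinarith
  have hDh : D * (2 * h) = 3 * C ^ 2 := by rw [hD]; field_simp
  have t7 : 3 * C ^ 2 * (a * E) ≤ 2 * h * a := by
    rw [← hDh]
    have : D * E ≤ 1 := (mul_le_mul_of_nonneg_left hE1 hD0.le).trans hσD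
    nlinarith [mul_nonneg hh.le ha0]
  have t8 : 2 * h * a ≤ 2 * h * (D * (e * E)) := by
    have : 3 * C ^ 2 * (e * E) = 2 * h * (D * (e * E)) := by rw [← hDh]; ring
    linarith
  exact le_of_mul_le_mul_left t8 (by positivity)

/-- Now `E ≤ σe`, while `a` and `W` are of order `eE`. So every term of the bound for `L` except
`-ke²` is of order `σe²`, and `T` is of order `σe³`; the constants add up to `K`, and `Kσ ≤ k/2`
preserves the sign. -/
lemma leading_term_of_estimates (hC : 1 ≤ C) (hD0 : 0 < D) (hk : 0 < k)
    (hK : K = C * (4 * C ^ 2 + D * (2 * C + 1) + 2) + C * (D + 2 + 2 * C)) (hσ0 : 0 < σ) (hσ1 : σ ≤ 1)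
    (hσD : D * σ ≤ 1) (hσK : K * σ ≤ k / 2) (ha0 : 0 ≤ a) (hepos : 0 < e) (he1 : e ≤ 1) (hE : 0 ≤ E)
    (hE1 : E ≤ σ) (hEσ : E ≤ σ * e) (hW : 0 ≤ W) (h1 : W ≤ C * (a + e) * E)
    (h3 : T ≤ C * (a * E + (a + e) * E ^ 2 + E * W))
    (h5 : L ≤ -(k * e ^ 2) + C * (W ^ 2 + a * (W + e) + a ^ 2 * E ^ 2 + E ^ 2))
    (haE : a ≤ D * (e * E)) : T + e * L < 0 := by
  have hC0 : 0 < C := by linarith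
  have he0 := hepos.le
  have hE1' : E ≤ 1 := hE1.trans hσ1
  have hae : a ≤ e := by
    have : D * E ≤ 1 := (mul_le_mul_of_nonneg_left hE1 hD0.le).trans hσD
    nlinarith
  have hW2 : W ≤ 2 * C * (e * E) := by
    refine h1.trans ?_
    have : (a + e) * E ≤ 2 * e * E := mul_le_mul_of_nonneg_right (by linarith) hE
    nlinarith
  have hE2 : E ^ 2 ≤ σ * e ^ 2 := by
    calc E ^ 2 ≤ (σ * e) ^ 2 := pow_le_pow_left₀ hE hEσ 2
      _ = σ * (σ * e ^ 2) := by ring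
      _ ≤ 1 * (σ * e ^ 2) := by gcongr
      _ = _ := one_mul _
  have heE : e * E ≤ σ * e ^ 2 := by nlinarith
  have hL : L ≤ -(k * e ^ 2) + C * (4 * C ^ 2 + D * (2 * C + 1) + 2) * (σ * e ^ 2) := by
    have u1 : W ^ 2 ≤ 4 * C ^ 2 * (σ * e ^ 2) := by
      calc W ^ 2 ≤ (2 * C * (e * E)) ^ 2 := pow_le_pow_left₀ hW hW2 2
        _ = 4 * C ^ 2 * (e ^ 2 * E ^ 2) := by ring
        _ ≤ 4 * C ^ 2 * (1 * (σ * e ^ 2)) := by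
          gcongr
          exact pow_le_one₀ he0 he1
        _ = _ := by ring
    have u2 : W + e ≤ 2 * C + 1 := by
      have : C * (e * E) ≤ C * 1 := by
        gcongr
        nlinarith
      linarith
    have u3 : a * (W + e) ≤ D * (σ * e ^ 2) * (2 * C + 1) := by
      refine mul_le_mul (haE.trans (by gcongr)) u2 (by positivity) (by positivity)
    have u4 : a ^ 2 * E ^ 2 ≤ σ * e ^ 2 := by
      have : a ^ 2 ≤ 1 := pow_le_one₀ ha0 (hae.trans he1)
      nlinarith [sq_nonneg E]
    refine h5.trans ?_
    have : C * (W ^ 2 + a * (W + e) + a ^ 2 * E ^ 2 + E ^ 2) ≤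
        C * (4 * C ^ 2 * (σ * e ^ 2) + D * (σ * e ^ 2) * (2 * C + 1) + σ * e ^ 2 + σ * e ^ 2) := by gcongr
    refine (add_le_add_right this _).trans (le_of_eq (by ring))
  have hT : T ≤ C * (D + 2 + 2 * C) * (σ * e ^ 2) * e := by
    have v1 : a * E ≤ D * e * E ^ 2 := by nlinarith
    have v2 : (a + e) * E ^ 2 ≤ 2 * e * E ^ 2 := mul_le_mul_of_nonneg_right (by linarith) (sq_nonneg E)
    have v3 : E * W ≤ 2 * C * e * E ^ 2 := by nlinarith
    have v4 : T ≤ C * (D * e * E ^ 2 + 2 * e * E ^ 2 + 2 * C * e * E ^ 2) := by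
      refine h3.trans ?_
      gcongr
    calc T ≤ C * (D + 2 + 2 * C) * E ^ 2 * e := by linarith
      _ ≤ _ := by gcongr
  have hfin : T + e * L ≤ e * (-(k * e ^ 2) + K * σ * e ^ 2) := by
    have := mul_le_mul_of_nonneg_left hL he0
    rw [hK]
    linarith
  have : e * (-(k * e ^ 2) + K * σ * e ^ 2) < 0 := by
    have : -(k * e ^ 2) + K * σ * e ^ 2 < 0 := by
      have := mul_le_mul_of_nonneg_right hσK (sq_nonneg e)
      nlinarith [mul_pos hk (pow_pos hepos 2)]
    exact mul_neg_of_pos_of_neg hepos this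
  linarith

/-- The sign of the velocity `c` follows from the estimates for the energy `E`, the normal derivative
`W`, and the leading term `L`. -/
lemma exists_sign_of_estimates {h C k : ℝ} (hh : 0 < h) (hC : 1 ≤ C) (hk : 0 < k) :
    ∃ δ, 0 < δ ∧ ∀ c ε m E W L : ℝ, m < δ → |c| < δ → |ε| < δ → 0 ≤ E → 0 ≤ W →
      W ≤ C * (|c| + |ε|) * E →
      E ^ 2 ≤ C * (m * (W ^ 2 + |ε| ^ 2) + |c| * ((W + |ε|) * E) + |c| ^ 2 * m * E ^ 2) →
      |4 * h * c - ε * L| ≤ C * (|c| * E + (|c| + |ε|) * E ^ 2 + E * W) → |L| ≤ C * E →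
      L ≤ -(k * |ε| ^ 2) + C * (W ^ 2 + |c| * (W + |ε|) + |c| ^ 2 * E ^ 2 + E ^ 2) →
      (0 < ε → c < 0) ∧ (ε < 0 → 0 < c) := by
  obtain ⟨D, hD⟩ : ∃ x, x = 3 * C ^ 2 / (2 * h) := ⟨_, rfl⟩
  have hC0 : 0 < C := by linarith
  have hD0 : 0 < D := by rw [hD]; positivity
  obtain ⟨K, hK⟩ : ∃ x, x = C * (4 * C ^ 2 + D * (2 * C + 1) + 2) + C * (D + 2 + 2 * C) := ⟨_, rfl⟩
  have hK0 : 0 < K := by rw [hK]; positivity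
  -- The ratio allowed between `E` and `|ε|`: `1/D` permits absorbing the velocity, and `k/(2K)`
  -- lets the leading term win.
  obtain ⟨σ, hσ⟩ : ∃ x, x = min 1 (min (1 / D) (k / (2 * K))) := ⟨_, rfl⟩
  have hσ0 : 0 < σ := by rw [hσ]; positivity
  have hσ1 : σ ≤ 1 := by rw [hσ]; exact min_le_left _ _
  have hσD : D * σ ≤ 1 := by
    have : σ ≤ 1 / D := hσ.le.trans <| (min_le_right _ _).trans (min_le_left _ _)
    rwa [le_div_iff₀ hD0, mul_comm] at this
  have hσK : K * σ ≤ k / 2 := by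
    have : σ ≤ k / (2 * K) := hσ.le.trans <| (min_le_right _ _).trans (min_le_right _ _)
    rw [le_div_iff₀ (by positivity)] at this
    linarith
  have hC3 : 1 ≤ C ^ 3 := one_le_pow₀ hC
  have hC2 : 1 ≤ C ^ 2 := one_le_pow₀ hC
  -- Chosen so that `C³δ = σ²/16`, as the absorption in the energy inequality requires.
  obtain ⟨δ, hδ⟩ : ∃ x, x = σ ^ 2 / (16 * C ^ 3) := ⟨_, rfl⟩
  have hδ0 : 0 < δ := by rw [hδ]; positivity
  refine ⟨δ, hδ0, ?_⟩
  intro c ε m E W L hmδ hcδ hεδ hE hW h1 h2 h3 h4 h5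
  have hδC : C ^ 3 * δ = σ ^ 2 / 16 := by rw [hδ]; field_simp
  have hσ2 : σ ^ 2 ≤ 1 := pow_le_one₀ hσ0.le hσ1
  have hδ1 : δ ≤ 1 := by nlinarith
  have ha0 := abs_nonneg c
  have he0 := abs_nonneg ε
  -- If `4hc` differs from `εL` by less than `-|ε|L`, then `L < 0` and `4hc` has the sign of `εL`.
  have hsign : ∀ e : ℝ, 0 < |e| → |4 * h * c - ε * L| < |ε| * -L → (0 < ε → c < 0) ∧ (ε < 0 → 0 < c) := by
    intro e _ hlt
    constructor
    · intro hε
      rw [abs_of_pos hε] at hlt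
      have := (abs_lt.1 hlt).2
      nlinarith
    · intro hε
      rw [abs_of_neg hε] at hlt
      have := (abs_lt.1 hlt).1
      nlinarith
  rcases eq_or_ne ε 0 with hε | hε
  · rw [hε]; exact ⟨fun h => absurd h (lt_irrefl _), fun h => absurd h (lt_irrefl _)⟩
  have hepos : 0 < |ε| := abs_pos.2 hε
  refine hsign ε hepos ?_
  clear hsign
  have hTc : 4 * h * |c| ≤ |ε| * |L| + |4 * h * c - ε * L| := by
    rw [← abs_mul, ← abs_of_pos (by positivity : 0 < 4 * h), ← abs_mul, abs_of_pos (by positivity : 0 < 4 * h)]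
    have := abs_add_le (ε * L) (4 * h * c - ε * L)
    rwa [add_sub_cancel] at this
  generalize |4 * h * c - ε * L| = T at *
  generalize |c| = a at *
  generalize |ε| = e at *
  have hEσ := energy_le_of_estimates hC hσ0 hσ1 hδC hδ0 hδ1 ha0 he0 hmδ hcδ hεδ hE hW h1 h2
  have he1 : e ≤ 1 := by linarith
  have hE1 : E ≤ σ := hEσ.trans (mul_le_of_le_one_right hσ0.le he1)
  have haE := velocity_le_of_estimates hh hC hD hσD hσ1 ha0 he0 hE hE1 hW h1 h3 h4 hTc
  have := leading_term_of_estimates hC hD0 hk hK hσ0 hσ1 hσD hσK ha0 hepos he1 hE hE1 hEσ hW h1 h3 h5 haE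
  linarith

end Sign

end PointVortex
end

/-! ### Conclusion for small waves and for curves of waves -/

noncomputable section
namespace PointVortex

lemma abs_le_of_schwartz (V : 𝓢(ℝ, ℝ)) : ∃ M, 0 < M ∧ ∀ x, |V x| ≤ M := by
  obtain ⟨M, hM⟩ := V.decay 0 0
  refine ⟨M, hM.1, fun x => ?_⟩
  have := hM.2 x
  rwa [pow_zero, one_mul, norm_iteratedFDeriv_zero, Real.norm_eq_abs] at this

/-- The difference of the two sides is a polynomial in the quantities with nonnegative coefficients.
It collects the constants of the energy estimate into a single factor. -/
lemma energy_combination_le {m W e E a N : ℝ} (hm : 0 ≤ m) (hW : 0 ≤ W) (he : 0 ≤ e) (hE : 0 ≤ E)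
    (ha : 0 ≤ a) (hN : 0 ≤ N) :
    m * (2 * W ^ 2 + 2 * (e ^ 2 * N ^ 2)) + a * ((W + e * N) * E) + a ^ 2 * m * E ^ 2 ≤
      (3 + 2 * N ^ 2 + N) * (m * (W ^ 2 + e ^ 2) + a * ((W + e) * E) + a ^ 2 * m * E ^ 2) := by
  have : 0 ≤ m * W ^ 2 * (1 + 2 * N ^ 2 + N) + m * e ^ 2 * (3 + N) +
      a * W * E * (2 + 2 * N ^ 2 + N) + a * e * E * (3 + 2 * N ^ 2) +
      a ^ 2 * m * E ^ 2 * (2 + 2 * N ^ 2 + N) := by positivity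
  linear_combination this

lemma test_combination_le {M v N P W a e E : ℝ} (hM : 0 ≤ M) (hv : 0 ≤ v) (hN : 0 ≤ N) (hP : 0 ≤ P)
    (hW : 0 ≤ W) (ha : 0 ≤ a) (he : 0 ≤ e) :
    M * W ^ 2 + a * ((W + e * N) * v) + a ^ 2 * M * E ^ 2 + P * E ^ 2 ≤
      (M + v * (1 + N) + P) * (W ^ 2 + a * (W + e) + a ^ 2 * E ^ 2 + E ^ 2) := by
  have : 0 ≤ W ^ 2 * (v * (1 + N) + P) + a * W * (M + v * N + P) + a * e * (M + v + P) +
      a ^ 2 * E ^ 2 * (v * (1 + N) + P) + E ^ 2 * (M + v * (1 + N)) := by positivity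
  linear_combination this

/-- Small waves over a vortex at half depth travel in the direction opposite to the sign of the
vortex strength. -/
theorem exists_sign_velocity {g α h s : ℝ} (hg : 0 < g) (hα : 0 < α) (hh : 0 < h) (hs : 3 / 2 < s) :
    ∃ δ : ℝ, 0 < δ ∧ ∀ (η ζ : ℝ → ℝ) (c ε : ℝ), IsWave g α h (1 / 2) s η ζ c ε →
      hsNorm s η < δ → |c| < δ → |ε| < δ → (0 < ε → c < 0) ∧ (ε < 0 → 0 < c) := by
  obtain ⟨Cs, hCs, hSob⟩ := exists_sobolev_bound hs
  obtain ⟨Cw, hCw, hWave⟩ := exists_wave_reduction hh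
  obtain ⟨Cv, hCv, hSpeed⟩ := exists_speed_estimate hh
  obtain ⟨V, hV, hVpos⟩ := exists_test_function (α := α) hg hh
  obtain ⟨M₁, hM₁, hVM₁⟩ := abs_le_of_schwartz V
  obtain ⟨M₂, hM₂, hVM₂⟩ := abs_le_of_schwartz (SchwartzMap.derivCLM ℝ ℝ V)
  set M := max M₁ M₂ with hM
  have hM0 : 0 < M := lt_max_of_lt_left hM₁
  have hVM : ∀ x, V x ≤ M := fun x => (le_abs_self _).trans ((hVM₁ x).trans (le_max_left _ _))
  have hVM' : ∀ x, |deriv V x| ≤ M := fun x => by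
    have := hVM₂ x
    rw [SchwartzMap.derivCLM_apply] at this
    exact this.trans (le_max_right _ _)
  have hV2 : MemLp V 2 := V.memLp 2 volume
  have hV2' : MemLp (deriv V) 2 := by
    have := (SchwartzMap.derivCLM ℝ ℝ V).memLp 2 volume
    refine (memLp_congr_ae (Eventually.of_forall fun x => ?_)).1 this
    exact SchwartzMap.derivCLM_apply ℝ V x
  set I := ∫ x, surfaceVelocity h x ^ 2 * V x with hI
  have hIpos : 0 < I := by
    have hp : ∀ x, 0 < surfaceVelocity h x ^ 2 * V x := fun x =>
      mul_pos (pow_pos (surfaceVelocity_pos hh x) 2) (hVpos x)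
    rw [hI, integral_pos_iff_support_of_nonneg fun x => (hp x).le]
    · rw [Function.support_eq_univ fun x => (hp x).ne']
      simp
    · exact (memLp_surfaceVelocity hh).integrable_sq.mul_bdd (c := M₁) V.continuous.aestronglyMeasurable
        (Eventually.of_forall hVM₁)
  set N := surfaceVelocityNorm h with hN
  have hN0 : 0 ≤ N := Real.sqrt_nonneg _
  set v := Real.sqrt (∫ x, V x ^ 2) with hv
  have hv0 : 0 ≤ v := Real.sqrt_nonneg _
  -- The coercivity constant of the energy estimate: gravity controls `η`, surface tension controls
  -- `η'`.
  set k := min g (α ^ 2 / 2) with hk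
  have hk0 : 0 < k := by positivity
  set A := (3 + 2 * N ^ 2 + N) / k with hA
  have hA0 : 0 < A := by positivity
  set B := M + v * (1 + N) + α ^ 2 * M with hB
  have hB0 : 0 < B := by positivity
  set C := 1 + Real.sqrt Cw + Cv + A + B with hC
  have hCw0 := Real.sqrt_nonneg Cw
  have hC1 : Real.sqrt Cw ≤ C ∧ Cv ≤ C ∧ A ≤ C ∧ B ≤ C ∧ 1 ≤ C := by
    refine ⟨?_, ?_, ?_, ?_, ?_⟩ <;> linarith
  obtain ⟨δ, hδ, hsign⟩ := exists_sign_of_estimates (C := C) (k := I / 128) hh (by linarith) (by positivity)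
  -- Ensures the `C¹` bounds `m ≤ 1` and `m ≤ h/32` of a small surface; division by the Sobolev
  -- constant converts this into a condition on the `H^s` norm.
  set δ' := min (min δ 1) (h / 32) with hδ'
  have hδ'0 : 0 < δ' := by positivity
  refine ⟨min δ (δ' / Cs), by positivity, ?_⟩
  intro η ζ c ε hW hη hc hε
  obtain ⟨e1, e2, e3, e4⟩ := hSob η hW.mem_surface.1
  obtain ⟨z1, z2, z3, -⟩ := hSob ζ hW.mem_trace.1
  set m := Cs * hsNorm s η with hm
  have hmδ' : m < δ' := by
    have := hη.trans_le (min_le_right _ _)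
    rwa [lt_div_iff₀ hCs, mul_comm] at this
  have hS : IsSmallSurface h m η := ⟨e1, e2, e3, fun x => (e4 x).1, fun x => (e4 x).2,
    (hmδ'.trans_le (min_le_right _ _)).le,
    (hmδ'.trans_le ((min_le_left _ _).trans (min_le_right _ _))).le⟩
  obtain ⟨w, hw, w1, w2, w3⟩ := hWave hW hS z1 z2 z3
  obtain ⟨s1, s2⟩ := hSpeed hS hw w3
  -- The weak Bernoulli equation is used twice: with `η` as test function, and then with the
  -- positive Helmholtz solution `V`.
  have t1 := hS.energy_estimate hh hw (min_le_left g (α ^ 2 / 2)) (min_le_right _ _)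
    (w2 η m e1 e2 e3 hS.abs_le)
  have t2 := hS.test_estimate hh hw V hV hVpos hVM hVM' (w2 V M₁ (V.smooth 1) hV2 hV2' hVM₁)
  have hE0 := energyNorm_nonneg η
  have hm0 := hS.nonneg
  have hW2 : Real.sqrt (∫ x, w x ^ 2) ^ 2 = ∫ x, w x ^ 2 :=
    Real.sq_sqrt (integral_nonneg fun _ => sq_nonneg _)
  have hw1 : Real.sqrt (∫ x, w x ^ 2) ≤ Real.sqrt Cw * (|c| + |ε|) * energyNorm η := by
    rw [← energyNorm_sq] at w1
    refine (Real.sqrt_le_sqrt w1).trans (le_of_eq ?_)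
    rw [Real.sqrt_mul (by positivity), Real.sqrt_mul hCw.le, Real.sqrt_sq (by positivity),
      Real.sqrt_sq hE0]
  rw [← hW2, ← hN] at t1 t2
  have hW0 := Real.sqrt_nonneg (∫ x, w x ^ 2)
  generalize energyNorm η = E at *
  generalize Real.sqrt (∫ x, w x ^ 2) = W at *
  generalize (∫ x, η x * (surfaceVelocity h x * surfaceKernel h x)) = L at *
  rw [Real.sqrt_sq hW0] at t1 t2
  have ha0 := abs_nonneg c
  have hb0 := abs_nonneg ε
  refine hsign c ε m E W L (hmδ'.trans_le ((min_le_left _ _).trans (min_le_left _ _)))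
    (hc.trans_le (min_le_left _ _)) (hε.trans_le (min_le_left _ _)) hE0 hW0 ?_ ?_ ?_ ?_ ?_
  · refine hw1.trans ?_
    gcongr
    linarith
  · have u1 : k * E ^ 2 ≤ (3 + 2 * N ^ 2 + N) * (m * (W ^ 2 + |ε| ^ 2) + |c| * ((W + |ε|) * E) +
        |c| ^ 2 * m * E ^ 2) := by
      refine t1.trans ?_
      rw [← sq_abs ε, ← sq_abs c]
      exact energy_combination_le hm0 hW0 hb0 hE0 ha0 hN0
    have u2 : E ^ 2 ≤ A * (m * (W ^ 2 + |ε| ^ 2) + |c| * ((W + |ε|) * E) + |c| ^ 2 * m * E ^ 2) := by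
      rw [hA, div_mul_eq_mul_div, le_div_iff₀ hk0]
      linarith
    refine u2.trans (mul_le_mul_of_nonneg_right (by linarith) (by positivity))
  · refine s1.trans (mul_le_mul_of_nonneg_right (by linarith) (by positivity))
  · exact s2.trans (mul_le_mul_of_nonneg_right (by linarith) hE0)
  · refine t2.trans ?_
    have u3 : M * W ^ 2 + |c| * ((W + |ε| * N) * v) + c ^ 2 * M * E ^ 2 + α ^ 2 * M * E ^ 2 ≤
        B * (W ^ 2 + |c| * (W + |ε|) + |c| ^ 2 * E ^ 2 + E ^ 2) := by
      rw [← sq_abs c, hB]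
      exact test_combination_le hM0.le hv0 hN0 (by positivity) hW0 ha0 hb0
    have u4 : B * (W ^ 2 + |c| * (W + |ε|) + |c| ^ 2 * E ^ 2 + E ^ 2) ≤
        C * (W ^ 2 + |c| * (W + |ε|) + |c| ^ 2 * E ^ 2 + E ^ 2) :=
      mul_le_mul_of_nonneg_right (by linarith) (by positivity)
    rw [sq_abs ε]
    linarith

end PointVortex
end

theorem mainTheorem4 (g α h : ℝ) (hg : 0 < g) (hα : 0 < α) (hh : 0 < h) :
    (∀ θ : ℝ, 0 < θ → θ ≤ 1 / 2 → PointVortex.c₃ g α h θ < 0) ∧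
    (∀ s : ℝ, 3 / 2 < s →
      -- all small waves with the vortex at half depth
      (∃ δ : ℝ, 0 < δ ∧ ∀ (η ζ : ℝ → ℝ) (c ε : ℝ),
        PointVortex.IsWave g α h (1 / 2) s η ζ c ε →
        PointVortex.hsNorm s η < δ → PointVortex.hsNorm s ζ < δ → |c| < δ → |ε| < δ →
        (0 < ε → c < 0) ∧ (ε < 0 → 0 < c)) ∧
      -- every curve of waves through the origin, parametrized by the vortex strength
      (∀ (I : Set ℝ) (η ζ : ℝ → ℝ → ℝ) (c : ℝ → ℝ),
        IsOpen I → I.OrdConnected → (0 : ℝ) ∈ I →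
        (∀ ε ∈ I, PointVortex.IsWave g α h (1 / 2) s (η ε) (ζ ε) (c ε) ε) →
        Tendsto (fun ε => PointVortex.hsNorm s (η ε)) (𝓝 0) (𝓝 0) →
        Tendsto (fun ε => PointVortex.hsNorm s (ζ ε)) (𝓝 0) (𝓝 0) →
        Tendsto c (𝓝 0) (𝓝 0) →
        ∃ ε₀ : ℝ, 0 < ε₀ ∧
          (∀ ε ∈ I, 0 < ε → ε < ε₀ → c ε < 0) ∧
          (∀ ε ∈ I, -ε₀ < ε → ε < 0 → 0 < c ε))) := by
  refine ⟨fun θ hθ hθ' => PointVortex.c₃_neg hg hh hθ hθ', fun s hs => ?_⟩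
  obtain ⟨δ, hδ, H⟩ := PointVortex.exists_sign_velocity hg hα hh hs
  refine ⟨⟨δ, hδ, fun η ζ c ε hW hη _ hc hε => H η ζ c ε hW hη hc hε⟩, ?_⟩
  intro I η ζ c _ _ _ hW hη _ hc
  have h1 : ∀ᶠ ε in 𝓝 (0 : ℝ), PointVortex.hsNorm s (η ε) < δ := hη.eventually (gt_mem_nhds hδ)
  have h2 : ∀ᶠ ε in 𝓝 (0 : ℝ), |c ε| < δ := by
    have := hc.abs
    rw [abs_zero] at this
    exact this.eventually (gt_mem_nhds hδ)
  obtain ⟨r, hr, hball⟩ := Metric.eventually_nhds_iff.1 (h1.and h2)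
  have key : ∀ ε ∈ I, |ε| < min r δ → (0 < ε → c ε < 0) ∧ (ε < 0 → 0 < c ε) := fun ε hε hlt => by
    have hb := hball (y := ε) (by
      rw [Real.dist_eq, sub_zero]
      exact hlt.trans_le (min_le_left _ _))
    exact H (η ε) (ζ ε) (c ε) ε (hW ε hε) hb.1 hb.2 (hlt.trans_le (min_le_right _ _))
  refine ⟨min r δ, lt_min hr hδ, fun ε hε hpos hlt => ?_, fun ε hε hlt hneg => ?_⟩
  · exact (key ε hε (by rwa [abs_of_pos hpos])).1 hpos
  · exact (key ε hε (by rw [abs_of_neg hneg]; linarith)).2 hneg
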